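/- Let $d\in\{1,2\}$ and $\langle\xi\rangle=(1+|\xi|^2)^{1/2}$. For $G:\mathbb R^d\to\mathbb R$ bounded, $\mathrm G=G(D)$ denotes the Fourier multiplier $\widehat{\mathrm G[u]}=G\,\widehat u$. A pair $(\mathrm G_1,\mathrm G_2)$ is called admissible with constant $K$ if $G_1,G_2$ are even functions in $W^{1,\infty}(\mathbb R^d)$ (identified with their Lipschitz representatives) with $|G_k|\le K$ and $\langle\cdot\rangle|\nabla G_k|\le K$ almost everywhere for $k=1,2$, and if $G_1(\xi)>0$ and $|G_2(\xi)|\le G_1(\xi)$ for all $\xi\in\mathbb R^d$. For $\sigma\ge 0$ let $X^\sigma$ be the space of $U=(\zeta,v)\in\mathcal S'(\mathbb R^d)\times\mathcal S'(\mathbb R^d)^d$ with $|U|_{X^\sigma}:=|\zeta|_{H^\sigma}+|\mathrm G_1[v]|_{H^\sigma}<\infty$, where $|f|_{H^\sigma}=|(1-\Delta)^{\sigma/2}f|_{L^2}$. For $\epsilon\in(0,1]$ and $j\in\{1,\dots,d\}$, let $A_j(U)$ be the operator which maps $W=(\eta,w)$ to $$A_j(U)[W]=\Big(\epsilon \mathrm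 G_2\big[\mathrm G_2[v_j]\,\eta\big]+\mathrm G_1^2[w_j]+\epsilon \mathrm G_2\big[\zeta\,\mathrm G_2[w_j]\big],\ \big(\delta_{jk}\eta+\epsilon\,\mathrm G_2[v_j]\,\mathrm G_2[w_k]\big)_{1\le k\le d}\Big).$$ All solutions below are real-valued, and equations hold in the sense of distributions. **Proposition 1.2 (Stability).** Let $s>d/2+1$ and $K\in\mathbb R$. There is a positive function $C=C(\lambda_1,\lambda_2,\lambda_3)$, non-decreasing in each of its arguments and depending only on $d,s,K$, such that for all $h_{\min}>0$ and $M>0$ there are $T>0$ and $C_0>0$ with the following property. Let $(\mathrm G_1,\mathrm G_2)$ be admissible with constant $K$, let $\epsilon\in(0,1]$, and let $U_0=(\zeta_0,v_0)\in X^s$ be real-valued with $|U_0|_{X^s}\le M$ and $1+\epsilon\zeta_0\ge h_{\min}$ on $\mathbb R^d$. Then the Cauchy problem $$\partial_tU+\sum_{j=1}^dA_j(U)[\partial_jU]=0,\qquad U|_{t=0}=U_0,$$ has a unique solution $U\in C([0,T/\epsilon],X^s)$; it satisfies $|U|_{L^\infty([0,T/\epsilon],X^s)}\le C_0|U_0|_{X^s}$.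 Moreover, for every $\widetilde T>0$, every $\widetilde R\in L^\infty([0,\widetilde T/\epsilon],X^{s-1})$ and every solution $\widetilde U\in C([0,\widetilde T/\epsilon],X^s)$ of $$\partial_t\widetilde U+\sum_{j=1}^dA_j(\widetilde U)[\partial_j\widetilde U]=\widetilde R,$$ the difference $\mathfrak e:=U-\widetilde U$ satisfies, for all $t\in[0,\min(\widetilde T,T)/\epsilon]$, $$|\mathfrak e|_{L^\infty([0,t],X^{s-1})}\le C\Big(\tfrac1{h_{\min}},|U|_{L^\infty([0,t],X^s)},|\widetilde U|_{L^\infty([0,t],X^s)}\Big)\Big(|\mathfrak e(0)|_{X^{s-1}}+t\,|\widetilde R|_{L^\infty([0,t],X^{s-1})}\Big).$$ -/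

import Mathlib

open Real Set Filter Topology MeasureTheory FourierTransform
open scoped ENNReal SchwartzMap

noncomputable section

namespace WhithamBoussinesq

/-- Physical space (and frequency space), with its Euclidean norm. -/
abbrev Space (d : ℕ) : Type := EuclideanSpace ℝ (Fin d)

/-- Pairs `U = (ζ, v)` of a tempered distribution and a `d`-tuple of tempered distributions. -/
abbrev State (d : ℕ) : Type := 𝓢'(Space d, ℂ) × (Fin d → 𝓢'(Space d, ℂ))

/-- The Japanese bracket `⟨ξ⟩ = (1 + |ξ|²)^(1/2)`. -/
def bracket {d : ℕ} (ξ : Space d) : ℝ := Real.sqrt (1 + ‖ξ‖ ^ 2)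

/-! ### Fourier multipliers

Mathlib's Fourier transform is `𝓕 u ξ = ∫ exp (-2πi x·ξ) u x`. Hence the operator `G(D)`, where
`D = -i∇`, is multiplication of `𝓕 u` by `G (2πξ)`. -/

/-- Symbols: bounded real functions with `⟨·⟩ ∇G` in `L^∞`, both bounded by `K`. Functions in
`W^{1,∞}` are identified with their Lipschitz representatives, and the gradient is taken almost
everywhere. The symbol is even, i.e. `G(D)` maps real-valued functions to real-valued functions. -/
structure IsSymbol {d : ℕ} (K : ℝ) (G : Space d → ℝ) : Prop where
  lipschitz : ∃ L, LipschitzWith L G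
  bound : ∀ ξ, |G ξ| ≤ K
  gradient_bound : ∀ᵐ ξ : Space d, bracket ξ * ‖fderiv ℝ G ξ‖ ≤ K
  even : ∀ ξ, G (-ξ) = G ξ

/-- Admissible pairs of symbols, with `|(G_k, ⟨·⟩∇G_k)|_{L^∞} ≤ K`. -/
structure Admissible {d : ℕ} (K : ℝ) (G₁ G₂ : Space d → ℝ) : Prop where
  symbol₁ : IsSymbol K G₁
  symbol₂ : IsSymbol K G₂
  pos : ∀ ξ, 0 < G₁ ξ
  abs_le : ∀ ξ, |G₂ ξ| ≤ G₁ ξ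

/-! ### Tempered distributions whose Fourier transform is a function -/

/-- The Fourier transform of `T` is the locally integrable function `f`. (Compactly supported test
functions are dense, so `f` determines `T`, and `f` is unique up to null sets.) -/
def IsFourierFn {d : ℕ} (T : 𝓢'(Space d, ℂ)) (f : Space d → ℂ) : Prop :=
  LocallyIntegrable f ∧
    ∀ χ : 𝓢(Space d, ℂ), HasCompactSupport χ → (𝓕 T) χ = ∫ ξ, χ ξ * f ξ

open Classical in
/-- The Fourier transform of `T` as a function, when it is one. -/
def fourierFn {d : ℕ} (T : 𝓢'(Space d, ℂ)) : Space d → ℂ :=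
  if h : ∃ f, IsFourierFn T f then h.choose else 0

/-- A tempered distribution is real if it takes real values on real test functions. -/
def IsRealDistribution {d : ℕ} (T : 𝓢'(Space d, ℂ)) : Prop :=
  ∀ φ : 𝓢(Space d, ℂ), (∀ x, (φ x).im = 0) → (T φ).im = 0

def IsRealState {d : ℕ} (U : State d) : Prop :=
  IsRealDistribution U.1 ∧ ∀ k, IsRealDistribution (U.2 k)

/-! ### Norms and function spaces -/

open Classical in
/-- `|G(D) T|_{H^s} = |Λ^s G(D) T|_{L²}`, computed on the Fourier side by Plancherel;
it is `⊤` if the Fourier transform of `T` is not a function. -/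
def multSobolevNorm {d : ℕ} (G : Space d → ℝ) (s : ℝ) (T : 𝓢'(Space d, ℂ)) : ℝ≥0∞ :=
  if ∃ f, IsFourierFn T f then
    eLpNorm (fun ξ => (bracket ((2 * π) • ξ) ^ s * G ((2 * π) • ξ)) • fourierFn T ξ) 2 volume
  else ⊤

/-- `|U|_{X^s} = |ζ|_{H^s} + |G₁(D) v|_{H^s}`; the space `X^s` consists of the `U` for which this
is finite. -/
def xNorm {d : ℕ} (G₁ : Space d → ℝ) (s : ℝ) (U : State d) : ℝ≥0∞ :=
  multSobolevNorm (fun _ => 1) s U.1 + (∑ k, multSobolevNorm G₁ s (U.2 k) ^ 2) ^ (1 / 2 : ℝ)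

/-- `U ∈ C([0, τ], X^s)`, with real-valued components. -/
def MemCX {d : ℕ} (G₁ : Space d → ℝ) (s τ : ℝ) (U : ℝ → State d) : Prop :=
  (∀ t ∈ Icc 0 τ, IsRealState (U t) ∧ xNorm G₁ s (U t) < ⊤) ∧
    ∀ t ∈ Icc 0 τ, Tendsto (fun t' => xNorm G₁ s (U t' - U t)) (𝓝[Icc 0 τ] t) (𝓝 0)

/-- `|U|_{L^∞([0, t], X^s)}` for `U` continuous in time. -/
def supNorm {d : ℕ} (G₁ : Space d → ℝ) (s t : ℝ) (U : ℝ → State d) : ℝ≥0∞ :=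
  ⨆ τ ∈ Icc 0 t, xNorm G₁ s (U τ)

/-- `|R|_{L^∞([0, t], X^s)}` for general `R`. -/
def essSupNorm {d : ℕ} (G₁ : Space d → ℝ) (s t : ℝ) (R : ℝ → State d) : ℝ≥0∞ :=
  essSup (fun τ => xNorm G₁ s (R τ)) (volume.restrict (Icc 0 t))

/-- `R ∈ L^∞([0, τ], X^s)`: strongly measurable (an almost everywhere limit, in `X^s`, of simple
functions) and essentially bounded. -/
def MemLinftyX {d : ℕ} (G₁ : Space d → ℝ) (s τ : ℝ) (R : ℝ → State d) : Prop :=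
  (∃ S : ℕ → SimpleFunc ℝ (State d), ∀ᵐ t ∂(volume.restrict (Icc 0 τ)),
      Tendsto (fun n => xNorm G₁ s (S n t - R t)) atTop (𝓝 0)) ∧
    essSupNorm G₁ s τ R < ⊤

/-- `1 + ε ζ(x) ≥ h` for all `x`, where `ζ` is a real distribution with integrable Fourier
transform, hence a continuous function. -/
def NonCavitating {d : ℕ} (ε h : ℝ) (ζ : 𝓢'(Space d, ℂ)) : Prop :=
  ∀ x : Space d, h ≤ 1 + ε * ((𝓕⁻ (fourierFn ζ) : Space d → ℂ) x).re

/-! ### The system, on the Fourier side -/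

/-- The Fourier transforms `(ζ̂, v̂)`. -/
abbrev FourierState (d : ℕ) : Type := (Space d → ℂ) × (Fin d → Space d → ℂ)

def State.hat {d : ℕ} (U : State d) : FourierState d :=
  (fourierFn U.1, fun k => fourierFn (U.2 k))

/-- The Fourier transform of `G(D) u`, from that of `u`. -/
def mul {d : ℕ} (G : Space d → ℝ) (f : Space d → ℂ) : Space d → ℂ :=
  fun ξ => (G ((2 * π) • ξ) : ℂ) * f ξ

/-- The Fourier transform of `∂_j u`, from that of `u`. -/
def diff {d : ℕ} (j : Fin d) (f : Space d → ℂ) : Space d → ℂ :=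
  fun ξ => (2 * π * Complex.I * (ξ j : ℂ)) * f ξ

/-- The Fourier transform of the pointwise product of the functions whose transforms are `f`
and `g`. -/
def prod {d : ℕ} (f g : Space d → ℂ) : Space d → ℂ :=
  𝓕 (fun x : Space d => (𝓕⁻ f : Space d → ℂ) x * (𝓕⁻ g : Space d → ℂ) x)

def FourierState.diff {d : ℕ} (j : Fin d) (W : FourierState d) : FourierState d :=
  (WhithamBoussinesq.diff j W.1, fun k => WhithamBoussinesq.diff j (W.2 k))

/-- The Fourier transform of `A_j(U)[W]`, from those of `U = (ζ, v)` and `W = (η, w)`. The first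
component of `A_j(U)[W]` is `ε G₂[G₂[v_j] η] + G₁²[w_j] + ε G₂[ζ G₂[w_j]]`, and the one with index
`k` in the velocity block is `δ_{jk} η + ε G₂[v_j] G₂[w_k]`. -/
def opA {d : ℕ} (G₁ G₂ : Space d → ℝ) (ε : ℝ) (j : Fin d) (U W : FourierState d) :
    FourierState d :=
  ((ε : ℂ) • mul G₂ (prod (mul G₂ (U.2 j)) W.1) + mul G₁ (mul G₁ (W.2 j))
      + (ε : ℂ) • mul G₂ (prod U.1 (mul G₂ (W.2 j))),
    fun k => (if j = k then W.1 else 0) + (ε : ℂ) • prod (mul G₂ (U.2 j)) (mul G₂ (W.2 k)))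

/-- The Fourier transform of `∑_j A_j(U)[∂_j U]`, from that of `U`. -/
def quasilinear {d : ℕ} (G₁ G₂ : Space d → ℝ) (ε : ℝ) (U : FourierState d) : FourierState d :=
  ∑ j, opA G₁ G₂ ε j U (FourierState.diff j U)

/-- `∂_t u + N = r` on `[0, τ]`, where the Fourier transform of `N(t)` is the function `n t`:
integrated in time, and tested against every `χ` in `C_c^∞` in the frequency variable. For `u`
continuous in time this is the equation in the sense of distributions. -/
def Evolves {d : ℕ} (τ : ℝ) (u r : ℝ → 𝓢'(Space d, ℂ)) (n : ℝ → Space d → ℂ) : Prop :=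
  ∀ χ : 𝓢(Space d, ℂ), HasCompactSupport χ →
    IntervalIntegrable (fun t => (𝓕 (r t)) χ - ∫ ξ, χ ξ * n t ξ) volume 0 τ ∧
    ∀ t ∈ Icc 0 τ, (𝓕 (u t)) χ - (𝓕 (u 0)) χ =
      ∫ t' in (0 : ℝ)..t, ((𝓕 (r t')) χ - ∫ ξ, χ ξ * n t' ξ)

/-- `U ∈ C([0, τ], X^s)` is real-valued and solves `∂_t U + ∑_j A_j(U)[∂_j U] = R` on `[0, τ]`. -/
structure IsSolution {d : ℕ} (G₁ G₂ : Space d → ℝ) (ε s τ : ℝ) (U R : ℝ → State d) : Prop where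
  continuous : MemCX G₁ s τ U
  elevation : Evolves τ (fun t => (U t).1) (fun t => (R t).1)
    (fun t => (quasilinear G₁ G₂ ε (State.hat (U t))).1)
  velocity : ∀ k, Evolves τ (fun t => (U t).2 k) (fun t => (R t).2 k)
    (fun t => (quasilinear G₁ G₂ ε (State.hat (U t))).2 k)

end WhithamBoussinesq

end

noncomputable section

namespace WhithamBoussinesq

open scoped InnerProductSpace

/-! ### Bounded multipliers on `L²` -/

/-! Put w = G₁(D)v and Q = G₂/G₁, so that |Q| ≤ 1 and G₂(D)v = Qw. In the unknown (ζ, w) the system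
is symmetrized by diag(1, 1 + εQζQ). This operator is coercive because 1 + εζ is bounded below and
|Q| ≤ 1 (`le_re_inner_symP`). The terms of order one cancel exactly in the energy identity, so the
energy varies at rate ε and times of order 1/ε are reached. The symbols G₁, G₂ have order zero and
their commutators with Lipschitz functions gain a derivative (`IsSymbol.isSym`,
`IsSym.norm_comm_le`). The quotient Q has no such regularity; every term is arranged so that Q is
never commuted with a function and meets the symbols only through QG₁ = G₂. The fixed-time estimate
is `abs_re_inner_symP_le`.

The analysis takes place in L² of the frequency variable. With r = s - 1 > d/2, a state is
represented by the functions ⟨ξ⟩^s ζ̂ and ⟨ξ⟩^s G₁v̂_k, real functions correspond to Hermitian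
symmetry, and products are convolutions. Product and commutator estimates follow from pointwise
inequalities between weights together with Young's inequality. They yield `exists_energy_low`, at
regularity s - 1, for the operator acting on a difference of states, and `exists_energy_cut`, at
regularity s with the weight m(ξ)⟨ξ⟩^s, uniformly over a class of slowly varying m containing 1 and
cutoffs to high frequencies. `norm_le_of_energy` integrates such estimates in time.

For existence, the Galerkin scheme replaces G₁, G₂ by j_n G₁, j_n G₂ and keeps Q, hence the
structure. The vector field is also switched off at large norm. This bounds the speed at regularity
s - 1, which preserves the depth on times T/ε; then the energy estimate applies and shows that the
switch never acts (`exists_isGalerkin`). The approximations form a Cauchy sequence at regularity s -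
1 (`exists_galerkin_diff_le`). The estimate with high-frequency m bounds the tails of all of them by
the tails of the data, so the convergence is uniform in time at regularity s as well
(`norm_le_low_add_cut`, `exists_isSol`), which gives continuity in time in X^s.

A limit of representatives need not come from a tempered distribution, because 1/G₁ may grow
arbitrarily fast. The velocity is recovered from its own equation, in which the nonlinearity carries
no outer G₁ (`IsSol.exists_velocity`, `Rep.exists_state`).

Stability and uniqueness follow from `exists_diff_energy`. The symmetrizer is built from the
constructed solution only, so the other one needs norm bounds but no depth condition. The residual
is seen through the weak equation: testing against a dense set bounds increments in norm
(`IsSolution.norm_increment_le`), and this suffices for a Gronwall argument with one-sided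
approximate derivatives. -/

abbrev L2 (d : ℕ) : Type := Lp ℂ 2 (volume : Measure (Space d))

/-- Bounded measurable functions. -/
def IsMult {d : ℕ} (m : Space d → ℂ) : Prop := Measurable m ∧ ∃ C, ∀ ξ, ‖m ξ‖ ≤ C

variable {d : ℕ}

lemma IsMult.mul {m m' : Space d → ℂ} (h : IsMult m) (h' : IsMult m') :
    IsMult (fun ξ => m ξ * m' ξ) := by
  obtain ⟨hm, C, hC⟩ := h
  obtain ⟨hm', C', hC'⟩ := h'
  refine ⟨hm.mul hm', C * C', fun ξ => ?_⟩
  rw [norm_mul]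
  exact mul_le_mul (hC ξ) (hC' ξ) (norm_nonneg _) ((norm_nonneg _).trans (hC ξ))

lemma IsMult.ofReal {m : Space d → ℝ} {C : ℝ} (hm : Measurable m) (hC : ∀ ξ, |m ξ| ≤ C) :
    IsMult (fun ξ => (m ξ : ℂ)) :=
  ⟨by fun_prop, C, fun ξ => by simpa using hC ξ⟩

lemma IsMult.memLp {m : Space d → ℂ} (h : IsMult m) {f : Space d → ℂ} (hf : MemLp f 2) :
    MemLp (fun ξ => m ξ * f ξ) 2 := by
  obtain ⟨hm, C, hC⟩ := h
  refine hf.of_le_mul (c := C) (hm.aestronglyMeasurable.mul hf.1) (.of_forall fun ξ => ?_)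
  rw [norm_mul]
  exact mul_le_mul_of_nonneg_right (hC ξ) (norm_nonneg _)

lemma norm_toLp_mul_le {m : Space d → ℂ} (h : IsMult m) (f : L2 d) {C : ℝ}
    (hC : ∀ ξ, ‖m ξ‖ ≤ C) : ‖(h.memLp (Lp.memLp f)).toLp _‖ ≤ C * ‖f‖ := by
  refine Lp.norm_le_mul_norm_of_ae_le_mul ?_
  filter_upwards [(h.memLp (Lp.memLp f)).coeFn_toLp] with ξ hξ
  rw [hξ, norm_mul]
  exact mul_le_mul_of_nonneg_right (hC ξ) (norm_nonneg _)

open Classical in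
/-- Multiplication by a bounded function, as an operator on `L²`. -/
def mulL (m : Space d → ℂ) : L2 d →L[ℂ] L2 d :=
  -- The value 0 for unbounded or non-measurable m makes the operator total, so that symbols are
  -- passed as plain functions and `IsMult` is asked for only where the formula is used.
  if h : IsMult m then
    LinearMap.mkContinuous
      { toFun := fun f => (h.memLp (Lp.memLp f)).toLp _
        map_add' := fun f g => by
          rw [← MemLp.toLp_add]
          refine MemLp.toLp_congr _ _ ?_
          filter_upwards [Lp.coeFn_add f g] with ξ hξ
          change m ξ * (f + g : L2 d) ξ = m ξ * f ξ + m ξ * g ξ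
          rw [hξ, Pi.add_apply, mul_add]
        map_smul' := fun c f => by
          rw [RingHom.id_apply, ← MemLp.toLp_const_smul]
          refine MemLp.toLp_congr _ _ ?_
          filter_upwards [Lp.coeFn_smul c f] with ξ hξ
          change m ξ * (c • f : L2 d) ξ = c * (m ξ * f ξ)
          rw [hξ, Pi.smul_apply, smul_eq_mul, mul_left_comm] }
      h.2.choose (fun f => norm_toLp_mul_le h f h.2.choose_spec)
  else 0

lemma coeFn_mulL {m : Space d → ℂ} (h : IsMult m) (f : L2 d) :
    mulL m f =ᵐ[volume] fun ξ => m ξ * f ξ := by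
  rw [mulL, dif_pos h]
  exact (h.memLp (Lp.memLp f)).coeFn_toLp

lemma norm_mulL_le {m : Space d → ℂ} (h : IsMult m) {C : ℝ} (hC : ∀ ξ, ‖m ξ‖ ≤ C) (f : L2 d) :
    ‖mulL m f‖ ≤ C * ‖f‖ := by
  refine Lp.norm_le_mul_norm_of_ae_le_mul ?_
  filter_upwards [coeFn_mulL h f] with ξ hξ
  rw [hξ, norm_mul]
  exact mul_le_mul_of_nonneg_right (hC ξ) (norm_nonneg _)

lemma mulL_mulL {m m' : Space d → ℂ} (h : IsMult m) (h' : IsMult m') (f : L2 d) :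
    mulL m (mulL m' f) = mulL (fun ξ => m ξ * m' ξ) f := by
  refine Lp.ext ?_
  filter_upwards [coeFn_mulL h (mulL m' f), coeFn_mulL h' f, coeFn_mulL (h.mul h') f]
    with ξ h1 h2 h3
  rw [h1, h2, h3, mul_assoc]

lemma mulL_comm {m m' : Space d → ℂ} (h : IsMult m) (h' : IsMult m') (f : L2 d) :
    mulL m (mulL m' f) = mulL m' (mulL m f) := by
  rw [mulL_mulL h h', mulL_mulL h' h]
  simp_rw [mul_comm]

lemma mulL_one (f : L2 d) : mulL (fun _ => 1) f = f := by
  refine Lp.ext ?_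
  filter_upwards [coeFn_mulL (m := fun _ => 1) ⟨measurable_const, 1, by simp⟩ f] with ξ h1
  rw [h1, one_mul]

lemma inner_mulL {m : Space d → ℂ} (h : IsMult m) (f g : L2 d) :
    ⟪mulL m f, g⟫_ℂ = ∫ ξ, (starRingEnd ℂ) (m ξ * f ξ) * g ξ := by
  rw [L2.inner_def]
  refine integral_congr_ae ?_
  filter_upwards [coeFn_mulL h f] with ξ h1
  rw [h1]
  simp [mul_comm]

lemma inner_mulL_conj {m m' : Space d → ℂ} (h : IsMult m) (h' : IsMult m')
    (hc : ∀ ξ, (starRingEnd ℂ) (m ξ) = m' ξ) (f g : L2 d) :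
    ⟪mulL m f, g⟫_ℂ = ⟪f, mulL m' g⟫_ℂ := by
  rw [inner_mulL h, L2.inner_def]
  refine integral_congr_ae ?_
  filter_upwards [coeFn_mulL h' g] with ξ h1
  rw [h1]
  simp [hc]
  ring

lemma inner_mulL_real {m : Space d → ℝ} (h : IsMult fun ξ => (m ξ : ℂ)) (f g : L2 d) :
    ⟪mulL (fun ξ => (m ξ : ℂ)) f, g⟫_ℂ = ⟪f, mulL (fun ξ => (m ξ : ℂ)) g⟫_ℂ :=
  inner_mulL_conj h h (by simp) f g

/-! ### Young's inequality -/

/-- Cauchy–Schwarz for the measure α(ξ - η)dη, applied to 1 · β, then Tonelli and translation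
invariance. In extended nonnegative reals no integrability has to be known beforehand. -/
lemma lintegral_conv_sq_le {α β : Space d → ℝ≥0∞} (hα : Measurable α) (hβ : Measurable β) :
    ∫⁻ ξ, (∫⁻ η, α (ξ - η) * β η) ^ 2 ≤ (∫⁻ ξ, α ξ) ^ 2 * ∫⁻ ξ, β ξ ^ 2 := by
  have key : ∀ ξ, (∫⁻ η, α (ξ - η) * β η) ^ 2
      ≤ (∫⁻ η, α η) * ∫⁻ η, α (ξ - η) * β η ^ 2 := by
    intro ξ
    have hm : Measurable fun η => α (ξ - η) := by fun_prop
    set μ : Measure (Space d) := volume.withDensity fun η => α (ξ - η)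
    have h1 := ENNReal.lintegral_mul_le_Lp_mul_Lq μ (p := 2) (q := 2)
      (by rw [Real.holderConjugate_iff]; norm_num) (f := fun _ => 1) (g := β) (by fun_prop)
      (by fun_prop)
    have h2 : ∀ γ : Space d → ℝ≥0∞, Measurable γ → ∫⁻ η, γ η ∂μ = ∫⁻ η, α (ξ - η) * γ η := by
      intro γ hγ
      rw [lintegral_withDensity_eq_lintegral_mul _ hm hγ]
      rfl
    have h3 : ∫⁻ η, α (ξ - η) * 1 = ∫⁻ η, α η := by
      simp_rw [mul_one]
      exact lintegral_sub_left_eq_self α ξ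
    simp only [Pi.mul_apply, one_mul, ENNReal.one_rpow] at h1
    rw [h2 _ hβ, h2 _ measurable_const, h3, h2 _ (by fun_prop)] at h1
    calc _ ≤ ((∫⁻ η, α η) ^ (1 / 2 : ℝ) * (∫⁻ η, α (ξ - η) * β η ^ (2 : ℝ)) ^ (1 / 2 : ℝ)) ^ 2 := by
          gcongr
      _ = _ := by
          rw [mul_pow, ← ENNReal.rpow_natCast, ← ENNReal.rpow_natCast, ← ENNReal.rpow_mul,
            ← ENNReal.rpow_mul]
          norm_num
  calc _ ≤ ∫⁻ ξ, (∫⁻ η, α η) * ∫⁻ η, α (ξ - η) * β η ^ 2 := lintegral_mono key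
    _ = (∫⁻ η, α η) * ∫⁻ ξ, ∫⁻ η, α (ξ - η) * β η ^ 2 := by
        rw [lintegral_const_mul]
        exact Measurable.lintegral_prod_right (by fun_prop)
    _ = (∫⁻ η, α η) * ∫⁻ η, ∫⁻ ξ, α (ξ - η) * β η ^ 2 := by
        rw [lintegral_lintegral_swap]
        exact (Measurable.aemeasurable (by fun_prop))
    _ = (∫⁻ η, α η) * ∫⁻ η, (∫⁻ ξ, α ξ) * β η ^ 2 := by
        congr 2
        ext η
        rw [lintegral_mul_const _ (by fun_prop), lintegral_sub_right_eq_self α η]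
    _ = _ := by
        rw [lintegral_const_mul _ (by fun_prop)]
        ring

/-- Convolution of functions on the frequency space. -/
def cv (a f : Space d → ℂ) (ξ : Space d) : ℂ := ∫ η, a (ξ - η) * f η

lemma cv_congr {a a' f f' : Space d → ℂ} (ha : a =ᵐ[volume] a') (hf : f =ᵐ[volume] f') :
    cv a f = cv a' f' := by
  ext ξ
  refine integral_congr_ae ?_
  have : ∀ᵐ η, a (ξ - η) = a' (ξ - η) :=
    (quasiMeasurePreserving_sub_left volume ξ).ae ha
  filter_upwards [this, hf] with η h1 h2
  rw [h1, h2]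

lemma lintegral_enorm_sq_L2 (f : L2 d) : ∫⁻ ξ, ‖f ξ‖ₑ ^ 2 = ENNReal.ofReal (‖f‖ ^ 2) := by
  have h := Lp.enorm_def f
  rw [eLpNorm_eq_lintegral_rpow_enorm_toReal (by norm_num) (by norm_num)] at h
  simp only [ENNReal.toReal_ofNat, ENNReal.rpow_ofNat] at h
  rw [ENNReal.ofReal_pow (norm_nonneg _), ofReal_norm, h, ← ENNReal.rpow_natCast,
    ← ENNReal.rpow_mul]
  norm_num

lemma norm_le_of_lintegral_sq_le {f : L2 d} {C : ℝ} (hC : 0 ≤ C)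
    (h : ∫⁻ ξ, ‖f ξ‖ₑ ^ 2 ≤ ENNReal.ofReal (C ^ 2)) : ‖f‖ ≤ C := by
  rw [lintegral_enorm_sq_L2, ENNReal.ofReal_le_ofReal_iff (by positivity)] at h
  exact le_of_sq_le_sq h hC

lemma lintegral_young {a : Space d → ℂ} (ha : Integrable a) (f : L2 d) :
    ∫⁻ ξ, (∫⁻ η, ‖a (ξ - η)‖ₑ * ‖f η‖ₑ) ^ 2 ≤ ENNReal.ofReal (((∫ ξ, ‖a ξ‖) * ‖f‖) ^ 2) := by
  obtain ⟨a', ha', haa'⟩ := ha.1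
  have h1 := lintegral_conv_sq_le (α := fun ξ => ‖a' ξ‖ₑ) (β := fun ξ => ‖f ξ‖ₑ)
    ha'.measurable.enorm (Lp.stronglyMeasurable f).measurable.enorm
  have h2 : ∀ ξ, ∫⁻ η, ‖a (ξ - η)‖ₑ * ‖f η‖ₑ = ∫⁻ η, ‖a' (ξ - η)‖ₑ * ‖f η‖ₑ := by
    intro ξ
    refine lintegral_congr_ae ?_
    filter_upwards [(quasiMeasurePreserving_sub_left volume ξ).ae haa'] with η h
    rw [h]
  simp_rw [h2]
  refine h1.trans ?_
  have h3 : ∫ ξ, ‖a ξ‖ = ∫ ξ, ‖a' ξ‖ := integral_congr_ae (haa'.fun_comp norm)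
  rw [lintegral_enorm_sq_L2, h3, mul_pow, ENNReal.ofReal_mul (by positivity), ENNReal.ofReal_pow (norm_nonneg f),
    ENNReal.ofReal_pow (integral_nonneg fun _ => norm_nonneg _),
    ofReal_integral_norm_eq_lintegral_enorm (ha.congr haa')]

/-- Young's inequality makes the squared inner integral of absolute values integrable in ξ, hence
finite for almost every ξ. This licenses every splitting of a convolution integral below. -/
lemma integrable_young {a : Space d → ℂ} (ha : Integrable a) {f : Space d → ℂ} (hf : MemLp f 2) :
    ∀ᵐ ξ, Integrable fun η => a (ξ - η) * f η := by
  have h0 : ∀ᵐ ξ, (∫⁻ η, ‖a (ξ - η)‖ₑ * ‖hf.toLp f η‖ₑ) ^ 2 < ∞ := by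
    have h := (lintegral_young ha (hf.toLp f)).trans_lt ENNReal.ofReal_lt_top
    obtain ⟨a', ha', haa'⟩ := ha.1
    have h2 : ∀ ξ, ∫⁻ η, ‖a (ξ - η)‖ₑ * ‖hf.toLp f η‖ₑ
        = ∫⁻ η, ‖a' (ξ - η)‖ₑ * ‖hf.toLp f η‖ₑ := by
      intro ξ
      refine lintegral_congr_ae ?_
      filter_upwards [(quasiMeasurePreserving_sub_left volume ξ).ae haa'] with η h
      rw [h]
    simp_rw [h2] at h ⊢
    refine ae_lt_top ?_ h.ne
    have hm : Measurable (hf.toLp f) := (Lp.stronglyMeasurable _).measurable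
    have := ha'.measurable
    exact (Measurable.lintegral_prod_right (by fun_prop)).pow_const 2
  filter_upwards [h0] with ξ hξ
  have hmeas : AEStronglyMeasurable fun η => a (ξ - η) :=
    ha.1.comp_quasiMeasurePreserving (quasiMeasurePreserving_sub_left volume ξ)
  have h1 : Integrable fun η => a (ξ - η) * hf.toLp f η := by
    refine ⟨hmeas.mul (Lp.aestronglyMeasurable _), ?_⟩
    simp only [HasFiniteIntegral, enorm_mul]
    by_contra hcon
    rw [not_lt, top_le_iff] at hcon
    simp [hcon] at hξ
  refine h1.congr ?_
  filter_upwards [hf.coeFn_toLp] with η h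
  rw [h]

/-- Supplies a genuine L² function with modulus α ∗ |x|, as a majorant for functions that are only
known through a pointwise kernel bound. -/
lemma exists_norm_conv (x : L2 d) {α : Space d → ℝ} (hα : Integrable α) (hα0 : ∀ ξ, 0 ≤ α ξ) :
    ∃ y : L2 d, (∀ᵐ ξ, ‖y ξ‖ = ∫ η, α (ξ - η) * ‖x η‖) ∧ ‖y‖ ≤ (∫ ξ, α ξ) * ‖x‖ := by
  have hαc : Integrable fun ξ => (α ξ : ℂ) := hα.ofReal
  have hx : MemLp (fun ξ => ((‖x ξ‖ : ℝ) : ℂ)) 2 := by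
    refine (Lp.memLp x).of_le (by
      exact Complex.continuous_ofReal.comp_aestronglyMeasurable (Lp.aestronglyMeasurable x).norm)
      (.of_forall fun ξ => by simp)
  have hnn : ∀ ξ, (∫ η, α (ξ - η) * ‖x η‖ : ℝ) = ‖cv (fun ξ => (α ξ : ℂ)) (fun ξ => ((‖x ξ‖ : ℝ) : ℂ)) ξ‖ := by
    intro ξ
    have : cv (fun ξ => (α ξ : ℂ)) (fun ξ => ((‖x ξ‖ : ℝ) : ℂ)) ξ
        = ((∫ η, α (ξ - η) * ‖x η‖ : ℝ) : ℂ) := by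
      rw [cv, ← integral_complex_ofReal]
      simp
    rw [this, Complex.norm_real, Real.norm_of_nonneg]
    exact integral_nonneg fun η => mul_nonneg (hα0 _) (norm_nonneg _)
  have hmeas : AEStronglyMeasurable (cv (fun ξ => (α ξ : ℂ)) (fun ξ => ((‖x ξ‖ : ℝ) : ℂ))) := by
    obtain ⟨a', ha', haa'⟩ := hαc.1
    rw [cv_congr haa' (.refl _ _)]
    have := ha'.measurable
    have hxm : Measurable x := (Lp.stronglyMeasurable x).measurable
    exact (StronglyMeasurable.integral_prod_right
      (Measurable.stronglyMeasurable (by fun_prop))).aestronglyMeasurable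
  have hle : ∫⁻ ξ, ‖cv (fun ξ => (α ξ : ℂ)) (fun ξ => ((‖x ξ‖ : ℝ) : ℂ)) ξ‖ₑ ^ 2
      ≤ ENNReal.ofReal (((∫ ξ, α ξ) * ‖x‖) ^ 2) := by
    have h3 := lintegral_young hαc x
    simp only [Complex.norm_real, Real.norm_of_nonneg (hα0 _)] at h3
    refine le_trans (lintegral_mono fun ξ => ?_) h3
    gcongr
    refine (enorm_integral_le_lintegral_enorm _).trans (lintegral_mono fun η => ?_)
    simp only [enorm_mul]
    gcongr
    rw [← ofReal_norm, ← ofReal_norm]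
    simp
  have hmem : MemLp (cv (fun ξ => (α ξ : ℂ)) (fun ξ => ((‖x ξ‖ : ℝ) : ℂ))) 2 := by
    refine ⟨hmeas, ?_⟩
    rw [eLpNorm_lt_top_iff_lintegral_rpow_enorm_lt_top (by norm_num) (by norm_num)]
    simp only [ENNReal.toReal_ofNat, ENNReal.rpow_ofNat]
    exact hle.trans_lt ENNReal.ofReal_lt_top
  refine ⟨hmem.toLp _, ?_, ?_⟩
  · filter_upwards [hmem.coeFn_toLp] with ξ h
    rw [h, hnn]
  · refine norm_le_of_lintegral_sq_le (mul_nonneg (integral_nonneg hα0) (norm_nonneg _)) ?_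
    refine (lintegral_congr_ae ?_).trans_le hle
    filter_upwards [hmem.coeFn_toLp] with ξ h
    rw [h]

lemma exists_ae_eq_of_ae_le_conv {F : Space d → ℂ} (hF : AEStronglyMeasurable F) {x₁ x₂ : L2 d}
    {α₁ α₂ : Space d → ℝ} (h1 : Integrable α₁) (h2 : Integrable α₂) (hα₁ : ∀ ξ, 0 ≤ α₁ ξ)
    (hα₂ : ∀ ξ, 0 ≤ α₂ ξ) {C : ℝ} (hC : 0 ≤ C)
    (h : ∀ᵐ ξ, ‖F ξ‖ ≤ C * ((∫ η, α₁ (ξ - η) * ‖x₁ η‖) + ∫ η, α₂ (ξ - η) * ‖x₂ η‖)) :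
    ∃ y : L2 d, y =ᵐ[volume] F ∧ ‖y‖ ≤ C * ((∫ ξ, α₁ ξ) * ‖x₁‖ + (∫ ξ, α₂ ξ) * ‖x₂‖) := by
  obtain ⟨y₁, hy₁, hy₁'⟩ := exists_norm_conv x₁ h1 hα₁
  obtain ⟨y₂, hy₂, hy₂'⟩ := exists_norm_conv x₂ h2 hα₂
  have hn : MemLp (fun ξ => ‖y₁ ξ‖ + ‖y₂ ξ‖) 2 := (Lp.memLp y₁).norm.add (Lp.memLp y₂).norm
  have hle : ∀ᵐ ξ, ‖F ξ‖ ≤ C * ‖‖y₁ ξ‖ + ‖y₂ ξ‖‖ := by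
    filter_upwards [h, hy₁, hy₂] with ξ g1 g2 g3
    rw [Real.norm_of_nonneg (by positivity), g2, g3]
    exact g1
  have hFm : MemLp F 2 := hn.of_le_mul hF hle
  refine ⟨hFm.toLp F, hFm.coeFn_toLp, ?_⟩
  have e1 : ‖hFm.toLp F‖ ≤ C * ‖hn.toLp _‖ := by
    refine Lp.norm_le_mul_norm_of_ae_le_mul ?_
    filter_upwards [hle, hFm.coeFn_toLp, hn.coeFn_toLp] with ξ g1 g2 g3
    rw [g2, g3]
    exact g1
  have e2 : ‖hn.toLp _‖ ≤ ‖y₁‖ + ‖y₂‖ := by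
    have : hn.toLp _ = (Lp.memLp y₁).norm.toLp _ + (Lp.memLp y₂).norm.toLp _ := rfl
    rw [this]
    refine (norm_add_le _ _).trans (le_of_eq ?_)
    rw [Lp.norm_toLp, Lp.norm_toLp, eLpNorm_norm, eLpNorm_norm]
    rfl
  exact e1.trans (mul_le_mul_of_nonneg_left (e2.trans (add_le_add hy₁' hy₂')) hC)

lemma norm_sq_eq_integral (g : L2 d) : ‖g‖ ^ 2 = ∫ x, ‖g x‖ ^ 2 := by
  rw [← ENNReal.toReal_ofReal (sq_nonneg ‖g‖), ← lintegral_enorm_sq_L2 g,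
    integral_eq_lintegral_of_nonneg_ae (.of_forall fun x => sq_nonneg _)
      (by exact (Lp.aestronglyMeasurable g).norm.pow 2)]
  congr 2
  ext x
  rw [ENNReal.ofReal_pow (norm_nonneg _), ofReal_norm]

/-! ### Convolution operators and the Fourier transform -/

lemma continuous_fourierFun {f : Space d → ℂ} (hf : Integrable f) :
    Continuous (𝓕 f : Space d → ℂ) :=
  VectorFourier.fourierIntegral_continuous Real.continuous_fourierChar
    (by exact continuous_inner) hf

lemma continuous_fourierInvFun {f : Space d → ℂ} (hf : Integrable f) :
    Continuous (𝓕⁻ f : Space d → ℂ) := by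
  have : (𝓕⁻ f : Space d → ℂ) = fun x => (𝓕 f : Space d → ℂ) (-x) := by
    ext x
    exact Real.fourierInv_eq_fourier_neg f x
  rw [this]
  exact (continuous_fourierFun hf).comp continuous_neg

lemma norm_fourierInvFun_le (f : Space d → ℂ) (x : Space d) :
    ‖(𝓕⁻ f : Space d → ℂ) x‖ ≤ ∫ ξ, ‖f ξ‖ := by
  rw [Real.fourierInv_eq_fourier_neg]
  exact VectorFourier.norm_fourierIntegral_le_integral_norm _ _ _ _ _

/-- The Fourier integral and the Plancherel extension both satisfy ∫ φ · 𝓕f = ∫ 𝓕φ · f for test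
functions φ, and this determines a locally integrable function. -/
lemma fourierFun_ae_eq {f : Space d → ℂ} (hf : Integrable f) (hf2 : MemLp f 2) :
    (𝓕 f : Space d → ℂ) =ᵐ[volume] (𝓕 (hf2.toLp f) : L2 d) := by
  refine ae_eq_of_integral_contDiff_smul_eq (continuous_fourierFun hf).locallyIntegrable
    ((Lp.memLp _).locallyIntegrable (by norm_num)) fun g hg hgc => ?_
  have hg₁ : HasCompactSupport (Complex.ofRealCLM ∘ g) := hgc.comp_left rfl
  have hg₂ : ContDiff ℝ (⊤ : ℕ∞) (Complex.ofRealCLM ∘ g) := Complex.ofRealCLM.contDiff.comp hg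
  set φ : 𝓢(Space d, ℂ) := hg₁.toSchwartzMap hg₂ with hφ
  have h1 := DFunLike.congr_fun (Lp.fourier_toTemperedDistribution_eq (hf2.toLp f)) φ
  rw [TemperedDistribution.fourier_apply, Lp.toTemperedDistribution_apply,
    Lp.toTemperedDistribution_apply] at h1
  have h2 := VectorFourier.integral_fourierIntegral_smul_eq_flip (L := innerₗ (Space d))
    (μ := volume) (ν := volume) Real.continuous_fourierChar (by exact continuous_inner) φ.integrable hf
  have e1 : ∫ x, g x • (𝓕 f : Space d → ℂ) x = ∫ x, φ x • (𝓕 f : Space d → ℂ) x := by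
    simp [φ]
  have e2 : ∫ x, g x • (𝓕 (hf2.toLp f) : L2 d) x = ∫ x, φ x • (𝓕 (hf2.toLp f) : L2 d) x := by
    simp [φ]
  rw [e1, e2, ← h1]
  have e3 : ∫ x, (𝓕 φ) x • hf2.toLp f x = ∫ x, (𝓕 φ) x • f x := by
    refine integral_congr_ae ?_
    filter_upwards [hf2.coeFn_toLp] with x hx
    rw [hx]
  rw [e3, SchwartzMap.fourier_coe]
  rw [flip_innerₗ] at h2
  exact h2.symm

lemma fourierInvFun_ae_eq {f : Space d → ℂ} (hf : Integrable f) (hf2 : MemLp f 2) :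
    (𝓕⁻ f : Space d → ℂ) =ᵐ[volume] (𝓕⁻ (hf2.toLp f) : L2 d) := by
  refine ae_eq_of_integral_contDiff_smul_eq (continuous_fourierInvFun hf).locallyIntegrable
    ((Lp.memLp _).locallyIntegrable (by norm_num)) fun g hg hgc => ?_
  have hg₁ : HasCompactSupport (Complex.ofRealCLM ∘ g) := hgc.comp_left rfl
  have hg₂ : ContDiff ℝ (⊤ : ℕ∞) (Complex.ofRealCLM ∘ g) := Complex.ofRealCLM.contDiff.comp hg
  set φ : 𝓢(Space d, ℂ) := hg₁.toSchwartzMap hg₂ with hφ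
  have h1 := DFunLike.congr_fun (Lp.fourierInv_toTemperedDistribution_eq (hf2.toLp f)) φ
  rw [TemperedDistribution.fourierInv_apply, Lp.toTemperedDistribution_apply,
    Lp.toTemperedDistribution_apply] at h1
  have h2 := VectorFourier.integral_fourierIntegral_smul_eq_flip (L := innerₗ (Space d))
    (μ := volume) (ν := volume) Real.continuous_fourierChar (by exact continuous_inner) φ.integrable hf.comp_neg
  have e1 : ∫ x, g x • (𝓕⁻ f : Space d → ℂ) x = ∫ x, φ x • (𝓕⁻ f : Space d → ℂ) x := by
    simp [φ]
  have e2 : ∫ x, g x • (𝓕⁻ (hf2.toLp f) : L2 d) x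
      = ∫ x, φ x • (𝓕⁻ (hf2.toLp f) : L2 d) x := by
    simp [φ]
  rw [e1, e2, ← h1]
  have e3 : ∫ x, (𝓕⁻ φ) x • hf2.toLp f x = ∫ x, (𝓕⁻ φ) x • f x := by
    refine integral_congr_ae ?_
    filter_upwards [hf2.coeFn_toLp] with x hx
    rw [hx]
  rw [e3, SchwartzMap.fourierInv_coe, Real.fourierInv_eq_fourier_comp_neg f]
  rw [flip_innerₗ] at h2
  refine h2.symm.trans ?_
  rw [← integral_neg_eq_self]
  simp only [neg_neg]
  refine integral_congr_ae (.of_forall fun x => ?_)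
  change _ = (𝓕⁻ (φ : Space d → ℂ) : Space d → ℂ) x • f x
  rw [Real.fourierInv_eq_fourier_neg]
  rfl

lemma isMult_fourierInv {a : Space d → ℂ} (ha : Integrable a) :
    IsMult (𝓕⁻ a : Space d → ℂ) :=
  ⟨(continuous_fourierInvFun ha).measurable, _, norm_fourierInvFun_le a⟩

/-- Convolution with an integrable function, as an operator on `L²`. -/
def convL (a : Space d → ℂ) : L2 d →L[ℂ] L2 d :=
  (Lp.fourierTransformₗᵢ (Space d) ℂ).toContinuousLinearEquiv.toContinuousLinearMap ∘L
    mulL (𝓕⁻ a : Space d → ℂ) ∘L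
    (Lp.fourierTransformₗᵢ (Space d) ℂ).symm.toContinuousLinearEquiv.toContinuousLinearMap

lemma convL_apply (a : Space d → ℂ) (f : L2 d) :
    convL a f = 𝓕 (mulL (𝓕⁻ a : Space d → ℂ) (𝓕⁻ f)) := rfl

lemma norm_fourierInv_L2 (f : L2 d) : ‖(𝓕⁻ f : L2 d)‖ = ‖f‖ :=
  (Lp.fourierTransformₗᵢ (Space d) ℂ).symm.norm_map f

lemma inner_fourier_left (f g : L2 d) : ⟪(𝓕 f : L2 d), g⟫_ℂ = ⟪f, (𝓕⁻ g : L2 d)⟫_ℂ := by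
  conv_lhs => rw [← FourierTransform.fourier_fourierInv_eq (E := L2 d) (F := L2 d) g]
  exact Lp.inner_fourier_eq _ _

lemma inner_fourierInv_left (f g : L2 d) : ⟪(𝓕⁻ f : L2 d), g⟫_ℂ = ⟪f, (𝓕 g : L2 d)⟫_ℂ := by
  rw [← inner_conj_symm, ← inner_fourier_left, inner_conj_symm]

lemma norm_convL_le {a : Space d → ℂ} (ha : Integrable a) (f : L2 d) :
    ‖convL a f‖ ≤ (∫ ξ, ‖a ξ‖) * ‖f‖ := by
  rw [convL_apply, Lp.norm_fourier_eq]
  refine (norm_mulL_le (isMult_fourierInv ha) (norm_fourierInvFun_le a) _).trans_eq ?_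
  rw [norm_fourierInv_L2]

/-- In physical space `convL a` is multiplication by the bounded function 𝓕⁻a. Commutation, symmetry
(`inner_convL`) and lower bounds (`le_inner_convL`) are thus facts about multiplication operators;
the convolution integral is only needed for kernel estimates. -/
lemma convL_comm {a a' : Space d → ℂ} (ha : Integrable a) (ha' : Integrable a') (f : L2 d) :
    convL a (convL a' f) = convL a' (convL a f) := by
  simp only [convL_apply, FourierTransform.fourierInv_fourier_eq]
  rw [mulL_comm (isMult_fourierInv ha) (isMult_fourierInv ha')]

/-- Hermitian symmetry, which characterizes the Fourier transforms of real functions. -/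
def Herm (a : Space d → ℂ) : Prop := ∀ᵐ ξ, a (-ξ) = (starRingEnd ℂ) (a ξ)

lemma Herm.conj_fourierInv {a : Space d → ℂ} (h : Herm a) (x : Space d) :
    (starRingEnd ℂ) ((𝓕⁻ a : Space d → ℂ) x) = (𝓕⁻ a : Space d → ℂ) x := by
  rw [Real.fourierInv_eq', ← integral_conj, ← integral_neg_eq_self]
  refine integral_congr_ae ?_
  filter_upwards [h] with ξ hξ
  simp only [hξ, smul_eq_mul, map_mul, ← Complex.exp_conj, inner_neg_left, Complex.conj_ofReal,
    Complex.conj_I]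
  congr 2
  · push_cast
    ring
  · exact Complex.conj_conj _

lemma inner_convL {a : Space d → ℂ} (ha : Integrable a) (h : Herm a) (f g : L2 d) :
    ⟪convL a f, g⟫_ℂ = ⟪f, convL a g⟫_ℂ := by
  rw [convL_apply, convL_apply, inner_fourier_left,
    inner_mulL_conj (isMult_fourierInv ha) (isMult_fourierInv ha) h.conj_fourierInv,
    ← inner_fourierInv_left]

lemma convL_sub {a a' : Space d → ℂ} (ha : Integrable a) (ha' : Integrable a') (f : L2 d) :
    convL (a - a') f = convL a f - convL a' f := by
  have h1 : (𝓕⁻ (a - a') : Space d → ℂ) = fun x =>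
      (𝓕⁻ a : Space d → ℂ) x - (𝓕⁻ a' : Space d → ℂ) x := by
    ext x
    simp only [Real.fourierInv_eq, Pi.sub_apply, smul_sub]
    exact integral_sub (by simpa using (Real.fourierIntegral_convergent_iff (-x)).2 ha)
      (by simpa using (Real.fourierIntegral_convergent_iff (-x)).2 ha')
  have h2 : mulL (𝓕⁻ (a - a') : Space d → ℂ) (𝓕⁻ f : L2 d)
      = mulL (𝓕⁻ a : Space d → ℂ) (𝓕⁻ f : L2 d) - mulL (𝓕⁻ a' : Space d → ℂ) (𝓕⁻ f : L2 d) := by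
    refine Lp.ext ?_
    filter_upwards [coeFn_mulL (isMult_fourierInv (ha.sub ha')) (𝓕⁻ f : L2 d),
      coeFn_mulL (isMult_fourierInv ha) (𝓕⁻ f : L2 d),
      coeFn_mulL (isMult_fourierInv ha') (𝓕⁻ f : L2 d), Lp.coeFn_sub
        (mulL (𝓕⁻ a : Space d → ℂ) (𝓕⁻ f : L2 d)) (mulL (𝓕⁻ a' : Space d → ℂ) (𝓕⁻ f : L2 d))]
      with x e1 e2 e3 e4
    rw [e4, Pi.sub_apply, e1, e2, e3, h1]
    ring
  rw [convL_apply, convL_apply, convL_apply, h2]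
  exact map_sub (Lp.fourierTransformₗᵢ (Space d) ℂ) _ _

/-- By Plancherel, Re⟨f, a ∗ f⟩ = ∫ Re(𝓕⁻a)|𝓕⁻f|². A pointwise lower bound on the depth thereby
becomes an operator lower bound. -/
lemma le_inner_convL {a : Space d → ℂ} (ha : Integrable a) {ε h : ℝ}
    (hh : ∀ x, h ≤ 1 + ε * ((𝓕⁻ a : Space d → ℂ) x).re) (f : L2 d) :
    h * ‖f‖ ^ 2 ≤ ‖f‖ ^ 2 + ε * (⟪f, convL a f⟫_ℂ).re := by
  have hm := isMult_fourierInv ha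
  set g : L2 d := 𝓕⁻ f with hg
  have h1 : ⟪f, convL a f⟫_ℂ = ⟪g, mulL (𝓕⁻ a : Space d → ℂ) g⟫_ℂ := by
    rw [convL_apply, inner_fourierInv_left]
  have hn : ‖f‖ = ‖g‖ := (norm_fourierInv_L2 f).symm
  have h2 := norm_sq_eq_integral g
  have hi : Integrable fun x => ‖g x‖ ^ 2 := (memLp_two_iff_integrable_sq_norm (Lp.aestronglyMeasurable g)).1 (Lp.memLp g)
  have h3 : (⟪g, mulL (𝓕⁻ a : Space d → ℂ) g⟫_ℂ).re
      = ∫ x, ((𝓕⁻ a : Space d → ℂ) x).re * ‖g x‖ ^ 2 := by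
    rw [L2.inner_def, ← RCLike.re_eq_complex_re, ← integral_re (L2.integrable_inner _ _)]
    refine integral_congr_ae ?_
    filter_upwards [coeFn_mulL hm g] with x hx
    rw [hx, RCLike.inner_apply, mul_assoc, RCLike.mul_conj]
    rw [RCLike.re_eq_complex_re]
    have : (((‖g x‖ : ℝ) : ℂ)) ^ 2 = ((‖g x‖ ^ 2 : ℝ) : ℂ) := by norm_cast
    exact (congrArg Complex.re (congrArg _ this)).trans (Complex.re_mul_ofReal _ _)
  obtain ⟨C, hC⟩ := hm.2
  have hi2 : Integrable fun x => ((𝓕⁻ a : Space d → ℂ) x).re * ‖g x‖ ^ 2 := by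
    refine hi.bdd_mul (c := C) ?_ (.of_forall fun x => ?_)
    · exact (Complex.continuous_re.comp (continuous_fourierInvFun ha)).aestronglyMeasurable
    · exact (Complex.abs_re_le_norm _).trans (hC x)
  rw [h1, hn, h3, h2, ← integral_const_mul, ← integral_const_mul, ← integral_add hi (hi2.const_mul _)]
  refine integral_mono (hi.const_mul _) (hi.add (hi2.const_mul _)) fun x => ?_
  have := mul_le_mul_of_nonneg_right (hh x) (sq_nonneg ‖g x‖)
  simp only
  linarith

lemma cv_eq_convolution (a f : Space d → ℂ) :
    cv a f = convolution f a (ContinuousLinearMap.mul ℂ ℂ) volume := by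
  ext ξ
  simp [cv, convolution, mul_comm]

lemma fourierInv_cv {a f : Space d → ℂ} (ha : Integrable a) (hf : Integrable f) (x : Space d) :
    (𝓕⁻ (cv a f) : Space d → ℂ) x = (𝓕⁻ a : Space d → ℂ) x * (𝓕⁻ f : Space d → ℂ) x := by
  rw [Real.fourierInv_eq_fourier_neg, Real.fourierInv_eq_fourier_neg,
    Real.fourierInv_eq_fourier_neg, cv_eq_convolution, Real.fourier_mul_convolution_eq hf ha,
    mul_comm]

lemma aestronglyMeasurable_cv {a f : Space d → ℂ} (ha : AEStronglyMeasurable a)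
    (hf : AEStronglyMeasurable f) : AEStronglyMeasurable (cv a f) := by
  obtain ⟨a', ha', haa'⟩ := ha
  obtain ⟨f', hf', hff'⟩ := hf
  rw [cv_congr haa' hff']
  have := ha'.measurable
  have := hf'.measurable
  exact (StronglyMeasurable.integral_prod_right
    (Measurable.stronglyMeasurable (by fun_prop))).aestronglyMeasurable

lemma lintegral_cv_sq_le {a f : Space d → ℂ} (ha : Integrable a) (hf : MemLp f 2) :
    ∫⁻ ξ, ‖cv a f ξ‖ₑ ^ 2 ≤ ENNReal.ofReal (((∫ ξ, ‖a ξ‖) * ‖hf.toLp f‖) ^ 2) := by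
  refine le_trans (lintegral_mono fun ξ => ?_) (lintegral_young ha (hf.toLp f))
  rw [cv_congr (.refl _ _) hf.coeFn_toLp.symm]
  gcongr
  refine (enorm_integral_le_lintegral_enorm _).trans_eq ?_
  simp only [enorm_mul]

lemma memLp_cv {a f : Space d → ℂ} (ha : Integrable a) (hf : MemLp f 2) : MemLp (cv a f) 2 := by
  refine ⟨aestronglyMeasurable_cv ha.1 hf.1, ?_⟩
  rw [eLpNorm_lt_top_iff_lintegral_rpow_enorm_lt_top (by norm_num) (by norm_num)]
  simp only [ENNReal.toReal_ofNat, ENNReal.rpow_ofNat]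
  exact (lintegral_cv_sq_le ha hf).trans_lt ENNReal.ofReal_lt_top

lemma integrable_cv {a f : Space d → ℂ} (ha : Integrable a) (hf : Integrable f) :
    Integrable (cv a f) := by
  rw [cv_eq_convolution]
  exact hf.integrable_convolution _ ha

lemma toLp_cv_of_integrable {a f : Space d → ℂ} (ha : Integrable a) (hf : Integrable f)
    (hf2 : MemLp f 2) : (memLp_cv ha hf2).toLp _ = convL a (hf2.toLp f) := by
  have h1 := fourierInvFun_ae_eq (integrable_cv ha hf) (memLp_cv ha hf2)
  have h2 := fourierInvFun_ae_eq hf hf2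
  have h3 : (𝓕⁻ ((memLp_cv ha hf2).toLp _) : L2 d)
      = mulL (𝓕⁻ a : Space d → ℂ) (𝓕⁻ (hf2.toLp f)) := by
    refine Lp.ext ?_
    filter_upwards [h1, h2, coeFn_mulL (isMult_fourierInv ha) (𝓕⁻ (hf2.toLp f) : L2 d)]
      with x e1 e2 e3
    rw [e3, ← e1, ← e2, fourierInv_cv ha hf]
  rw [convL_apply, ← h3, FourierTransform.fourier_fourierInv_eq]

/-- Restriction of a square-integrable function to a ball. -/
lemma tendsto_indicator_ball (f : L2 d) :
    Tendsto (fun n : ℕ => ((Lp.memLp f).indicator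
      (measurableSet_closedBall (x := (0 : Space d)) (ε := n))).toLp _) atTop (𝓝 f) := by
  rw [tendsto_iff_norm_sub_tendsto_zero]
  have h := tendsto_integral_filter_of_dominated_convergence (l := atTop) (μ := volume)
    (F := fun (n : ℕ) (ξ : Space d) => ‖(Metric.closedBall (0 : Space d) n)ᶜ.indicator f ξ‖ ^ 2)
    (f := fun _ => 0) (fun ξ => ‖f ξ‖ ^ 2) (.of_forall fun n => by
      have := (Lp.aestronglyMeasurable f).indicator
        (measurableSet_closedBall (x := (0 : Space d)) (ε := n)).compl
      exact (this.norm.pow 2)) (.of_forall fun n => .of_forall fun ξ => by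
        rw [Real.norm_of_nonneg (by positivity)]
        gcongr
        exact norm_indicator_le_norm_self _ _)
    ((memLp_two_iff_integrable_sq_norm (Lp.aestronglyMeasurable f)).1 (Lp.memLp f))
    (.of_forall fun ξ => by
      refine tendsto_const_nhds.congr' ?_
      filter_upwards [eventually_ge_atTop ⌈‖ξ‖⌉₊] with n hn
      rw [indicator_of_notMem]
      · simp
      · simpa using (Nat.le_ceil _).trans (Nat.cast_le.2 hn))
  simp only [integral_zero] at h
  have hs : ∀ n : ℕ, ‖((Lp.memLp f).indicator
      (measurableSet_closedBall (x := (0 : Space d)) (ε := n))).toLp _ - f‖ ^ 2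
      = ∫ ξ, ‖(Metric.closedBall (0 : Space d) n)ᶜ.indicator f ξ‖ ^ 2 := by
    intro n
    set g := ((Lp.memLp f).indicator
      (measurableSet_closedBall (x := (0 : Space d)) (ε := n))).toLp _ - f with hg
    rw [norm_sq_eq_integral g]
    refine integral_congr_ae ?_
    filter_upwards [Lp.coeFn_sub (((Lp.memLp f).indicator
      (measurableSet_closedBall (x := (0 : Space d)) (ε := n))).toLp _) f,
      ((Lp.memLp f).indicator
      (measurableSet_closedBall (x := (0 : Space d)) (ε := n))).coeFn_toLp] with x h1 h2
    rw [h1, Pi.sub_apply, h2]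
    by_cases hx : x ∈ Metric.closedBall (0 : Space d) n
    · rw [indicator_of_mem hx, indicator_of_notMem (by simpa using hx)]; simp
    · rw [indicator_of_notMem hx, indicator_of_mem (by simpa using hx)]; simp
  have h2 := (Real.continuous_sqrt.tendsto 0).comp h
  rw [Real.sqrt_zero] at h2
  refine h2.congr fun n => ?_
  rw [Function.comp_apply, ← hs, Real.sqrt_sq (norm_nonneg _)]

/-- Both sides are continuous in f for the L² norm, the right one by Young's inequality. Restricting
f to balls puts it in L¹ ∩ L², where the classical convolution theorem applies. -/
lemma coeFn_convL {a : Space d → ℂ} (ha : Integrable a) (f : L2 d) :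
    convL a f =ᵐ[volume] cv a f := by
  have hmem := memLp_cv ha (Lp.memLp f)
  suffices h : convL a f = hmem.toLp _ by
    rw [h]; exact hmem.coeFn_toLp
  have hcut : ∀ n : ℕ, MemLp ((Metric.closedBall (0 : Space d) n).indicator f) 2 := fun n =>
    (Lp.memLp f).indicator measurableSet_closedBall
  have hint : ∀ n : ℕ, Integrable ((Metric.closedBall (0 : Space d) n).indicator f) := fun n => by
    rw [integrable_indicator_iff measurableSet_closedBall]
    exact ((Lp.memLp f).locallyIntegrable (by norm_num)).integrableOn_isCompact
      (isCompact_closedBall _ _)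
  have ht := tendsto_indicator_ball f
  have l1 := ((convL a).continuous.tendsto f).comp ht
  refine tendsto_nhds_unique l1 ?_
  rw [tendsto_iff_norm_sub_tendsto_zero] at ht ⊢
  have h0 : Tendsto (fun n : ℕ => (∫ ξ, ‖a ξ‖) * ‖(hcut n).toLp _ - f‖) atTop (𝓝 0) := by
    simpa using ht.const_mul (∫ ξ, ‖a ξ‖)
  refine squeeze_zero (fun _ => norm_nonneg _) (fun n => ?_) h0
  have hsub : MemLp ((Metric.closedBall (0 : Space d) n).indicator f - (f : Space d → ℂ)) 2 :=
    (hcut n).sub (Lp.memLp f)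
  have e1 : (memLp_cv ha hsub).toLp _ = (memLp_cv ha (hcut n)).toLp _ - hmem.toLp _ := by
    rw [← MemLp.toLp_sub]
    refine MemLp.toLp_congr _ _ ?_
    filter_upwards [integrable_young ha (hcut n), integrable_young ha (Lp.memLp f)] with ξ i1 i2
    simp only [cv, Pi.sub_apply, mul_sub]
    exact integral_sub i1 i2
  have e2 : (hcut n).toLp _ - f = hsub.toLp _ := by
    rw [MemLp.toLp_sub (hcut n) (Lp.memLp f), Lp.toLp_coeFn]
  rw [Function.comp_apply, ← toLp_cv_of_integrable ha (hint n) (hcut n), ← e1, e2]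
  refine norm_le_of_lintegral_sq_le (by positivity) ((lintegral_congr_ae ?_).trans_le
    (lintegral_cv_sq_le ha hsub))
  filter_upwards [(memLp_cv ha hsub).coeFn_toLp] with ξ h
  rw [h]

/-- On `L¹ ∩ L²`, the Fourier transform of a product is a convolution. -/
lemma prod_ae_eq_cv {f g : Space d → ℂ} (hf : Integrable f) (hg : Integrable g)
    (hf2 : MemLp f 2) (hg2 : MemLp g 2) : prod f g =ᵐ[volume] cv f g := by
  have h1 := fourierInvFun_ae_eq hf hf2
  have h2 := fourierInvFun_ae_eq hg hg2
  set F : L2 d := 𝓕⁻ (hf2.toLp f) with hF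
  set G : L2 d := 𝓕⁻ (hg2.toLp g) with hG
  have hp : (fun x => (𝓕⁻ f : Space d → ℂ) x * (𝓕⁻ g : Space d → ℂ) x)
      =ᵐ[volume] fun x => F x * G x := by
    filter_upwards [h1, h2] with x e1 e2
    rw [e1, e2]
  -- A product of two L² functions is integrable, so the outer Fourier transform in `prod` is an
  -- honest integral.
  have hint : Integrable (fun x => (𝓕⁻ f : Space d → ℂ) x * (𝓕⁻ g : Space d → ℂ) x) := by
    refine Integrable.congr ?_ hp.symm
    exact MemLp.integrable_mul (p := 2) (q := 2) (Lp.memLp F) (Lp.memLp G)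
  have hmulp : mulL (𝓕⁻ f : Space d → ℂ) G =ᵐ[volume]
      fun x => (𝓕⁻ f : Space d → ℂ) x * (𝓕⁻ g : Space d → ℂ) x := by
    filter_upwards [coeFn_mulL (isMult_fourierInv hf) G, h2] with x e1 e2
    rw [e1, e2]
  -- The same product is also square integrable, one factor being bounded. Its Fourier integral
  -- therefore agrees with the Plancherel transform, which is a `convL`.
  have hmem : MemLp (fun x => (𝓕⁻ f : Space d → ℂ) x * (𝓕⁻ g : Space d → ℂ) x) 2 :=
    (memLp_congr_ae hmulp).1 (Lp.memLp _)
  have e1 := fourierFun_ae_eq hint hmem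
  have e2 : hmem.toLp _ = mulL (𝓕⁻ f : Space d → ℂ) G := by
    refine Lp.ext ?_
    exact hmem.coeFn_toLp.trans hmulp.symm
  rw [e2] at e1
  have e3 := coeFn_convL hf (hg2.toLp g)
  rw [convL_apply] at e3
  refine e1.trans (e3.trans ?_)
  rw [cv_congr (.refl _ _) hg2.coeFn_toLp]

/-! ### Weights -/

/-- The bracket in the frequency variable of `𝓕`. -/
def bk (ξ : Space d) : ℝ := bracket ((2 * π) • ξ)

/-- The weight `⟨2πξ⟩^r`. -/
def wt (r : ℝ) (ξ : Space d) : ℝ := bk ξ ^ r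

lemma continuous_bk : Continuous (bk : Space d → ℝ) := by
  unfold bk bracket
  fun_prop

lemma one_le_bk (ξ : Space d) : 1 ≤ bk ξ := by
  rw [bk, bracket, Real.one_le_sqrt]
  nlinarith [sq_nonneg ‖(2 * π) • ξ‖]

lemma bk_pos (ξ : Space d) : 0 < bk ξ := zero_lt_one.trans_le (one_le_bk ξ)

lemma bk_neg (ξ : Space d) : bk (-ξ) = bk ξ := by simp [bk, bracket]

lemma norm_le_bk (ξ : Space d) : ‖(2 * π) • ξ‖ ≤ bk ξ := by
  rw [bk, bracket]
  exact Real.le_sqrt_of_sq_le (by linarith)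

lemma bk_le_one_add (ξ : Space d) : bk ξ ≤ 1 + ‖(2 * π) • ξ‖ := by
  rw [bk, bracket, Real.sqrt_le_left (by positivity)]
  nlinarith [norm_nonneg ((2 * π) • ξ)]

lemma bk_le_add_norm (ξ η : Space d) : bk ξ ≤ bk η + ‖(2 * π) • (ξ - η)‖ := by
  have h1 : ‖(2 * π) • ξ‖ ≤ ‖(2 * π) • η‖ + ‖(2 * π) • (ξ - η)‖ := by
    refine le_trans (le_of_eq ?_) (norm_add_le _ _)
    rw [← smul_add]
    simp
  have h2 := norm_le_bk η
  have h3 : bk η ^ 2 = 1 + ‖(2 * π) • η‖ ^ 2 := by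
    rw [bk, bracket, Real.sq_sqrt (by positivity)]
  have h4 := bk_pos η
  rw [bk, bracket, Real.sqrt_le_left (by positivity)]
  have := norm_nonneg ((2 * π) • ξ)
  have := norm_nonneg ((2 * π) • (ξ - η))
  nlinarith [mul_le_mul h1 h1 (norm_nonneg _) (by positivity),
    mul_le_mul_of_nonneg_right h2 (norm_nonneg ((2 * π) • (ξ - η)))]

lemma norm_sub_symm (ξ η : Space d) : ‖(2 * π) • (ξ - η)‖ = ‖(2 * π) • (η - ξ)‖ := by
  rw [← norm_neg, ← smul_neg, neg_sub]

lemma abs_bk_sub_le (ξ η : Space d) : |bk ξ - bk η| ≤ ‖(2 * π) • (ξ - η)‖ := by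
  rw [abs_le]
  have h1 := bk_le_add_norm ξ η
  have h2 := bk_le_add_norm η ξ
  rw [norm_sub_symm η ξ] at h2
  constructor <;> linarith

lemma bk_le_add (ξ η : Space d) : bk ξ ≤ bk (ξ - η) + bk η := by
  have := bk_le_add_norm ξ η
  have := norm_le_bk (ξ - η)
  linarith

lemma bk_mono {ξ η : Space d} (h : ‖ξ‖ ≤ ‖η‖) : bk ξ ≤ bk η := by
  rw [bk, bk, bracket, bracket, norm_smul, norm_smul]
  gcongr

lemma continuous_wt (r : ℝ) : Continuous (wt r : Space d → ℝ) :=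
  continuous_bk.rpow_const fun ξ => Or.inl (bk_pos ξ).ne'

lemma wt_pos (r : ℝ) (ξ : Space d) : 0 < wt r ξ := rpow_pos_of_pos (bk_pos ξ) r

lemma wt_neg_arg (r : ℝ) (ξ : Space d) : wt r (-ξ) = wt r ξ := by rw [wt, wt, bk_neg]

lemma wt_add (r r' : ℝ) (ξ : Space d) : wt (r + r') ξ = wt r ξ * wt r' ξ :=
  rpow_add (bk_pos ξ) r r'

lemma wt_one (ξ : Space d) : wt 1 ξ = bk ξ := rpow_one _

lemma wt_zero (ξ : Space d) : wt 0 ξ = 1 := rpow_zero _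

lemma wt_mono {r r' : ℝ} (h : r ≤ r') (ξ : Space d) : wt r ξ ≤ wt r' ξ :=
  rpow_le_rpow_of_exponent_le (one_le_bk ξ) h

lemma wt_mul_neg (r : ℝ) (ξ : Space d) : wt r ξ * wt (-r) ξ = 1 := by
  rw [← wt_add, add_neg_cancel, wt_zero]

lemma isMult_wt_neg {r : ℝ} (hr : r ≤ 0) : IsMult fun ξ : Space d => (wt r ξ : ℂ) :=
  IsMult.ofReal (C := 1) (continuous_wt r).measurable fun ξ => by
    rw [abs_of_pos (wt_pos r ξ), ← wt_zero ξ]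
    exact wt_mono hr ξ

lemma norm_wt_le_one {r : ℝ} (hr : r ≤ 0) (ξ : Space d) : ‖(wt r ξ : ℂ)‖ ≤ 1 := by
  rw [Complex.norm_real, Real.norm_of_nonneg (wt_pos r ξ).le, ← wt_zero ξ]
  exact wt_mono hr ξ

/-- Bernoulli's inequality with exponent r + 1, since r itself may be below 1; for t ≥ 1 it is
applied to 1/t and multiplied by t^(r+1) ≤ 2^(r+1). -/
lemma abs_rpow_sub_one_le {r t : ℝ} (hr : 0 ≤ r) (ht0 : 0 < t) (ht : t ≤ 2) :
    |t ^ r - 1| ≤ (r + 1) * 2 ^ (r + 1) * |t - 1| := by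
  have h2 : (1 : ℝ) ≤ 2 ^ (r + 1) := one_le_rpow (by norm_num) (by linarith)
  rcases le_total t 1 with h | h
  · have b := one_add_mul_self_le_rpow_one_add (s := t - 1) (by linarith) (p := r + 1) (by linarith)
    rw [show 1 + (t - 1) = t by ring] at b
    have h3 : t ^ (r + 1) ≤ t ^ r := rpow_le_rpow_of_exponent_ge ht0 h (by linarith)
    have h4 : t ^ r ≤ 1 := rpow_le_one ht0.le h hr
    rw [abs_of_nonpos (by linarith), abs_of_nonpos (by linarith)]
    have h5 : (r + 1) * (1 - t) ≤ (r + 1) * 2 ^ (r + 1) * (1 - t) := by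
      have : 0 ≤ (r + 1) * (1 - t) := by apply mul_nonneg <;> linarith
      nlinarith
    linarith
  · have b := one_add_mul_self_le_rpow_one_add (s := t⁻¹ - 1)
      (by have := inv_pos.2 ht0; linarith) (p := r + 1) (by linarith)
    rw [show 1 + (t⁻¹ - 1) = t⁻¹ by ring, inv_rpow ht0.le] at b
    have h3 : t ^ r ≤ t ^ (r + 1) := rpow_le_rpow_of_exponent_le h (by linarith)
    have h4 : 1 ≤ t ^ r := one_le_rpow h hr
    have h5 : t ^ (r + 1) ≤ 2 ^ (r + 1) := rpow_le_rpow ht0.le ht (by linarith)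
    have hp : 0 < t ^ (r + 1) := rpow_pos_of_pos ht0 _
    rw [abs_of_nonneg (by linarith), abs_of_nonneg (by linarith)]
    have h6 : t ^ (r + 1) - 1 ≤ t ^ (r + 1) * ((r + 1) * (1 - t⁻¹)) := by
      have := mul_le_mul_of_nonneg_left b hp.le
      rw [mul_inv_cancel₀ hp.ne'] at this
      nlinarith
    have h7 : 1 - t⁻¹ ≤ t - 1 := by
      have : t * t⁻¹ = 1 := mul_inv_cancel₀ ht0.ne'
      nlinarith [sq_nonneg (t - 1), inv_pos.2 ht0, sq_nonneg (t⁻¹ - 1)]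
    have h8 : 0 ≤ 1 - t⁻¹ := by
      rw [sub_nonneg]; exact inv_le_one_of_one_le₀ h
    have h9 : t ^ (r + 1) * ((r + 1) * (1 - t⁻¹)) ≤ 2 ^ (r + 1) * ((r + 1) * (t - 1)) := by
      gcongr
    linarith

/-- Where |ξ - η| ≤ |η| the ratio of the brackets is at most 2, and the bracket is Lipschitz: the
difference of the weights is then smaller by a factor ⟨ξ - η⟩/⟨η⟩. -/
lemma exists_abs_wt_sub_le {r : ℝ} (hr : 0 ≤ r) : ∃ C, 0 ≤ C ∧ ∀ ξ η : Space d,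
    ‖ξ - η‖ ≤ ‖η‖ → |wt r ξ - wt r η| * bk η ≤ C * (bk (ξ - η) * wt r η) := by
  refine ⟨(r + 1) * 2 ^ (r + 1), by positivity, fun ξ η h => ?_⟩
  have hη := bk_pos η
  have hξ := bk_pos ξ
  have h1 : bk ξ ≤ 2 * bk η := by
    have := bk_le_add ξ η
    have := bk_mono h
    linarith
  have h2 := abs_rpow_sub_one_le hr (div_pos hξ hη) ((div_le_iff₀ hη).2 h1)
  have e1 : wt r ξ - wt r η = ((bk ξ / bk η) ^ r - 1) * wt r η := by
    rw [wt, wt, div_rpow hξ.le hη.le]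
    have := (rpow_pos_of_pos hη r).ne'
    field_simp
  have e2 : bk ξ / bk η - 1 = (bk ξ - bk η) / bk η := by field_simp
  rw [e2, abs_div, abs_of_pos hη] at h2
  rw [e1, abs_mul, abs_of_pos (wt_pos r η)]
  have h3 : |bk ξ - bk η| ≤ bk (ξ - η) := (abs_bk_sub_le ξ η).trans (norm_le_bk _)
  calc _ ≤ ((r + 1) * 2 ^ (r + 1) * (|bk ξ - bk η| / bk η)) * wt r η * bk η := by
        have := wt_pos r η
        gcongr
    _ = (r + 1) * 2 ^ (r + 1) * (|bk ξ - bk η| * wt r η) := by field_simp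
    _ ≤ _ := by
        have := wt_pos r η
        gcongr

lemma wt_le_of_norm_le {r : ℝ} (hr : 0 ≤ r) {ξ η : Space d} (h : ‖ξ - η‖ ≤ ‖η‖) :
    wt r ξ ≤ 2 ^ r * wt r η := by
  rw [wt, wt, ← mul_rpow (by norm_num) (bk_pos η).le]
  refine rpow_le_rpow (bk_pos ξ).le ?_ hr
  have := bk_le_add ξ η
  have := bk_mono h
  linarith

lemma wt_le_of_norm_ge {r : ℝ} (hr : 0 ≤ r) {ξ η : Space d} (h : ‖η‖ ≤ ‖ξ - η‖) :
    wt r ξ ≤ 2 ^ r * wt r (ξ - η) := by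
  rw [wt, wt, ← mul_rpow (by norm_num) (bk_pos _).le]
  refine rpow_le_rpow (bk_pos ξ).le ?_ hr
  have := bk_le_add ξ η
  have := bk_mono h
  linarith

lemma wt_mono_norm {r : ℝ} (hr : 0 ≤ r) {ξ η : Space d} (h : ‖ξ‖ ≤ ‖η‖) : wt r ξ ≤ wt r η :=
  rpow_le_rpow (bk_pos ξ).le (bk_mono h) hr

/-- Slowly varying increasing cutoffs. -/
structure IsCut (m : Space d → ℝ) : Prop where
  measurable : Measurable m
  nonneg : ∀ ξ, 0 ≤ m ξ
  le_one : ∀ ξ, m ξ ≤ 1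
  mono : ∀ ξ η, ‖ξ‖ ≤ ‖η‖ → m ξ ≤ m η
  add : ∀ ξ η, m ξ ≤ m (ξ - η) + m η
  lip : ∀ ξ η, |m ξ - m η| * ‖η‖ ≤ m η * ‖ξ - η‖

/-- With the trivial cutoff every localized estimate specializes to the plain one. -/
lemma isCut_one : IsCut (fun _ : Space d => (1 : ℝ)) :=
  ⟨measurable_const, by simp, by simp, by simp, by simp, by simp⟩

/-- The cutoff to frequencies `≳ R`. -/
def cut (R : ℝ) (ξ : Space d) : ℝ := min 1 (‖ξ‖ / R)

/-- The profile min(1, ·/R) is increasing, concave and zero at 0. Hence it is subadditive, and its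
increment between x and y is at most |x - y| times its mean slope on [0, y]. -/
lemma isCut_cut {R : ℝ} (hR : 0 < R) : IsCut (cut R : Space d → ℝ) := by
  refine ⟨by unfold cut; fun_prop, fun ξ => by unfold cut; positivity, fun ξ => min_le_left _ _,
    fun ξ η h => ?_, fun ξ η => ?_, fun ξ η => ?_⟩
  · unfold cut; gcongr
  · have h1 : ‖ξ‖ / R ≤ ‖ξ - η‖ / R + ‖η‖ / R := by
      rw [← add_div]
      gcongr
      simpa using norm_add_le (ξ - η) η
    have h2 : 0 ≤ ‖ξ - η‖ / R := by positivity
    have h3 : 0 ≤ ‖η‖ / R := by positivity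
    unfold cut
    rcases min_cases 1 (‖ξ - η‖ / R) with h | h <;> rcases min_cases 1 (‖η‖ / R) with h' | h' <;>
      rcases min_cases 1 (‖ξ‖ / R) with h'' | h'' <;> linarith
  · set x := ‖ξ‖
    set y := ‖η‖
    have hx : 0 ≤ x := norm_nonneg _
    have hy : 0 ≤ y := norm_nonneg _
    have hz : |x - y| ≤ ‖ξ - η‖ := abs_norm_sub_norm_le ξ η
    have hm : 0 ≤ min 1 (y / R) := by positivity
    refine le_trans ?_ (mul_le_mul_of_nonneg_left hz hm)
    change |min 1 (x / R) - min 1 (y / R)| * y ≤ min 1 (y / R) * |x - y|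
    have e1 : ∀ u : ℝ, u / R ≤ 1 ↔ u ≤ R := fun u => div_le_one hR
    rcases le_total x R with h | h <;> rcases le_total y R with h' | h'
    · rw [min_eq_right ((e1 x).2 h), min_eq_right ((e1 y).2 h'), ← sub_div, abs_div, abs_of_pos hR]
      apply le_of_eq; ring
    · rw [min_eq_right ((e1 x).2 h), min_eq_left ((one_le_div hR).2 h'),
        abs_of_nonpos (by linarith [(e1 x).2 h]), abs_of_nonpos (by linarith)]
      have : x / R * R = x := div_mul_cancel₀ _ hR.ne'
      have h5 : 0 ≤ x / R := by positivity
      nlinarith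
    · rw [min_eq_left ((one_le_div hR).2 h), min_eq_right ((e1 y).2 h'),
        abs_of_nonneg (by linarith [(e1 y).2 h']), abs_of_nonneg (by linarith)]
      have h4 : y / R * R = y := div_mul_cancel₀ _ hR.ne'
      have h5 : 0 ≤ y / R := by positivity
      nlinarith
    · rw [min_eq_left ((one_le_div hR).2 h), min_eq_left ((one_le_div hR).2 h')]
      simp

namespace IsCut

variable {m : Space d → ℝ}

lemma neg (hm : IsCut m) (ξ : Space d) : m (-ξ) = m ξ :=
  le_antisymm (hm.mono _ _ (by simp)) (hm.mono _ _ (by simp))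

lemma abs_sub_le (hm : IsCut m) (ξ η : Space d) : |m ξ - m η| ≤ m (ξ - η) := by
  have h1 := hm.add ξ η
  have h2 := hm.add η ξ
  rw [← neg_sub ξ η, hm.neg] at h2
  rw [abs_le]
  constructor <;> linarith

lemma le_two_mul (hm : IsCut m) {ξ η : Space d} (h : ‖ξ - η‖ ≤ ‖η‖) : m ξ ≤ 2 * m η := by
  have := hm.add ξ η
  have := hm.mono _ _ h
  linarith

lemma le_two_mul' (hm : IsCut m) {ξ η : Space d} (h : ‖η‖ ≤ ‖ξ - η‖) : m ξ ≤ 2 * m (ξ - η) := by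
  have := hm.add ξ η
  have := hm.mono _ _ h
  linarith

lemma isMult (hm : IsCut m) : IsMult fun ξ => (m ξ : ℂ) :=
  IsMult.ofReal (C := 1) hm.measurable fun ξ => by
    rw [abs_of_nonneg (hm.nonneg ξ)]; exact hm.le_one ξ

lemma norm_le (hm : IsCut m) (ξ : Space d) : ‖(m ξ : ℂ)‖ ≤ 1 := by
  rw [Complex.norm_real, Real.norm_of_nonneg (hm.nonneg ξ)]
  exact hm.le_one ξ

/-- Bound ⟨η⟩ by 1 + 2π|η|: the 1 is handled by |m(ξ) - m(η)| ≤ m(ξ - η) ≤ m(η), and the term in |η|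
by `lip`. -/
lemma abs_sub_mul_bk_le (hm : IsCut m) {ξ η : Space d} (h : ‖ξ - η‖ ≤ ‖η‖) :
    |m ξ - m η| * bk η ≤ 2 * (bk (ξ - η) * m η) := by
  have h1 := (hm.abs_sub_le ξ η).trans (hm.mono _ _ h)
  have h2 := mul_le_mul_of_nonneg_left (hm.lip ξ η) (by positivity : 0 ≤ 2 * π)
  have h3 := mul_le_mul_of_nonneg_left (bk_le_one_add η) (abs_nonneg (m ξ - m η))
  have h4 := norm_le_bk (ξ - η)
  rw [norm_smul, Real.norm_of_nonneg (by positivity)] at h3 h4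
  have h5 := mul_le_mul_of_nonneg_left h4 (hm.nonneg η)
  have h6 := mul_le_mul_of_nonneg_right (one_le_bk (ξ - η)) (hm.nonneg η)
  nlinarith

end IsCut

/-- The product estimate for weights. -/
lemma exists_cut_mul_wt_le {r : ℝ} (hr : 0 ≤ r) : ∃ C, 0 ≤ C ∧ ∀ m : Space d → ℝ, IsCut m →
    ∀ ξ η, m ξ * wt r ξ ≤ C * (m (ξ - η) * wt r (ξ - η) + m η * wt r η) := by
  refine ⟨2 * 2 ^ r, by positivity, fun m hm ξ η => ?_⟩
  have p1 := mul_nonneg (hm.nonneg η) (wt_pos r η).le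
  have p2 := mul_nonneg (hm.nonneg (ξ - η)) (wt_pos r (ξ - η)).le
  have h2 : (0 : ℝ) < 2 ^ r := by positivity
  -- One of the two frequencies ξ - η and η has at least half the size of ξ and carries both the
  -- weight and the cutoff.
  rcases le_total ‖ξ - η‖ ‖η‖ with h | h
  · have := mul_le_mul (hm.le_two_mul h) (wt_le_of_norm_le hr h) (wt_pos r ξ).le
      (by linarith [hm.nonneg η])
    nlinarith
  · have := mul_le_mul (hm.le_two_mul' h) (wt_le_of_norm_ge hr h) (wt_pos r ξ).le
      (by linarith [hm.nonneg (ξ - η)])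
    nlinarith

/-- The commutator estimate for the weight `⟨ξ⟩^r`. -/
lemma exists_wt_comm_le {r : ℝ} (hr : 0 ≤ r) : ∃ C, 0 ≤ C ∧ ∀ ξ η : Space d,
    |wt r ξ - wt r η| * bk η ≤ C * (bk (ξ - η) * wt r η + wt (r + 1) (ξ - η)) := by
  obtain ⟨C, hC, h⟩ := exists_abs_wt_sub_le (d := d) hr
  refine ⟨C + 2 ^ r + 1, by positivity, fun ξ η => ?_⟩
  have h2 : (0 : ℝ) < 2 ^ r := by positivity
  have p1 := mul_pos (bk_pos (ξ - η)) (wt_pos r η)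
  have p2 := wt_pos (r + 1) (ξ - η)
  -- If η dominates, the difference of weights gains a derivative. Otherwise there is nothing to
  -- gain, and both weights and the factor ⟨η⟩ are absorbed by ξ - η.
  rcases le_total ‖ξ - η‖ ‖η‖ with hh | hh
  · have := h ξ η hh
    nlinarith
  · have h3 := wt_le_of_norm_ge hr hh
    have h4 := wt_mono_norm hr hh
    have h5 := bk_mono hh
    have h6 : |wt r ξ - wt r η| ≤ (2 ^ r + 1) * wt r (ξ - η) := by
      have := wt_pos r ξ
      have := wt_pos r η
      have := wt_pos r (ξ - η)
      rw [abs_le]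
      constructor <;> nlinarith
    have h7 := mul_le_mul h6 h5 (bk_pos η).le (by have := wt_pos r (ξ - η); positivity)
    rw [mul_assoc, ← wt_one (ξ - η), ← wt_add] at h7
    nlinarith

/-- The commutator estimate for the weight `m(ξ)⟨ξ⟩^r`. -/
lemma exists_cut_comm_le {r : ℝ} (hr : 0 ≤ r) : ∃ C, 0 ≤ C ∧ ∀ m : Space d → ℝ, IsCut m →
    ∀ ξ η, |m ξ * wt r ξ - m η * wt r η| * bk η
      ≤ C * (bk (ξ - η) * (m η * wt r η) + m (ξ - η) * wt r (ξ - η) * bk η) := by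
  obtain ⟨C, hC, h⟩ := exists_abs_wt_sub_le (d := d) hr
  refine ⟨2 * C + 2 + 2 * 2 ^ r + 1, by positivity, fun m hm ξ η => ?_⟩
  have h2 : (0 : ℝ) < 2 ^ r := by positivity
  have w1 := wt_pos r ξ
  have w2 := wt_pos r η
  have w3 := wt_pos r (ξ - η)
  have b1 := bk_pos (ξ - η)
  have b2 := bk_pos η
  have p1 := mul_nonneg b1.le (mul_nonneg (hm.nonneg η) w2.le)
  have p2 := mul_nonneg (mul_nonneg (hm.nonneg (ξ - η)) w3.le) b2.le
  rcases le_total ‖ξ - η‖ ‖η‖ with hh | hh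
  -- A product rule for the weight: the increment of ⟨ξ⟩^r and the increment of m each gain the
  -- derivative separately.
  · have e : m ξ * wt r ξ - m η * wt r η = m ξ * (wt r ξ - wt r η) + (m ξ - m η) * wt r η := by ring
    have h3 : |m ξ * wt r ξ - m η * wt r η| ≤ m ξ * |wt r ξ - wt r η| + |m ξ - m η| * wt r η := by
      rw [e]
      refine (abs_add_le _ _).trans (le_of_eq ?_)
      rw [abs_mul, abs_mul, abs_of_nonneg (hm.nonneg ξ), abs_of_pos w2]
    have h4 := mul_le_mul_of_nonneg_right h3 b2.le
    have h5 := mul_le_mul (hm.le_two_mul hh) (h ξ η hh) (by positivity)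
      (by linarith [hm.nonneg η])
    have h6 := mul_le_mul_of_nonneg_right (hm.abs_sub_mul_bk_le hh) w2.le
    have p3 : 0 ≤ (2 * 2 ^ r + 1) * (bk (ξ - η) * (m η * wt r η)) := by positivity
    have p4 : 0 ≤ (2 * C + 2 + 2 * 2 ^ r + 1) * (m (ξ - η) * wt r (ξ - η) * bk η) := by positivity
    nlinarith
  · have h3 := mul_le_mul (hm.le_two_mul' hh) (wt_le_of_norm_ge hr hh) w1.le
      (by linarith [hm.nonneg (ξ - η)])
    have h4 := mul_le_mul (hm.mono _ _ hh) (wt_mono_norm hr hh) w2.le (hm.nonneg _)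
    have h5 : |m ξ * wt r ξ - m η * wt r η| ≤ (2 * 2 ^ r + 1) * (m (ξ - η) * wt r (ξ - η)) := by
      have q1 := mul_nonneg (hm.nonneg ξ) w1.le
      have q2 := mul_nonneg (hm.nonneg η) w2.le
      have q3 := mul_nonneg (hm.nonneg (ξ - η)) w3.le
      rw [abs_le]
      constructor <;> nlinarith
    have h6 := mul_le_mul_of_nonneg_right h5 b2.le
    have p3 : 0 ≤ (2 * C + 2) * (m (ξ - η) * wt r (ξ - η) * bk η) := by positivity
    have p4 : 0 ≤ (2 * C + 2 + 2 * 2 ^ r + 1) * (bk (ξ - η) * (m η * wt r η)) := by positivity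
    nlinarith

/-! ### Integrability of weighted functions -/

/-- Division by the weight `⟨ξ⟩^r`. -/
def low (r : ℝ) (x : Space d → ℂ) (ξ : Space d) : ℂ := (wt (-r) ξ : ℂ) * x ξ

/-- The place where s > d/2 + 1 is used: ⟨ξ⟩^(-2r) is integrable because 2r > d. -/
lemma memLp_wt_neg {r : ℝ} (hr : (d : ℝ) < 2 * r) :
    MemLp (fun ξ : Space d => (wt (-r) ξ : ℂ)) 2 := by
  have hr0 : 0 ≤ r := by have : (0 : ℝ) ≤ d := by positivity
                         linarith
  have hmeas : AEStronglyMeasurable (fun ξ : Space d => (wt (-r) ξ : ℂ)) volume :=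
    (Complex.continuous_ofReal.comp (continuous_wt _)).aestronglyMeasurable
  rw [memLp_two_iff_integrable_sq_norm hmeas]
  have h := integrable_rpow_neg_one_add_norm_sq (E := Space d) (μ := volume) (r := 2 * r)
    (by simpa using hr)
  refine h.mono' (hmeas.norm.pow 2) (.of_forall fun ξ => ?_)
  rw [Real.norm_of_nonneg (by positivity), Complex.norm_real, Real.norm_of_nonneg (wt_pos _ _).le]
  have h1 : (1 + ‖ξ‖ ^ 2) ≤ bk ξ ^ 2 := by
    rw [bk, bracket, Real.sq_sqrt (by positivity), norm_smul, mul_pow]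
    have : 1 ≤ ‖2 * π‖ ^ 2 := by
      rw [Real.norm_of_nonneg (by positivity)]
      nlinarith [pi_gt_three]
    nlinarith [sq_nonneg ‖ξ‖]
  have h2 : wt (-r) ξ ^ 2 = (bk ξ ^ 2) ^ (-(2 * r) / 2) := by
    rw [wt, ← rpow_natCast, ← rpow_natCast, ← rpow_mul (bk_pos ξ).le, ← rpow_mul (bk_pos ξ).le]
    congr 1
    push_cast
    ring
  rw [h2]
  exact rpow_le_rpow_of_nonpos (by positivity) h1 (by linarith)

/-- The Sobolev embedding on the Fourier side, by Cauchy–Schwarz; the constant is the L² norm of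
⟨ξ⟩^(-r). -/
lemma exists_integral_low_le {r : ℝ} (hr : (d : ℝ) < 2 * r) : ∃ c, 0 ≤ c ∧ ∀ x : L2 d,
    Integrable (low r x) ∧ ∫ ξ, ‖low r x ξ‖ ≤ c * ‖x‖ := by
  have hm := memLp_wt_neg (d := d) hr
  refine ⟨‖hm.toLp _‖, norm_nonneg _, fun x => ?_⟩
  have hi : Integrable (low r x) := MemLp.integrable_mul (p := 2) (q := 2) hm (Lp.memLp x)
  refine ⟨hi, ?_⟩
  have hy : MemLp (fun ξ => ((‖x ξ‖ : ℝ) : ℂ)) 2 :=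
    (Lp.memLp x).of_le (by
      exact Complex.continuous_ofReal.comp_aestronglyMeasurable (Lp.aestronglyMeasurable x).norm)
      (.of_forall fun ξ => by simp)
  have h1 : ((∫ ξ, ‖low r x ξ‖ : ℝ) : ℂ) = ⟪hm.toLp _, hy.toLp _⟫_ℂ := by
    rw [L2.inner_def, ← integral_complex_ofReal]
    refine integral_congr_ae ?_
    filter_upwards [hm.coeFn_toLp, hy.coeFn_toLp] with ξ e1 e2
    rw [e1, e2]
    simp only [low, norm_mul, Complex.norm_real, Real.norm_of_nonneg (wt_pos (-r) ξ).le,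
      RCLike.inner_apply, Complex.conj_ofReal]
    push_cast
    ring
  have h2 : ‖hy.toLp _‖ = ‖x‖ := by
    refine le_antisymm ?_ ?_
    · rw [← one_mul ‖x‖]
      refine Lp.norm_le_mul_norm_of_ae_le_mul ?_
      filter_upwards [hy.coeFn_toLp] with ξ e
      rw [e]; simp
    · rw [← one_mul ‖hy.toLp _‖]
      refine Lp.norm_le_mul_norm_of_ae_le_mul ?_
      filter_upwards [hy.coeFn_toLp] with ξ e
      rw [e]; simp
  calc ∫ ξ, ‖low r x ξ‖ ≤ ‖((∫ ξ, ‖low r x ξ‖ : ℝ) : ℂ)‖ := by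
        rw [Complex.norm_real]; exact le_abs_self _
    _ ≤ _ := by
        rw [h1, ← h2]
        exact norm_inner_le_norm _ _

lemma memLp_low {r : ℝ} (hr : 0 ≤ r) {x : Space d → ℂ} (hx : MemLp x 2) : MemLp (low r x) 2 :=
  (isMult_wt_neg (r := -r) (by linarith)).memLp hx

/-! ### Kernel estimates -/

/-- Common mechanism of all product and commutator bounds: each summand of the kernel has one
integrable and one square-integrable factor, in either order. Substituting η by ξ - η in the second
summand reduces both to Young's inequality. -/
lemma exists_ae_eq_of_kernel_le {F : Space d → ℂ} (hF : AEStronglyMeasurable F)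
    {k : Space d → Space d → ℝ} (hk0 : ∀ ξ η, 0 ≤ k ξ η) (hFk : ∀ᵐ ξ, ‖F ξ‖ ≤ ∫ η, k ξ η)
    {x₁ x₂ : L2 d} {α₁ α₂ : Space d → ℝ} (h1 : Integrable α₁) (h2 : Integrable α₂)
    (hα₁ : ∀ ξ, 0 ≤ α₁ ξ) (hα₂ : ∀ ξ, 0 ≤ α₂ ξ) {C : ℝ} (hC : 0 ≤ C)
    (hk : ∀ ξ, ∀ᵐ η, k ξ η ≤ C * (α₁ (ξ - η) * ‖x₁ η‖ + ‖x₂ (ξ - η)‖ * α₂ η)) :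
    ∃ y : L2 d, y =ᵐ[volume] F ∧ ‖y‖ ≤ C * ((∫ ξ, α₁ ξ) * ‖x₁‖ + (∫ ξ, α₂ ξ) * ‖x₂‖) := by
  refine exists_ae_eq_of_ae_le_conv hF h1 h2 hα₁ hα₂ hC ?_
  have i1 := integrable_young h1.ofReal (f := fun η => ((‖x₁ η‖ : ℝ) : ℂ)) (by
    exact (Lp.memLp x₁).norm.ofReal)
  have i2 := integrable_young h2.ofReal (f := fun η => ((‖x₂ η‖ : ℝ) : ℂ)) (by
    exact (Lp.memLp x₂).norm.ofReal)
  filter_upwards [hFk, i1, i2] with ξ g1 g2 g3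
  have g2' : Integrable fun η => α₁ (ξ - η) * ‖x₁ η‖ := by
    have := g2.re
    refine this.congr (.of_forall fun η => ?_)
    simp
  have g3' : Integrable fun η => α₂ (ξ - η) * ‖x₂ η‖ := by
    have := g3.re
    refine this.congr (.of_forall fun η => ?_)
    simp
  have g4 : Integrable fun η => ‖x₂ (ξ - η)‖ * α₂ η := by
    have := g3'.comp_sub_left ξ
    simpa [mul_comm] using this
  have e : ∫ η, α₂ (ξ - η) * ‖x₂ η‖ = ∫ η, ‖x₂ (ξ - η)‖ * α₂ η := by
    rw [← integral_sub_left_eq_self _ volume ξ]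
    simp [mul_comm]
  rw [e, ← integral_add g2' g4, ← integral_const_mul]
  refine g1.trans (integral_mono_of_nonneg (.of_forall fun η => hk0 ξ η) ((g2'.add g4).const_mul C)
    (hk ξ))

/-! ### Derivatives -/

/-- The symbol of `∂_j`. -/
def dl (j : Fin d) (ξ : Space d) : ℂ := 2 * π * Complex.I * (ξ j : ℂ)

lemma continuous_dl (j : Fin d) : Continuous (dl j) := by
  unfold dl
  fun_prop

lemma norm_dl_le (j : Fin d) (ξ : Space d) : ‖dl j ξ‖ ≤ bk ξ := by
  refine le_trans ?_ (norm_le_bk ξ)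
  rw [norm_smul, dl, Real.norm_of_nonneg (by positivity : 0 ≤ 2 * π)]
  simp only [norm_mul, Complex.norm_real, Complex.norm_I, Complex.norm_ofNat, mul_one,
    Real.norm_of_nonneg pi_pos.le, Real.norm_eq_abs]
  have : |ξ j| ≤ ‖ξ‖ := PiLp.norm_apply_le ξ j
  gcongr

lemma dl_sub (j : Fin d) (ξ η : Space d) : dl j (ξ - η) = dl j ξ - dl j η := by
  simp [dl, mul_sub]

lemma conj_dl (j : Fin d) (ξ : Space d) : (starRingEnd ℂ) (dl j ξ) = -dl j ξ := by
  simp only [dl, map_mul, Complex.conj_I, Complex.conj_ofReal, map_ofNat]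
  ring

lemma dl_neg (j : Fin d) (ξ : Space d) : dl j (-ξ) = -dl j ξ := by simp [dl]

/-- `f' = ∂_j f` for Fourier transforms of square-integrable functions. -/
def IsD (j : Fin d) (f f' : L2 d) : Prop := f' =ᵐ[volume] fun ξ => dl j ξ * f ξ

lemma IsD.mulL {j : Fin d} {f f' : L2 d} (h : IsD j f f') {m : Space d → ℂ} (hm : IsMult m) :
    IsD j (mulL m f) (mulL m f') := by
  unfold IsD at *
  filter_upwards [h, coeFn_mulL hm f, coeFn_mulL hm f'] with ξ h1 h2 h3
  rw [h3, h2, h1]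
  ring

/-- Integration by parts: the symbol of ∂_j is purely imaginary. As `IsD` relates two given elements
of L², no unbounded operator or domain appears. -/
lemma IsD.inner {j : Fin d} {f f' g g' : L2 d} (h : IsD j f f') (h' : IsD j g g') :
    ⟪f, g'⟫_ℂ = -⟪f', g⟫_ℂ := by
  rw [L2.inner_def, L2.inner_def, ← integral_neg]
  refine integral_congr_ae ?_
  filter_upwards [h, h'] with ξ h1 h2
  simp only [h1, h2, RCLike.inner_apply, map_mul, conj_dl]
  ring

lemma Integrable.of_bk_mul {a : Space d → ℂ} (ham : AEStronglyMeasurable a)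
    (ha : Integrable fun ξ => bk ξ * ‖a ξ‖) : Integrable a := by
  refine ha.mono' ham (.of_forall fun ξ => ?_)
  nlinarith [one_le_bk ξ, norm_nonneg (a ξ)]

lemma integrable_dl_mul {a : Space d → ℂ} (ham : AEStronglyMeasurable a)
    (ha : Integrable fun ξ => bk ξ * ‖a ξ‖) (j : Fin d) : Integrable fun ξ => dl j ξ * a ξ := by
  refine ha.mono' ((continuous_dl j).aestronglyMeasurable.mul ham) (.of_forall fun ξ => ?_)
  rw [norm_mul]
  exact mul_le_mul_of_nonneg_right (norm_dl_le j ξ) (norm_nonneg _)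

lemma integral_norm_le_integral_bk {a : Space d → ℂ} (ham : AEStronglyMeasurable a)
    (ha : Integrable fun ξ => bk ξ * ‖a ξ‖) : ∫ ξ, ‖a ξ‖ ≤ ∫ ξ, bk ξ * ‖a ξ‖ := by
  refine integral_mono (Integrable.of_bk_mul ham ha).norm ha fun ξ => ?_
  nlinarith [one_le_bk ξ, norm_nonneg (a ξ)]

lemma integral_norm_dl_le {a : Space d → ℂ} (ham : AEStronglyMeasurable a)
    (ha : Integrable fun ξ => bk ξ * ‖a ξ‖) (j : Fin d) :
    ∫ ξ, ‖dl j ξ * a ξ‖ ≤ ∫ ξ, bk ξ * ‖a ξ‖ := by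
  refine integral_mono (integrable_dl_mul ham ha j).norm ha fun ξ => ?_
  simp only [norm_mul]
  exact mul_le_mul_of_nonneg_right (norm_dl_le j ξ) (norm_nonneg _)

/-- The Leibniz rule, from linearity of the symbol: the frequency of the product is (ξ - η) + η. -/
lemma IsD.convL {j : Fin d} {f f' : L2 d} (h : IsD j f f') {a : Space d → ℂ}
    (ham : AEStronglyMeasurable a) (ha : Integrable fun ξ => bk ξ * ‖a ξ‖) :
    IsD j (convL a f) (convL a f' + convL (fun ξ => dl j ξ * a ξ) f) := by
  have ha1 := Integrable.of_bk_mul ham ha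
  have ha2 := integrable_dl_mul ham ha j
  unfold IsD
  filter_upwards [coeFn_convL ha1 f, coeFn_convL ha1 f', coeFn_convL ha2 f,
    Lp.coeFn_add (WhithamBoussinesq.convL a f')
      (WhithamBoussinesq.convL (fun ξ => dl j ξ * a ξ) f),
    integrable_young ha1 (Lp.memLp f), integrable_young ha1 (Lp.memLp f'),
    integrable_young ha2 (Lp.memLp f)] with ξ e1 e2 e3 e4 i1 i2 i3
  rw [e4, Pi.add_apply, e1, e2, e3, cv, cv, cv, ← integral_add i2 i3, ← integral_const_mul]
  refine integral_congr_ae ?_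
  filter_upwards [h] with η hη
  rw [hη, dl_sub]
  ring

/-! ### Commutators -/

/-- Symbols of order zero with one bounded derivative in the sense of commutators. -/
structure IsSym (κ : ℝ) (g : Space d → ℝ) : Prop where
  measurable : Measurable g
  bound : ∀ ξ, |g ξ| ≤ κ
  comm : ∀ ξ η, |g ξ - g η| * bk η ≤ κ * bk (ξ - η)

namespace IsSym

variable {κ : ℝ} {g : Space d → ℝ}

lemma nonneg (h : IsSym κ g) : 0 ≤ κ := (abs_nonneg _).trans (h.bound 0)

lemma isMult (h : IsSym κ g) : IsMult fun ξ => (g ξ : ℂ) := IsMult.ofReal h.measurable h.bound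

lemma norm_le (h : IsSym κ g) (ξ : Space d) : ‖(g ξ : ℂ)‖ ≤ κ := by
  rw [Complex.norm_real]; exact h.bound ξ

/-- The kernel of [g, a]∂_j is (g(ξ) - g(η)) a(ξ - η) times the symbol of ∂_j at η. By `comm` the
factor ⟨η⟩ is traded for ⟨ξ - η⟩, so the derivative falls on a, and Young's inequality concludes. -/
lemma norm_comm_le (h : IsSym κ g) {a : Space d → ℂ} (ham : AEStronglyMeasurable a)
    (ha : Integrable fun ξ => bk ξ * ‖a ξ‖) {j : Fin d} {f f' : L2 d} (hf : IsD j f f') :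
    ‖mulL (fun ξ => (g ξ : ℂ)) (convL a f') - convL a (mulL (fun ξ => (g ξ : ℂ)) f')‖
      ≤ κ * ((∫ ξ, bk ξ * ‖a ξ‖) * ‖f‖) := by
  have ha1 := Integrable.of_bk_mul ham ha
  set gf := mulL (fun ξ => (g ξ : ℂ)) f' with hgf
  set F := mulL (fun ξ => (g ξ : ℂ)) (convL a f') - convL a gf with hF
  have hFk : ∀ᵐ ξ, ‖F ξ‖ ≤ ∫ η, |g ξ - g η| * bk η * ‖a (ξ - η)‖ * ‖f η‖ := by
    filter_upwards [coeFn_mulL h.isMult (convL a f'), coeFn_convL ha1 f', coeFn_convL ha1 gf,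
      Lp.coeFn_sub (mulL (fun ξ => (g ξ : ℂ)) (convL a f')) (convL a gf),
      integrable_young ha1 (Lp.memLp f'), integrable_young ha1 (Lp.memLp gf),
      integrable_young ha.ofReal (f := fun η => ((‖f η‖ : ℝ) : ℂ)) (by
        exact (Lp.memLp f).norm.ofReal)] with ξ e1 e2 e3 e4 i1 i2 i3
    rw [hF, e4, Pi.sub_apply, e1, e2, e3, cv, cv, ← integral_const_mul,
      ← integral_sub (i1.const_mul _) i2]
    refine norm_integral_le_of_norm_le ?_ ?_
    · refine (i3.norm.const_mul κ).mono' ?_ (.of_forall fun η => ?_)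
      · have m1 : AEStronglyMeasurable fun η => a (ξ - η) :=
          ham.comp_quasiMeasurePreserving (quasiMeasurePreserving_sub_left volume ξ)
        have m2 : Measurable fun η => |g ξ - g η| * bk η := by
          have := h.measurable
          have := (continuous_bk (d := d)).measurable
          fun_prop
        exact (m2.aestronglyMeasurable.mul m1.norm).mul (Lp.aestronglyMeasurable f).norm
      · have := mul_le_mul_of_nonneg_right (h.comm ξ η)
          (by positivity : 0 ≤ ‖a (ξ - η)‖ * ‖f η‖)
        rw [Real.norm_of_nonneg (by have := bk_pos η; positivity), norm_mul, Complex.norm_real,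
          norm_norm, RCLike.norm_ofReal,
          abs_of_nonneg (mul_nonneg (bk_pos (ξ - η)).le (norm_nonneg (a (ξ - η))))]
        linarith
    · filter_upwards [coeFn_mulL h.isMult f', hf] with η h1 h2
      rw [hgf, h1, h2]
      have : (g ξ : ℂ) * (a (ξ - η) * (dl j η * f η)) - a (ξ - η) * (g η * (dl j η * f η))
          = ((g ξ - g η : ℝ) : ℂ) * dl j η * a (ξ - η) * f η := by push_cast; ring
      rw [this]
      simp only [norm_mul, Complex.norm_real, Real.norm_eq_abs]
      have := norm_dl_le j η
      gcongr
  obtain ⟨y, hy, hyn⟩ := exists_ae_eq_of_kernel_le (Lp.aestronglyMeasurable F)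
    (fun ξ η => by have := bk_pos η; positivity) hFk (x₁ := f) (x₂ := 0) ha
    (integrable_zero _ _ _) (fun ξ => by have := bk_pos ξ; positivity) (fun ξ => le_rfl) h.nonneg
    (fun ξ => .of_forall fun η => by
      have := mul_le_mul_of_nonneg_right (h.comm ξ η)
          (by positivity : 0 ≤ ‖a (ξ - η)‖ * ‖f η‖)
      simp only [Pi.zero_apply, mul_zero, add_zero]
      nlinarith)
  rw [← Lp.ext hy]
  simpa using hyn

end IsSym

/-- Commutators of weights with convolutions. -/
lemma exists_weight_comm {W V₁ V₂ : Space d → ℝ} (hW : Measurable W)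
    (hV₂ : ∀ ξ, 0 ≤ V₂ ξ) {C : ℝ} (hC : 0 ≤ C)
    (hcomm : ∀ ξ η, |W ξ - W η| * bk η ≤ C * (bk (ξ - η) * W η + V₁ (ξ - η) * V₂ η))
    {a h g : Space d → ℂ} (ham : AEStronglyMeasurable a)
    (ha : Integrable fun ξ => bk ξ * ‖a ξ‖) (hg : ∀ᵐ ξ, ‖g ξ‖ ≤ bk ξ * ‖h ξ‖)
    (hg2 : MemLp g 2) (hh : Integrable fun ξ => V₂ ξ * ‖h ξ‖) {x₁ x₂ z : L2 d}
    (hx₁ : ∀ᵐ ξ, ‖x₁ ξ‖ = W ξ * ‖h ξ‖) (hx₂ : ∀ᵐ ξ, ‖x₂ ξ‖ = V₁ ξ * ‖a ξ‖)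
    (hz : z =ᵐ[volume] fun ξ => W ξ * g ξ) :
    ∃ c : L2 d, (fun ξ => (W ξ : ℂ) * cv a g ξ) =ᵐ[volume] (convL a z + c : L2 d) ∧
      ‖c‖ ≤ C * ((∫ ξ, bk ξ * ‖a ξ‖) * ‖x₁‖ + (∫ ξ, V₂ ξ * ‖h ξ‖) * ‖x₂‖) := by
  have ha1 := Integrable.of_bk_mul ham ha
  have hFm : AEStronglyMeasurable fun ξ => (W ξ : ℂ) * cv a g ξ - convL a z ξ := by
    refine AEStronglyMeasurable.sub (AEStronglyMeasurable.mul ?_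
      (aestronglyMeasurable_cv ham hg2.1)) (Lp.aestronglyMeasurable _)
    exact (Complex.measurable_ofReal.comp hW).aestronglyMeasurable
  have hFk : ∀ᵐ ξ, ‖(W ξ : ℂ) * cv a g ξ - convL a z ξ‖
      ≤ ∫ η, ‖((W ξ - W η : ℝ) : ℂ) * (a (ξ - η) * g η)‖ := by
    filter_upwards [coeFn_convL ha1 z, integrable_young ha1 hg2,
      integrable_young ha1 (Lp.memLp z)] with ξ e1 i1 i2
    rw [e1, cv, cv, ← integral_const_mul, ← integral_sub (i1.const_mul _) i2]
    refine (norm_integral_le_integral_norm _).trans_eq (integral_congr_ae ?_)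
    filter_upwards [hz] with η hη
    rw [hη]
    congr 1
    push_cast
    ring
  obtain ⟨c, hc, hcn⟩ := exists_ae_eq_of_kernel_le hFm (fun ξ η => norm_nonneg _) hFk (x₁ := x₁)
    (x₂ := x₂) ha hh (fun ξ => by have := bk_pos ξ; positivity)
    (fun ξ => mul_nonneg (hV₂ ξ) (norm_nonneg _)) hC (fun ξ => by
      filter_upwards [hg, hx₁, (quasiMeasurePreserving_sub_left volume ξ).ae hx₂] with η g1 g2 g3
      rw [g2, g3, norm_mul, norm_mul, Complex.norm_real, Real.norm_eq_abs]
      calc |W ξ - W η| * (‖a (ξ - η)‖ * ‖g η‖)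
          ≤ |W ξ - W η| * (‖a (ξ - η)‖ * (bk η * ‖h η‖)) := by gcongr
        _ = (|W ξ - W η| * bk η) * (‖a (ξ - η)‖ * ‖h η‖) := by ring
        _ ≤ (C * (bk (ξ - η) * W η + V₁ (ξ - η) * V₂ η)) * (‖a (ξ - η)‖ * ‖h η‖) :=
          mul_le_mul_of_nonneg_right (hcomm ξ η) (by positivity)
        _ = _ := by ring)
  refine ⟨c, ?_, hcn⟩
  filter_upwards [hc, Lp.coeFn_add (convL a z) c] with ξ e1 e2
  rw [e2, Pi.add_apply, e1]
  ring

/-! ### The algebra product -/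

open Classical in
/-- The product of `H^r`, in terms of `⟨ξ⟩^r`-weighted Fourier transforms. -/
def Bil (r : ℝ) (x y : L2 d) : L2 d :=
  if h : MemLp (fun ξ => (wt r ξ : ℂ) * cv (low r x) (low r y) ξ) 2 then h.toLp _ else 0

/-- H^r is an algebra, in a form where the localized norm of a product is linear in the localized
norms of the factors. The case m = 1 also supplies the square integrability on which the definition
of `Bil` branches. -/
lemma exists_Bil_bound {r : ℝ} (hr : (d : ℝ) < 2 * r) : ∃ C, 0 ≤ C ∧
    (∀ x y : L2 d, Bil r x y =ᵐ[volume] fun ξ => (wt r ξ : ℂ) * cv (low r x) (low r y) ξ) ∧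
    ∀ m : Space d → ℝ, IsCut m → ∀ x y : L2 d, ‖mulL (fun ξ => (m ξ : ℂ)) (Bil r x y)‖
      ≤ C * (‖mulL (fun ξ => (m ξ : ℂ)) x‖ * ‖y‖ + ‖x‖ * ‖mulL (fun ξ => (m ξ : ℂ)) y‖) := by
  have hr0 : 0 ≤ r := by have : (0 : ℝ) ≤ d := by positivity
                         linarith
  obtain ⟨C, hC, hw⟩ := exists_cut_mul_wt_le (d := d) hr0
  obtain ⟨c, hc, hlow⟩ := exists_integral_low_le hr
  have key : ∀ m : Space d → ℝ, IsCut m → ∀ x y : L2 d, ∃ z : L2 d,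
      z =ᵐ[volume] (fun ξ => (m ξ : ℂ) * ((wt r ξ : ℂ) * cv (low r x) (low r y) ξ)) ∧
      ‖z‖ ≤ C * c * (‖mulL (fun ξ => (m ξ : ℂ)) x‖ * ‖y‖
        + ‖x‖ * ‖mulL (fun ξ => (m ξ : ℂ)) y‖) := by
    intro m hm x y
    have hFm : AEStronglyMeasurable fun ξ =>
        (m ξ : ℂ) * ((wt r ξ : ℂ) * cv (low r x) (low r y) ξ) := by
      refine AEStronglyMeasurable.mul ?_ (AEStronglyMeasurable.mul ?_ (aestronglyMeasurable_cv
        (hlow x).1.1 (hlow y).1.1))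
      · exact (Complex.measurable_ofReal.comp hm.measurable).aestronglyMeasurable
      · exact (Complex.measurable_ofReal.comp (continuous_wt r).measurable).aestronglyMeasurable
    have hwn : ∀ (x : L2 d) (ξ : Space d), wt r ξ * ‖low r x ξ‖ = ‖x ξ‖ := by
      intro x ξ
      rw [low, norm_mul, Complex.norm_real, Real.norm_of_nonneg (wt_pos _ _).le, ← mul_assoc,
        wt_mul_neg, one_mul]
    have hmn : ∀ x : L2 d, ∀ᵐ ξ, ‖mulL (fun ξ => (m ξ : ℂ)) x ξ‖ = m ξ * ‖x ξ‖ := by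
      intro x
      filter_upwards [coeFn_mulL hm.isMult x] with ξ e
      rw [e, norm_mul, Complex.norm_real, Real.norm_of_nonneg (hm.nonneg ξ)]
    obtain ⟨z, hz, hzn⟩ := exists_ae_eq_of_kernel_le hFm
      (k := fun ξ η => m ξ * wt r ξ * (‖low r x (ξ - η)‖ * ‖low r y η‖))
      (fun ξ η => by have := hm.nonneg ξ; have := wt_pos r ξ; positivity)
      (.of_forall fun ξ => by
        rw [norm_mul, norm_mul, Complex.norm_real, Complex.norm_real,
          Real.norm_of_nonneg (hm.nonneg ξ), Real.norm_of_nonneg (wt_pos r ξ).le, ← mul_assoc,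
          integral_const_mul]
        refine mul_le_mul_of_nonneg_left ?_ (mul_nonneg (hm.nonneg ξ) (wt_pos r ξ).le)
        refine (norm_integral_le_integral_norm _).trans_eq ?_
        simp only [norm_mul])
      (x₁ := mulL (fun ξ => (m ξ : ℂ)) y) (x₂ := mulL (fun ξ => (m ξ : ℂ)) x)
      (hlow x).1.norm (hlow y).1.norm (fun ξ => norm_nonneg _) (fun ξ => norm_nonneg _) hC
      (fun ξ => by
        filter_upwards [hmn y, (quasiMeasurePreserving_sub_left volume ξ).ae (hmn x)] with η e1 e2
        rw [e1, e2, ← hwn x, ← hwn y]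
        refine (mul_le_mul_of_nonneg_right (hw m hm ξ η) (by positivity)).trans (le_of_eq ?_)
        ring)
    refine ⟨z, hz, hzn.trans ?_⟩
    have h1 := (hlow x).2
    have h2 := (hlow y).2
    calc _ ≤ C * (c * ‖x‖ * ‖mulL (fun ξ => (m ξ : ℂ)) y‖
          + c * ‖y‖ * ‖mulL (fun ξ => (m ξ : ℂ)) x‖) := by gcongr
      _ = _ := by ring
  have hae : ∀ x y : L2 d,
      Bil r x y =ᵐ[volume] fun ξ => (wt r ξ : ℂ) * cv (low r x) (low r y) ξ := by
    intro x y
    obtain ⟨z, hz, -⟩ := key _ isCut_one x y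
    simp only [Complex.ofReal_one, one_mul] at hz
    have hm := (memLp_congr_ae hz).1 (Lp.memLp z)
    rw [Bil, dif_pos hm]
    exact hm.coeFn_toLp
  refine ⟨C * c, by positivity, hae, fun m hm x y => ?_⟩
  obtain ⟨z, hz, hzn⟩ := key m hm x y
  suffices h : mulL (fun ξ => (m ξ : ℂ)) (Bil r x y) = z by rw [h]; exact hzn
  refine Lp.ext ?_
  filter_upwards [hz, coeFn_mulL hm.isMult (Bil r x y), hae x y] with ξ e1 e2 e3
  rw [e1, e2, e3]

section Bil

variable {r : ℝ}

lemma coeFn_Bil (hr : (d : ℝ) < 2 * r) (x y : L2 d) :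
    Bil r x y =ᵐ[volume] fun ξ => (wt r ξ : ℂ) * cv (low r x) (low r y) ξ :=
  (exists_Bil_bound hr).choose_spec.2.1 x y

lemma integrable_cv_low (hr : (d : ℝ) < 2 * r) (x y : L2 d) (ξ : Space d) :
    Integrable fun η => low r x (ξ - η) * low r y η := by
  have hr0 : 0 ≤ r := by have : (0 : ℝ) ≤ d := by positivity
                         linarith
  have h1 := memLp_low hr0 (Lp.memLp x)
  have h2 : MemLp (fun η => low r x (ξ - η)) 2 :=
    h1.comp_measurePreserving (Measure.measurePreserving_sub_left volume ξ)
  exact MemLp.integrable_mul (p := 2) (q := 2) h2 (memLp_low hr0 (Lp.memLp y))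

lemma Bil_sub_left (hr : (d : ℝ) < 2 * r) (x x' y : L2 d) :
    Bil r (x - x') y = Bil r x y - Bil r x' y := by
  refine Lp.ext ?_
  filter_upwards [coeFn_Bil hr (x - x') y, coeFn_Bil hr x y, coeFn_Bil hr x' y,
    Lp.coeFn_sub (Bil r x y) (Bil r x' y)] with ξ e1 e2 e3 e4
  rw [e1, e4, Pi.sub_apply, e2, e3, ← mul_sub, cv, cv, cv,
    ← integral_sub (integrable_cv_low hr x y ξ) (integrable_cv_low hr x' y ξ)]
  congr 1
  refine integral_congr_ae ?_
  filter_upwards [(quasiMeasurePreserving_sub_left volume ξ).ae (Lp.coeFn_sub x x')] with η e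
  simp only [low, e, Pi.sub_apply]
  ring

lemma Bil_sub_right (hr : (d : ℝ) < 2 * r) (x y y' : L2 d) :
    Bil r x (y - y') = Bil r x y - Bil r x y' := by
  refine Lp.ext ?_
  filter_upwards [coeFn_Bil hr x (y - y'), coeFn_Bil hr x y, coeFn_Bil hr x y',
    Lp.coeFn_sub (Bil r x y) (Bil r x y')] with ξ e1 e2 e3 e4
  rw [e1, e4, Pi.sub_apply, e2, e3, ← mul_sub, cv, cv, cv,
    ← integral_sub (integrable_cv_low hr x y ξ) (integrable_cv_low hr x y' ξ)]
  congr 1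
  refine integral_congr_ae ?_
  filter_upwards [Lp.coeFn_sub y y'] with η e
  simp only [low, e, Pi.sub_apply]
  ring

end Bil

/-! ### Energy estimates for the linearized system at a fixed time -/

/-- Admissible coefficients: Fourier transforms of real Lipschitz functions. -/
structure IsCoef (N : ℝ) (a : Space d → ℂ) : Prop where
  aesm : AEStronglyMeasurable a
  int : Integrable fun ξ => bk ξ * ‖a ξ‖
  herm : Herm a
  le : ∫ ξ, bk ξ * ‖a ξ‖ ≤ N

namespace IsCoef

variable {N : ℝ} {a : Space d → ℂ}

lemma nonneg (h : IsCoef N a) : 0 ≤ N :=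
  (integral_nonneg fun ξ => mul_nonneg (bk_pos ξ).le (norm_nonneg _)).trans h.le

lemma integrable (h : IsCoef N a) : Integrable a := Integrable.of_bk_mul h.aesm h.int

lemma norm_convL_le (h : IsCoef N a) (f : L2 d) : ‖convL a f‖ ≤ N * ‖f‖ :=
  (WhithamBoussinesq.norm_convL_le h.integrable f).trans (mul_le_mul_of_nonneg_right
    ((integral_norm_le_integral_bk h.aesm h.int).trans h.le) (norm_nonneg _))

lemma norm_convL_dl_le (h : IsCoef N a) (j : Fin d) (f : L2 d) :
    ‖convL (fun ξ => dl j ξ * a ξ) f‖ ≤ N * ‖f‖ :=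
  (WhithamBoussinesq.norm_convL_le (integrable_dl_mul h.aesm h.int j) f).trans
    (mul_le_mul_of_nonneg_right ((integral_norm_dl_le h.aesm h.int j).trans h.le) (norm_nonneg _))

lemma isD (h : IsCoef N a) {j : Fin d} {f f' : L2 d} (hf : IsD j f f') :
    IsD j (convL a f) (convL a f' + convL (fun ξ => dl j ξ * a ξ) f) :=
  hf.convL h.aesm h.int

lemma inner (h : IsCoef N a) (f g : L2 d) : ⟪convL a f, g⟫_ℂ = ⟪f, convL a g⟫_ℂ :=
  inner_convL h.integrable h.herm f g

lemma norm_comm_le (h : IsCoef N a) {κ : ℝ} {g : Space d → ℝ} (hg : IsSym κ g) {j : Fin d}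
    {f f' : L2 d} (hf : IsD j f f') :
    ‖mulL (fun ξ => (g ξ : ℂ)) (convL a f') - convL a (mulL (fun ξ => (g ξ : ℂ)) f')‖
      ≤ κ * N * ‖f‖ := by
  refine (hg.norm_comm_le h.aesm h.int hf).trans ?_
  have := hg.nonneg
  have := h.le
  rw [mul_assoc]
  gcongr

end IsCoef

lemma abs_re_inner_le (f g : L2 d) : |(⟪f, g⟫_ℂ).re| ≤ ‖f‖ * ‖g‖ :=
  (Complex.abs_re_le_norm _).trans (norm_inner_le_norm f g)

/-- Antisymmetry of `C ∂_j`, up to commutators. -/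
lemma abs_re_inner_D_le {C : L2 d →L[ℂ] L2 d} (hC : ∀ f g, ⟪C f, g⟫_ℂ = ⟪f, C g⟫_ℂ)
    {g : Space d → ℝ} (hg : IsMult fun ξ => (g ξ : ℂ)) {j : Fin d} {f f' e : L2 d}
    (hf : IsD j f f') (he : IsD j (C f) (C f' + e)) :
    |(⟪f, mulL (fun ξ => (g ξ : ℂ)) (C f')⟫_ℂ).re|
      ≤ ‖mulL (fun ξ => (g ξ : ℂ)) (C f') - C (mulL (fun ξ => (g ξ : ℂ)) f')‖ * ‖f‖
        + ‖mulL (fun ξ => (g ξ : ℂ)) f‖ * ‖e‖ := by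
  set G := mulL (fun ξ => (g ξ : ℂ)) with hG
  set c := G (C f') - C (G f') with hc
  -- Integrating by parts in ⟨Gf, ∂_j(Cf)⟩ and using the symmetry of C and G reproduces the
  -- conjugate of the original pairing with the opposite sign. Its real part is thus half of the
  -- commutator and Leibniz errors.
  have h1 := (hf.mulL hg).inner he
  rw [← hG, inner_add_right, ← hC (G f') f, show C (G f') = G (C f') - c by rw [hc]; abel,
    inner_sub_left] at h1
  have h2 : ⟪f, G (C f')⟫_ℂ = ⟪G f, C f'⟫_ℂ := (inner_mulL_real hg _ _).symm
  have h3 : ⟪G (C f'), f⟫_ℂ = (starRingEnd ℂ) ⟪f, G (C f')⟫_ℂ := (inner_conj_symm _ _).symm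
  rw [← h2, h3] at h1
  have h4 := congrArg Complex.re h1
  simp only [Complex.add_re, Complex.neg_re, Complex.sub_re, Complex.conj_re] at h4
  have h5 := abs_le.1 (abs_re_inner_le c f)
  have h6 := abs_le.1 (abs_re_inner_le (G f) e)
  have p1 : 0 ≤ ‖c‖ * ‖f‖ := by positivity
  have p2 : 0 ≤ ‖G f‖ * ‖e‖ := by positivity
  rw [abs_le]
  constructor <;> linarith [h5.1, h5.2, h6.1, h6.2]

/-! ### The individual terms of the energy identity. -/

section Terms

variable {N κ : ℝ} {a a₀ : Space d → ℂ} {g g₁ g₂ Q : Space d → ℝ} {j : Fin d}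

lemma abs_re_transport_le (ha : IsCoef N a) (hg : IsSym κ g) {f f' : L2 d} (hf : IsD j f f') :
    |(⟪f, mulL (fun ξ => (g ξ : ℂ)) (convL a f')⟫_ℂ).re| ≤ 2 * κ * N * ‖f‖ ^ 2 := by
  refine (abs_re_inner_D_le ha.inner hg.isMult hf (ha.isD hf)).trans ?_
  have h1 := ha.norm_comm_le hg hf
  have h2 := ha.norm_convL_dl_le j f
  have h3 := norm_mulL_le hg.isMult hg.norm_le f
  have := hg.nonneg
  have := ha.nonneg
  calc _ ≤ κ * N * ‖f‖ * ‖f‖ + κ * ‖f‖ * (N * ‖f‖) := by gcongr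
    _ = _ := by ring

lemma norm_mulL_Q_le (hQ : IsMult fun ξ => (Q ξ : ℂ)) (hQ1 : ∀ ξ, |Q ξ| ≤ 1) (f : L2 d) :
    ‖mulL (fun ξ => (Q ξ : ℂ)) f‖ ≤ ‖f‖ := by
  simpa using norm_mulL_le hQ (C := 1) (fun ξ => by
    rw [Complex.norm_real]; exact hQ1 ξ) f

lemma mulL_Q_mulL (hQ : IsMult fun ξ => (Q ξ : ℂ)) (h1 : IsSym κ g₁)
    (hg : ∀ ξ, g₂ ξ = Q ξ * g₁ ξ) (f : L2 d) :
    mulL (fun ξ => (Q ξ : ℂ)) (mulL (fun ξ => (g₁ ξ : ℂ)) f) = mulL (fun ξ => (g₂ ξ : ℂ)) f := by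
  rw [mulL_mulL hQ h1.isMult]
  simp_rw [hg, Complex.ofReal_mul]

lemma mulL_mulL_Q (hQ : IsMult fun ξ => (Q ξ : ℂ)) (h1 : IsSym κ g₁)
    (hg : ∀ ξ, g₂ ξ = Q ξ * g₁ ξ) (f : L2 d) :
    mulL (fun ξ => (g₁ ξ : ℂ)) (mulL (fun ξ => (Q ξ : ℂ)) f) = mulL (fun ξ => (g₂ ξ : ℂ)) f := by
  rw [mulL_comm h1.isMult hQ, mulL_Q_mulL hQ h1 hg]

/-- Here Q cannot be commuted with a. Instead G₁aQ = [G₁, a]Q + aG₂ = [G₁, a]Q - [G₂, a] + G₂a, by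
QG₁ = G₂. Both commutators are bounded on derivatives, and G₂a∂_j is the scalar transport term
already estimated. -/
lemma abs_re_velocity_transport_le (ha : IsCoef N a) (h1 : IsSym κ g₁) (h2 : IsSym κ g₂)
    (hQ : IsMult fun ξ => (Q ξ : ℂ)) (hQ1 : ∀ ξ, |Q ξ| ≤ 1) (hg : ∀ ξ, g₂ ξ = Q ξ * g₁ ξ)
    {f f' : L2 d} (hf : IsD j f f') :
    |(⟪f, mulL (fun ξ => (g₁ ξ : ℂ)) (convL a (mulL (fun ξ => (Q ξ : ℂ)) f'))⟫_ℂ).re|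
      ≤ 4 * κ * N * ‖f‖ ^ 2 := by
  set p' := mulL (fun ξ => (Q ξ : ℂ)) f' with hp'
  have c1 := ha.norm_comm_le h1 (hf.mulL hQ)
  have c2 := ha.norm_comm_le h2 hf
  have t := abs_re_transport_le ha h2 hf
  rw [← hp', hp', mulL_mulL_Q hQ h1 hg, ← hp'] at c1
  set A := mulL (fun ξ => (g₁ ξ : ℂ)) (convL a p')
  set B := convL a (mulL (fun ξ => (g₂ ξ : ℂ)) f')
  set D := mulL (fun ξ => (g₂ ξ : ℂ)) (convL a f')
  have e : A = (A - B) - (D - B) + D := by abel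
  have e2 : (⟪f, A⟫_ℂ).re = (⟪f, A - B⟫_ℂ).re - (⟪f, D - B⟫_ℂ).re + (⟪f, D⟫_ℂ).re := by
    conv_lhs => rw [e]
    rw [inner_add_right, inner_sub_right]
    simp
  have i1 := abs_le.1 (abs_re_inner_le f (A - B))
  have i2 := abs_le.1 (abs_re_inner_le f (D - B))
  have t' := abs_le.1 t
  have b1 : ‖f‖ * ‖A - B‖ ≤ κ * N * ‖f‖ ^ 2 := by
    have h := norm_mulL_Q_le hQ hQ1 f
    have := h1.nonneg
    have := ha.nonneg
    calc _ ≤ ‖f‖ * (κ * N * ‖f‖) := by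
          refine mul_le_mul_of_nonneg_left (c1.trans ?_) (norm_nonneg _)
          gcongr
      _ = _ := by ring
  have b2 : ‖f‖ * ‖D - B‖ ≤ κ * N * ‖f‖ ^ 2 := by
    calc _ ≤ ‖f‖ * (κ * N * ‖f‖) := mul_le_mul_of_nonneg_left c2 (norm_nonneg _)
      _ = _ := by ring
  rw [e2, abs_le]
  constructor <;> linarith [i1.1, i1.2, i2.1, i2.2, t'.1, t'.2]

/-- The term of order ε², created by the symmetrizer acting on the transport term. Multiplications
commute, so the product C = a₀a is symmetric and C∂_j is antisymmetric up to derivatives of the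
coefficients and commutators with G. -/
lemma abs_re_symmetrizer_transport_le (ha : IsCoef N a) (h0 : IsCoef N a₀) (hg : IsSym κ g)
    {p p' : L2 d} (hp : IsD j p p') :
    |(⟪convL a₀ p, mulL (fun ξ => (g ξ : ℂ)) (convL a p')⟫_ℂ).re| ≤ 9 * κ * N ^ 2 * ‖p‖ ^ 2 := by
  set G := mulL (fun ξ => (g ξ : ℂ)) with hG
  set e := convL (fun ξ => dl j ξ * a ξ) p with he
  set h := convL a p with hh
  set h' := convL a p' + e with hh'
  have hD : IsD j h h' := ha.isD hp
  set e₀ := convL (fun ξ => dl j ξ * a₀ ξ) h with he₀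
  have hκ := hg.nonneg
  have hN := ha.nonneg
  have nG : ∀ x, ‖G x‖ ≤ κ * ‖x‖ := norm_mulL_le hg.isMult hg.norm_le
  have ne : ‖e‖ ≤ N * ‖p‖ := ha.norm_convL_dl_le j p
  have nh : ‖h‖ ≤ N * ‖p‖ := ha.norm_convL_le p
  have ne₀ : ‖e₀‖ ≤ N * (N * ‖p‖) := (h0.norm_convL_dl_le j h).trans (by gcongr)
  set c₀ := G (convL a₀ h') - convL a₀ (G h') with hc₀
  have nc₀ : ‖c₀‖ ≤ κ * N * (N * ‖p‖) := (h0.norm_comm_le hg hD).trans (by gcongr)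
  set c := G (convL a p') - convL a (G p') with hc
  have nc : ‖c‖ ≤ κ * N * ‖p‖ := ha.norm_comm_le hg hp
  set C := convL a₀ ∘L convL a with hCdef
  have hC : ∀ x y, ⟪C x, y⟫_ℂ = ⟪x, C y⟫_ℂ := fun x y => by
    rw [hCdef, ContinuousLinearMap.comp_apply, ContinuousLinearMap.comp_apply, h0.inner, ha.inner,
      convL_comm ha.integrable h0.integrable]
  have hCD : IsD j (C p) (C p' + (convL a₀ e + e₀)) := by
    have := h0.isD hD
    rw [hh', map_add, add_assoc] at this
    exact this
  -- The commutator estimate for a₀ needs an argument that is a derivative. So a∂_jp is written as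
  -- ∂_j(ap) minus the bounded term e before a₀ is moved past G.
  have k1 : convL a₀ (G (convL a p'))
      = G (C p') + (G (convL a₀ e) - c₀ - convL a₀ (G e)) := by
    have : convL a p' = h' - e := by rw [hh']; abel
    rw [hc₀, hCdef, ContinuousLinearMap.comp_apply, this]
    simp only [map_sub]
    abel
  have k2 : G (C p') - C (G p') = convL a₀ c - (G (convL a₀ e) - c₀ - convL a₀ (G e)) := by
    have : G (C p') = convL a₀ (G (convL a p')) - (G (convL a₀ e) - c₀ - convL a₀ (G e)) := by
      rw [k1]; abel
    rw [this, hc, hCdef, ContinuousLinearMap.comp_apply]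
    simp only [map_sub]
    abel
  have nr : ‖G (convL a₀ e) - c₀ - convL a₀ (G e)‖ ≤ 3 * (κ * N ^ 2 * ‖p‖) := by
    have r1 : ‖G (convL a₀ e)‖ ≤ κ * (N * (N * ‖p‖)) := (nG _).trans (by
      gcongr; exact (h0.norm_convL_le e).trans (by gcongr))
    have r2 : ‖convL a₀ (G e)‖ ≤ N * (κ * (N * ‖p‖)) := (h0.norm_convL_le _).trans (by
      gcongr; exact (nG e).trans (by gcongr))
    have r3 := norm_sub_le (G (convL a₀ e) - c₀) (convL a₀ (G e))
    have r4 := norm_sub_le (G (convL a₀ e)) c₀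
    linarith
  have nc' : ‖G (C p') - C (G p')‖ ≤ 4 * (κ * N ^ 2 * ‖p‖) := by
    rw [k2]
    have r1 := norm_sub_le (convL a₀ c) (G (convL a₀ e) - c₀ - convL a₀ (G e))
    have r2 : ‖convL a₀ c‖ ≤ N * (κ * N * ‖p‖) := (h0.norm_convL_le _).trans (by gcongr)
    linarith
  have ne' : ‖convL a₀ e + e₀‖ ≤ 2 * (N ^ 2 * ‖p‖) := by
    have r1 := norm_add_le (convL a₀ e) e₀
    have r2 : ‖convL a₀ e‖ ≤ N * (N * ‖p‖) := (h0.norm_convL_le _).trans (by gcongr)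
    linarith
  have main := abs_re_inner_D_le hC hg.isMult hp hCD
  rw [← hG] at main
  have main' : |(⟪p, G (C p')⟫_ℂ).re| ≤ 6 * (κ * N ^ 2 * ‖p‖ ^ 2) := by
    refine main.trans ?_
    calc _ ≤ 4 * (κ * N ^ 2 * ‖p‖) * ‖p‖ + κ * ‖p‖ * (2 * (N ^ 2 * ‖p‖)) := by
          gcongr; exact nG p
      _ = _ := by ring
  have e2 : (⟪convL a₀ p, G (convL a p')⟫_ℂ).re
      = (⟪p, G (C p')⟫_ℂ).re + (⟪p, G (convL a₀ e) - c₀ - convL a₀ (G e)⟫_ℂ).re := by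
    rw [h0.inner, k1, inner_add_right, Complex.add_re]
  have i1 := abs_re_inner_le p (G (convL a₀ e) - c₀ - convL a₀ (G e))
  have i2 := mul_le_mul_of_nonneg_left nr (norm_nonneg p)
  rw [e2]
  refine (abs_add_le _ _).trans ?_
  nlinarith

/-- The form Qa₀Q of the symmetrizer is chosen for this cancellation. Since QG₁ = G₂, integrating by
parts in the second pairing gives minus the conjugate of the first, and only a derivative of a₀
remains. -/
lemma abs_re_coupling_le (h0 : IsCoef N a₀) (h1 : IsSym κ g₁) (h2 : IsSym κ g₂)
    (hQ : IsMult fun ξ => (Q ξ : ℂ)) (hQ1 : ∀ ξ, |Q ξ| ≤ 1) (hg : ∀ ξ, g₂ ξ = Q ξ * g₁ ξ)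
    {f f' w w' : L2 d} (hf : IsD j f f') (hw : IsD j w w') :
    |(⟪f, mulL (fun ξ => (g₂ ξ : ℂ)) (convL a₀ (mulL (fun ξ => (Q ξ : ℂ)) w'))⟫_ℂ).re
      + (⟪mulL (fun ξ => (Q ξ : ℂ)) (convL a₀ (mulL (fun ξ => (Q ξ : ℂ)) w)),
          mulL (fun ξ => (g₁ ξ : ℂ)) f'⟫_ℂ).re| ≤ κ * N * (‖f‖ * ‖w‖) := by
  set p := mulL (fun ξ => (Q ξ : ℂ)) w with hp
  set p' := mulL (fun ξ => (Q ξ : ℂ)) w' with hp'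
  set q := mulL (fun ξ => (g₂ ξ : ℂ)) f with hq
  set q' := mulL (fun ξ => (g₂ ξ : ℂ)) f' with hq'
  set e := convL (fun ξ => dl j ξ * a₀ ξ) p with he
  have hqD : IsD j q q' := hf.mulL h2.isMult
  have hpD : IsD j (convL a₀ p) (convL a₀ p' + e) := h0.isD (hw.mulL hQ)
  have k := hpD.inner hqD
  rw [inner_mulL_real hQ, mulL_Q_mulL hQ h1 hg, ← hq', k, ← inner_mulL_real h2.isMult, ← hq,
    inner_add_left, ← inner_conj_symm (convL a₀ p') q]
  simp only [Complex.neg_re, Complex.add_re, Complex.conj_re]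
  have : (⟪q, convL a₀ p'⟫_ℂ).re + -((⟪q, convL a₀ p'⟫_ℂ).re + (⟪e, q⟫_ℂ).re) = -(⟪e, q⟫_ℂ).re := by
    ring
  rw [this, abs_neg]
  refine (abs_re_inner_le e q).trans ?_
  have n1 : ‖e‖ ≤ N * ‖w‖ := (h0.norm_convL_dl_le j p).trans (by
    have := h0.nonneg
    gcongr
    exact norm_mulL_Q_le hQ hQ1 w)
  have n2 : ‖q‖ ≤ κ * ‖f‖ := norm_mulL_le h2.isMult h2.norm_le f
  have := h0.nonneg
  calc _ ≤ N * ‖w‖ * (κ * ‖f‖) := by gcongr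
    _ = _ := by ring

end Terms

/-! ### The state space -/

/-- Weighted Fourier transforms of elevation (`none`) and velocity (`some k`). -/
abbrev HH (d : ℕ) : Type := PiLp 2 (fun _ : Option (Fin d) => L2 d)

lemma HH.norm_le_sum (x : HH d) : ‖x‖ ≤ ∑ i, ‖x i‖ := by
  have h : ‖x‖ ^ 2 = ∑ i, ‖x i‖ ^ 2 := PiLp.norm_sq_eq_of_L2 _ x
  have h2 : ∑ i, ‖x i‖ ^ 2 ≤ (∑ i, ‖x i‖) ^ 2 :=
    Finset.sum_sq_le_sq_sum_of_nonneg fun i _ => norm_nonneg _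
  exact le_of_sq_le_sq (h.trans_le h2) (Finset.sum_nonneg fun i _ => norm_nonneg _)

lemma HH.norm_apply_le (x : HH d) (i : Option (Fin d)) : ‖x i‖ ≤ ‖x‖ := PiLp.norm_apply_le x i

lemma HH.norm_le {x : HH d} {c : ℝ} (h : ∀ i, ‖x i‖ ≤ c) : ‖x‖ ≤ (d + 1) * c := by
  refine (HH.norm_le_sum x).trans ((Finset.sum_le_sum fun i _ => h i).trans_eq ?_)
  simp

lemma HH.norm_le_mul {x y : HH d} {c : ℝ} (hc : 0 ≤ c) (h : ∀ i, ‖x i‖ ≤ c * ‖y i‖) :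
    ‖x‖ ≤ c * ‖y‖ := by
  have hx : ‖x‖ ^ 2 = ∑ i, ‖x i‖ ^ 2 := PiLp.norm_sq_eq_of_L2 _ x
  have hy : ‖y‖ ^ 2 = ∑ i, ‖y i‖ ^ 2 := PiLp.norm_sq_eq_of_L2 _ y
  refine le_of_sq_le_sq ?_ (by positivity)
  rw [mul_pow, hx, hy, Finset.mul_sum]
  refine Finset.sum_le_sum fun i _ => ?_
  rw [← mul_pow]
  exact pow_le_pow_left₀ (norm_nonneg _) (h i) 2

/-- Componentwise action of operators. -/
def mapP (T : Option (Fin d) → L2 d →L[ℂ] L2 d) : HH d →L[ℂ] HH d :=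
  (PiLp.continuousLinearEquiv 2 ℂ (fun _ : Option (Fin d) => L2 d)).symm.toContinuousLinearMap ∘L
    ContinuousLinearMap.pi fun i => T i ∘L PiLp.proj 2 (fun _ : Option (Fin d) => L2 d) i

/-- Multiplication of all components. -/
def mulP (m : Space d → ℂ) : HH d →L[ℂ] HH d := mapP fun _ => mulL m

@[simp] lemma mulP_apply (m : Space d → ℂ) (x : HH d) (i : Option (Fin d)) :
    mulP m x i = mulL m (x i) := rfl

lemma norm_mulP_le {m : Space d → ℂ} (h : IsMult m) {C : ℝ} (hC0 : 0 ≤ C)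
    (hC : ∀ ξ, ‖m ξ‖ ≤ C) (x : HH d) : ‖mulP m x‖ ≤ C * ‖x‖ :=
  HH.norm_le_mul hC0 fun i => norm_mulL_le h hC (x i)

lemma mulP_mulP {m m' : Space d → ℂ} (h : IsMult m) (h' : IsMult m') (x : HH d) :
    mulP m (mulP m' x) = mulP (fun ξ => m ξ * m' ξ) x := by
  ext1 i
  exact mulL_mulL h h' (x i)

lemma mulP_comm {m m' : Space d → ℂ} (h : IsMult m) (h' : IsMult m') (x : HH d) :
    mulP m (mulP m' x) = mulP m' (mulP m x) := by
  ext1 i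
  exact mulL_comm h h' (x i)

lemma mulP_one (x : HH d) : mulP (fun _ => 1) x = x := by
  ext1 i
  exact mulL_one (x i)

/-- The symbols of the system in the frequency variable; `g₁`, `g₂` stand for `G₁`, `G₂` and `Q` for
their quotient. -/
structure IsSys (κ : ℝ) (g₁ g₂ Q : Space d → ℝ) : Prop where
  sym₁ : IsSym κ g₁
  sym₂ : IsSym κ g₂
  measurable : Measurable Q
  le_one : ∀ ξ, |Q ξ| ≤ 1
  eq : ∀ ξ, g₂ ξ = Q ξ * g₁ ξ
  even₁ : ∀ ξ, g₁ (-ξ) = g₁ ξ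
  even : ∀ ξ, Q (-ξ) = Q ξ

namespace IsSys

variable {κ : ℝ} {g₁ g₂ Q : Space d → ℝ}

lemma isMult (h : IsSys κ g₁ g₂ Q) : IsMult fun ξ => (Q ξ : ℂ) :=
  IsMult.ofReal h.measurable h.le_one

lemma norm_Q_le (h : IsSys κ g₁ g₂ Q) (x : L2 d) : ‖mulL (fun ξ => (Q ξ : ℂ)) x‖ ≤ ‖x‖ :=
  norm_mulL_Q_le h.isMult h.le_one x

lemma even₂ (h : IsSys κ g₁ g₂ Q) (ξ : Space d) : g₂ (-ξ) = g₂ ξ := by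
  rw [h.eq, h.eq, h.even, h.even₁]

end IsSys

/-- The normalized derivative `∂_j ⟨D⟩⁻¹`. -/
def dm (j : Fin d) (ξ : Space d) : ℂ := dl j ξ * (wt (-1) ξ : ℂ)

lemma norm_dm_le (j : Fin d) (ξ : Space d) : ‖dm j ξ‖ ≤ 1 := by
  rw [dm, norm_mul, Complex.norm_real, Real.norm_of_nonneg (wt_pos _ ξ).le]
  have h := mul_le_mul_of_nonneg_right (norm_dl_le j ξ) (wt_pos (-1) ξ).le
  rwa [← wt_one, wt_mul_neg] at h

lemma isMult_dm (j : Fin d) : IsMult (dm j) := by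
  refine ⟨?_, 1, norm_dm_le j⟩
  have := (continuous_wt (d := d) (-1)).measurable
  have := (continuous_dl j).measurable
  unfold dm
  fun_prop

lemma norm_mulL_dm_le (j : Fin d) (x : L2 d) : ‖mulL (dm j) x‖ ≤ ‖x‖ := by
  simpa using norm_mulL_le (isMult_dm j) (norm_dm_le j) x

/-- The inverse bracket as an operator. -/
def lowL : L2 d →L[ℂ] L2 d := mulL fun ξ => (wt (-1) ξ : ℂ)

lemma isMult_wt_neg_one : IsMult fun ξ : Space d => (wt (-1) ξ : ℂ) := isMult_wt_neg (by norm_num)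

/-- The inverse bracket on states. -/
def lowP : HH d →L[ℂ] HH d := mulP fun ξ => (wt (-1) ξ : ℂ)

lemma lowP_apply (x : HH d) (i : Option (Fin d)) : lowP x i = lowL (x i) := rfl

lemma norm_lowP_le (x : HH d) : ‖lowP x‖ ≤ ‖x‖ :=
  (norm_mulP_le isMult_wt_neg_one zero_le_one (norm_wt_le_one (by norm_num)) x).trans_eq
    (one_mul _)

/-! ### The system for the weighted Fourier transforms of ζ and G₁v. -/

section System

variable (g₁ g₂ Q : Space d → ℝ) (r : ℝ)

/-- The linear part of the system. -/
def linP (e : HH d) : HH d := WithLp.toLp 2 fun i => match i with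
  | none => ∑ j, mulL (fun ξ => (g₁ ξ : ℂ)) (mulL (dm j) (e (some j)))
  | some k => mulL (fun ξ => (g₁ ξ : ℂ)) (mulL (dm k) (e none))

/-- The bilinear part of the system. -/
def bilP (U e : HH d) : HH d := WithLp.toLp 2 fun i => match i with
  | none => ∑ j, mulL (fun ξ => (g₂ ξ : ℂ))
      (Bil r (lowL (mulL (fun ξ => (Q ξ : ℂ)) (U (some j)))) (mulL (dm j) (e none))
        + Bil r (lowL (U none)) (mulL (dm j) (mulL (fun ξ => (Q ξ : ℂ)) (e (some j)))))
  -- The velocity unknown is G₁v, so the velocity equation is multiplied by G₁ and each G₂v is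
  -- written as Q applied to the unknown.
  | some k => ∑ j, mulL (fun ξ => (g₁ ξ : ℂ))
      (Bil r (lowL (mulL (fun ξ => (Q ξ : ℂ)) (U (some j))))
        (mulL (dm j) (mulL (fun ξ => (Q ξ : ℂ)) (e (some k)))))

/-- The quasilinear operator, from `X^s` to `X^{s-1}`, `r = s - 1`. -/
def quadP (ε : ℝ) (U e : HH d) : HH d := linP g₁ e + (ε : ℂ) • bilP g₁ g₂ Q r U e

end System

/-! ### Bilinearity and boundedness of the operator. -/

section Bounds

variable {κ : ℝ} {g₁ g₂ Q : Space d → ℝ} {r : ℝ}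

lemma linP_sub (e e' : HH d) : linP g₁ (e - e') = linP g₁ e - linP g₁ e' := by
  ext1 i
  rcases i with _ | k
  · simp [linP]
  · simp [linP]

lemma bilP_sub_left (hr : (d : ℝ) < 2 * r) (U U' e : HH d) :
    bilP g₁ g₂ Q r (U - U') e = bilP g₁ g₂ Q r U e - bilP g₁ g₂ Q r U' e := by
  ext1 i
  rcases i with _ | k
  · simp only [bilP, PiLp.sub_apply, map_sub, Bil_sub_left hr, map_add, ← Finset.sum_sub_distrib]
    refine Finset.sum_congr rfl fun j _ => ?_
    abel
  · simp only [bilP, PiLp.sub_apply, map_sub, Bil_sub_left hr, ← Finset.sum_sub_distrib]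

lemma bilP_sub_right (hr : (d : ℝ) < 2 * r) (U e e' : HH d) :
    bilP g₁ g₂ Q r U (e - e') = bilP g₁ g₂ Q r U e - bilP g₁ g₂ Q r U e' := by
  ext1 i
  rcases i with _ | k
  · simp only [bilP, PiLp.sub_apply, map_sub, Bil_sub_right hr, map_add, ← Finset.sum_sub_distrib]
    refine Finset.sum_congr rfl fun j _ => ?_
    abel
  · simp only [bilP, PiLp.sub_apply, map_sub, Bil_sub_right hr, ← Finset.sum_sub_distrib]

/-- The derivative of the difference keeps the coefficients of U, so the symmetrizer of U handles
it. In the remaining term the difference is a mere coefficient and V alone is differentiated; it is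
bounded without integration by parts. -/
lemma quadP_sub (hr : (d : ℝ) < 2 * r) (ε : ℝ) (U V : HH d) :
    quadP g₁ g₂ Q r ε U U - quadP g₁ g₂ Q r ε V V
      = quadP g₁ g₂ Q r ε U (U - V) + (ε : ℂ) • bilP g₁ g₂ Q r (U - V) V := by
  simp only [quadP, linP_sub, bilP_sub_left hr, bilP_sub_right hr, smul_sub]
  abel

lemma norm_cut_linP_le (h : IsSym κ g₁) {m : Space d → ℝ} (hm : IsCut m) (e : HH d) :
    ‖mulP (fun ξ => (m ξ : ℂ)) (linP g₁ e)‖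
      ≤ (d + 1) ^ 2 * κ * ‖mulP (fun ξ => (m ξ : ℂ)) e‖ := by
  have hκ := h.nonneg
  have key : ∀ (k : Fin d) i, ‖mulL (fun ξ => (m ξ : ℂ)) (mulL (fun ξ => (g₁ ξ : ℂ))
      (mulL (dm k) (e i)))‖ ≤ κ * ‖mulP (fun ξ => (m ξ : ℂ)) e‖ := by
    intro k i
    rw [mulL_comm hm.isMult h.isMult, mulL_comm hm.isMult (isMult_dm k)]
    refine (norm_mulL_le h.isMult h.norm_le _).trans ?_
    gcongr
    exact (norm_mulL_dm_le k _).trans (PiLp.norm_apply_le (mulP (fun ξ => (m ξ : ℂ)) e) i)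
  have h2 : ∀ i, ‖mulP (fun ξ => (m ξ : ℂ)) (linP g₁ e) i‖
      ≤ (d + 1) * (κ * ‖mulP (fun ξ => (m ξ : ℂ)) e‖) := by
    intro i
    have hp : 0 ≤ κ * ‖mulP (fun ξ => (m ξ : ℂ)) e‖ := by positivity
    have hd : (0 : ℝ) ≤ d := by positivity
    rw [mulP_apply]
    rcases i with _ | k
    · simp only [linP, map_sum]
      refine (norm_sum_le _ _).trans ((Finset.sum_le_sum fun j _ => key j (some j)).trans ?_)
      simp only [Finset.sum_const, Finset.card_univ, Fintype.card_fin, nsmul_eq_mul]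
      nlinarith
    · refine (key k none).trans ?_
      nlinarith
  refine (HH.norm_le h2).trans (le_of_eq ?_)
  ring

/-- The first argument is not differentiated and enters one level lower, through `lowP`. This lets a
difference of solutions, controlled only at regularity s - 1, act as a coefficient. -/
lemma exists_norm_cut_bilP_le (d : ℕ) {r : ℝ} (hr : (d : ℝ) < 2 * r) : ∃ C, 0 ≤ C ∧
    ∀ (κ : ℝ) (g₁ g₂ Q : Space d → ℝ), IsSys κ g₁ g₂ Q → ∀ m : Space d → ℝ, IsCut m →
    ∀ U e : HH d, ‖mulP (fun ξ => (m ξ : ℂ)) (bilP g₁ g₂ Q r U e)‖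
      ≤ C * κ * (‖mulP (fun ξ => (m ξ : ℂ)) (lowP U)‖ * ‖e‖
        + ‖lowP U‖ * ‖mulP (fun ξ => (m ξ : ℂ)) e‖) := by
  obtain ⟨C, hC, -, hB⟩ := exists_Bil_bound hr
  refine ⟨2 * (d + 1) ^ 2 * C, by positivity, fun κ g₁ g₂ Q hS m hm U e => ?_⟩
  have hκ := hS.sym₁.nonneg
  obtain ⟨n₁, hn₁⟩ : ∃ n, n = ‖mulP (fun ξ => (m ξ : ℂ)) (lowP U)‖ := ⟨_, rfl⟩
  obtain ⟨n₂, hn₂⟩ : ∃ n, n = ‖mulP (fun ξ => (m ξ : ℂ)) e‖ := ⟨_, rfl⟩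
  obtain ⟨P, hP⟩ : ∃ P, P = n₁ * ‖e‖ + ‖lowP U‖ * n₂ := ⟨_, rfl⟩
  have hn₁0 : 0 ≤ n₁ := hn₁ ▸ norm_nonneg _
  have hn₂0 : 0 ≤ n₂ := hn₂ ▸ norm_nonneg _
  have hP0 : 0 ≤ P := hP ▸ add_nonneg (mul_nonneg hn₁0 (norm_nonneg _))
    (mul_nonneg (norm_nonneg _) hn₂0)
  rw [← hn₁, ← hn₂, ← hP]
  have hQ := hS.isMult
  have key : ∀ (g : Space d → ℝ), IsSym κ g → ∀ x y : L2 d, ‖mulL (fun ξ => (m ξ : ℂ)) x‖ ≤ n₁ →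
      ‖x‖ ≤ ‖lowP U‖ → ‖mulL (fun ξ => (m ξ : ℂ)) y‖ ≤ n₂ → ‖y‖ ≤ ‖e‖ →
      ‖mulL (fun ξ => (m ξ : ℂ)) (mulL (fun ξ => (g ξ : ℂ)) (Bil r x y))‖ ≤ κ * (C * P) := by
    intro g hg x y h1 h2 h3 h4
    rw [mulL_comm hm.isMult hg.isMult]
    refine (norm_mulL_le hg.isMult hg.norm_le _).trans ?_
    refine mul_le_mul_of_nonneg_left ((hB m hm x y).trans ?_) hκ
    rw [hP]
    exact mul_le_mul_of_nonneg_left (add_le_add (mul_le_mul h1 h4 (norm_nonneg _) hn₁0)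
      (mul_le_mul h2 h3 (norm_nonneg _) (norm_nonneg _))) hC
  have u1 : ∀ i, ‖mulL (fun ξ => (m ξ : ℂ)) (lowL (U i))‖ ≤ n₁ := fun i => by
    rw [hn₁, ← lowP_apply, ← mulP_apply]
    exact HH.norm_apply_le (mulP (fun ξ => (m ξ : ℂ)) (lowP U)) i
  have u2 : ∀ i, ‖lowL (U i)‖ ≤ ‖lowP U‖ := fun i => by
    rw [← lowP_apply]
    exact HH.norm_apply_le (lowP U) i
  have cQ : ∀ x, lowL (mulL (fun ξ => (Q ξ : ℂ)) x) = mulL (fun ξ => (Q ξ : ℂ)) (lowL x) :=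
    fun x => mulL_comm isMult_wt_neg_one hQ x
  have u1' : ∀ i, ‖mulL (fun ξ => (m ξ : ℂ)) (lowL (mulL (fun ξ => (Q ξ : ℂ)) (U i)))‖
      ≤ n₁ := fun i => by
    rw [cQ, mulL_comm hm.isMult hQ]
    exact (hS.norm_Q_le _).trans (u1 i)
  have u2' : ∀ i, ‖lowL (mulL (fun ξ => (Q ξ : ℂ)) (U i))‖ ≤ ‖lowP U‖ := fun i => by
    rw [cQ]
    exact (hS.norm_Q_le _).trans (u2 i)
  have v1 : ∀ i j, ‖mulL (fun ξ => (m ξ : ℂ)) (mulL (dm j) (e i))‖ ≤ n₂ := fun i j => by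
    rw [mulL_comm hm.isMult (isMult_dm j)]
    exact (norm_mulL_dm_le j _).trans (by
      rw [hn₂, ← mulP_apply]
      exact HH.norm_apply_le (mulP (fun ξ => (m ξ : ℂ)) e) i)
  have v2 : ∀ i j, ‖mulL (dm j) (e i)‖ ≤ ‖e‖ := fun i j =>
    (norm_mulL_dm_le j _).trans (HH.norm_apply_le e i)
  have v1' : ∀ i j, ‖mulL (fun ξ => (m ξ : ℂ)) (mulL (dm j) (mulL (fun ξ => (Q ξ : ℂ)) (e i)))‖
      ≤ n₂ := fun i j => by
    rw [mulL_comm (isMult_dm j) hQ, mulL_comm hm.isMult hQ]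
    exact (hS.norm_Q_le _).trans (v1 i j)
  have v2' : ∀ i j, ‖mulL (dm j) (mulL (fun ξ => (Q ξ : ℂ)) (e i))‖ ≤ ‖e‖ := fun i j => by
    rw [mulL_comm (isMult_dm j) hQ]
    exact (hS.norm_Q_le _).trans (v2 i j)
  have h2 : ∀ i, ‖mulP (fun ξ => (m ξ : ℂ)) (bilP g₁ g₂ Q r U e) i‖
      ≤ (d + 1) * (2 * (κ * (C * P))) := by
    intro i
    have hp : 0 ≤ κ * (C * P) := mul_nonneg hκ (mul_nonneg hC hP0)
    have hd : (0 : ℝ) ≤ d := d.cast_nonneg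
    rw [mulP_apply]
    rcases i with _ | k
    · simp only [bilP, map_sum, map_add]
      refine (norm_sum_le _ _).trans ((Finset.sum_le_sum fun j _ => (norm_add_le _ _).trans
        (add_le_add (key g₂ hS.sym₂ _ _ (u1' _) (u2' _) (v1 _ _) (v2 _ _))
          (key g₂ hS.sym₂ _ _ (u1 _) (u2 _) (v1' _ _) (v2' _ _)))).trans ?_)
      simp only [Finset.sum_const, Finset.card_univ, Fintype.card_fin, nsmul_eq_mul]
      nlinarith
    · simp only [bilP, map_sum]
      refine (norm_sum_le _ _).trans ((Finset.sum_le_sum fun j _ =>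
        key g₁ hS.sym₁ _ _ (u1' _) (u2' _) (v1' _ _) (v2' _ _)).trans ?_)
      simp only [Finset.sum_const, Finset.card_univ, Fintype.card_fin, nsmul_eq_mul]
      nlinarith
  refine (HH.norm_le h2).trans (le_of_eq ?_)
  ring

/-- In each component a symbol g₁ or g₂ is the outermost operation, so truncating the symbols
amounts to truncating the output, while Q inside is untouched. -/
lemma quadP_mul {j : Space d → ℝ} (hj : IsMult fun ξ => (j ξ : ℂ)) (hS : IsSys κ g₁ g₂ Q) (ε : ℝ)
    (U e : HH d) : quadP (fun ξ => j ξ * g₁ ξ) (fun ξ => j ξ * g₂ ξ) Q r ε U e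
      = mulP (fun ξ => (j ξ : ℂ)) (quadP g₁ g₂ Q r ε U e) := by
  have h1 : ∀ x, mulL (fun ξ => ((j ξ * g₁ ξ : ℝ) : ℂ)) x
      = mulL (fun ξ => (j ξ : ℂ)) (mulL (fun ξ => (g₁ ξ : ℂ)) x) := fun x => by
    rw [mulL_mulL hj hS.sym₁.isMult]; simp_rw [Complex.ofReal_mul]
  have h2 : ∀ x, mulL (fun ξ => ((j ξ * g₂ ξ : ℝ) : ℂ)) x
      = mulL (fun ξ => (j ξ : ℂ)) (mulL (fun ξ => (g₂ ξ : ℂ)) x) := fun x => by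
    rw [mulL_mulL hj hS.sym₂.isMult]; simp_rw [Complex.ofReal_mul]
  ext1 i
  rcases i with _ | k
  · simp only [quadP, linP, bilP, PiLp.add_apply, PiLp.smul_apply, mulP_apply, h1, h2, map_add,
      map_smul, map_sum]
  · simp only [quadP, linP, bilP, PiLp.add_apply, PiLp.smul_apply, mulP_apply, h1, h2, map_add,
      map_smul, map_sum]

end Bounds

/-! ### The symmetrizer -/

/-- The symmetrizer of the system. -/
def symP (ε : ℝ) (Q : Space d → ℝ) (a : Space d → ℂ) : HH d →L[ℂ] HH d :=
  mapP fun i => match i with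
    | none => ContinuousLinearMap.id ℂ (L2 d)
    | some _ => ContinuousLinearMap.id ℂ (L2 d) + (ε : ℂ) •
        (mulL (fun ξ => (Q ξ : ℂ)) ∘L convL a ∘L mulL (fun ξ => (Q ξ : ℂ)))

lemma symP_none (ε : ℝ) (Q : Space d → ℝ) (a : Space d → ℂ) (f : HH d) :
    symP ε Q a f none = f none := rfl

lemma symP_some (ε : ℝ) (Q : Space d → ℝ) (a : Space d → ℂ) (f : HH d) (k : Fin d) :
    symP ε Q a f (some k) = f (some k) + (ε : ℂ) • mulL (fun ξ => (Q ξ : ℂ))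
      (convL a (mulL (fun ξ => (Q ξ : ℂ)) (f (some k)))) := rfl

lemma HH.inner_eq (x y : HH d) : ⟪x, y⟫_ℂ = ⟪x none, y none⟫_ℂ + ∑ k, ⟪x (some k), y (some k)⟫_ℂ := by
  rw [PiLp.inner_apply, Fintype.sum_option]

lemma HH.norm_sq_eq (x : HH d) : ‖x‖ ^ 2 = ‖x none‖ ^ 2 + ∑ k, ‖x (some k)‖ ^ 2 := by
  rw [PiLp.norm_sq_eq_of_L2 _ x, Fintype.sum_option]

lemma re_inner_eps (ε : ℝ) (x y : L2 d) : (⟪x, (ε : ℂ) • y⟫_ℂ).re = ε * (⟪x, y⟫_ℂ).re := by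
  rw [inner_smul_right, Complex.re_ofReal_mul]

lemma re_inner_eps_left (ε : ℝ) (x y : L2 d) : (⟪(ε : ℂ) • x, y⟫_ℂ).re = ε * (⟪x, y⟫_ℂ).re := by
  rw [inner_smul_left, Complex.conj_ofReal, Complex.re_ofReal_mul]

section Energy

variable {κ : ℝ} {g₁ g₂ Q : Space d → ℝ} {a₀ : Space d → ℂ} {N ε : ℝ}

lemma norm_symP_le (hS : IsSys κ g₁ g₂ Q) (h0 : IsCoef N a₀) (hε0 : 0 ≤ ε) (hε1 : ε ≤ 1)
    (f : HH d) : ‖symP ε Q a₀ f‖ ≤ (1 + N) * ‖f‖ := by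
  have hN := h0.nonneg
  refine HH.norm_le_mul (by positivity) fun i => ?_
  rcases i with _ | k
  · rw [symP_none]
    nlinarith [norm_nonneg (f none)]
  · rw [symP_some]
    refine (norm_add_le _ _).trans ?_
    rw [norm_smul, Complex.norm_real, Real.norm_of_nonneg hε0]
    have h1 : ‖mulL (fun ξ => (Q ξ : ℂ)) (convL a₀ (mulL (fun ξ => (Q ξ : ℂ)) (f (some k))))‖
        ≤ N * ‖f (some k)‖ :=
      (hS.norm_Q_le _).trans ((h0.norm_convL_le _).trans
        (mul_le_mul_of_nonneg_left (hS.norm_Q_le _) hN))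
    nlinarith [norm_nonneg (mulL (fun ξ => (Q ξ : ℂ)) (convL a₀ (mulL (fun ξ => (Q ξ : ℂ))
      (f (some k)))))]

lemma inner_symP (hS : IsSys κ g₁ g₂ Q) (h0 : IsCoef N a₀) (f g : HH d) :
    ⟪symP ε Q a₀ f, g⟫_ℂ = ⟪f, symP ε Q a₀ g⟫_ℂ := by
  rw [HH.inner_eq, HH.inner_eq]
  simp only [symP_none, symP_some, inner_add_left, inner_add_right, inner_smul_left,
    inner_smul_right, Complex.conj_ofReal, inner_mulL_real hS.isMult, h0.inner]

/-- On each velocity component the form is (|f|² - |Qf|²) + (|Qf|² + ε⟨Qf, a₀Qf⟩). The first bracket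
is nonnegative as |Q| ≤ 1, the second is at least h|Qf|², and h ≤ 1 combines them. -/
lemma le_re_inner_symP (hS : IsSys κ g₁ g₂ Q) (h0 : IsCoef N a₀) {h : ℝ}
    (hh1 : h ≤ 1) (hnc : ∀ x, h ≤ 1 + ε * ((𝓕⁻ a₀ : Space d → ℂ) x).re) (f : HH d) :
    h * ‖f‖ ^ 2 ≤ (⟪f, symP ε Q a₀ f⟫_ℂ).re := by
  rw [HH.inner_eq, HH.norm_sq_eq, Complex.add_re, Complex.re_sum, mul_add, Finset.mul_sum]
  refine add_le_add ?_ (Finset.sum_le_sum fun k _ => ?_)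
  · rw [symP_none, inner_self_eq_norm_sq_to_K]
    have : ((↑‖f none‖ : ℂ) ^ 2).re = ‖f none‖ ^ 2 := by
      rw [← Complex.ofReal_pow, Complex.ofReal_re]
    erw [this]
    nlinarith [sq_nonneg ‖f none‖]
  · set x := f (some k)
    set p := mulL (fun ξ => (Q ξ : ℂ)) x with hp
    rw [symP_some, inner_add_right, inner_self_eq_norm_sq_to_K, Complex.add_re, re_inner_eps,
      ← inner_mulL_real hS.isMult, ← hp]
    have : ((↑‖x‖ : ℂ) ^ 2).re = ‖x‖ ^ 2 := by
      rw [← Complex.ofReal_pow, Complex.ofReal_re]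
    erw [this]
    have h1 := le_inner_convL h0.integrable hnc p
    have h2 : ‖p‖ ^ 2 ≤ ‖x‖ ^ 2 := pow_le_pow_left₀ (norm_nonneg _) (hS.norm_Q_le x) 2
    nlinarith

/-- The energy estimate at a fixed time: the symmetrized operator is skew-adjoint up to bounded
terms of size `ε`. -/
lemma abs_re_inner_symP_le (hS : IsSys κ g₁ g₂ Q) (h0 : IsCoef N a₀) {a : Fin d → Space d → ℂ}
    (ha : ∀ j, IsCoef N (a j)) (hε0 : 0 ≤ ε) (hε1 : ε ≤ 1) {f F : HH d}
    {f' : Fin d → Option (Fin d) → L2 d} (hf : ∀ j i, IsD j (f i) (f' j i)) {Φ : ℝ}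
    (hΦ : 0 ≤ Φ) {c₁ c₂ : Fin d → L2 d} {c₃ : Fin d → Fin d → L2 d} (hc₁ : ∀ j, ‖c₁ j‖ ≤ Φ)
    (hc₂ : ∀ j, ‖c₂ j‖ ≤ Φ) (hc₃ : ∀ j k, ‖c₃ j k‖ ≤ Φ)
    (hF0 : F none = ∑ j, (mulL (fun ξ => (g₁ ξ : ℂ)) (f' j (some j))
      + (ε : ℂ) • (mulL (fun ξ => (g₂ ξ : ℂ)) (convL (a j) (f' j none) + c₁ j)
      + mulL (fun ξ => (g₂ ξ : ℂ)) (convL a₀ (mulL (fun ξ => (Q ξ : ℂ)) (f' j (some j))) + c₂ j))))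
    (hFk : ∀ k, F (some k) = mulL (fun ξ => (g₁ ξ : ℂ)) (f' k none) + (ε : ℂ) • ∑ j,
      mulL (fun ξ => (g₁ ξ : ℂ)) (convL (a j) (mulL (fun ξ => (Q ξ : ℂ)) (f' j (some k)))
        + c₃ j k)) :
    |(⟪symP ε Q a₀ f, F⟫_ℂ).re|
      ≤ ε * (20 * (d + 1) ^ 2 * (κ * (1 + N) ^ 2 * ‖f‖ ^ 2 + κ * (1 + N) * Φ * ‖f‖)) := by
  have hκ := hS.sym₁.nonneg
  have hN := h0.nonneg
  obtain ⟨X, hX⟩ : ∃ X, X = κ * (1 + N) ^ 2 * ‖f‖ ^ 2 + κ * (1 + N) * Φ * ‖f‖ := ⟨_, rfl⟩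
  have hnf : ∀ i, ‖f i‖ ≤ ‖f‖ := HH.norm_apply_le f
  have hn0 := norm_nonneg f
  have hX1 : ∀ {n y : ℝ}, 0 ≤ n → n ≤ ‖f‖ → 0 ≤ y → y ≤ (1 + N) ^ 2 → κ * y * n ^ 2 ≤ X := by
    intro n y hn hn' hy hy'
    have : κ * y * n ^ 2 ≤ κ * (1 + N) ^ 2 * ‖f‖ ^ 2 := by gcongr
    have : 0 ≤ κ * (1 + N) * Φ * ‖f‖ := by positivity
    linarith
  have hX2 : ∀ {n y : ℝ}, 0 ≤ n → n ≤ (1 + N) * ‖f‖ → 0 ≤ y → y ≤ Φ →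
      n * (κ * y) ≤ X := by
    intro n y hn hn' hy hy'
    have : n * (κ * y) ≤ (1 + N) * ‖f‖ * (κ * Φ) := by gcongr
    have : 0 ≤ κ * (1 + N) ^ 2 * ‖f‖ ^ 2 := by positivity
    linarith
  have hN1 : N ≤ (1 + N) ^ 2 := by nlinarith
  have hN2 : N ^ 2 ≤ (1 + N) ^ 2 := by nlinarith
  have hg1 := fun x => norm_mulL_le hS.sym₁.isMult hS.sym₁.norm_le x
  have hg2 := fun x => norm_mulL_le hS.sym₂.isMult hS.sym₂.norm_le x
  have hq : ∀ k, ‖mulL (fun ξ => (Q ξ : ℂ)) (convL a₀ (mulL (fun ξ => (Q ξ : ℂ)) (f (some k))))‖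
      ≤ N * ‖f‖ := fun k => (hS.norm_Q_le _).trans ((h0.norm_convL_le _).trans
        (mul_le_mul_of_nonneg_left ((hS.norm_Q_le _).trans (hnf _)) hN))
  have inn : ∀ {x y : L2 d} {g : Space d → ℝ}, (∀ x, ‖mulL (fun ξ => (g ξ : ℂ)) x‖ ≤ κ * ‖x‖) →
      ‖x‖ ≤ (1 + N) * ‖f‖ → ‖y‖ ≤ Φ → |(⟪x, mulL (fun ξ => (g ξ : ℂ)) y⟫_ℂ).re| ≤ X := by
    intro x y g hg hx hy
    refine (abs_re_inner_le _ _).trans ((mul_le_mul_of_nonneg_left (hg y) (norm_nonneg _)).trans ?_)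
    exact hX2 (norm_nonneg _) hx (norm_nonneg _) hy
  have hle : ∀ i, ‖f i‖ ≤ (1 + N) * ‖f‖ := fun i => (hnf i).trans (by nlinarith)
  have tB : ∀ j, |(⟪f none, mulL (fun ξ => (g₂ ξ : ℂ)) (convL (a j) (f' j none))⟫_ℂ).re| ≤ 2 * X :=
    fun j => (abs_re_transport_le (ha j) hS.sym₂ (hf j none)).trans (by
      have := hX1 (norm_nonneg _) (hnf none) hN hN1
      linarith)
  have tb : ∀ j, |(⟪f none, mulL (fun ξ => (g₂ ξ : ℂ)) (c₁ j)⟫_ℂ).re| ≤ X :=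
    fun j => inn hg2 (hle _) (hc₁ j)
  have td : ∀ j, |(⟪f none, mulL (fun ξ => (g₂ ξ : ℂ)) (c₂ j)⟫_ℂ).re| ≤ X :=
    fun j => inn hg2 (hle _) (hc₂ j)
  have tD : ∀ j, |(⟪f none, mulL (fun ξ => (g₂ ξ : ℂ)) (convL a₀ (mulL (fun ξ => (Q ξ : ℂ))
        (f' j (some j))))⟫_ℂ).re
      + (⟪mulL (fun ξ => (Q ξ : ℂ)) (convL a₀ (mulL (fun ξ => (Q ξ : ℂ)) (f (some j)))),
          mulL (fun ξ => (g₁ ξ : ℂ)) (f' j none)⟫_ℂ).re| ≤ X := fun j =>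
    (abs_re_coupling_le h0 hS.sym₁ hS.sym₂ hS.isMult hS.le_one hS.eq (hf j none)
      (hf j (some j))).trans (by
        have h1 : κ * N * (‖f none‖ * ‖f (some j)‖) ≤ κ * N * (‖f‖ * ‖f‖) := by
          have := hnf none
          have := hnf (some j)
          gcongr
        have := hX1 hn0 le_rfl hN hN1
        nlinarith)
  have tE : ∀ j k, |(⟪f (some k), mulL (fun ξ => (g₁ ξ : ℂ)) (convL (a j)
      (mulL (fun ξ => (Q ξ : ℂ)) (f' j (some k))))⟫_ℂ).re| ≤ 4 * X := fun j k =>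
    (abs_re_velocity_transport_le (ha j) hS.sym₁ hS.sym₂ hS.isMult hS.le_one hS.eq
      (hf j (some k))).trans (by
        have := hX1 (norm_nonneg _) (hnf (some k)) hN hN1
        linarith)
  have te : ∀ j k, |(⟪f (some k), mulL (fun ξ => (g₁ ξ : ℂ)) (c₃ j k)⟫_ℂ).re| ≤ X :=
    fun j k => inn hg1 (hle _) (hc₃ j k)
  -- Moving the outer Q to the right-hand factor turns G₁ into G₂, so the pairing is one in p = Qf
  -- alone.
  have tH : ∀ j k, |(⟪mulL (fun ξ => (Q ξ : ℂ)) (convL a₀ (mulL (fun ξ => (Q ξ : ℂ))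
      (f (some k)))), mulL (fun ξ => (g₁ ξ : ℂ)) (convL (a j)
      (mulL (fun ξ => (Q ξ : ℂ)) (f' j (some k))))⟫_ℂ).re| ≤ 9 * X := fun j k => by
    rw [inner_mulL_real hS.isMult, mulL_Q_mulL hS.isMult hS.sym₁ hS.eq]
    refine (abs_re_symmetrizer_transport_le (ha j) h0 hS.sym₂ ((hf j (some k)).mulL
      hS.isMult)).trans ?_
    have := hX1 (norm_nonneg _) ((hS.norm_Q_le _).trans (hnf (some k))) (sq_nonneg N) hN2
    linarith
  have th : ∀ j k, |(⟪mulL (fun ξ => (Q ξ : ℂ)) (convL a₀ (mulL (fun ξ => (Q ξ : ℂ))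
      (f (some k)))), mulL (fun ξ => (g₁ ξ : ℂ)) (c₃ j k)⟫_ℂ).re| ≤ X :=
    fun j k => inn hg1 ((hq k).trans (by nlinarith)) (hc₃ j k)
  -- The terms of order one cancel exactly, G₁ being real and commuting with ∂_j. Everything else
  -- carries a factor ε, and so does the final bound.
  have tA : ∀ j, (⟪f none, mulL (fun ξ => (g₁ ξ : ℂ)) (f' j (some j))⟫_ℂ).re
      = -(⟪f (some j), mulL (fun ξ => (g₁ ξ : ℂ)) (f' j none)⟫_ℂ).re := fun j => by
    have h1 := (hf j none).inner ((hf j (some j)).mulL hS.sym₁.isMult)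
    rw [h1, Complex.neg_re, ← inner_mulL_real hS.sym₁.isMult (f (some j)),
      ← inner_conj_symm, Complex.conj_re, inner_mulL_real hS.sym₁.isMult]
  -- The coupling terms, one from the elevation and one from the symmetrizer on the velocity, are
  -- kept together because only their sum is bounded.
  have expand : (⟪symP ε Q a₀ f, F⟫_ℂ).re = ε * (∑ j, (
      (⟪f none, mulL (fun ξ => (g₂ ξ : ℂ)) (convL (a j) (f' j none))⟫_ℂ).re
      + (⟪f none, mulL (fun ξ => (g₂ ξ : ℂ)) (c₁ j)⟫_ℂ).re
      + (⟪f none, mulL (fun ξ => (g₂ ξ : ℂ)) (c₂ j)⟫_ℂ).re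
      + ((⟪f none, mulL (fun ξ => (g₂ ξ : ℂ)) (convL a₀ (mulL (fun ξ => (Q ξ : ℂ))
        (f' j (some j))))⟫_ℂ).re
      + (⟪mulL (fun ξ => (Q ξ : ℂ)) (convL a₀ (mulL (fun ξ => (Q ξ : ℂ)) (f (some j)))),
          mulL (fun ξ => (g₁ ξ : ℂ)) (f' j none)⟫_ℂ).re))
      + ∑ k, ∑ j, (
      (⟪f (some k), mulL (fun ξ => (g₁ ξ : ℂ)) (convL (a j)
        (mulL (fun ξ => (Q ξ : ℂ)) (f' j (some k))))⟫_ℂ).re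
      + (⟪f (some k), mulL (fun ξ => (g₁ ξ : ℂ)) (c₃ j k)⟫_ℂ).re
      + ε * ((⟪mulL (fun ξ => (Q ξ : ℂ)) (convL a₀ (mulL (fun ξ => (Q ξ : ℂ))
      (f (some k)))), mulL (fun ξ => (g₁ ξ : ℂ)) (convL (a j)
      (mulL (fun ξ => (Q ξ : ℂ)) (f' j (some k))))⟫_ℂ).re
      + (⟪mulL (fun ξ => (Q ξ : ℂ)) (convL a₀ (mulL (fun ξ => (Q ξ : ℂ))
      (f (some k)))), mulL (fun ξ => (g₁ ξ : ℂ)) (c₃ j k)⟫_ℂ).re))) := by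
    rw [HH.inner_eq, hF0, Complex.add_re, Complex.re_sum]
    simp only [symP_none, symP_some, hFk, inner_sum, Complex.re_sum, inner_add_right,
      inner_add_left, Complex.add_re, re_inner_eps, re_inner_eps_left, map_add, tA,
      Finset.sum_add_distrib, Finset.mul_sum, mul_add, Finset.sum_neg_distrib]
    ring
  rw [expand, abs_mul, abs_of_nonneg hε0, ← hX]
  refine mul_le_mul_of_nonneg_left ?_ hε0
  have hX0 : 0 ≤ X := by rw [hX]; positivity
  have s1 : ∀ (v : Fin d → ℝ) (c : ℝ), (∀ j, |v j| ≤ c) → |∑ j, v j| ≤ d * c := fun v c h =>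
    (Finset.abs_sum_le_sum_abs _ _).trans ((Finset.sum_le_sum fun j _ => h j).trans_eq (by simp))
  -- Per j: 2 + 1 + 1 + 1 = 5. Per pair (j, k): 4 + 1 + (9 + 1) = 15. Finally 5d + 15d² ≤ 20(d +
  -- 1)².
  refine (abs_add_le _ _).trans ((add_le_add (s1 _ (5 * X) fun j => ?_) (s1 _ (d * (15 * X))
    fun k => s1 _ _ fun j => ?_)).trans ?_)
  · have h1 := abs_le.1 (tB j)
    have h2 := abs_le.1 (tb j)
    have h3 := abs_le.1 (td j)
    have h4 := abs_le.1 (tD j)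
    rw [abs_le]
    constructor <;> linarith [h1.1, h1.2, h2.1, h2.2, h3.1, h3.2, h4.1, h4.2]
  · have h1 := tE j k
    have h2 := te j k
    have h3 := (abs_add_le _ _).trans (add_le_add (tH j k) (th j k))
    refine (abs_add_le _ _).trans ((add_le_add (abs_add_le _ _) le_rfl).trans ?_)
    rw [abs_mul, abs_of_nonneg hε0]
    have := mul_le_mul hε1 h3 (abs_nonneg _) zero_le_one
    linarith
  · have : (0 : ℝ) ≤ d := by positivity
    nlinarith [mul_nonneg this hX0, mul_nonneg (mul_nonneg this this) hX0]

/-! ### Energy estimates for the quasilinear operator -/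

/-- The product with a weight is, up to a bounded term, the paraproduct with the derivative. -/
def CommLe (r : ℝ) (g₁ g₂ : Space d → ℝ) (ω : Space d → ℂ) (Φ : ℝ) (x y : L2 d) : Prop :=
  -- The identity is required only after applying g₁ or g₂: at the top level the truncated symbols
  -- vanish where ω differs from the intended weight.
  ∀ j, ∃ c : L2 d, ‖c‖ ≤ Φ ∧ ∀ g, g = g₁ ∨ g = g₂ →
    mulL (fun ξ => (g ξ : ℂ)) (mulL ω (Bil r (lowL x) (mulL (dm j) y)))
      = mulL (fun ξ => (g ξ : ℂ)) (convL (low (r + 1) x) (mulL ω (mulL (dm j) y)) + c)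

/-- The commutator hypotheses replace each weighted product by multiplication of the weighted
derivative by a fixed coefficient, plus a bounded term. What is left has exactly the shape required
by `abs_re_inner_symP_le`, with coefficients QU_j and ζ. -/
lemma abs_re_inner_symP_quadP_le (hS : IsSys κ g₁ g₂ Q) {r : ℝ} {U e f : HH d}
    (hU0 : IsCoef N (low (r + 1) (U none)))
    (hU : ∀ j, IsCoef N (low (r + 1) (mulL (fun ξ => (Q ξ : ℂ)) (U (some j)))))
    (hε0 : 0 ≤ ε) (hε1 : ε ≤ 1) {ω : Space d → ℂ} (hω : IsMult ω)
    (hf : ∀ j i, IsD j (f i) (mulL ω (mulL (dm j) (e i)))) {Φ : ℝ} (hΦ : 0 ≤ Φ)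
    (h₁ : ∀ j, CommLe r g₁ g₂ ω Φ (mulL (fun ξ => (Q ξ : ℂ)) (U (some j))) (e none))
    (h₂ : ∀ j, CommLe r g₁ g₂ ω Φ (U none) (mulL (fun ξ => (Q ξ : ℂ)) (e (some j))))
    (h₃ : ∀ j k, CommLe r g₁ g₂ ω Φ (mulL (fun ξ => (Q ξ : ℂ)) (U (some j)))
      (mulL (fun ξ => (Q ξ : ℂ)) (e (some k)))) :
    |(⟪symP ε Q (low (r + 1) (U none)) f, mulP ω (quadP g₁ g₂ Q r ε U e)⟫_ℂ).re|
      ≤ ε * (20 * (d + 1) ^ 2 * (κ * (1 + N) ^ 2 * ‖f‖ ^ 2 + κ * (1 + N) * Φ * ‖f‖)) := by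
  choose c₁ hc₁ e₁ using fun j => h₁ j j
  choose c₂ hc₂ e₂ using fun j => h₂ j j
  choose c₃ hc₃ e₃ using fun j k => h₃ j k j
  have hQ : ∀ j x, mulL (fun ξ => (Q ξ : ℂ)) (mulL ω (mulL (dm j) x))
      = mulL ω (mulL (dm j) (mulL (fun ξ => (Q ξ : ℂ)) x)) := fun j x => by
    rw [mulL_comm hS.isMult hω, mulL_comm hS.isMult (isMult_dm j)]
  refine abs_re_inner_symP_le hS hU0 hU hε0 hε1 hf hΦ hc₁ hc₂ hc₃ ?_ fun k => ?_
  · simp only [mulP_apply, quadP, linP, bilP, PiLp.add_apply, PiLp.smul_apply, map_add, map_smul,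
      map_sum]
    rw [Finset.smul_sum, ← Finset.sum_add_distrib]
    refine Finset.sum_congr rfl fun j _ => ?_
    rw [mulL_comm hω hS.sym₁.isMult, mulL_comm hω hS.sym₂.isMult, mulL_comm hω hS.sym₂.isMult,
      e₁ j g₂ (Or.inr rfl), e₂ j g₂ (Or.inr rfl), hQ, map_add, map_add]
  · simp only [mulP_apply, quadP, linP, bilP, PiLp.add_apply, PiLp.smul_apply, map_add, map_smul,
      map_sum]
    rw [mulL_comm hω hS.sym₁.isMult]
    congr 2
    refine Finset.sum_congr rfl fun j _ => ?_
    rw [mulL_comm hω hS.sym₁.isMult, e₃ j k g₁ (Or.inl rfl), hQ, map_add]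

end Energy

/-- Coefficients from states. -/
lemma exists_isCoef {r : ℝ} (hr : (d : ℝ) < 2 * r) : ∃ c, 0 ≤ c ∧ ∀ x : L2 d, Herm x →
    IsCoef (c * ‖x‖) (low (r + 1) x) := by
  obtain ⟨c, hc, h⟩ := exists_integral_low_le hr
  have hr0 : 0 ≤ r := by have : (0 : ℝ) ≤ d := by positivity
                         linarith
  refine ⟨c, hc, fun x hx => ?_⟩
  have e : ∀ ξ, bk ξ * ‖low (r + 1) x ξ‖ = ‖low r x ξ‖ := fun ξ => by
    rw [low, low, norm_mul, norm_mul, Complex.norm_real, Complex.norm_real,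
      Real.norm_of_nonneg (wt_pos _ _).le, Real.norm_of_nonneg (wt_pos _ _).le, ← mul_assoc,
      ← wt_one, ← wt_add]
    ring_nf
  refine ⟨(memLp_low (by linarith) (Lp.memLp x)).1, ?_, ?_, ?_⟩
  · simp_rw [e]
    exact (h x).1.norm
  · filter_upwards [hx] with ξ hξ
    simp only [low, wt_neg_arg, hξ, map_mul, Complex.conj_ofReal]
  · simp_rw [e]
    exact (h x).2

lemma Herm.mulL {m : Space d → ℂ} (hm : IsMult m) (h : ∀ ξ, m (-ξ) = (starRingEnd ℂ) (m ξ))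
    {x : L2 d} (hx : Herm x) : Herm (WhithamBoussinesq.mulL m x) := by
  have h1 := coeFn_mulL hm x
  have h2 := (Measure.measurePreserving_neg (volume : Measure (Space d))).quasiMeasurePreserving.ae h1
  filter_upwards [hx, h1, h2] with ξ e1 e2 e3
  rw [e2, e3, e1, h, map_mul]

/-! ### Commutators of weights with products, and energy estimates for the operator. -/

section Weights

variable {r : ℝ}

lemma norm_wt_mul (r : ℝ) (ξ : Space d) (z : ℂ) : ‖(wt r ξ : ℂ) * z‖ = wt r ξ * ‖z‖ := by
  rw [norm_mul, Complex.norm_real, Real.norm_of_nonneg (wt_pos _ _).le]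

lemma wt_mul_norm_low (r : ℝ) (x : Space d → ℂ) (ξ : Space d) :
    wt r ξ * ‖low r x ξ‖ = ‖x ξ‖ := by
  rw [low, norm_wt_mul, ← mul_assoc, wt_mul_neg, one_mul]

lemma low_lowL (r : ℝ) (x : L2 d) : low r (lowL x) =ᵐ[volume] low (r + 1) x := by
  filter_upwards [coeFn_mulL isMult_wt_neg_one x] with ξ e
  rw [low, low, lowL, e, ← mul_assoc, ← Complex.ofReal_mul, ← wt_add]
  ring_nf

lemma coeFn_Bil_lowL (hr : (d : ℝ) < 2 * r) (x y : L2 d) : Bil r (lowL x) y =ᵐ[volume]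
    fun ξ => (wt r ξ : ℂ) * cv (low (r + 1) x) (low r y) ξ := by
  filter_upwards [coeFn_Bil hr (lowL x) y] with ξ e
  rw [e, cv_congr (low_lowL r x) (ae_eq_refl _)]

/-- The commutator estimate one level below the top. -/
lemma exists_commLe_low (hr : (d : ℝ) < 2 * r) : ∃ C, 0 ≤ C ∧ ∀ (g₁ g₂ : Space d → ℝ) (x y : L2 d)
    (N : ℝ), IsCoef N (low (r + 1) x) →
    CommLe r g₁ g₂ (fun _ => 1) (C * ((N + ‖x‖) * ‖lowL y‖)) x y := by
  have hr0 : 0 ≤ r := by have : (0 : ℝ) ≤ d := by positivity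
                         linarith
  obtain ⟨C, hC, hw⟩ := exists_wt_comm_le (d := d) hr0
  obtain ⟨c₀, hc₀, hlow⟩ := exists_integral_low_le hr
  refine ⟨C * (1 + c₀), by positivity, fun g₁ g₂ x y N hx j => ?_⟩
  -- In the second summand all r + 1 derivatives fall on the coefficient x, which is available at
  -- the top level; y is needed only through `lowL y`, so nothing is lost for differences.
  obtain ⟨c, hc, hcn⟩ := exists_weight_comm (W := wt r) (V₁ := wt (r + 1)) (V₂ := fun _ => 1)
    (continuous_wt r).measurable (fun _ => zero_le_one) hC (fun ξ η => by simpa using hw ξ η)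
    hx.aesm hx.int (g := low r (mulL (dm j) y)) (h := low r (lowL y)) (x₁ := lowL y) (x₂ := x)
    (z := mulL (dm j) y)
    (by
      filter_upwards [coeFn_mulL (isMult_dm j) y, coeFn_mulL isMult_wt_neg_one y] with ξ e1 e2
      rw [low, low, norm_wt_mul, norm_wt_mul, e1, lowL, e2, dm, mul_assoc, norm_mul]
      have := norm_dl_le j ξ
      have := wt_pos (-r) ξ
      calc _ ≤ wt (-r) ξ * (bk ξ * ‖(wt (-1) ξ : ℂ) * y ξ‖) := by gcongr
        _ = _ := by ring)
    (memLp_low hr0 (Lp.memLp _)) (by simpa using (hlow (lowL y)).1.norm)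
    (.of_forall fun ξ => (wt_mul_norm_low r _ ξ).symm)
    (.of_forall fun ξ => (wt_mul_norm_low (r + 1) _ ξ).symm)
    (.of_forall fun ξ => by
      simp only [low]
      rw [← mul_assoc, ← Complex.ofReal_mul, wt_mul_neg, Complex.ofReal_one, one_mul])
  refine ⟨c, hcn.trans ?_, fun g _ => ?_⟩
  · have h1 := hx.le
    have h2 := (hlow (lowL y)).2
    simp only [one_mul]
    have h3 := norm_nonneg (lowL y)
    have h4 := norm_nonneg x
    have h5 := hx.nonneg
    calc _ ≤ C * (N * ‖lowL y‖ + c₀ * ‖lowL y‖ * ‖x‖) := by gcongr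
      _ ≤ C * (N * ‖lowL y‖ + c₀ * ‖lowL y‖ * ‖x‖) + C * (‖x‖ * ‖lowL y‖ + c₀ * (N * ‖lowL y‖)) :=
        le_add_of_nonneg_right (by positivity)
      _ = _ := by ring
  · rw [mulL_one, mulL_one]
    congr 1
    refine Lp.ext ?_
    filter_upwards [hc, coeFn_Bil_lowL hr x (mulL (dm j) y)] with ξ e1 e2
    rw [e2, e1]

/-- The commutator estimate at the top level. -/
lemma exists_commLe_cut (hr : (d : ℝ) < 2 * r) : ∃ C, 0 ≤ C ∧ ∀ (g₁ g₂ : Space d → ℝ) (n : ℝ),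
    (∀ ξ, n < ‖ξ‖ → g₁ ξ = 0) → (∀ ξ, n < ‖ξ‖ → g₂ ξ = 0) →
    (IsMult fun ξ => (g₁ ξ : ℂ)) → (IsMult fun ξ => (g₂ ξ : ℂ)) →
    ∀ m : Space d → ℝ, IsCut m → ∀ ω : Space d → ℂ, IsMult ω →
    (∀ ξ, ‖ξ‖ ≤ n → ω ξ = ((m ξ * bk ξ : ℝ) : ℂ)) →
    ∀ (x y : L2 d) (N : ℝ), IsCoef N (low (r + 1) x) → (∀ᵐ ξ, n < ‖ξ‖ → y ξ = 0) →
    CommLe r g₁ g₂ ω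
      (C * (N * ‖mulL (fun ξ => (m ξ : ℂ)) y‖ + ‖mulL (fun ξ => (m ξ : ℂ)) x‖ * ‖y‖)) x y := by
  have hr0 : 0 ≤ r := by have : (0 : ℝ) ≤ d := by positivity
                         linarith
  obtain ⟨C, hC, hw⟩ := exists_cut_comm_le (d := d) (r := r + 1) (by linarith)
  obtain ⟨c₀, hc₀, hlow⟩ := exists_integral_low_le hr
  refine ⟨C * (1 + c₀), by positivity, fun g₁ g₂ n hg₁ hg₂ hm₁ hm₂ m hm ω hω hωm x y N hx hy j => ?_⟩
  have hlow1 : ∀ ξ, bk ξ * ‖low (r + 1) y ξ‖ = ‖low r y ξ‖ := fun ξ => by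
    rw [low, low, norm_wt_mul, norm_wt_mul, ← mul_assoc, ← wt_one, ← wt_add]
    ring_nf
  have hmn : ∀ x : L2 d, ∀ᵐ ξ, ‖mulL (fun ξ => (m ξ : ℂ)) x ξ‖
      = m ξ * wt (r + 1) ξ * ‖low (r + 1) x ξ‖ := fun x => by
    filter_upwards [coeFn_mulL hm.isMult x] with ξ e
    rw [e, norm_mul, Complex.norm_real, Real.norm_of_nonneg (hm.nonneg ξ), mul_assoc,
      wt_mul_norm_low]
  -- Here the weight has the full order r + 1. The derivative stays on y in both summands: in the
  -- second as V₂ = ⟨ξ⟩, where it is absorbed by the embedding, and the localized weight falls on x.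
  obtain ⟨c, hc, hcn⟩ := exists_weight_comm (W := fun ξ => m ξ * wt (r + 1) ξ)
    (V₁ := fun ξ => m ξ * wt (r + 1) ξ) (V₂ := bk)
    (hm.measurable.mul (continuous_wt (r + 1)).measurable) (fun ξ => (bk_pos ξ).le) hC
    (fun ξ η => hw m hm ξ η)
    hx.aesm hx.int (g := low r (mulL (dm j) y)) (h := low (r + 1) y)
    (x₁ := mulL (fun ξ => (m ξ : ℂ)) y) (x₂ := mulL (fun ξ => (m ξ : ℂ)) x)
    (z := mulL ω (mulL (dm j) y))
    (by
      filter_upwards [coeFn_mulL (isMult_dm j) y] with ξ e1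
      rw [hlow1, low, low, norm_wt_mul, norm_wt_mul, e1, norm_mul]
      have := norm_dm_le j ξ
      have := wt_pos (-r) ξ
      calc _ ≤ wt (-r) ξ * (1 * ‖y ξ‖) := by gcongr
        _ = _ := by ring)
    (memLp_low hr0 (Lp.memLp _)) (by simp_rw [hlow1]; exact (hlow y).1.norm) (hmn y) (hmn x)
    (by
      filter_upwards [coeFn_mulL hω (mulL (dm j) y), coeFn_mulL (isMult_dm j) y, hy] with ξ e1 e2 e3
      rw [e1, low, e2]
      rcases le_or_gt ‖ξ‖ n with h | h
      · rw [hωm ξ h]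
        have : m ξ * bk ξ = m ξ * wt (r + 1) ξ * wt (-r) ξ := by
          rw [mul_assoc, ← wt_add, ← wt_one]
          ring_nf
        rw [this, Complex.ofReal_mul _ (wt (-r) ξ)]
        ring
      · rw [e3 h]
        simp)
  refine ⟨c, hcn.trans ?_, fun g hg => ?_⟩
  · have h1 := hx.le
    have h2 := (hlow y).2
    simp_rw [hlow1]
    have h5 := hx.nonneg
    set A := ‖mulL (fun ξ => (m ξ : ℂ)) y‖
    set B := ‖mulL (fun ξ => (m ξ : ℂ)) x‖
    have hA : 0 ≤ A := norm_nonneg _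
    have hB : 0 ≤ B := norm_nonneg _
    calc _ ≤ C * (N * A + c₀ * ‖y‖ * B) := by gcongr
      _ ≤ C * (N * A + c₀ * ‖y‖ * B) + C * (B * ‖y‖ + c₀ * (N * A)) :=
        le_add_of_nonneg_right (by positivity)
      _ = _ := by ring
  · have hgm : IsMult fun ξ => (g ξ : ℂ) := by rcases hg with rfl | rfl <;> assumption
    have hgs : ∀ ξ, n < ‖ξ‖ → g ξ = 0 := by rcases hg with rfl | rfl <;> assumption
    refine Lp.ext ?_
    filter_upwards [hc, coeFn_Bil_lowL hr x (mulL (dm j) y),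
      coeFn_mulL hgm (mulL ω (Bil r (lowL x) (mulL (dm j) y))),
      coeFn_mulL hω (Bil r (lowL x) (mulL (dm j) y)),
      coeFn_mulL hgm (convL (low (r + 1) x) (mulL ω (mulL (dm j) y)) + c)] with ξ e1 e2 e3 e4 e5
    rw [e3, e4, e5, e2, ← e1]
    rcases le_or_gt ‖ξ‖ n with h | h
    · rw [hωm ξ h]
      have : m ξ * wt (r + 1) ξ = m ξ * bk ξ * wt r ξ := by
        rw [mul_assoc, ← wt_one, ← wt_add]
        ring_nf
      rw [this, Complex.ofReal_mul _ (wt r ξ)]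
      ring
    -- Beyond radius n nothing is claimed about ω, but both sides vanish with g.
    · rw [hgs ξ h]
      simp

lemma CommLe.mono {g₁ g₂ : Space d → ℝ} {ω : Space d → ℂ} {Φ Φ' : ℝ} {x y : L2 d}
    (h : CommLe r g₁ g₂ ω Φ x y) (hΦ : Φ ≤ Φ') : CommLe r g₁ g₂ ω Φ' x y := fun j =>
  let ⟨c, hc, e⟩ := h j
  ⟨c, hc.trans hΦ, e⟩

lemma IsCoef.mono {N N' : ℝ} {a : Space d → ℂ} (h : IsCoef N a) (hN : N ≤ N') : IsCoef N' a :=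
  ⟨h.aesm, h.int, h.herm, h.le.trans hN⟩

/-- States whose components are Fourier transforms of real functions. -/
def HermP (U : HH d) : Prop := ∀ i, Herm (U i)

lemma IsSys.herm_Q {κ : ℝ} {g₁ g₂ Q : Space d → ℝ} (hS : IsSys κ g₁ g₂ Q) {x : L2 d}
    (hx : Herm x) : Herm (mulL (fun ξ => (Q ξ : ℂ)) x) :=
  hx.mulL hS.isMult fun ξ => by rw [hS.even, Complex.conj_ofReal]

/-- No extra weight is needed: the operator maps regularity s to s - 1, where its output is already
paired with `lowP e`. The bound is quadratic in this lower norm of e, as a Gronwall argument for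
differences requires. -/
lemma exists_energy_low (hr : (d : ℝ) < 2 * r) : ∃ D, 0 ≤ D ∧ ∀ (κ : ℝ) (g₁ g₂ Q : Space d → ℝ),
    IsSys κ g₁ g₂ Q → ∀ ε : ℝ, 0 ≤ ε → ε ≤ 1 → ∀ U e : HH d, HermP U →
    |(⟪symP ε Q (low (r + 1) (U none)) (lowP e), quadP g₁ g₂ Q r ε U e⟫_ℂ).re|
      ≤ ε * (D * (κ * (1 + ‖U‖) ^ 2 * ‖lowP e‖ ^ 2)) := by
  obtain ⟨c, hc, hcoef⟩ := exists_isCoef (d := d) hr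
  obtain ⟨C, hC, hcomm⟩ := exists_commLe_low (d := d) hr
  refine ⟨20 * (d + 1) ^ 2 * ((1 + c) ^ 2 + (1 + c) * (C * (c + 1))), by positivity,
    fun κ g₁ g₂ Q hS ε hε0 hε1 U e hU => ?_⟩
  have hκ := hS.sym₁.nonneg
  have hn := HH.norm_apply_le U
  have hN0 := (hcoef (U none) (hU none)).mono (mul_le_mul_of_nonneg_left (hn none) hc)
  have hNj : ∀ j, IsCoef (c * ‖U‖) (low (r + 1) (mulL (fun ξ => (Q ξ : ℂ)) (U (some j)))) :=
    fun j => (hcoef _ (hS.herm_Q (hU (some j)))).mono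
      (mul_le_mul_of_nonneg_left ((hS.norm_Q_le _).trans (hn _)) hc)
  have he : ∀ i, ‖lowL (e i)‖ ≤ ‖lowP e‖ := fun i => HH.norm_apply_le (lowP e) i
  have he' : ∀ i, ‖lowL (mulL (fun ξ => (Q ξ : ℂ)) (e i))‖ ≤ ‖lowP e‖ := fun i => by
    rw [lowL, mulL_comm isMult_wt_neg_one hS.isMult]
    exact (hS.norm_Q_le _).trans (he i)
  have hΦ : ∀ {x y : L2 d}, ‖x‖ ≤ ‖U‖ → ‖lowL y‖ ≤ ‖lowP e‖ →
      C * ((c * ‖U‖ + ‖x‖) * ‖lowL y‖) ≤ C * (c + 1) * (‖U‖ * ‖lowP e‖) := by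
    intro x y h1 h2
    calc _ ≤ C * ((c * ‖U‖ + ‖U‖) * ‖lowP e‖) := by gcongr
      _ = _ := by ring
  have main := abs_re_inner_symP_quadP_le hS (U := U) (e := e) (f := lowP e) hN0 hNj hε0 hε1
    (ω := fun _ => 1) ⟨measurable_const, 1, fun _ => by simp⟩ (Φ := C * (c + 1) * (‖U‖ * ‖lowP e‖))
    (fun j i => by
      rw [mulL_one]
      unfold IsD
      filter_upwards [coeFn_mulL (isMult_dm j) (e i), coeFn_mulL isMult_wt_neg_one (e i)] with ξ h1 h2
      rw [lowP_apply, lowL, h1, h2, dm, mul_assoc]) (by positivity)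
    (fun j => (hcomm g₁ g₂ _ _ _ (hNj j)).mono (hΦ ((hS.norm_Q_le _).trans (hn _)) (he _)))
    (fun j => (hcomm g₁ g₂ _ _ _ hN0).mono (hΦ (hn _) (he' _)))
    (fun j k => (hcomm g₁ g₂ _ _ _ (hNj j)).mono (hΦ ((hS.norm_Q_le _).trans (hn _)) (he' _)))
  rw [mulP_one] at main
  refine main.trans (mul_le_mul_of_nonneg_left ?_ hε0)
  have h1 : 1 + c * ‖U‖ ≤ (1 + c) * (1 + ‖U‖) := by nlinarith [norm_nonneg U]
  have h2 : ‖U‖ ≤ 1 + ‖U‖ := by linarith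
  set f := ‖lowP e‖
  have hf : 0 ≤ f := norm_nonneg _
  calc _ ≤ 20 * (d + 1) ^ 2 * (κ * ((1 + c) * (1 + ‖U‖)) ^ 2 * f ^ 2
        + κ * ((1 + c) * (1 + ‖U‖)) * (C * (c + 1) * ((1 + ‖U‖) * f)) * f) := by gcongr
    _ = _ := by ring

/-- The bound is quadratic in the localized norm and its coefficient involves only the full norm of
U, so high-frequency tails satisfy a closed inequality. Restriction to frequencies at most n makes
the growing weight ω a bounded multiplier; the constant does not see n. -/
lemma exists_energy_cut (hr : (d : ℝ) < 2 * r) : ∃ D, 0 ≤ D ∧ ∀ (κ : ℝ) (g₁ g₂ Q : Space d → ℝ),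
    IsSys κ g₁ g₂ Q → ∀ ε : ℝ, 0 ≤ ε → ε ≤ 1 → ∀ n : ℝ,
    (∀ ξ, n < ‖ξ‖ → g₁ ξ = 0) → (∀ ξ, n < ‖ξ‖ → g₂ ξ = 0) →
    ∀ m : Space d → ℝ, IsCut m → ∀ ω : Space d → ℂ, IsMult ω →
    (∀ ξ, ‖ξ‖ ≤ n → ω ξ = ((m ξ * bk ξ : ℝ) : ℂ)) →
    ∀ U : HH d, HermP U → (∀ i, ∀ᵐ ξ, n < ‖ξ‖ → U i ξ = 0) →
    |(⟪symP ε Q (low (r + 1) (U none)) (mulP (fun ξ => (m ξ : ℂ)) U),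
        mulP ω (quadP g₁ g₂ Q r ε U U)⟫_ℂ).re|
      ≤ ε * (D * (κ * (1 + ‖U‖) ^ 2 * ‖mulP (fun ξ => (m ξ : ℂ)) U‖ ^ 2)) := by
  obtain ⟨c, hc, hcoef⟩ := exists_isCoef (d := d) hr
  obtain ⟨C, hC, hcomm⟩ := exists_commLe_cut (d := d) hr
  refine ⟨20 * (d + 1) ^ 2 * ((1 + c) ^ 2 + (1 + c) * (C * (c + 1))), by positivity,
    fun κ g₁ g₂ Q hS ε hε0 hε1 n hg₁ hg₂ m hm ω hω hωm U hU hUn => ?_⟩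
  have hκ := hS.sym₁.nonneg
  have hn := HH.norm_apply_le U
  have hnQ : ∀ i, ‖mulL (fun ξ => (Q ξ : ℂ)) (U i)‖ ≤ ‖U‖ := fun i => (hS.norm_Q_le _).trans (hn _)
  have hN0 := (hcoef (U none) (hU none)).mono (mul_le_mul_of_nonneg_left (hn none) hc)
  have hNj : ∀ j, IsCoef (c * ‖U‖) (low (r + 1) (mulL (fun ξ => (Q ξ : ℂ)) (U (some j)))) :=
    fun j => (hcoef _ (hS.herm_Q (hU (some j)))).mono (mul_le_mul_of_nonneg_left (hnQ _) hc)
  set f := mulP (fun ξ => (m ξ : ℂ)) U with hf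
  have he : ∀ i, ‖mulL (fun ξ => (m ξ : ℂ)) (U i)‖ ≤ ‖f‖ := fun i => HH.norm_apply_le f i
  have he' : ∀ i, ‖mulL (fun ξ => (m ξ : ℂ)) (mulL (fun ξ => (Q ξ : ℂ)) (U i))‖ ≤ ‖f‖ := fun i => by
    rw [mulL_comm hm.isMult hS.isMult]
    exact (hS.norm_Q_le _).trans (he i)
  have hUn' : ∀ i, ∀ᵐ ξ, n < ‖ξ‖ → mulL (fun ξ => (Q ξ : ℂ)) (U i) ξ = 0 := fun i => by
    filter_upwards [hUn i, coeFn_mulL hS.isMult (U i)] with ξ h1 h2 h3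
    rw [h2, h1 h3, mul_zero]
  have hΦ : ∀ {x y : L2 d}, ‖mulL (fun ξ => (m ξ : ℂ)) x‖ ≤ ‖f‖ →
      ‖mulL (fun ξ => (m ξ : ℂ)) y‖ ≤ ‖f‖ → ‖y‖ ≤ ‖U‖ →
      C * (c * ‖U‖ * ‖mulL (fun ξ => (m ξ : ℂ)) y‖ + ‖mulL (fun ξ => (m ξ : ℂ)) x‖ * ‖y‖)
        ≤ C * (c + 1) * (‖U‖ * ‖f‖) := by
    intro x y h1 h2 h3
    calc _ ≤ C * (c * ‖U‖ * ‖f‖ + ‖f‖ * ‖U‖) := by gcongr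
      _ = _ := by ring
  have hc' : ∀ {x y : L2 d} {N : ℝ}, IsCoef N (low (r + 1) x) → (∀ᵐ ξ, n < ‖ξ‖ → y ξ = 0) →
      CommLe r g₁ g₂ ω (C * (N * ‖mulL (fun ξ => (m ξ : ℂ)) y‖
        + ‖mulL (fun ξ => (m ξ : ℂ)) x‖ * ‖y‖)) x y := fun hx hy =>
    hcomm g₁ g₂ n hg₁ hg₂ hS.sym₁.isMult hS.sym₂.isMult m hm ω hω hωm _ _ _ hx hy
  have main := abs_re_inner_symP_quadP_le hS (U := U) (e := U) (f := f) hN0 hNj hε0 hε1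
    hω (Φ := C * (c + 1) * (‖U‖ * ‖f‖))
    (fun j i => by
      unfold IsD
      filter_upwards [coeFn_mulL (isMult_dm j) (U i), coeFn_mulL hω (mulL (dm j) (U i)),
        coeFn_mulL hm.isMult (U i), hUn i] with ξ h1 h2 h3 h4
      rw [hf, mulP_apply, h2, h1, h3]
      rcases le_or_gt ‖ξ‖ n with h | h
      · rw [hωm ξ h, dm, ← wt_one, Complex.ofReal_mul]
        have : (wt 1 ξ : ℂ) * (wt (-1) ξ : ℂ) = 1 := by
          rw [← Complex.ofReal_mul, wt_mul_neg, Complex.ofReal_one]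
        linear_combination ((m ξ : ℂ) * dl j ξ * U i ξ) * this
      · rw [h4 h]; simp) (by positivity)
    (fun j => (hc' (hNj j) (hUn _)).mono (hΦ (he' _) (he _) (hn _)))
    (fun j => (hc' hN0 (hUn' _)).mono (hΦ (he _) (he' _) (hnQ _)))
    (fun j k => (hc' (hNj j) (hUn' _)).mono (hΦ (he' _) (he' _) (hnQ _)))
  refine main.trans (mul_le_mul_of_nonneg_left ?_ hε0)
  have h1 : 1 + c * ‖U‖ ≤ (1 + c) * (1 + ‖U‖) := by nlinarith [norm_nonneg U]
  have h2 : ‖U‖ ≤ 1 + ‖U‖ := by linarith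
  have hf0 : 0 ≤ ‖f‖ := norm_nonneg _
  calc _ ≤ 20 * (d + 1) ^ 2 * (κ * ((1 + c) * (1 + ‖U‖)) ^ 2 * ‖f‖ ^ 2
        + κ * ((1 + c) * (1 + ‖U‖)) * (C * (c + 1) * ((1 + ‖U‖) * ‖f‖)) * ‖f‖) := by gcongr
    _ = _ := by ring

end Weights

/-! ### Gronwall's lemma for symmetrizable systems -/

section Gronwall

variable {H : Type*} [NormedAddCommGroup H]

/-- `g` is the right derivative of `f` at `t`, up to an error of size `ρ`. -/
def NearDeriv [Module ℂ H] (f : ℝ → H) (t : ℝ) (g : H) (ρ : ℝ) : Prop :=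
  ∀ η > 0, ∀ᶠ z in 𝓝[>] t, ‖f z - f t - ((z - t : ℝ) : ℂ) • g‖ ≤ (ρ + η) * (z - t)

/-- A form without division by K, from e^y - 1 ≤ y e^y, that also covers K = 0. -/
lemma gronwallBound_le {δ K e x : ℝ} (hK : 0 ≤ K) (he : 0 ≤ e) :
    gronwallBound δ K e x ≤ (δ + e * x) * exp (K * x) := by
  rcases hK.eq_or_lt with rfl | hK
  · simp [gronwallBound_K0]
  · rw [gronwallBound_of_K_ne_0 hK.ne']
    have h1 : 1 - K * x ≤ exp (-(K * x)) := by linarith [add_one_le_exp (-(K * x))]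
    have h2 : exp (K * x) - 1 ≤ K * x * exp (K * x) := by
      have := mul_le_mul_of_nonneg_right h1 (exp_pos (K * x)).le
      rw [← Real.exp_add, neg_add_cancel, Real.exp_zero] at this
      linarith
    have h3 : e / K * (exp (K * x) - 1) ≤ e * x * exp (K * x) := by
      calc _ ≤ e / K * (K * x * exp (K * x)) := by gcongr
        _ = _ := by field_simp
    simp only
    linarith

variable [InnerProductSpace ℂ H]

lemma re_inner_le_mul (x y : H) : (⟪x, y⟫_ℂ).re ≤ ‖x‖ * ‖y‖ :=
  (Complex.re_le_norm _).trans (norm_inner_le_norm x y)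

set_option maxHeartbeats 1000000 in
/-- Energy estimate for a near-solution of `f' = G` with symmetrizer `S`. -/
theorem norm_le_of_energy {f G : ℝ → H} {S : ℝ → H →L[ℂ] H} {τ h B B₀ β γ ρ σ : ℝ} (hh : 0 < h)
    (hB0 : 0 ≤ B) (hB₀0 : 0 ≤ B₀) (hβ0 : 0 ≤ β) (hγ0 : 0 ≤ γ) (hρ0 : 0 ≤ ρ) (hσ0 : 0 ≤ σ)
    (hf : ContinuousOn f (Icc 0 τ)) (hG : ∀ t ∈ Ico 0 τ, NearDeriv f t (G t) ρ)
    (hS : ∀ t ∈ Icc 0 τ, ∀ x, h * ‖x‖ ^ 2 ≤ (⟪x, S t x⟫_ℂ).re)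
    (symm : ∀ t ∈ Icc 0 τ, ∀ x y, ⟪S t x, y⟫_ℂ = ⟪x, S t y⟫_ℂ)
    (hB : ∀ t ∈ Icc 0 τ, ∀ x, ‖S t x‖ ≤ B * ‖x‖) (hB₀ : ∀ x, ‖S 0 x‖ ≤ B₀ * ‖x‖)
    (hβ : ∀ t ∈ Icc 0 τ, ∀ z ∈ Icc 0 τ, ∀ x, ‖S z x - S t x‖ ≤ β * |z - t| * ‖x‖)
    (hγ : ∀ t ∈ Ico 0 τ, (⟪S t (f t), G t⟫_ℂ).re ≤ γ * ‖f t‖ ^ 2 + σ * ‖f t‖) :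
    ∀ t ∈ Icc 0 τ, h * ‖f t‖ ≤ exp ((β + 2 * γ) / h * τ) * (B₀ * ‖f 0‖ + 2 * τ * (σ + ρ * B)) := by
  intro t₀ ht₀
  have hτ : 0 ≤ τ := ht₀.1.trans ht₀.2
  have h0 : (0 : ℝ) ∈ Icc 0 τ := left_mem_Icc.2 hτ
  have hSf : ContinuousOn (fun t => S t (f t)) (Icc 0 τ) := by
    intro t ht
    rw [ContinuousWithinAt, tendsto_iff_norm_sub_tendsto_zero]
    have hft := hf t ht
    have l1 : Tendsto (fun z => B * ‖f z - f t‖ + β * |z - t| * ‖f t‖) (𝓝[Icc 0 τ] t) (𝓝 0) := by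
      have a1 := (tendsto_iff_norm_sub_tendsto_zero.1 hft).const_mul B
      have a2 : Tendsto (fun z : ℝ => β * |z - t| * ‖f t‖) (𝓝[Icc 0 τ] t) (𝓝 (β * |t - t| * ‖f t‖)) :=
        (Continuous.tendsto (by fun_prop) t).mono_left nhdsWithin_le_nhds
      simpa using a1.add a2
    refine squeeze_zero' (.of_forall fun _ => norm_nonneg _) ?_ l1
    filter_upwards [self_mem_nhdsWithin] with z hz
    have e : S z (f z) - S t (f t) = S z (f z - f t) + (S z (f t) - S t (f t)) := by
      rw [map_sub]; abel
    rw [e]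
    exact (norm_add_le _ _).trans (add_le_add (hB z hz _) (hβ t ht z hz _))
  set E : ℝ → ℝ := fun t => (⟪f t, S t (f t)⟫_ℂ).re with hE
  have hEc : ContinuousOn E (Icc 0 τ) :=
    Complex.continuous_re.comp_continuousOn (hf.inner hSf)
  -- Gronwall is run up to a time s where ‖f‖ is maximal. The forcing, linear in ‖f‖, is bounded by
  -- a constant times this maximum m, and one factor m is divided out at the end.
  obtain ⟨s, hs, hmax⟩ := isCompact_Icc.exists_isMaxOn ⟨0, h0⟩ hf.norm
  set m := ‖f s‖ with hm
  have hm0 : 0 ≤ m := norm_nonneg _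
  have hle : ∀ t ∈ Icc 0 τ, ‖f t‖ ≤ m := fun t ht => hmax ht
  set K := (β + 2 * γ) / h with hK
  have hK0 : 0 ≤ K := by positivity
  set e := 2 * (σ + ρ * B) * m with he
  have he0 : 0 ≤ e := by positivity
  have key := le_gronwallBound_of_liminf_deriv_right_le (f := E) (δ := B₀ * ‖f 0‖ ^ 2) (K := K) (ε := e)
    (f' := fun t => (β + 2 * γ) * ‖f t‖ ^ 2 + 2 * (σ + ρ * B) * ‖f t‖) hEc
    (by
      intro t ht r hr
      have ht' := Ico_subset_Icc_self ht
      have hB1 : 0 ≤ B * ‖f t‖ := by positivity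
      set D₀ := r - ((β + 2 * γ) * ‖f t‖ ^ 2 + 2 * (σ + ρ * B) * ‖f t‖) with hD₀
      have hD₀0 : 0 < D₀ := sub_pos.2 hr
      -- Small enough for the contribution 2B‖f‖η to fit in the slack D₀; the summand 1 covers f(t)
      -- = 0.
      set η := D₀ / (2 * (B * ‖f t‖) + 1) with hη
      have hη0 : 0 < η := by positivity
      have hηlt : 2 * (B * ‖f t‖) * η < D₀ := by
        rw [hη, ← mul_div_assoc, div_lt_iff₀ (by positivity)]
        linarith
      have hmem : Icc 0 τ ∈ 𝓝[>] t :=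
        mem_of_superset (Ioc_mem_nhdsGT ht.2) fun z hz => ⟨ht.1.trans hz.1.le, hz.2⟩
      have hfc : Tendsto f (𝓝[>] t) (𝓝 (f t)) :=
        ((hf t ht').mono_of_mem_nhdsWithin hmem)
      have hid : Tendsto (fun z : ℝ => z - t) (𝓝[>] t) (𝓝 0) := by
        have : Tendsto (fun z : ℝ => z - t) (𝓝 t) (𝓝 (t - t)) := Continuous.tendsto (by fun_prop) t
        rw [sub_self] at this
        exact this.mono_left nhdsWithin_le_nhds
      have hlim : Tendsto (fun z => β * ‖f z‖ ^ 2 + 2 * (γ * ‖f t‖ ^ 2 + σ * ‖f t‖)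
          + 2 * (B * ‖f t‖) * (ρ + η) + B * (‖G t‖ + ρ + η) ^ 2 * (z - t)) (𝓝[>] t)
          (𝓝 (β * ‖f t‖ ^ 2 + 2 * (γ * ‖f t‖ ^ 2 + σ * ‖f t‖)
          + 2 * (B * ‖f t‖) * (ρ + η) + B * (‖G t‖ + ρ + η) ^ 2 * 0)) :=
        (((((hfc.norm).pow 2).const_mul β).add_const _).add_const _).add (hid.const_mul _)
      refine Eventually.frequently ?_
      filter_upwards [hmem, hG t ht η hη0, self_mem_nhdsWithin,
        hlim.eventually_lt_const (u := r) (by rw [hD₀] at hηlt; linarith)] with z hz hGz hzt hlt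
      have hzt' : 0 < z - t := sub_pos.2 hzt
      rw [inv_mul_lt_iff₀ hzt']
      refine lt_of_le_of_lt ?_ (mul_lt_mul_of_pos_left hlt hzt')
      obtain ⟨Δ, hΔ⟩ : ∃ Δ, Δ = f z - f t - ((z - t : ℝ) : ℂ) • G t := ⟨_, rfl⟩
      obtain ⟨D, hD⟩ : ∃ D, D = f z - f t := ⟨_, rfl⟩
      rw [← hΔ] at hGz
      have hDΔ : D = ((z - t : ℝ) : ℂ) • G t + Δ := by rw [hΔ, hD]; abel
      have hfz : f z = f t + D := by rw [hD]; abel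
      have hDn : ‖D‖ ≤ (‖G t‖ + ρ + η) * (z - t) := by
        rw [hDΔ]
        refine (norm_add_le _ _).trans ?_
        rw [norm_smul, Complex.norm_real, Real.norm_of_nonneg hzt'.le]
        linarith
      -- The symmetry of S(t) gives this expansion of the increment: the variation of S costs β, the
      -- cross term is the energy production, and the quadratic term is of order (z - t)².
      have x1 : E z - E t = (⟪f z, S z (f z) - S t (f z)⟫_ℂ).re
          + (2 * (⟪S t (f t), D⟫_ℂ).re + (⟪D, S t D⟫_ℂ).re) := by
        have s1 : (⟪D, S t (f t)⟫_ℂ).re = (⟪S t (f t), D⟫_ℂ).re := by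
          rw [← inner_conj_symm, Complex.conj_re]
        have s2 : ⟪f t, S t D⟫_ℂ = ⟪S t (f t), D⟫_ℂ := (symm t ht' _ _).symm
        have s3 : (⟪f z, S t (f z)⟫_ℂ).re = E t + (2 * (⟪S t (f t), D⟫_ℂ).re + (⟪D, S t D⟫_ℂ).re) := by
          rw [hE, hfz]
          simp only [map_add, inner_add_left, inner_add_right, Complex.add_re, s1, s2]
          ring
        rw [inner_sub_right, Complex.sub_re, s3]
        simp only [hE]
        ring
      have x2 : (⟪f z, S z (f z) - S t (f z)⟫_ℂ).re ≤ (z - t) * (β * ‖f z‖ ^ 2) := by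
        refine (re_inner_le_mul _ _).trans ((mul_le_mul_of_nonneg_left (hβ t ht' z hz _)
          (norm_nonneg _)).trans_eq ?_)
        rw [abs_of_pos hzt']
        ring
      have x3 : (⟪S t (f t), D⟫_ℂ).re ≤ (z - t) * (γ * ‖f t‖ ^ 2 + σ * ‖f t‖)
          + B * ‖f t‖ * ((ρ + η) * (z - t)) := by
        rw [hDΔ, inner_add_right, Complex.add_re, inner_smul_right, Complex.re_ofReal_mul]
        refine add_le_add (mul_le_mul_of_nonneg_left (hγ t ht) hzt'.le) ?_
        exact (re_inner_le_mul _ _).trans (mul_le_mul (hB t ht' _) hGz (norm_nonneg _) hB1)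
      have x4 : (⟪D, S t D⟫_ℂ).re ≤ B * ((‖G t‖ + ρ + η) * (z - t)) ^ 2 := by
        refine (re_inner_le_mul _ _).trans ((mul_le_mul_of_nonneg_left (hB t ht' _)
          (norm_nonneg _)).trans ?_)
        have := mul_le_mul_of_nonneg_left (pow_le_pow_left₀ (norm_nonneg _) hDn 2) hB0
        linarith
      rw [x1]
      linarith)
    (by
      refine (re_inner_le_mul _ _).trans ?_
      have := mul_le_mul_of_nonneg_left (hB₀ (f 0)) (norm_nonneg (f 0))
      linarith)
    (by
      intro t ht
      have ht' := Ico_subset_Icc_self ht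
      have a1 : (β + 2 * γ) * ‖f t‖ ^ 2 ≤ K * E t := by
        have := mul_le_mul_of_nonneg_left (hS t ht' (f t)) hK0
        refine le_trans (le_of_eq ?_) this
        rw [hK]
        field_simp
      have a2 : 2 * (σ + ρ * B) * ‖f t‖ ≤ e :=
        mul_le_mul_of_nonneg_left (hle t ht') (by positivity)
      exact add_le_add a1 a2) s hs
  rw [sub_zero] at key
  have k1 : h * m ^ 2 ≤ (B₀ * ‖f 0‖ ^ 2 + e * s) * exp (K * s) :=
    (hS s hs _).trans (key.trans (gronwallBound_le hK0 he0))
  have k2 : (B₀ * ‖f 0‖ ^ 2 + e * s) * exp (K * s)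
      ≤ m * (exp (K * τ) * (B₀ * ‖f 0‖ + 2 * τ * (σ + ρ * B))) := by
    have hs1 := hs.1
    have hs2 := hs.2
    have hf0 := hle 0 h0
    calc _ ≤ (B₀ * (‖f 0‖ * m) + e * τ) * exp (K * τ) := by
          rw [pow_two]; gcongr
      _ = _ := by rw [he]; ring
  have hX : 0 ≤ exp (K * τ) * (B₀ * ‖f 0‖ + 2 * τ * (σ + ρ * B)) := by positivity
  have k3 : h * m ≤ exp (K * τ) * (B₀ * ‖f 0‖ + 2 * τ * (σ + ρ * B)) := by
    rcases hm0.eq_or_lt with h' | h'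
    · rw [← h', mul_zero]; exact hX
    · refine le_of_mul_le_mul_left ?_ h'
      linarith
  exact (mul_le_mul_of_nonneg_left (hle t₀ ht₀) hh.le).trans k3

end Gronwall

/-! ### Symbols -/

lemma one_le_bracket (p : Space d) : 1 ≤ bracket p := by
  rw [bracket, Real.one_le_sqrt]
  nlinarith [sq_nonneg ‖p‖]

lemma bracket_le_add_norm (p q : Space d) : bracket p ≤ bracket q + ‖p - q‖ := by
  have h1 : ‖p‖ ≤ ‖q‖ + ‖p - q‖ := by simpa using norm_add_le q (p - q)
  have h2 : ‖q‖ ≤ bracket q := Real.le_sqrt_of_sq_le (by linarith)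
  have h3 : bracket q ^ 2 = 1 + ‖q‖ ^ 2 := Real.sq_sqrt (by positivity)
  have h4 := one_le_bracket q
  rw [bracket, Real.sqrt_le_left (by positivity)]
  nlinarith [mul_le_mul h1 h1 (norm_nonneg _) (by positivity),
    mul_le_mul_of_nonneg_right h2 (norm_nonneg (p - q))]

lemma continuous_bracket : Continuous (bracket : Space d → ℝ) := by
  unfold bracket
  fun_prop

lemma IsSymbol.nonneg {K : ℝ} {G : Space d → ℝ} (h : IsSymbol K G) : 0 ≤ K :=
  (abs_nonneg _).trans (h.bound 0)

/-- Integrate the gradient along the segment from x to x + v, on which the bracket is at least ⟨x⟩ -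
|v|. The gradient bound holds only almost everywhere, hence the exceptional set of x. -/
lemma IsSymbol.ae_abs_sub_le {K : ℝ} {G : Space d → ℝ} (h : IsSymbol K G) (v : Space d) :
    ∀ᵐ x, |G (x + v) - G x| * (bracket x - ‖v‖) ≤ K * ‖v‖ := by
  obtain ⟨L, hL⟩ := h.lipschitz
  have hgood : ∀ᵐ p : Space d, DifferentiableAt ℝ G p ∧ bracket p * ‖fderiv ℝ G p‖ ≤ K := by
    filter_upwards [hL.ae_differentiableAt, h.gradient_bound] with p h1 h2 using ⟨h1, h2⟩
  obtain ⟨s, hs, hsm, hsp⟩ := hgood.exists_measurable_mem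
  have h1 : ∀ᵐ t : ℝ, ∀ᵐ x : Space d, x + t • v ∈ s := .of_forall fun t =>
    (measurePreserving_add_right volume (t • v)).quasiMeasurePreserving.ae hs
  -- Fubini: each translate of a null set is null, so almost every segment meets the exceptional set
  -- in a null set of parameters.
  have h2 : ∀ᵐ x : Space d, ∀ᵐ t : ℝ, x + t • v ∈ s := by
    refine (Measure.ae_ae_comm ?_).1 h1
    have : Measurable fun z : ℝ × Space d => z.2 + z.1 • v := by fun_prop
    exact this hsm
  filter_upwards [h2] with x hx
  rcases le_or_gt (bracket x - ‖v‖) 0 with hneg | hpos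
  · have := h.nonneg
    have : 0 ≤ K * ‖v‖ := by positivity
    exact (mul_nonpos_of_nonneg_of_nonpos (abs_nonneg _) hneg).trans this
  set φ : ℝ → ℝ := fun t => G (x + t • v) with hφ
  have hφL : LipschitzWith (L * ‖v‖₊) φ := by
    refine hL.comp ?_
    refine LipschitzWith.of_dist_le_mul fun t t' => ?_
    rw [dist_eq_norm, dist_eq_norm, add_sub_add_left_eq_sub, ← sub_smul, norm_smul, mul_comm]
    rfl
  have hac := (hφL.lipschitzOnWith (s := uIcc 0 1)).absolutelyContinuousOnInterval
  have hint := hac.integral_deriv_eq_sub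
  have hb : ‖∫ t in (0 : ℝ)..1, deriv φ t‖ ≤ K * ‖v‖ / (bracket x - ‖v‖) * |1 - 0| := by
    refine intervalIntegral.norm_integral_le_of_norm_le_const_ae ?_
    filter_upwards [hx] with t ht htI
    rw [uIoc_of_le zero_le_one] at htI
    obtain ⟨hd, hK⟩ := hsp _ ht
    have hder : HasDerivAt φ (fderiv ℝ G (x + t • v) v) t := by
      have e : HasDerivAt (fun t : ℝ => x + t • v) v t := by
        simpa using ((hasDerivAt_id t).smul_const v).const_add x
      exact hd.hasFDerivAt.comp_hasDerivAt t e
    rw [hder.deriv, le_div_iff₀ hpos]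
    have hbr : bracket x - ‖v‖ ≤ bracket (x + t • v) := by
      have e1 := bracket_le_add_norm x (x + t • v)
      have e2 : ‖x - (x + t • v)‖ ≤ ‖v‖ := by
        rw [sub_add_cancel_left, norm_neg, norm_smul, Real.norm_of_nonneg htI.1.le]
        exact mul_le_of_le_one_left (norm_nonneg _) htI.2
      linarith
    calc ‖fderiv ℝ G (x + t • v) v‖ * (bracket x - ‖v‖)
        ≤ ‖fderiv ℝ G (x + t • v)‖ * ‖v‖ * bracket (x + t • v) := by
          gcongr
          exact ContinuousLinearMap.le_opNorm _ _
      _ = bracket (x + t • v) * ‖fderiv ℝ G (x + t • v)‖ * ‖v‖ := by ring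
      _ ≤ K * ‖v‖ := by gcongr
  rw [hint, sub_zero, abs_one, mul_one, le_div_iff₀ hpos] at hb
  simpa [hφ] using hb

/-- A full-measure set is dense and the inequality is closed, so it holds at every point. Adding
|ΔG||v| ≤ 2K|v| removes the subtracted |v|, whence the constant 3K. -/
lemma IsSymbol.isSym {K : ℝ} {G : Space d → ℝ} (h : IsSymbol K G) :
    IsSym (3 * K) fun ξ => G ((2 * π) • ξ) := by
  have hK := h.nonneg
  obtain ⟨L, hL⟩ := h.lipschitz
  have hGc := hL.continuous
  refine ⟨?_, fun ξ => (h.bound _).trans (by linarith), fun ξ η => ?_⟩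
  · fun_prop
  set v := (2 * π) • (ξ - η) with hv
  have hcl : IsClosed {x | |G (x + v) - G x| * (bracket x - ‖v‖) ≤ K * ‖v‖} := by
    have := continuous_bracket (d := d)
    exact isClosed_le (by fun_prop) continuous_const
  have hall : ∀ x, |G (x + v) - G x| * (bracket x - ‖v‖) ≤ K * ‖v‖ := by
    intro x
    have := hcl.closure_subset_iff.2 subset_rfl (Measure.dense_of_ae (h.ae_abs_sub_le v) x)
    exact this
  have h1 := hall ((2 * π) • η)
  have e : (2 * π) • η + v = (2 * π) • ξ := by
    rw [hv, smul_sub]; abel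
  rw [e] at h1
  have h2 : |G ((2 * π) • ξ) - G ((2 * π) • η)| ≤ 2 * K := by
    have a1 := h.bound ((2 * π) • ξ)
    have a2 := h.bound ((2 * π) • η)
    exact (abs_sub _ _).trans (by linarith)
  have h3 : ‖v‖ ≤ bk (ξ - η) := norm_le_bk _
  have h4 := mul_le_mul_of_nonneg_right h2 (norm_nonneg v)
  have h5 := mul_le_mul_of_nonneg_left h3 hK
  change _ * bracket ((2 * π) • η) ≤ _
  nlinarith

/-- The quotient of the symbols. -/
def quot (G₁ G₂ : Space d → ℝ) (ξ : Space d) : ℝ := G₂ ((2 * π) • ξ) / G₁ ((2 * π) • ξ)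

/-- Of the quotient only measurability, evenness and |Q| ≤ 1 are recorded; differentiating it would
bring in 1/G₁, which has no bound. -/
lemma Admissible.isSys {K : ℝ} {G₁ G₂ : Space d → ℝ} (h : Admissible K G₁ G₂) :
    IsSys (3 * K) (fun ξ => G₁ ((2 * π) • ξ)) (fun ξ => G₂ ((2 * π) • ξ)) (quot G₁ G₂) := by
  refine ⟨h.symbol₁.isSym, h.symbol₂.isSym, h.symbol₂.isSym.measurable.div h.symbol₁.isSym.measurable,
    fun ξ => ?_, fun ξ => ?_, fun ξ => ?_, fun ξ => ?_⟩
  · rw [quot, abs_div, abs_of_pos (h.pos _), div_le_one (h.pos _)]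
    exact h.abs_le _
  · exact (div_mul_cancel₀ _ (h.pos _).ne').symm
  · simp only [smul_neg, h.symbol₁.even]
  · simp only [quot, smul_neg, h.symbol₁.even, h.symbol₂.even]

/-! ### Truncation -/

/-- The cutoff to frequencies `≤ n`. -/
def jn (n : ℝ) (ξ : Space d) : ℝ := 1 - cut n ξ

section Truncation

variable {n : ℝ}

lemma jn_eq_zero (hn : 0 < n) {ξ : Space d} (h : n < ‖ξ‖) : jn n ξ = 0 := by
  rw [jn, cut, min_eq_left ((one_le_div hn).2 h.le), sub_self]

lemma jn_nonneg (n : ℝ) (ξ : Space d) : 0 ≤ jn n ξ := sub_nonneg.2 (min_le_left _ _)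

lemma jn_le_one (hn : 0 < n) (ξ : Space d) : jn n ξ ≤ 1 := sub_le_self _ ((isCut_cut hn).nonneg ξ)

lemma abs_jn_le_one (hn : 0 < n) (ξ : Space d) : |jn n ξ| ≤ 1 := by
  rw [abs_of_nonneg (jn_nonneg n ξ)]
  exact jn_le_one hn ξ

lemma measurable_jn (n : ℝ) : Measurable (jn n : Space d → ℝ) := by
  unfold jn cut
  fun_prop

lemma isMult_jn (hn : 0 < n) : IsMult fun ξ : Space d => (jn n ξ : ℂ) :=
  IsMult.ofReal (measurable_jn n) (abs_jn_le_one hn)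

lemma jn_neg (hn : 0 < n) (ξ : Space d) : jn n (-ξ) = jn n ξ := by rw [jn, jn, (isCut_cut hn).neg]

/-- Product rule for increments; the cutoff varies on the scale n, so its increment times ⟨η⟩ is at
most 2⟨ξ - η⟩. The constant 1 + 2 = 3 is uniform in n. -/
lemma isSym_jn_mul (hn : 0 < n) {κ : ℝ} {g : Space d → ℝ} (h : IsSym κ g) :
    IsSym (3 * κ) fun ξ => jn n ξ * g ξ := by
  have hκ := h.nonneg
  have hc := isCut_cut (d := d) hn
  refine ⟨(measurable_jn n).mul h.measurable, fun ξ => ?_, fun ξ η => ?_⟩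
  · rw [abs_mul]
    have := mul_le_mul (abs_jn_le_one hn ξ) (h.bound ξ) (abs_nonneg _) zero_le_one
    linarith
  · have e : jn n ξ * g ξ - jn n η * g η = jn n ξ * (g ξ - g η) + (jn n ξ - jn n η) * g η := by ring
    have hb := bk_pos η
    have h1 : |jn n ξ * (g ξ - g η)| * bk η ≤ κ * bk (ξ - η) := by
      rw [abs_mul, mul_assoc]
      have := h.comm ξ η
      calc _ ≤ 1 * (|g ξ - g η| * bk η) := by
            gcongr
            exact abs_jn_le_one hn ξ
        _ ≤ _ := by linarith
    have h2 : |jn n ξ - jn n η| * bk η ≤ 2 * bk (ξ - η) := by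
      have e : |jn n ξ - jn n η| = |cut n ξ - cut n η| := by
        rw [jn, jn, sub_sub_sub_cancel_left, abs_sub_comm]
      have a1 : |cut n ξ - cut n η| ≤ 1 :=
        (hc.abs_sub_le ξ η).trans (hc.le_one _)
      have a2 := (hc.lip ξ η).trans (mul_le_mul_of_nonneg_right (hc.le_one η) (norm_nonneg _))
      have a3 := bk_le_one_add η
      have a4 := norm_le_bk (ξ - η)
      rw [norm_smul, Real.norm_of_nonneg (by positivity)] at a3 a4
      rw [e]
      have a5 := one_le_bk (ξ - η)
      have a6 := mul_le_mul_of_nonneg_left a2 (by positivity : 0 ≤ 2 * π)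
      calc _ ≤ |cut n ξ - cut n η| * (1 + 2 * π * ‖η‖) := by gcongr
        _ = |cut n ξ - cut n η| + 2 * π * (|cut n ξ - cut n η| * ‖η‖) := by ring
        _ ≤ _ := by linarith
    rw [e]
    calc _ ≤ (|jn n ξ * (g ξ - g η)| + |(jn n ξ - jn n η) * g η|) * bk η := by
          gcongr
          exact abs_add_le _ _
      _ = |jn n ξ * (g ξ - g η)| * bk η + |jn n ξ - jn n η| * bk η * |g η| := by
          rw [abs_mul (_ - _)]; ring
      _ ≤ κ * bk (ξ - η) + 2 * bk (ξ - η) * κ := by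
          have := bk_pos (ξ - η)
          have := h.bound η
          gcongr
      _ = _ := by ring

/-- Both symbols receive the same factor, so their quotient is still represented by Q: the truncated
system has the same symmetrizer and obeys the same estimates uniformly in n. -/
lemma IsSys.jn_mul (hn : 0 < n) {κ : ℝ} {g₁ g₂ Q : Space d → ℝ} (h : IsSys κ g₁ g₂ Q) :
    IsSys (3 * κ) (fun ξ => jn n ξ * g₁ ξ) (fun ξ => jn n ξ * g₂ ξ) Q :=
  ⟨isSym_jn_mul hn h.sym₁, isSym_jn_mul hn h.sym₂, h.measurable, h.le_one,
    fun ξ => by rw [h.eq]; ring, fun ξ => by rw [jn_neg hn, h.even₁], h.even⟩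

end Truncation

/-! ### Bounds on the quasilinear operator -/

section QuadBounds

variable {r : ℝ}

lemma mulP_smul_real (m : Space d → ℂ) (c : ℝ) (x : HH d) : mulP m (c • x) = c • mulP m x := by
  rw [← algebraMap_smul ℂ c x, map_smul, algebraMap_smul]

lemma norm_coe_smul (ε : ℝ) (hε0 : 0 ≤ ε) (x : HH d) : ‖(ε : ℂ) • x‖ = ε * ‖x‖ := by
  rw [norm_smul, Complex.norm_real, Real.norm_of_nonneg hε0]

lemma add_le_mul_one_add {a b κ A u : ℝ} (ha : 0 ≤ a) (hb : 0 ≤ b) (hκ : 0 ≤ κ) (hA : 0 ≤ A)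
    (hu : 0 ≤ u) : a * κ * A + b * κ * (u * A) ≤ (a + b) * κ * ((1 + u) * A) := by
  have : 0 ≤ a * κ * (u * A) + b * κ * A := by positivity
  linarith

set_option maxHeartbeats 1000000 in
lemma exists_quadP_bounds (d : ℕ) {r : ℝ} (hr : (d : ℝ) < 2 * r) : ∃ C, 0 ≤ C ∧
    ∀ (κ : ℝ) (g₁ g₂ Q : Space d → ℝ), IsSys κ g₁ g₂ Q →
    (∀ U e, ‖bilP g₁ g₂ Q r U e‖ ≤ C * κ * (‖lowP U‖ * ‖e‖)) ∧
    ∀ ε, 0 ≤ ε → ε ≤ 1 →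
      (∀ m : Space d → ℝ, IsCut m → ∀ U, ‖mulP (fun ξ => (m ξ : ℂ)) (quadP g₁ g₂ Q r ε U U)‖
        ≤ C * κ * ((1 + ‖U‖) * ‖mulP (fun ξ => (m ξ : ℂ)) U‖)) ∧
      (∀ U, ‖quadP g₁ g₂ Q r ε U U‖ ≤ C * κ * ((1 + ‖U‖) * ‖U‖)) ∧
      ∀ U V, ‖quadP g₁ g₂ Q r ε U U - quadP g₁ g₂ Q r ε V V‖
        ≤ C * κ * ((1 + ‖U‖ + ‖V‖) * ‖U - V‖) := by
  obtain ⟨C, hC, hb⟩ := exists_norm_cut_bilP_le d hr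
  refine ⟨(d + 1) ^ 2 + 2 * C, by positivity, fun κ g₁ g₂ Q hS => ?_⟩
  have hκ := hS.sym₁.nonneg
  have hd2 : (0 : ℝ) ≤ (d + 1) ^ 2 := by positivity
  have hC2 : 0 ≤ 2 * C := by positivity
  have h1 : ∀ x : HH d, mulP (fun _ => ((1 : ℝ) : ℂ)) x = x := fun x => by
    simpa using mulP_one x
  have hbil : ∀ U e, ‖bilP g₁ g₂ Q r U e‖ ≤ 2 * C * κ * (‖lowP U‖ * ‖e‖) := fun U e => by
    have := hb κ g₁ g₂ Q hS _ isCut_one U e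
    rw [h1, h1, h1] at this
    linarith
  have hlin : ∀ e, ‖linP g₁ e‖ ≤ (d + 1) ^ 2 * κ * ‖e‖ := fun e => by
    have := norm_cut_linP_le hS.sym₁ isCut_one e
    rwa [h1, h1] at this
  refine ⟨fun U e => (hbil U e).trans ?_, fun ε hε0 hε1 => ?_⟩
  · rw [add_mul, add_mul]
    exact le_add_of_nonneg_left (mul_nonneg (mul_nonneg hd2 hκ)
      (mul_nonneg (norm_nonneg _) (norm_nonneg _)))
  have hcut : ∀ m : Space d → ℝ, IsCut m → ∀ U,
      ‖mulP (fun ξ => (m ξ : ℂ)) (quadP g₁ g₂ Q r ε U U)‖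
        ≤ ((d + 1) ^ 2 + 2 * C) * κ * ((1 + ‖U‖) * ‖mulP (fun ξ => (m ξ : ℂ)) U‖) := by
    intro m hm U
    rw [quadP, map_add, map_smul]
    refine (norm_add_le _ _).trans ?_
    rw [norm_coe_smul ε hε0]
    have a1 := norm_cut_linP_le hS.sym₁ hm U
    have a2 := hb κ g₁ g₂ Q hS m hm U U
    have a3 : ‖mulP (fun ξ => (m ξ : ℂ)) (lowP U)‖ ≤ ‖mulP (fun ξ => (m ξ : ℂ)) U‖ := by
      rw [lowP, mulP_comm hm.isMult isMult_wt_neg_one]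
      exact norm_lowP_le _
    have a4 := norm_lowP_le U
    set A := ‖mulP (fun ξ => (m ξ : ℂ)) U‖
    set u := ‖U‖
    have hA : 0 ≤ A := norm_nonneg _
    have hu : 0 ≤ u := norm_nonneg _
    have a5 : ‖mulP (fun ξ => (m ξ : ℂ)) (bilP g₁ g₂ Q r U U)‖ ≤ 2 * C * κ * (u * A) := by
      refine a2.trans ?_
      calc _ ≤ C * κ * (A * u + u * A) := mul_le_mul_of_nonneg_left (add_le_add
            (mul_le_mul_of_nonneg_right a3 hu) (mul_le_mul_of_nonneg_right a4 hA))
            (mul_nonneg hC hκ)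
        _ = _ := by ring
    have a6 : ε * ‖mulP (fun ξ => (m ξ : ℂ)) (bilP g₁ g₂ Q r U U)‖ ≤ 2 * C * κ * (u * A) :=
      (mul_le_of_le_one_left (norm_nonneg _) hε1).trans a5
    exact (add_le_add a1 a6).trans (add_le_mul_one_add hd2 hC2 hκ hA hu)
  refine ⟨hcut, fun U => ?_, fun U V => ?_⟩
  · have := hcut _ isCut_one U
    rwa [h1, h1] at this
  · have e : quadP g₁ g₂ Q r ε U U - quadP g₁ g₂ Q r ε V V = linP g₁ (U - V)
        + (ε : ℂ) • (bilP g₁ g₂ Q r U (U - V) + bilP g₁ g₂ Q r (U - V) V) := by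
      rw [quadP_sub hr, quadP, smul_add (ε : ℂ) (bilP g₁ g₂ Q r U (U - V)), add_assoc]
    rw [e]
    refine (norm_add_le _ _).trans ?_
    rw [norm_coe_smul ε hε0]
    have a1 := hlin (U - V)
    have a2 := hbil U (U - V)
    have a3 := hbil (U - V) V
    have a4 := norm_lowP_le U
    have a5 := norm_lowP_le (U - V)
    set A := ‖U - V‖
    set u := ‖U‖
    set v := ‖V‖
    have hA : 0 ≤ A := norm_nonneg _
    have hu : 0 ≤ u := norm_nonneg _
    have hv : 0 ≤ v := norm_nonneg _
    have a6 : ε * ‖bilP g₁ g₂ Q r U (U - V) + bilP g₁ g₂ Q r (U - V) V‖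
        ≤ 2 * C * κ * ((u + v) * A) := by
      refine (mul_le_of_le_one_left (norm_nonneg _) hε1).trans ((norm_add_le _ _).trans
        ((add_le_add (a2.trans (mul_le_mul_of_nonneg_left (mul_le_mul_of_nonneg_right a4 hA)
          (mul_nonneg hC2 hκ))) (a3.trans (mul_le_mul_of_nonneg_left
          (mul_le_mul_of_nonneg_right a5 hv) (mul_nonneg hC2 hκ)))).trans_eq ?_))
      ring
    rw [add_assoc 1 u v]
    exact (add_le_add a1 a6).trans (add_le_mul_one_add hd2 hC2 hκ hA (add_nonneg hu hv))

end QuadBounds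

/-! ### Fourier transforms of real functions -/

/-- The involution whose fixed points are the Fourier transforms of real functions. -/
def conjL : L2 d →L[ℝ] L2 d :=
  ((Complex.conjCLE : ℂ →L[ℝ] ℂ).compLpL 2 volume) ∘L
    (Lp.compMeasurePreservingₗᵢ ℝ (fun ξ : Space d => -ξ)
      (Measure.measurePreserving_neg volume)).toContinuousLinearMap

lemma coeFn_conjL (x : L2 d) : conjL x =ᵐ[volume] fun ξ => (starRingEnd ℂ) (x (-ξ)) := by
  have h1 := ContinuousLinearMap.coeFn_compLpL (p := 2) (μ := volume) (Complex.conjCLE : ℂ →L[ℝ] ℂ)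
    (Lp.compMeasurePreserving (fun ξ : Space d => -ξ) (Measure.measurePreserving_neg volume) x)
  have h2 := Lp.coeFn_compMeasurePreserving x (Measure.measurePreserving_neg (volume : Measure (Space d)))
  filter_upwards [h1, h2] with ξ e1 e2
  refine e1.trans ?_
  rw [e2]
  rfl

/-- As a fixed-point condition of a continuous real-linear map, reality is closed under limits and
cuts out a closed real subspace. -/
lemma herm_iff {x : L2 d} : Herm x ↔ conjL x = x := by
  constructor
  · intro h
    refine Lp.ext ?_
    filter_upwards [coeFn_conjL x, h] with ξ e1 e2
    rw [e1, e2, Complex.conj_conj]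
  · intro h
    have h1 := coeFn_conjL x
    rw [h] at h1
    filter_upwards [h1] with ξ e1
    rw [e1, Complex.conj_conj]

lemma Herm.Bil {r : ℝ} (hr : (d : ℝ) < 2 * r) {x y : L2 d} (hx : Herm x) (hy : Herm y) :
    Herm (Bil r x y) := by
  have h1 := coeFn_Bil hr x y
  have h2 := (Measure.measurePreserving_neg (volume : Measure (Space d))).quasiMeasurePreserving.ae h1
  filter_upwards [h1, h2] with ξ e1 e2
  rw [e1, e2, map_mul, Complex.conj_ofReal, wt_neg_arg, cv, cv, ← integral_conj,
    ← integral_neg_eq_self]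
  congr 1
  refine integral_congr_ae ?_
  filter_upwards [(quasiMeasurePreserving_sub_left volume ξ).ae hx, hy] with η e3 e4
  have : -ξ - -η = -(ξ - η) := by abel
  rw [this, low, low, low, low, wt_neg_arg, wt_neg_arg, e3, e4]
  simp only [map_mul, Complex.conj_ofReal]

lemma dm_neg (j : Fin d) (ξ : Space d) : dm j (-ξ) = (starRingEnd ℂ) (dm j ξ) := by
  rw [dm, dm, map_mul, Complex.conj_ofReal, dl_neg, conj_dl, wt_neg_arg]

lemma Herm.add {x y : L2 d} (hx : Herm x) (hy : Herm y) : Herm (x + y : L2 d) := by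
  rw [herm_iff] at *
  rw [map_add, hx, hy]

lemma Herm.sum {ι : Type*} {s : Finset ι} {x : ι → L2 d} (hx : ∀ i ∈ s, Herm (x i)) :
    Herm (∑ i ∈ s, x i : L2 d) := by
  rw [herm_iff, map_sum]
  exact Finset.sum_congr rfl fun i hi => herm_iff.1 (hx i hi)

lemma Herm.smul {x : L2 d} (hx : Herm x) (c : ℝ) : Herm ((c : ℂ) • x : L2 d) := by
  rw [herm_iff] at *
  have : (c : ℂ) • x = c • x := algebraMap_smul ℂ c x
  rw [this, map_smul, hx]

lemma HermP.quadP {r : ℝ} (hr : (d : ℝ) < 2 * r) {κ : ℝ} {g₁ g₂ Q : Space d → ℝ}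
    (hS : IsSys κ g₁ g₂ Q) (ε : ℝ) {U e : HH d} (hU : HermP U) (he : HermP e) :
    HermP (quadP g₁ g₂ Q r ε U e) := by
  have c1 : ∀ {x : L2 d}, Herm x → Herm (mulL (fun ξ => (g₁ ξ : ℂ)) x) := fun hx =>
    hx.mulL hS.sym₁.isMult fun ξ => by rw [hS.even₁, Complex.conj_ofReal]
  have c2 : ∀ {x : L2 d}, Herm x → Herm (mulL (fun ξ => (g₂ ξ : ℂ)) x) := fun hx =>
    hx.mulL hS.sym₂.isMult fun ξ => by rw [hS.even₂, Complex.conj_ofReal]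
  have c3 : ∀ {x : L2 d} (j : Fin d), Herm x → Herm (mulL (dm j) x) := fun j hx =>
    hx.mulL (isMult_dm j) (dm_neg j)
  have c4 : ∀ {x : L2 d}, Herm x → Herm (lowL x) := fun hx =>
    hx.mulL isMult_wt_neg_one fun ξ => by rw [wt_neg_arg, Complex.conj_ofReal]
  intro i
  rcases i with _ | k
  · refine Herm.add (Herm.sum fun j _ => c1 (c3 j (he _))) (Herm.smul (Herm.sum fun j _ => c2 ?_) ε)
    exact ((c4 (hS.herm_Q (hU _))).Bil hr (c3 j (he _))).add
      ((c4 (hU _)).Bil hr (c3 j (hS.herm_Q (he _))))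
  · refine Herm.add (c1 (c3 k (he _))) (Herm.smul (Herm.sum fun j _ => c1 ?_) ε)
    exact (c4 (hS.herm_Q (hU _))).Bil hr (c3 j (hS.herm_Q (he _)))

/-- States of real functions with frequencies in the ball of radius `n`. -/
def galSub (d : ℕ) (n : ℝ) : Submodule ℝ (HH d) where
  carrier := {U | (∀ i, conjL (U i) = U i) ∧ mulP (indicator {ξ | ‖ξ‖ ≤ n} 1) U = U}
  add_mem' := fun {a b} ha hb => ⟨fun i => by rw [PiLp.add_apply, map_add, ha.1, hb.1],
    by rw [map_add, ha.2, hb.2]⟩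
  zero_mem' := ⟨fun i => by simp, by simp⟩
  smul_mem' := fun c x hx => ⟨fun i => by rw [PiLp.smul_apply, map_smul, hx.1],
    by rw [mulP_smul_real, hx.2]⟩

lemma isMult_ball (n : ℝ) : IsMult (indicator {ξ : Space d | ‖ξ‖ ≤ n} 1) := by
  refine ⟨measurable_one.indicator (measurableSet_le measurable_norm measurable_const), 1, fun ξ => ?_⟩
  rw [indicator_apply]
  split_ifs <;> simp

lemma isClosed_galSub (n : ℝ) : IsClosed (galSub d n : Set (HH d)) := by
  have h1 : IsClosed {U : HH d | ∀ i, conjL (U i) = U i} := by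
    simp only [ofPred_forall]
    refine isClosed_iInter fun i => isClosed_eq ?_ ?_
    · exact conjL.continuous.comp (PiLp.continuous_apply 2 _ i)
    · exact PiLp.continuous_apply 2 _ i
  exact h1.inter (isClosed_eq (mulP _).continuous continuous_id)

lemma mem_galSub {n : ℝ} {U : HH d} : U ∈ galSub d n ↔
    HermP U ∧ ∀ i, ∀ᵐ ξ, n < ‖ξ‖ → U i ξ = 0 := by
  have h2 : mulP (indicator {ξ | ‖ξ‖ ≤ n} 1) U = U ↔ ∀ i, ∀ᵐ ξ, n < ‖ξ‖ → U i ξ = 0 := by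
    constructor
    · intro h i
      have h1 := coeFn_mulL (isMult_ball n) (U i)
      rw [← mulP_apply, h] at h1
      filter_upwards [h1] with ξ e1 hξ
      rw [e1, indicator_of_notMem (by simpa using hξ), zero_mul]
    · intro h
      ext1 i
      rw [mulP_apply]
      refine Lp.ext ?_
      filter_upwards [coeFn_mulL (isMult_ball n) (U i), h i] with ξ e1 e2
      rw [e1]
      rcases le_or_gt ‖ξ‖ n with hξ | hξ
      · rw [indicator_of_mem (by exact hξ), Pi.one_apply, one_mul]
      · rw [e2 hξ, mul_zero]
  rw [← h2]
  exact and_congr (forall_congr' fun i => herm_iff.symm) Iff.rfl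

/-! ### Truncated differential equations -/

/-- The field is bounded by L, so the ball of radius Lτ in the Picard–Lindelöf theorem cannot be
left and the solution exists on all of [0, τ] without continuation. -/
lemma exists_ode {E : Type*} [NormedAddCommGroup E] [NormedSpace ℝ E] [CompleteSpace E] {F : E → E}
    {K L : NNReal} (hK : LipschitzWith K F) (hL : ∀ x, ‖F x‖ ≤ L) (x₀ : E) {τ : ℝ} (hτ : 0 ≤ τ) :
    ∃ α : ℝ → E, α 0 = x₀ ∧ ∀ t ∈ Icc 0 τ, HasDerivWithinAt α (F (α t)) (Icc 0 τ) t := by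
  have h0 : (0 : ℝ) ∈ Icc 0 τ := left_mem_Icc.2 hτ
  have hP : IsPicardLindelof (fun _ => F) (⟨0, h0⟩ : Icc 0 τ) x₀ (L * τ.toNNReal) 0 L K := by
    refine IsPicardLindelof.of_time_independent (fun x _ => hL x) hK.lipschitzOnWith ?_
    rw [sub_zero, sub_self, max_eq_left hτ, NNReal.coe_zero, sub_zero, NNReal.coe_mul,
      Real.coe_toNNReal τ hτ]
  exact hP.exists_eq_forall_mem_Icc_hasDerivWithinAt₀

/-- The truncation of vector fields to bounded sets. -/
def theta (R ρ : ℝ) : ℝ := max 0 (min 1 (2 - ρ / R))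

lemma theta_nonneg (R ρ : ℝ) : 0 ≤ theta R ρ := le_max_left _ _

lemma theta_le_one (R ρ : ℝ) : theta R ρ ≤ 1 := max_le zero_le_one (min_le_left _ _)

lemma theta_eq_one {R ρ : ℝ} (hR : 0 < R) (h : ρ ≤ R) : theta R ρ = 1 := by
  have : ρ / R ≤ 1 := (div_le_one hR).2 h
  rw [theta, min_eq_left (by linarith), max_eq_right zero_le_one]

lemma theta_eq_zero {R ρ : ℝ} (hR : 0 < R) (h : 2 * R ≤ ρ) : theta R ρ = 0 := by
  have : 2 ≤ ρ / R := (le_div_iff₀ hR).2 h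
  rw [theta, max_eq_left]
  exact (min_le_right _ _).trans (by linarith)

lemma abs_theta_sub_le {R : ℝ} (hR : 0 < R) (ρ ρ' : ℝ) :
    |theta R ρ - theta R ρ'| ≤ |ρ - ρ'| / R := by
  refine (abs_max_sub_max_le_max _ _ _ _).trans ?_
  rw [sub_self, abs_zero, max_eq_right (abs_nonneg _)]
  refine (abs_min_sub_min_le_max _ _ _ _).trans ?_
  rw [sub_self, abs_zero, max_eq_right (abs_nonneg _), sub_sub_sub_cancel_left, ← sub_div, abs_div,
    abs_of_pos hR, abs_sub_comm]

section

variable {E : Type*} [NormedAddCommGroup E] [NormedSpace ℝ E] {F : E → E} {A R : ℝ}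

lemma norm_theta_smul_le (hA : 0 ≤ A) (hR : 0 < R) (hF : ∀ U, ‖F U‖ ≤ A * ((1 + ‖U‖) * ‖U‖))
    (U : E) : ‖theta R ‖U‖ • F U‖ ≤ A * ((1 + 2 * R) * (2 * R)) := by
  rcases le_or_gt (2 * R) ‖U‖ with h | h
  · rw [theta_eq_zero hR h, zero_smul, norm_zero]
    positivity
  · rw [norm_smul, Real.norm_of_nonneg (theta_nonneg _ _)]
    refine (mul_le_of_le_one_left (norm_nonneg _) (theta_le_one _ _)).trans ((hF U).trans ?_)
    gcongr

/-- The increment of the cutoff is multiplied by the field at a point of norm below 2R, where growth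
is controlled; the increment of the field is needed only when both points are there. -/
lemma lipschitzWith_theta_smul (hA : 0 ≤ A) (hR : 0 < R)
    (hF : ∀ U, ‖F U‖ ≤ A * ((1 + ‖U‖) * ‖U‖))
    (hF' : ∀ U V, ‖F U - F V‖ ≤ A * ((1 + ‖U‖ + ‖V‖) * ‖U - V‖)) :
    LipschitzWith (Real.toNNReal (A * (2 * (1 + 2 * R) + (1 + 4 * R))))
      fun U => theta R ‖U‖ • F U := by
  have key : ∀ U V : E, ‖U‖ < 2 * R → ‖(theta R ‖U‖ - theta R ‖V‖) • F U‖
      ≤ A * (2 * (1 + 2 * R)) * ‖U - V‖ := by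
    intro U V hU
    rw [norm_smul, Real.norm_eq_abs]
    have h1 : |theta R ‖U‖ - theta R ‖V‖| ≤ ‖U - V‖ / R :=
      (abs_theta_sub_le hR _ _).trans (by gcongr; exact abs_norm_sub_norm_le U V)
    calc _ ≤ ‖U - V‖ / R * (A * ((1 + 2 * R) * (2 * R))) := by
          gcongr
          exact (hF U).trans (by gcongr)
      _ = _ := by field_simp
  have hp : ∀ U V : E, 0 ≤ A * (1 + 4 * R) * ‖U - V‖ := fun U V => by positivity
  refine LipschitzWith.of_dist_le_mul fun U V => ?_
  rw [dist_eq_norm, dist_eq_norm, Real.coe_toNNReal _ (by positivity)]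
  rcases le_or_gt (2 * R) ‖U‖ with hU | hU
  · rcases le_or_gt (2 * R) ‖V‖ with hV | hV
    · rw [theta_eq_zero hR hU, theta_eq_zero hR hV]
      simp only [zero_smul, sub_self, norm_zero]
      positivity
    · have h1 := key V U hV
      rw [theta_eq_zero hR hU, sub_zero] at h1
      rw [theta_eq_zero hR hU, zero_smul, zero_sub, norm_neg, norm_sub_rev U V]
      linarith [hp V U]
  · rcases le_or_gt (2 * R) ‖V‖ with hV | hV
    · have h1 := key U V hU
      rw [theta_eq_zero hR hV, sub_zero] at h1
      rw [theta_eq_zero hR hV, zero_smul, sub_zero]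
      linarith [hp U V]
    · have e : theta R ‖U‖ • F U - theta R ‖V‖ • F V
          = (theta R ‖U‖ - theta R ‖V‖) • F U + theta R ‖V‖ • (F U - F V) := by
        rw [sub_smul, smul_sub]; abel
      rw [e]
      refine (norm_add_le _ _).trans ?_
      have h1 := key U V hU
      have h2 : ‖theta R ‖V‖ • (F U - F V)‖ ≤ A * (1 + 4 * R) * ‖U - V‖ := by
        rw [norm_smul, Real.norm_of_nonneg (theta_nonneg _ _)]
        refine (mul_le_of_le_one_left (norm_nonneg _) (theta_le_one _ _)).trans ((hF' U V).trans ?_)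
        calc _ ≤ A * ((1 + 2 * R + 2 * R) * ‖U - V‖) := by gcongr
          _ = _ := by ring
      linarith

end

/-! ### The Galerkin scheme -/

/-- The bracket, truncated to the ball of radius `n`. -/
def bkn (n : ℝ) : Space d → ℂ := indicator {ξ | ‖ξ‖ ≤ n} fun ξ => (bk ξ : ℂ)

lemma bkn_of_le {n : ℝ} {ξ : Space d} (h : ‖ξ‖ ≤ n) : bkn n ξ = (bk ξ : ℂ) :=
  indicator_of_mem (by exact h) _

lemma bkn_of_lt {n : ℝ} {ξ : Space d} (h : n < ‖ξ‖) : bkn n ξ = 0 :=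
  indicator_of_notMem (by simpa using h) _

lemma norm_bkn_le {n : ℝ} (hn : 0 ≤ n) (ξ : Space d) : ‖bkn n ξ‖ ≤ 1 + 2 * π * n := by
  rcases le_or_gt ‖ξ‖ n with h | h
  · rw [bkn_of_le h, Complex.norm_real, Real.norm_of_nonneg (bk_pos ξ).le]
    refine (bk_le_one_add ξ).trans ?_
    rw [norm_smul, Real.norm_of_nonneg (by positivity)]
    gcongr
  · rw [bkn_of_lt h, norm_zero]
    positivity

lemma isMult_bkn {n : ℝ} (hn : 0 ≤ n) : IsMult (bkn n : Space d → ℂ) := by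
  refine ⟨Measurable.indicator ?_ (measurableSet_le measurable_norm measurable_const), _,
    norm_bkn_le hn⟩
  exact Complex.measurable_ofReal.comp continuous_bk.measurable

section Galerkin

variable {r κ ε n : ℝ} {g₁ g₂ Q : Space d → ℝ}

/-- The truncated quasilinear operator. -/
def galF (g₁ g₂ Q : Space d → ℝ) (r ε n : ℝ) (U : HH d) : HH d :=
  -- The truncated bracket returns the output from regularity s - 1 to s, which makes the equation
  -- an ordinary differential equation in a fixed Hilbert space.
  mulP (bkn n) (quadP (fun ξ => jn n ξ * g₁ ξ) (fun ξ => jn n ξ * g₂ ξ) Q r ε U U)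

lemma herm_bkn (n : ℝ) (ξ : Space d) : bkn n (-ξ) = (starRingEnd ℂ) (bkn n ξ) := by
  rcases le_or_gt ‖ξ‖ n with h | h
  · rw [bkn_of_le h, bkn_of_le (by rwa [norm_neg]), bk_neg, Complex.conj_ofReal]
  · rw [bkn_of_lt h, bkn_of_lt (by rwa [norm_neg]), map_zero]

lemma galF_mem (hr : (d : ℝ) < 2 * r) (hS : IsSys κ g₁ g₂ Q) (hn : 0 < n) {U : HH d}
    (hU : U ∈ galSub d n) : galF g₁ g₂ Q r ε n U ∈ galSub d n := by
  rw [mem_galSub] at *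
  refine ⟨fun i => ?_, fun i => ?_⟩
  · exact (HermP.quadP hr (hS.jn_mul hn) ε hU.1 hU.1 i).mulL (isMult_bkn hn.le) (herm_bkn n)
  · filter_upwards [coeFn_mulL (isMult_bkn hn.le) (quadP (fun ξ => jn n ξ * g₁ ξ)
      (fun ξ => jn n ξ * g₂ ξ) Q r ε U U i)] with ξ e h
    rw [galF, mulP_apply, e, bkn_of_lt h, zero_mul]

/-- The equation is solved inside the closed subspace `galSub d n`, which the field preserves;
reality and the frequency bound are thus built into the solution. -/
lemma exists_galerkin (hr : (d : ℝ) < 2 * r) (hS : IsSys κ g₁ g₂ Q) (hε0 : 0 ≤ ε) (hε1 : ε ≤ 1)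
    (hn : 0 < n) {R τ : ℝ} (hR : 0 < R) (hτ : 0 ≤ τ) {Y₀ : HH d} (hY₀ : Y₀ ∈ galSub d n) :
    ∃ Y : ℝ → HH d, Y 0 = Y₀ ∧ ∀ t ∈ Icc 0 τ, Y t ∈ galSub d n ∧
      HasDerivWithinAt Y (-(theta R ‖Y t‖ • galF g₁ g₂ Q r ε n (Y t))) (Icc 0 τ) t := by
  obtain ⟨C, hC, hb⟩ := exists_quadP_bounds d hr
  obtain ⟨-, hb⟩ := hb _ _ _ Q (hS.jn_mul hn)
  obtain ⟨-, hb1, hb2⟩ := hb ε hε0 hε1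
  have hκ := hS.sym₁.nonneg
  have hN : 0 ≤ 1 + 2 * π * n := by positivity
  set A := (1 + 2 * π * n) * (C * (3 * κ)) with hA
  have hA0 : 0 ≤ A := by positivity
  have hF1 : ∀ U : HH d, ‖galF g₁ g₂ Q r ε n U‖ ≤ A * ((1 + ‖U‖) * ‖U‖) := fun U => by
    refine (norm_mulP_le (isMult_bkn hn.le) hN (norm_bkn_le hn.le) _).trans ?_
    rw [hA, mul_assoc (1 + 2 * π * n)]
    exact mul_le_mul_of_nonneg_left (hb1 U) hN
  have hF2 : ∀ U V : HH d, ‖galF g₁ g₂ Q r ε n U - galF g₁ g₂ Q r ε n V‖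
      ≤ A * ((1 + ‖U‖ + ‖V‖) * ‖U - V‖) := fun U V => by
    rw [galF, galF, ← map_sub]
    refine (norm_mulP_le (isMult_bkn hn.le) hN (norm_bkn_le hn.le) _).trans ?_
    rw [hA, mul_assoc (1 + 2 * π * n)]
    exact mul_le_mul_of_nonneg_left (hb2 U V) hN
  have : CompleteSpace (galSub d n) := (isClosed_galSub n).completeSpace_coe
  set F : galSub d n → galSub d n := fun U => -⟨galF g₁ g₂ Q r ε n U, galF_mem hr hS hn U.2⟩ with hF
  have l1 : ∀ U : galSub d n, ‖F U‖ ≤ A * ((1 + ‖U‖) * ‖U‖) := fun U => by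
    rw [hF, norm_neg]
    exact hF1 U
  have l2 : ∀ U V : galSub d n, ‖F U - F V‖ ≤ A * ((1 + ‖U‖ + ‖V‖) * ‖U - V‖) := fun U V => by
    rw [hF, neg_sub_neg, norm_sub_rev]
    exact hF2 U V
  obtain ⟨α, hα0, hα⟩ := exists_ode (lipschitzWith_theta_smul hA0 hR l1 l2)
    (L := (A * ((1 + 2 * R) * (2 * R))).toNNReal)
    (fun U => (norm_theta_smul_le hA0 hR l1 U).trans (Real.le_coe_toNNReal _)) ⟨Y₀, hY₀⟩ hτ
  refine ⟨fun t => (α t : HH d), congrArg Subtype.val hα0, fun t ht => ⟨(α t).2, ?_⟩⟩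
  have h1 := (galSub d n).subtypeL.hasFDerivAt.comp_hasDerivWithinAt t (hα t ht)
  have e : (galSub d n).subtypeL (theta R ‖α t‖ • F (α t))
      = -(theta R ‖(α t : HH d)‖ • galF g₁ g₂ Q r ε n (α t)) := by
    rw [map_smul, hF, map_neg, smul_neg]
    rfl
  rw [e] at h1
  exact h1

end Galerkin

/-! ### Time-dependent symmetrizers -/

/-- The state has a depth of at least `h`. -/
def NonCav (r ε h : ℝ) (U : HH d) : Prop :=
  ∀ x, h ≤ 1 + ε * ((𝓕⁻ (low (r + 1) (U none)) : Space d → ℂ) x).re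

lemma exists_low_sub_bound {r : ℝ} (hr : (d : ℝ) < 2 * r) : ∃ c, 0 ≤ c ∧ ∀ x y : L2 d,
    Integrable (low (r + 1) x) ∧
    ∫ ξ, ‖low (r + 1) x ξ - low (r + 1) y ξ‖ ≤ c * ‖lowL (x - y)‖ := by
  obtain ⟨c, hc, h⟩ := exists_integral_low_le hr
  have hi : ∀ x : L2 d, Integrable (low (r + 1) x) := fun x =>
    ((h (lowL x)).1).congr (low_lowL r x)
  refine ⟨c, hc, fun x y => ⟨hi x, le_trans (le_of_eq ?_) (h (lowL (x - y))).2⟩⟩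
  refine integral_congr_ae ?_
  filter_upwards [low_lowL r (x - y), Lp.coeFn_sub x y] with ξ e1 e2
  rw [e1, low, low, low, e2, Pi.sub_apply, mul_sub]

lemma fourierInv_sub {f g : Space d → ℂ} (hf : Integrable f) (hg : Integrable g) (x : Space d) :
    (𝓕⁻ (fun ξ => f ξ - g ξ) : Space d → ℂ) x
      = (𝓕⁻ f : Space d → ℂ) x - (𝓕⁻ g : Space d → ℂ) x := by
  simp only [Real.fourierInv_eq, smul_sub]
  exact integral_sub (by simpa using (Real.fourierIntegral_convergent_iff (-x)).2 hf)
    (by simpa using (Real.fourierIntegral_convergent_iff (-x)).2 hg)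

/-- Coefficient estimates, with a common constant. -/
lemma exists_coef_bounds (d : ℕ) {r : ℝ} (hr : (d : ℝ) < 2 * r) : ∃ c, 0 ≤ c ∧
    (∀ x : L2 d, Herm x → IsCoef (c * ‖x‖) (low (r + 1) x)) ∧
    (∀ (ε h : ℝ) (U V : HH d), 0 ≤ ε → NonCav r ε h U →
      NonCav r ε (h - ε * (c * ‖lowP (U - V)‖)) V) ∧
    ∀ (κ : ℝ) (g₁ g₂ Q : Space d → ℝ), IsSys κ g₁ g₂ Q → ∀ (ε : ℝ) (U V f : HH d), 0 ≤ ε →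
      ‖symP ε Q (low (r + 1) (U none)) f - symP ε Q (low (r + 1) (V none)) f‖
        ≤ ε * (c * ‖lowP (U - V)‖) * ‖f‖ := by
  obtain ⟨c₁, hc₁, h₁⟩ := exists_isCoef (d := d) hr
  obtain ⟨c₂, hc₂, h₂⟩ := exists_low_sub_bound (d := d) hr
  have hsub : ∀ U V : HH d, ‖lowL (U none - V none)‖ ≤ ‖lowP (U - V)‖ := fun U V =>
    HH.norm_apply_le (lowP (U - V)) none
  refine ⟨c₁ + c₂, by positivity, fun x hx => (h₁ x hx).mono ?_, ?_, ?_⟩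
  · nlinarith [norm_nonneg x]
  · intro ε h U V hε hU x
    have hi := (h₂ (U none) (V none)).1
    have hi' := (h₂ (V none) (U none)).1
    have h3 : ‖(𝓕⁻ (low (r + 1) (U none)) : Space d → ℂ) x
        - (𝓕⁻ (low (r + 1) (V none)) : Space d → ℂ) x‖ ≤ c₂ * ‖lowL (U none - V none)‖ := by
      rw [← fourierInv_sub hi hi']
      exact (norm_fourierInvFun_le _ x).trans (h₂ _ _).2
    have h4 := (Complex.abs_re_le_norm _).trans h3
    rw [Complex.sub_re] at h4
    have h5 := (abs_le.1 h4).2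
    have h6 := hU x
    have h7 : c₂ * ‖lowL (U none - V none)‖ ≤ (c₁ + c₂) * ‖lowP (U - V)‖ :=
      mul_le_mul (by linarith) (hsub U V) (norm_nonneg _) (by positivity)
    have h8 := mul_le_mul_of_nonneg_left (h5.trans h7) hε
    linarith
  · intro κ g₁ g₂ Q hS ε U V f hε
    refine HH.norm_le_mul (by positivity) fun i => ?_
    have hp : 0 ≤ ε * ((c₁ + c₂) * ‖lowP (U - V)‖) := by positivity
    rcases i with _ | k
    · rw [PiLp.sub_apply, symP_none, symP_none, sub_self, norm_zero]
      positivity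
    · rw [PiLp.sub_apply, symP_some, symP_some, add_sub_add_left_eq_sub, ← smul_sub, ← map_sub,
        norm_smul, Complex.norm_real, Real.norm_of_nonneg hε, mul_assoc ε]
      refine mul_le_mul_of_nonneg_left ((hS.norm_Q_le _).trans ?_) hε
      rw [← convL_sub (h₂ _ (V none)).1 (h₂ _ (U none)).1]
      refine (norm_convL_le ((h₂ _ (V none)).1.sub (h₂ _ (U none)).1) _).trans ?_
      refine mul_le_mul ((h₂ _ _).2.trans ?_) (hS.norm_Q_le _) (norm_nonneg _) (by positivity)
      exact mul_le_mul (by linarith) (hsub U V) (norm_nonneg _) (by positivity)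

lemma HasDerivWithinAt.nearDeriv {f : ℝ → HH d} {g : HH d} {τ t : ℝ}
    (h : HasDerivWithinAt f g (Icc 0 τ) t) (ht : t ∈ Ico 0 τ) : NearDeriv f t g 0 := by
  intro η hη
  have hmem : Icc 0 τ ∈ 𝓝[>] t :=
    mem_of_superset (Ioc_mem_nhdsGT ht.2) fun z hz => ⟨ht.1.trans hz.1.le, hz.2⟩
  have h1 := (hasDerivWithinAt_iff_isLittleO.1 h).def hη
  have h2 : 𝓝[>] t ≤ 𝓝[Icc 0 τ] t := le_inf inf_le_left (le_principal_iff.2 hmem)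
  filter_upwards [h2 h1, self_mem_nhdsWithin] with z hz hzt
  have hzt' : 0 < z - t := sub_pos.2 hzt
  have e : ((z - t : ℝ) : ℂ) • g = (z - t) • g := algebraMap_smul ℂ (z - t) g
  rwa [Real.norm_of_nonneg hzt'.le, ← e, ← zero_add η] at hz

lemma norm_lowP_mulP_bkn_le {n : ℝ} (hn : 0 ≤ n) (x : HH d) : ‖lowP (mulP (bkn n) x)‖ ≤ ‖x‖ := by
  rw [lowP, mulP_mulP isMult_wt_neg_one (isMult_bkn hn)]
  refine (norm_mulP_le (isMult_wt_neg_one.mul (isMult_bkn hn)) zero_le_one (fun ξ => ?_) x).trans_eq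
    (one_mul _)
  rw [norm_mul]
  rcases le_or_gt ‖ξ‖ n with h | h
  · rw [bkn_of_le h, ← norm_mul, ← wt_one, ← Complex.ofReal_mul, mul_comm, wt_mul_neg]
    simp
  · rw [bkn_of_lt h]
    simp

/-- Energy estimate for the Galerkin scheme, localized to high frequencies. -/
lemma exists_cut_energy (d : ℕ) {r : ℝ} (hr : (d : ℝ) < 2 * r) : ∃ A, 0 ≤ A ∧
    ∀ (κ : ℝ) (g₁ g₂ Q : Space d → ℝ), IsSys κ g₁ g₂ Q → ∀ ε n R τ h : ℝ, 0 ≤ ε → ε ≤ 1 → 0 < n →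
    0 < R → 0 < h → h ≤ 1 → ∀ Y : ℝ → HH d, (∀ t ∈ Icc 0 τ, Y t ∈ galSub d n ∧
      HasDerivWithinAt Y (-(theta R ‖Y t‖ • galF g₁ g₂ Q r ε n (Y t))) (Icc 0 τ) t) →
    (∀ t ∈ Icc 0 τ, ∀ z ∈ Icc 0 τ,
      ‖lowP (Y z - Y t)‖ ≤ A * κ * ((1 + 2 * R) * (2 * R)) * |z - t|) ∧
    ((∀ t ∈ Icc 0 τ, NonCav r ε h (Y t)) → ∀ m : Space d → ℝ, IsCut m → ∀ t ∈ Icc 0 τ,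
      h * ‖mulP (fun ξ => (m ξ : ℂ)) (Y t)‖ ≤ exp (ε * (A * (κ * (1 + 2 * R) ^ 2)) / h * τ)
        * ((1 + A * ‖Y 0‖) * ‖mulP (fun ξ => (m ξ : ℂ)) (Y 0)‖)) := by
  obtain ⟨c, hc, hcoef, -, hsym⟩ := exists_coef_bounds d hr
  obtain ⟨D, hD, hen⟩ := exists_energy_cut (d := d) hr
  obtain ⟨C, hC, hb⟩ := exists_quadP_bounds d hr
  refine ⟨3 * C + (c + c * (3 * C) + 6 * D), by positivity,
    fun κ g₁ g₂ Q hS ε n R τ h hε0 hε1 hn hR hh hh1 Y hY => ?_⟩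
  have hκ := hS.sym₁.nonneg
  have hSn := hS.jn_mul hn
  obtain ⟨-, hb⟩ := hb _ _ _ Q hSn
  obtain ⟨-, hb1, -⟩ := hb ε hε0 hε1
  set ℓ := C * (3 * κ) * ((1 + 2 * R) * (2 * R)) with hℓ
  have hℓ0 : 0 ≤ ℓ := by positivity
  -- The speed at the lower level is bounded by the norm cutoff alone, uniformly in n and before any
  -- energy estimate.
  have hlip : ∀ t ∈ Icc 0 τ, ∀ z ∈ Icc 0 τ, ‖lowP (Y z - Y t)‖ ≤ ℓ * |z - t| := by
    intro t ht z hz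
    rw [map_sub]
    refine (convex_Icc 0 τ).norm_image_sub_le_of_norm_hasDerivWithin_le (f := fun t => lowP (Y t))
      (f' := fun t => -(theta R ‖Y t‖ • lowP (galF g₁ g₂ Q r ε n (Y t)))) (fun x hx => ?_)
      (fun x _ => ?_) ht hz
    · have h1 := ((lowP (d := d)).restrictScalars ℝ).hasFDerivAt.comp_hasDerivWithinAt x (hY x hx).2
      rw [map_neg, map_smul] at h1
      exact h1
    · rw [norm_neg]
      exact norm_theta_smul_le (F := fun U => lowP (galF g₁ g₂ Q r ε n U)) (by positivity) hR
        (fun U => (norm_lowP_mulP_bkn_le hn.le _).trans (hb1 U)) (Y x)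
  refine ⟨fun t ht z hz => (hlip t ht z hz).trans ?_, fun hnc m hm t ht => ?_⟩
  · have : 0 ≤ (c + c * (3 * C) + 6 * D) * κ * ((1 + 2 * R) * (2 * R)) * |z - t| := by positivity
    rw [hℓ]
    linarith
  have hcont : ContinuousOn Y (Icc 0 τ) := fun t ht => (hY t ht).2.continuousWithinAt
  -- This bound is merely qualitative: N enters only B, which multiplies ρ = 0 in the conclusion.
  obtain ⟨N, hN⟩ := isCompact_Icc.exists_bound_of_continuousOn hcont
  have hN0 : 0 ≤ N := (norm_nonneg _).trans (hN t ht)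
  have h0 : (0 : ℝ) ∈ Icc 0 τ := left_mem_Icc.2 (ht.1.trans ht.2)
  have hherm : ∀ t ∈ Icc 0 τ, HermP (Y t) := fun t ht => (mem_galSub.1 (hY t ht).1).1
  have hco : ∀ t ∈ Icc 0 τ, IsCoef (c * ‖Y t‖) (low (r + 1) (Y t none)) := fun t ht =>
    (hcoef _ (hherm t ht none)).mono (mul_le_mul_of_nonneg_left (HH.norm_apply_le _ _) hc)
  have main := norm_le_of_energy (τ := τ) (f := fun t => mulP (fun ξ => (m ξ : ℂ)) (Y t))
    (G := fun t => mulP (fun ξ => (m ξ : ℂ)) (-(theta R ‖Y t‖ • galF g₁ g₂ Q r ε n (Y t))))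
    (S := fun t => symP ε Q (low (r + 1) (Y t none))) (h := h) (B := 1 + c * N)
    (B₀ := 1 + c * ‖Y 0‖) (β := ε * (c * ℓ)) (γ := ε * (D * (3 * κ * (1 + 2 * R) ^ 2))) (ρ := 0)
    (σ := 0) hh (by positivity) (by positivity) (by positivity) (by positivity) le_rfl le_rfl
    ((mulP _).continuous.comp_continuousOn hcont)
    (fun t ht => by
      have h1 := ((mulP (d := d) (fun ξ => (m ξ : ℂ))).restrictScalars ℝ).hasFDerivAt
        |>.comp_hasDerivWithinAt t (hY t (Ico_subset_Icc_self ht)).2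
      exact HasDerivWithinAt.nearDeriv h1 ht)
    (fun t ht x => le_re_inner_symP hS (hco t ht) hh1 (hnc t ht) x)
    (fun t ht x y => inner_symP hS (hco t ht) x y)
    (fun t ht x => norm_symP_le hS ((hco t ht).mono (mul_le_mul_of_nonneg_left (hN t ht) hc))
      hε0 hε1 x)
    (fun x => norm_symP_le hS (hco 0 h0) hε0 hε1 x)
    (fun t ht z hz x => (hsym κ g₁ g₂ Q hS ε (Y z) (Y t) x hε0).trans (by
      have := hlip t ht z hz
      calc _ ≤ ε * (c * (ℓ * |z - t|)) * ‖x‖ := by gcongr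
        _ = _ := by ring))
    (fun t ht => by
      have ht' := Ico_subset_Icc_self ht
      rw [zero_mul, add_zero]
      -- Where the cutoff vanishes the solution is at rest. Elsewhere ‖Y‖ < 2R bounds the constants,
      -- and the factor in [0, 1] multiplies the two-sided energy estimate harmlessly.
      rcases le_or_gt (2 * R) ‖Y t‖ with hYR | hYR
      · rw [theta_eq_zero hR hYR, zero_smul, neg_zero, map_zero, inner_zero_right]
        simp only [Complex.zero_re]
        positivity
      have e1 := hen _ _ _ Q hSn ε hε0 hε1 n (fun ξ hξ => by rw [jn_eq_zero hn hξ, zero_mul])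
        (fun ξ hξ => by rw [jn_eq_zero hn hξ, zero_mul]) m hm (fun ξ => (m ξ : ℂ) * bkn n ξ)
        (hm.isMult.mul (isMult_bkn hn.le)) (fun ξ hξ => by rw [bkn_of_le hξ, Complex.ofReal_mul])
        (Y t) (hherm t ht') (mem_galSub.1 (hY t ht').1).2
      rw [← mulP_mulP hm.isMult (isMult_bkn hn.le)] at e1
      have e2 : mulP (fun ξ => (m ξ : ℂ)) (-(theta R ‖Y t‖ • galF g₁ g₂ Q r ε n (Y t)))
          = ((-theta R ‖Y t‖ : ℝ) : ℂ) • mulP (fun ξ => (m ξ : ℂ)) (galF g₁ g₂ Q r ε n (Y t)) := by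
        rw [map_neg, mulP_smul_real, ← neg_smul]
        exact (algebraMap_smul ℂ (-theta R ‖Y t‖) _).symm
      rw [e2, inner_smul_right, Complex.re_ofReal_mul, neg_mul]
      have e3 := (abs_le.1 e1).1
      have e4 : (1 + ‖Y t‖) ^ 2 ≤ (1 + 2 * R) ^ 2 := by gcongr
      set F := ‖mulP (fun ξ => (m ξ : ℂ)) (Y t)‖ ^ 2 with hF
      have hF0 : 0 ≤ F := sq_nonneg _
      set I := (⟪symP ε Q (low (r + 1) (Y t none)) (mulP (fun ξ => (m ξ : ℂ)) (Y t)),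
        mulP (fun ξ => (m ξ : ℂ)) (galF g₁ g₂ Q r ε n (Y t))⟫_ℂ).re with hI
      have e5 : ε * (D * (3 * κ * (1 + ‖Y t‖) ^ 2 * F)) ≤ ε * (D * (3 * κ * (1 + 2 * R) ^ 2 * F)) := by
        gcongr
      have e6 : -I ≤ ε * (D * (3 * κ * (1 + 2 * R) ^ 2 * F)) := by
        refine le_trans ?_ e5
        have : I = (⟪symP ε Q (low (r + 1) (Y t none)) (mulP (fun ξ => (m ξ : ℂ)) (Y t)),
          mulP (fun ξ => (m ξ : ℂ)) (mulP (bkn n) (quadP (fun ξ => jn n ξ * g₁ ξ)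
            (fun ξ => jn n ξ * g₂ ξ) Q r ε (Y t) (Y t)))⟫_ℂ).re := rfl
        rw [this]
        linarith
      have e7 := mul_le_mul_of_nonneg_left e6 (theta_nonneg R ‖Y t‖)
      have e8 : theta R ‖Y t‖ * (ε * (D * (3 * κ * (1 + 2 * R) ^ 2 * F)))
          ≤ ε * (D * (3 * κ * (1 + 2 * R) ^ 2 * F)) :=
        mul_le_of_le_one_left (by positivity) (theta_le_one _ _)
      linarith) t ht
  refine main.trans ?_
  rw [zero_mul, add_zero, mul_zero, add_zero]
  have hτ : 0 ≤ τ := ht.1.trans ht.2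
  have k0 : (1 + 2 * R) * (2 * R) ≤ (1 + 2 * R) ^ 2 := by nlinarith
  have k1 : ε * (c * ℓ) + 2 * (ε * (D * (3 * κ * (1 + 2 * R) ^ 2)))
      ≤ ε * ((3 * C + (c + c * (3 * C) + 6 * D)) * (κ * (1 + 2 * R) ^ 2)) := by
    have : c * ℓ ≤ c * (3 * C) * (κ * (1 + 2 * R) ^ 2) := by
      rw [hℓ]
      calc _ ≤ c * (C * (3 * κ) * (1 + 2 * R) ^ 2) := by gcongr
        _ = _ := by ring
    have h2 : 0 ≤ (3 * C + c) * (κ * (1 + 2 * R) ^ 2) := by positivity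
    have h3 := mul_le_mul_of_nonneg_left this hε0
    have h4 := mul_nonneg hε0 h2
    nlinarith
  have k2 : c ≤ 3 * C + (c + c * (3 * C) + 6 * D) := by
    have : 0 ≤ 3 * C + c * (3 * C) + 6 * D := by positivity
    linarith
  gcongr

/-- Energy estimate for differences of solutions. -/
lemma exists_diff_energy (d : ℕ) {r : ℝ} (hr : (d : ℝ) < 2 * r) : ∃ A, 0 ≤ A ∧
    ∀ (κ : ℝ) (g₁ g₂ Q : Space d → ℝ), IsSys κ g₁ g₂ Q → ∀ ε τ h N₁ N₂ ℓ σ ρ : ℝ, 0 ≤ ε → ε ≤ 1 →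
    0 < h → h ≤ 1 → 0 ≤ ℓ → 0 ≤ σ → 0 ≤ ρ → ∀ Y V W : ℝ → HH d,
    ContinuousOn (fun t => lowP (Y t - V t)) (Icc 0 τ) →
    (∀ t ∈ Icc 0 τ, HermP (Y t) ∧ ‖Y t‖ ≤ N₁ ∧ ‖V t‖ ≤ N₂ ∧ NonCav r ε h (Y t)) →
    (∀ t ∈ Icc 0 τ, ∀ z ∈ Icc 0 τ, ‖lowP (Y z - Y t)‖ ≤ ℓ * |z - t|) →
    (∀ t ∈ Ico 0 τ, ‖W t‖ ≤ σ ∧ NearDeriv (fun t => lowP (Y t - V t)) t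
      (-(quadP g₁ g₂ Q r ε (Y t) (Y t) - quadP g₁ g₂ Q r ε (V t) (V t)) - W t) ρ) →
    ∀ t ∈ Icc 0 τ, h * ‖lowP (Y t - V t)‖
      ≤ exp (ε * (A * (ℓ + κ * (1 + N₁) ^ 2 * (1 + N₂))) / h * τ)
        * ((1 + A * N₁) * (‖lowP (Y 0 - V 0)‖ + 2 * τ * (σ + ρ))) := by
  obtain ⟨c, hc, hcoef, -, hsym⟩ := exists_coef_bounds d hr
  obtain ⟨D, hD, hen⟩ := exists_energy_low (d := d) hr
  obtain ⟨C, hC, hb⟩ := exists_quadP_bounds d hr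
  refine ⟨c + 2 * D + 2 * (1 + c) * C, by positivity,
    fun κ g₁ g₂ Q hS ε τ h N₁ N₂ ℓ σ ρ hε0 hε1 hh hh1 hℓ hσ hρ Y V W hcont hY hlip hder t ht => ?_⟩
  have hκ := hS.sym₁.nonneg
  obtain ⟨hbil, -⟩ := hb _ _ _ Q hS
  have hN₁ : 0 ≤ N₁ := (norm_nonneg _).trans (hY t ht).2.1
  have hN₂ : 0 ≤ N₂ := (norm_nonneg _).trans (hY t ht).2.2.1
  have h0 : (0 : ℝ) ∈ Icc 0 τ := left_mem_Icc.2 (ht.1.trans ht.2)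
  have hco : ∀ t ∈ Icc 0 τ, IsCoef (c * N₁) (low (r + 1) (Y t none)) := fun t ht =>
    (hcoef _ ((hY t ht).1 none)).mono (mul_le_mul_of_nonneg_left
      ((HH.norm_apply_le _ _).trans (hY t ht).2.1) hc)
  set B := 1 + c * N₁ with hB
  have hB0 : 0 ≤ B := by positivity
  -- In γ, the first term comes from the symmetrized operator acting on the difference, the second
  -- from the product in which the difference is the coefficient and V is differentiated. β is the
  -- speed of the symmetrizer.
  have main := norm_le_of_energy (τ := τ) (f := fun t => lowP (Y t - V t))
    (G := fun t => -(quadP g₁ g₂ Q r ε (Y t) (Y t) - quadP g₁ g₂ Q r ε (V t) (V t)) - W t)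
    (S := fun t => symP ε Q (low (r + 1) (Y t none))) (h := h) (B := B)
    (B₀ := B) (β := ε * (c * ℓ)) (γ := ε * (D * (κ * (1 + N₁) ^ 2) + B * (C * κ * N₂))) (ρ := ρ)
    (σ := B * σ) hh hB0 hB0 (by positivity) (by positivity) hρ (by positivity) hcont
    (fun t ht => (hder t ht).2)
    (fun t ht x => le_re_inner_symP hS (hco t ht) hh1 (hY t ht).2.2.2 x)
    (fun t ht x y => inner_symP hS (hco t ht) x y)
    (fun t ht x => norm_symP_le hS (hco t ht) hε0 hε1 x)
    (fun x => norm_symP_le hS (hco 0 h0) hε0 hε1 x)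
    (fun t ht z hz x => (hsym κ g₁ g₂ Q hS ε (Y z) (Y t) x hε0).trans (by
      have := hlip t ht z hz
      calc _ ≤ ε * (c * (ℓ * |z - t|)) * ‖x‖ := by gcongr
        _ = _ := by ring))
    (fun t ht => by
      have ht' := Ico_subset_Icc_self ht
      obtain ⟨hYh, hYN, hVN, -⟩ := hY t ht'
      obtain ⟨δ, hδ⟩ : ∃ δ, δ = Y t - V t := ⟨_, rfl⟩
      have e0 := quadP_sub (g₁ := g₁) (g₂ := g₂) (Q := Q) hr ε (Y t) (V t)
      rw [← hδ] at e0 ⊢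
      rw [e0]
      obtain ⟨q, hq⟩ : ∃ q, q = quadP g₁ g₂ Q r ε (Y t) δ := ⟨_, rfl⟩
      obtain ⟨b, hbd⟩ : ∃ b, b = bilP g₁ g₂ Q r δ (V t) := ⟨_, rfl⟩
      obtain ⟨x, hx⟩ : ∃ x, x = symP ε Q (low (r + 1) (Y t none)) (lowP δ) := ⟨_, rfl⟩
      obtain ⟨f, hf⟩ : ∃ f, f = ‖lowP δ‖ := ⟨_, rfl⟩
      have hf0 : 0 ≤ f := hf ▸ norm_nonneg _
      have e1 := hen κ g₁ g₂ Q hS ε hε0 hε1 (Y t) δ hYh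
      have e2 : ‖b‖ ≤ C * κ * (f * N₂) := by
        rw [hbd, hf]
        refine (hbil δ (V t)).trans ?_
        gcongr
      have e3 : ‖x‖ ≤ B * f := by
        rw [hx, hf]
        exact norm_symP_le hS (hco t ht') hε0 hε1 _
      rw [← hq, ← hx, ← hf] at e1
      rw [← hq, ← hbd, ← hx, ← hf]
      have e4 : (⟪x, -(q + (ε : ℂ) • b) - W t⟫_ℂ).re
          = -(⟪x, q⟫_ℂ).re - ε * (⟪x, b⟫_ℂ).re - (⟪x, W t⟫_ℂ).re := by
        rw [inner_sub_right, inner_neg_right, inner_add_right, inner_smul_right, Complex.sub_re,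
          Complex.neg_re, Complex.add_re, Complex.re_ofReal_mul]
        ring
      rw [e4]
      have i1 := (abs_le.1 e1).1
      have i2 : -(⟪x, b⟫_ℂ).re ≤ B * f * (C * κ * (f * N₂)) := by
        rw [← Complex.neg_re, ← inner_neg_right]
        refine (re_inner_le_mul _ _).trans ?_
        rw [norm_neg]
        gcongr
      have i3 : -(⟪x, W t⟫_ℂ).re ≤ B * f * σ := by
        rw [← Complex.neg_re, ← inner_neg_right]
        refine (re_inner_le_mul _ _).trans ?_
        rw [norm_neg]
        have := (hder t ht).1
        gcongr
      have i4 : ε * (D * (κ * (1 + ‖Y t‖) ^ 2 * f ^ 2)) ≤ ε * (D * (κ * (1 + N₁) ^ 2 * f ^ 2)) := by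
        gcongr
      have i5 := mul_le_mul_of_nonneg_left i2 hε0
      nlinarith) t ht
  refine main.trans ?_
  have hτ : 0 ≤ τ := ht.1.trans ht.2
  have k1 : ε * (c * ℓ) + 2 * (ε * (D * (κ * (1 + N₁) ^ 2) + B * (C * κ * N₂)))
      ≤ ε * ((c + 2 * D + 2 * (1 + c) * C) * (ℓ + κ * (1 + N₁) ^ 2 * (1 + N₂))) := by
    have j1 : B ≤ (1 + c) * (1 + N₁) ^ 2 := by rw [hB]; nlinarith
    have j2 : B * (C * κ * N₂) ≤ (1 + c) * (1 + N₁) ^ 2 * (C * κ * (1 + N₂)) := by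
      gcongr
      linarith
    have j3 : D * (κ * (1 + N₁) ^ 2) ≤ D * (κ * (1 + N₁) ^ 2 * (1 + N₂)) := by
      have : 0 ≤ D * (κ * (1 + N₁) ^ 2) * N₂ := by positivity
      linarith
    have j4 : 0 ≤ c * (κ * (1 + N₁) ^ 2 * (1 + N₂)) + (2 * D + 2 * (1 + c) * C) * ℓ := by positivity
    have : c * ℓ + 2 * (D * (κ * (1 + N₁) ^ 2) + B * (C * κ * N₂))
        ≤ (c + 2 * D + 2 * (1 + c) * C) * (ℓ + κ * (1 + N₁) ^ 2 * (1 + N₂)) := by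
      linarith
    have := mul_le_mul_of_nonneg_left this hε0
    linarith
  have k2 : B ≤ 1 + (c + 2 * D + 2 * (1 + c) * C) * N₁ := by
    have : 0 ≤ (2 * D + 2 * (1 + c) * C) * N₁ := by positivity
    rw [hB]
    linarith
  have k3 : B * ‖lowP (Y 0 - V 0)‖ + 2 * τ * (B * σ + ρ * B)
      = B * (‖lowP (Y 0 - V 0)‖ + 2 * τ * (σ + ρ)) := by ring
  rw [k3]
  gcongr

/-! ### Tails -/

lemma tendsto_mulL_cut (x : L2 d) :
    Tendsto (fun n : ℕ => ‖mulL (fun ξ => (cut n ξ : ℂ)) x‖) atTop (𝓝 0) := by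
  have hint : Integrable fun ξ => ‖x ξ‖ ^ 2 := by
    have := Lp.memLp x
    rwa [memLp_two_iff_integrable_sq_norm this.1] at this
  -- The index is shifted because a cutoff radius 0 is degenerate.
  have h1 : Tendsto (fun n : ℕ => ∫ ξ, ‖(cut (n + 1 : ℕ) ξ : ℂ) * x ξ‖ ^ 2) atTop (𝓝 (∫ _ : Space d, (0 : ℝ))) := by
    refine tendsto_integral_of_dominated_convergence (fun ξ => ‖x ξ‖ ^ 2) (fun n => ?_) hint
      (fun n => .of_forall fun ξ => ?_) (.of_forall fun ξ => ?_)
    · have hm := (isCut_cut (d := d) (R := (n + 1 : ℕ)) (by positivity)).isMult.1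
      exact ((hm.aestronglyMeasurable.mul (Lp.aestronglyMeasurable x)).norm.pow 2)
    · have hm := (isCut_cut (d := d) (R := (n + 1 : ℕ)) (by positivity)).norm_le ξ
      rw [Real.norm_of_nonneg (by positivity), norm_mul]
      exact pow_le_pow_left₀ (by positivity) (mul_le_of_le_one_left (norm_nonneg _) hm) 2
    · have l1 : Tendsto (fun n : ℕ => (cut (n + 1 : ℕ) ξ : ℝ)) atTop (𝓝 0) := by
        have l2 : Tendsto (fun n : ℕ => ‖ξ‖ / ((n + 1 : ℕ) : ℝ)) atTop (𝓝 0) :=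
          (tendsto_const_div_atTop_nhds_zero_nat ‖ξ‖).comp (tendsto_add_atTop_nat 1)
        refine squeeze_zero (fun n => (isCut_cut (by positivity)).nonneg ξ) (fun n => ?_) l2
        exact min_le_right _ _
      have l3 : Tendsto (fun n : ℕ => ‖(cut (n + 1 : ℕ) ξ : ℂ) * x ξ‖ ^ 2) atTop
          (𝓝 (‖((0 : ℝ) : ℂ) * x ξ‖ ^ 2)) :=
        ((((Complex.continuous_ofReal.tendsto 0).comp l1).mul_const _).norm).pow 2
      simpa using l3
  have h2 : ∀ n : ℕ, ‖mulL (fun ξ => (cut (n + 1 : ℕ) ξ : ℂ)) x‖ ^ 2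
      = ∫ ξ, ‖(cut (n + 1 : ℕ) ξ : ℂ) * x ξ‖ ^ 2 := fun n => by
    rw [norm_sq_eq_integral]
    refine integral_congr_ae ?_
    filter_upwards [coeFn_mulL (isCut_cut (d := d) (R := (n + 1 : ℕ)) (by positivity)).isMult x]
      with ξ e
    rw [e]
  simp_rw [← h2, integral_zero] at h1
  rw [← tendsto_add_atTop_iff_nat 1]
  have h3 := h1.sqrt
  simpa [Real.sqrt_sq] using h3

lemma tendsto_mulP_cut (x : HH d) :
    Tendsto (fun n : ℕ => ‖mulP (fun ξ => (cut n ξ : ℂ)) x‖) atTop (𝓝 0) := by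
  have h1 : Tendsto (fun n : ℕ => ∑ i, ‖mulL (fun ξ => (cut n ξ : ℂ)) (x i)‖) atTop
      (𝓝 (∑ _i : Option (Fin d), (0 : ℝ))) := tendsto_finsetSum _ fun i _ => tendsto_mulL_cut (x i)
  rw [Finset.sum_const_zero] at h1
  exact squeeze_zero (fun _ => norm_nonneg _)
    (fun n => HH.norm_le_sum (mulP (fun ξ => (cut n ξ : ℂ)) x)) h1

lemma isMult_compl_ball (n : ℝ) : IsMult (indicator {ξ : Space d | n < ‖ξ‖} 1) := by
  refine ⟨measurable_one.indicator (measurableSet_lt measurable_const measurable_norm), 1, fun ξ => ?_⟩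
  rw [indicator_apply]
  split_ifs <;> simp

lemma mulP_compl_ball {n : ℝ} (hn : 0 < n) (x : HH d) :
    mulP (indicator {ξ | n < ‖ξ‖} 1) (mulP (fun ξ => (cut n ξ : ℂ)) x)
      = mulP (indicator {ξ | n < ‖ξ‖} 1) x := by
  rw [mulP_mulP (isMult_compl_ball n) (isCut_cut hn).isMult]
  congr 2
  ext ξ
  rw [indicator_apply]
  split_ifs with h
  · rw [cut, min_eq_left ((one_le_div hn).2 (le_of_lt h))]
    simp
  · simp

lemma norm_mulP_compl_ball_le {n : ℝ} (hn : 0 < n) (x : HH d) :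
    ‖mulP (indicator {ξ | n < ‖ξ‖} 1) x‖ ≤ ‖mulP (fun ξ => (cut n ξ : ℂ)) x‖ := by
  rw [← mulP_compl_ball hn]
  refine (norm_mulP_le (isMult_compl_ball n) zero_le_one (fun ξ => ?_) _).trans_eq (one_mul _)
  rw [indicator_apply]
  split_ifs <;> simp

lemma HH.ext_ae {x y : HH d} (h : ∀ i, x i =ᵐ[volume] y i) : x = y := by
  ext1 i
  exact Lp.ext (h i)

lemma sub_mulP_ball (n : ℝ) (x : HH d) :
    x - mulP (indicator {ξ | ‖ξ‖ ≤ n} 1) x = mulP (indicator {ξ | n < ‖ξ‖} 1) x := by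
  refine HH.ext_ae fun i => ?_
  rw [PiLp.sub_apply, mulP_apply, mulP_apply]
  filter_upwards [Lp.coeFn_sub (x i) (mulL (indicator {ξ | ‖ξ‖ ≤ n} 1) (x i)),
    coeFn_mulL (isMult_ball n) (x i), coeFn_mulL (isMult_compl_ball n) (x i)] with ξ e1 e2 e3
  rw [e1, Pi.sub_apply, e2, e3, indicator_apply, indicator_apply]
  rcases le_or_gt ‖ξ‖ n with h | h
  · rw [if_pos (by exact h), if_neg (by simpa using h)]
    simp
  · rw [if_neg (by simpa using h), if_pos (by exact h)]
    simp

/-- Below frequency n the two norms are comparable with constant 1 + 2πn, and above it the cutoff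
equals 1. Lower-norm convergence together with uniformly small tails thus gives convergence in the
top norm. -/
lemma norm_le_low_add_cut {n : ℝ} (hn : 0 < n) (x : HH d) :
    ‖x‖ ≤ (1 + 2 * π * n) * ‖lowP x‖ + ‖mulP (fun ξ => (cut n ξ : ℂ)) x‖ := by
  have e : x = mulP (bkn n) (lowP x) + mulP (indicator {ξ | n < ‖ξ‖} 1) x := by
    rw [← sub_mulP_ball, lowP, mulP_mulP (isMult_bkn hn.le) isMult_wt_neg_one]
    have : (fun ξ : Space d => bkn n ξ * (wt (-1) ξ : ℂ)) = indicator {ξ | ‖ξ‖ ≤ n} 1 := by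
      ext ξ
      rw [indicator_apply]
      split_ifs with h
      · rw [bkn_of_le h, ← wt_one, ← Complex.ofReal_mul, wt_mul_neg]
        simp
      · rw [bkn_of_lt (by simpa using h), zero_mul]
    rw [this]
    abel
  conv_lhs => rw [e]
  exact (norm_add_le _ _).trans (add_le_add
    (norm_mulP_le (isMult_bkn hn.le) (by positivity) (norm_bkn_le hn.le) _)
    (norm_mulP_compl_ball_le hn x))

lemma NonCav.mono {r ε h h' : ℝ} {U : HH d} (H : NonCav r ε h U) (hh : h' ≤ h) : NonCav r ε h' U :=
  fun x => hh.trans (H x)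

/-! ### Uniform bounds for the Galerkin scheme -/

/-- Uniformly bounded solutions of the Galerkin scheme. -/
structure IsGalerkin (g₁ g₂ Q : Space d → ℝ) (r ε h C₀ τ n : ℝ) (Y₀ : HH d) (Y : ℝ → HH d) :
    Prop where
  init : Y 0 = mulP (indicator {ξ | ‖ξ‖ ≤ n} 1) Y₀
  mem : ∀ t ∈ Icc 0 τ, Y t ∈ galSub d n
  deriv : ∀ t ∈ Icc 0 τ, HasDerivWithinAt Y (-galF g₁ g₂ Q r ε n (Y t)) (Icc 0 τ) t
  cut_le : ∀ m : Space d → ℝ, IsCut m → ∀ t ∈ Icc 0 τ,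
    ‖mulP (fun ξ => (m ξ : ℂ)) (Y t)‖ ≤ C₀ * ‖mulP (fun ξ => (m ξ : ℂ)) Y₀‖
  nonCav : ∀ t ∈ Icc 0 τ, NonCav r ε h (Y t)

lemma IsGalerkin.norm_le {g₁ g₂ Q : Space d → ℝ} {r ε h C₀ τ n : ℝ} {Y₀ : HH d} {Y : ℝ → HH d}
    (H : IsGalerkin g₁ g₂ Q r ε h C₀ τ n Y₀ Y) {t : ℝ} (ht : t ∈ Icc 0 τ) :
    ‖Y t‖ ≤ C₀ * ‖Y₀‖ := by
  have h1 : ∀ x : HH d, mulP (fun _ => ((1 : ℝ) : ℂ)) x = x := fun x => by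
    simpa using mulP_one x
  have := H.cut_le _ isCut_one t ht
  rwa [h1, h1] at this

lemma norm_mulP_ball_le (n : ℝ) (x : HH d) : ‖mulP (indicator {ξ | ‖ξ‖ ≤ n} 1) x‖ ≤ ‖x‖ := by
  refine (norm_mulP_le (isMult_ball n) zero_le_one (fun ξ => ?_) _).trans_eq (one_mul _)
  rw [indicator_apply]
  split_ifs <;> simp

/-- No continuity argument is needed. The norm cutoff bounds the speed at regularity s - 1, the
speed bound preserves the depth on [0, T/ε], the depth permits the energy estimate, and the energy
bound shows that the cutoff equals 1 throughout. -/
lemma exists_isGalerkin (d : ℕ) {r : ℝ} (hr : (d : ℝ) < 2 * r) {κ : ℝ} (hκ : 0 ≤ κ) {hmin M : ℝ}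
    (hh : 0 < hmin) (hM : 0 < M) : ∃ T C₀ : ℝ, 0 < T ∧ T ≤ 1 ∧ 0 < C₀ ∧
    ∀ g₁ g₂ Q : Space d → ℝ, IsSys κ g₁ g₂ Q → ∀ ε, 0 < ε → ε ≤ 1 → ∀ Y₀ : HH d, HermP Y₀ →
    ‖Y₀‖ ≤ M → NonCav r ε hmin Y₀ → ∃ n₀ : ℕ, 0 < n₀ ∧ ∀ n : ℕ, n₀ ≤ n → ∃ Y,
      IsGalerkin g₁ g₂ Q r ε (min 1 (hmin / 2)) C₀ (T / ε) n Y₀ Y := by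
  obtain ⟨A, hA, hen⟩ := exists_cut_energy d hr
  obtain ⟨c, hc, -, hcav, -⟩ := exists_coef_bounds d hr
  set h := min 1 (hmin / 2) with hh'
  have h0 : 0 < h := by positivity
  set C₀ := exp 1 * (1 + A * M) / h with hC₀
  have hC₀0 : 0 < C₀ := by positivity
  -- The radius is the bound to be proved, so that the cutoff turns out to be inactive.
  set R := C₀ * M with hR
  have hR0 : 0 < R := by positivity
  set L := A * κ * ((1 + 2 * R) * (2 * R)) with hL
  have hL0 : 0 ≤ L := by positivity
  set Z := A * (κ * (1 + 2 * R) ^ 2) with hZ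
  have hZ0 : 0 ≤ Z := by positivity
  -- The first entry keeps εt ≤ 1 in the stability estimate, the second keeps the Gronwall exponent
  -- at most 1, and the third keeps the loss of depth during [0, T/ε] below hmin/4.
  set T := min 1 (min (h / (Z + 1)) (hmin / (4 * (c * L + 1)))) with hT
  have hT0 : 0 < T := by positivity
  have hT1 : Z * T ≤ h := by
    have : T ≤ h / (Z + 1) := (min_le_right _ _).trans (min_le_left _ _)
    rw [le_div_iff₀ (by positivity)] at this
    nlinarith
  have hT2 : c * (L * T) ≤ hmin / 4 := by
    have : T ≤ hmin / (4 * (c * L + 1)) := (min_le_right _ _).trans (min_le_right _ _)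
    rw [le_div_iff₀ (by positivity)] at this
    nlinarith
  refine ⟨T, C₀, hT0, min_le_left _ _, hC₀0, fun g₁ g₂ Q hS ε hε hε1 Y₀ hY₀ hYM hcav₀ => ?_⟩
  have htail : Tendsto (fun n : ℕ => c * ‖mulP (fun ξ => (cut n ξ : ℂ)) Y₀‖) atTop (𝓝 (c * 0)) :=
    (tendsto_mulP_cut Y₀).const_mul c
  rw [mul_zero] at htail
  -- Truncating the data costs at most another hmin/4 of depth for n ≥ n₀. Only n₀ depends on the
  -- particular data; T and C₀ do not.
  obtain ⟨n₀, hn₀⟩ := eventually_atTop.1 ((htail.eventually_lt_const (u := hmin / 4)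
    (by positivity)).and (eventually_gt_atTop 0))
  refine ⟨n₀, (hn₀ n₀ le_rfl).2, fun n hn => ?_⟩
  obtain ⟨hn1, hn2⟩ := hn₀ n hn
  have hn2' : (0 : ℝ) < n := by exact_mod_cast hn2
  have hτ : 0 ≤ T / ε := by positivity
  have hmem : mulP (indicator {ξ | ‖ξ‖ ≤ (n : ℝ)} 1) Y₀ ∈ galSub d n := by
    rw [mem_galSub]
    refine ⟨fun i => (hY₀ i).mulL (isMult_ball n) fun ξ => ?_, fun i => ?_⟩
    · simp only [indicator_apply, mem_ofPred_eq, norm_neg]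
      split_ifs <;> simp
    · filter_upwards [coeFn_mulL (isMult_ball n) (Y₀ i)] with ξ e h
      rw [mulP_apply, e, indicator_of_notMem (by simpa using h), zero_mul]
  obtain ⟨Y, hY0, hY⟩ := exists_galerkin (τ := T / ε) hr hS hε.le hε1 hn2' hR0 hτ hmem
  obtain ⟨hlip, hbd⟩ := hen κ g₁ g₂ Q hS ε n R (T / ε) h hε.le hε1 hn2' hR0 h0 (min_le_left _ _) Y hY
  have h0τ : (0 : ℝ) ∈ Icc 0 (T / ε) := left_mem_Icc.2 hτ
  -- The factor ε in front of ζ compensates the length T/ε of the interval, so a speed bound of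
  -- order one is enough.
  have hnc : ∀ t ∈ Icc 0 (T / ε), NonCav r ε h (Y t) := by
    intro t ht
    refine (hcav ε hmin Y₀ (Y t) hε.le hcav₀).mono ?_
    have e : Y₀ - Y t = (Y₀ - Y 0) - (Y t - Y 0) := by abel
    have l1 : ‖lowP (Y₀ - Y 0)‖ ≤ ‖mulP (fun ξ => (cut n ξ : ℂ)) Y₀‖ := by
      rw [hY0, sub_mulP_ball]
      exact (norm_lowP_le _).trans (norm_mulP_compl_ball_le hn2' Y₀)
    have l2 : ‖lowP (Y t - Y 0)‖ ≤ L * (T / ε) := by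
      refine (hlip 0 h0τ t ht).trans ?_
      rw [sub_zero, abs_of_nonneg ht.1]
      exact mul_le_mul_of_nonneg_left ht.2 hL0
    have l3 : ‖lowP (Y₀ - Y t)‖ ≤ ‖mulP (fun ξ => (cut n ξ : ℂ)) Y₀‖ + L * (T / ε) := by
      rw [e, map_sub]
      exact (norm_sub_le _ _).trans (add_le_add l1 l2)
    have l4 : ε * (c * ‖lowP (Y₀ - Y t)‖)
        ≤ c * ‖mulP (fun ξ => (cut n ξ : ℂ)) Y₀‖ + c * (L * T) := by
      calc _ ≤ ε * (c * (‖mulP (fun ξ => (cut n ξ : ℂ)) Y₀‖ + L * (T / ε))) := by gcongr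
        _ = ε * (c * ‖mulP (fun ξ => (cut n ξ : ℂ)) Y₀‖) + c * (L * T) := by field_simp
        _ ≤ _ := add_le_add (mul_le_of_le_one_left (mul_nonneg hc (norm_nonneg _)) hε1) le_rfl
    have : h ≤ hmin / 2 := min_le_right _ _
    linarith
  have hcut : ∀ m : Space d → ℝ, IsCut m → ∀ t ∈ Icc 0 (T / ε),
      ‖mulP (fun ξ => (m ξ : ℂ)) (Y t)‖ ≤ C₀ * ‖mulP (fun ξ => (m ξ : ℂ)) Y₀‖ := by
    intro m hm t ht
    have b1 := hbd hnc m hm t ht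
    have b2 : ε * Z / h * (T / ε) ≤ 1 := by
      have : ε * Z / h * (T / ε) = Z * T / h := by field_simp
      rw [this]
      exact (div_le_one h0).2 hT1
    have b3 : ‖Y 0‖ ≤ M := by rw [hY0]; exact (norm_mulP_ball_le _ _).trans hYM
    have b4 : ‖mulP (fun ξ => (m ξ : ℂ)) (Y 0)‖ ≤ ‖mulP (fun ξ => (m ξ : ℂ)) Y₀‖ := by
      rw [hY0, mulP_comm hm.isMult (isMult_ball _)]
      exact norm_mulP_ball_le _ _
    have b5 : h * ‖mulP (fun ξ => (m ξ : ℂ)) (Y t)‖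
        ≤ exp 1 * ((1 + A * M) * ‖mulP (fun ξ => (m ξ : ℂ)) Y₀‖) :=
      b1.trans (by gcongr)
    have b6 : C₀ * ‖mulP (fun ξ => (m ξ : ℂ)) Y₀‖
        = exp 1 * ((1 + A * M) * ‖mulP (fun ξ => (m ξ : ℂ)) Y₀‖) / h := by
      rw [hC₀]; ring
    rw [b6, le_div_iff₀ h0]
    linarith
  have hnorm : ∀ t ∈ Icc 0 (T / ε), ‖Y t‖ ≤ R := by
    intro t ht
    have h1 : ∀ x : HH d, mulP (fun _ => ((1 : ℝ) : ℂ)) x = x := fun x => by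
      simpa using mulP_one x
    have := hcut _ isCut_one t ht
    rw [h1, h1] at this
    exact this.trans (mul_le_mul_of_nonneg_left hYM hC₀0.le)
  refine ⟨Y, hY0, fun t ht => (hY t ht).1, fun t ht => ?_, hcut, hnc⟩
  have := (hY t ht).2
  rwa [theta_eq_one hR0 (hnorm t ht), one_smul] at this

/-! ### Existence of solutions -/

/-- Solutions of the system in terms of weighted Fourier transforms. -/
structure IsSol (g₁ g₂ Q : Space d → ℝ) (r ε h C₀ τ : ℝ) (Y₀ : HH d) (Y : ℝ → HH d) : Prop where
  init : Y 0 = Y₀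
  cont : ContinuousOn Y (Icc 0 τ)
  herm : ∀ t ∈ Icc 0 τ, HermP (Y t)
  norm_le : ∀ t ∈ Icc 0 τ, ‖Y t‖ ≤ C₀ * ‖Y₀‖
  nonCav : ∀ t ∈ Icc 0 τ, NonCav r ε h (Y t)
  deriv : ∀ t ∈ Icc 0 τ, HasDerivWithinAt (fun t => lowP (Y t))
    (-quadP g₁ g₂ Q r ε (Y t) (Y t)) (Icc 0 τ) t

/-! ### Comparison of approximate solutions. -/

section

variable {r ε h C₀ τ κ : ℝ} {g₁ g₂ Q : Space d → ℝ} {Y₀ : HH d}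

lemma mulP_jn {n : ℝ} (hn : 0 < n) (x : HH d) :
    mulP (fun ξ => (jn n ξ : ℂ)) x = x - mulP (fun ξ => (cut n ξ : ℂ)) x := by
  refine HH.ext_ae fun i => ?_
  rw [PiLp.sub_apply, mulP_apply, mulP_apply]
  filter_upwards [Lp.coeFn_sub (x i) (mulL (fun ξ => (cut n ξ : ℂ)) (x i)),
    coeFn_mulL (isMult_jn hn) (x i), coeFn_mulL (isCut_cut hn).isMult (x i)] with ξ e1 e2 e3
  rw [e1, Pi.sub_apply, e2, e3, jn]
  push_cast
  ring

/-- Consistency: at the lower level the truncated field is the true one minus its high-frequency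
part, since the bracket and its inverse cancel on the ball. -/
lemma lowP_galF (hS : IsSys κ g₁ g₂ Q) {n : ℝ} (hn : 0 < n) (U : HH d) :
    lowP (galF g₁ g₂ Q r ε n U) = quadP g₁ g₂ Q r ε U U
      - mulP (fun ξ => (cut n ξ : ℂ)) (quadP g₁ g₂ Q r ε U U) := by
  rw [galF, quadP_mul (isMult_jn hn) hS, ← mulP_jn hn, lowP,
    mulP_mulP (isMult_bkn hn.le) (isMult_jn hn),
    mulP_mulP isMult_wt_neg_one ((isMult_bkn hn.le).mul (isMult_jn hn))]
  congr 2
  ext ξ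
  rcases le_or_gt ‖ξ‖ n with h | h
  · rw [bkn_of_le h, ← wt_one, ← mul_assoc, ← Complex.ofReal_mul, mul_comm (wt (-1) ξ), wt_mul_neg]
    simp
  · rw [jn_eq_zero hn h]
    simp

lemma IsGalerkin.continuousOn {n : ℝ} {Y : ℝ → HH d}
    (H : IsGalerkin g₁ g₂ Q r ε h C₀ τ n Y₀ Y) : ContinuousOn Y (Icc 0 τ) :=
  fun t ht => (H.deriv t ht).continuousWithinAt

lemma IsGalerkin.deriv_low (hS : IsSys κ g₁ g₂ Q) {n : ℝ} (hn : 0 < n) {Y : ℝ → HH d}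
    (H : IsGalerkin g₁ g₂ Q r ε h C₀ τ n Y₀ Y) {t : ℝ} (ht : t ∈ Icc 0 τ) :
    HasDerivWithinAt (fun t => lowP (Y t)) (-(quadP g₁ g₂ Q r ε (Y t) (Y t)
      - mulP (fun ξ => (cut n ξ : ℂ)) (quadP g₁ g₂ Q r ε (Y t) (Y t)))) (Icc 0 τ) t := by
  have h1 := ((lowP (d := d)).restrictScalars ℝ).hasFDerivAt.comp_hasDerivWithinAt t (H.deriv t ht)
  have e : ((lowP (d := d)).restrictScalars ℝ) (-galF g₁ g₂ Q r ε n (Y t))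
      = -(quadP g₁ g₂ Q r ε (Y t) (Y t)
        - mulP (fun ξ => (cut n ξ : ℂ)) (quadP g₁ g₂ Q r ε (Y t) (Y t))) := by
    rw [← lowP_galF hS hn]
    exact map_neg _ _
  rw [e] at h1
  exact h1

lemma exists_galerkin_cut_le (d : ℕ) {r : ℝ} (hr : (d : ℝ) < 2 * r) : ∃ C, 0 ≤ C ∧
    ∀ (κ ε h C₀ τ n : ℝ) (g₁ g₂ Q : Space d → ℝ) (Y₀ : HH d) (Y : ℝ → HH d), IsSys κ g₁ g₂ Q →
    0 ≤ ε → ε ≤ 1 → 0 ≤ C₀ → IsGalerkin g₁ g₂ Q r ε h C₀ τ n Y₀ Y → ∀ R : ℝ, 0 < R →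
    ∀ t ∈ Icc 0 τ, ‖mulP (fun ξ => (cut R ξ : ℂ)) (quadP g₁ g₂ Q r ε (Y t) (Y t))‖
      ≤ C * κ * (1 + C₀ * ‖Y₀‖) * C₀ * ‖mulP (fun ξ => (cut R ξ : ℂ)) Y₀‖ := by
  obtain ⟨C, hC, hb⟩ := exists_quadP_bounds d hr
  refine ⟨C, hC, fun κ ε h C₀ τ n g₁ g₂ Q Y₀ Y hS hε0 hε1 hC₀ H R hR t ht => ?_⟩
  have hκ := hS.sym₁.nonneg
  refine (((hb κ g₁ g₂ Q hS).2 ε hε0 hε1).1 _ (isCut_cut hR) (Y t)).trans ?_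
  have h1 := H.norm_le ht
  have h2 := H.cut_le _ (isCut_cut hR) t ht
  calc _ ≤ C * κ * ((1 + C₀ * ‖Y₀‖) * (C₀ * ‖mulP (fun ξ => (cut R ξ : ℂ)) Y₀‖)) := by gcongr
    _ = _ := by ring

-- The m-th approximation is regarded as an approximate solution of the n-th system. Its residual is
-- a difference of high-frequency parts of the field, which `exists_galerkin_cut_le` bounds by tails
-- of the data; the difference of the initial values is bounded in the same way.
set_option maxHeartbeats 1000000 in
lemma exists_galerkin_diff_le (hr : (d : ℝ) < 2 * r) (hS : IsSys κ g₁ g₂ Q) (hε0 : 0 ≤ ε)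
    (hε1 : ε ≤ 1) (hh : 0 < h) (hh1 : h ≤ 1) (hC₀ : 0 ≤ C₀) : ∃ B, 0 ≤ B ∧
    ∀ (n m : ℝ) (Y V : ℝ → HH d), 0 < n → 0 < m → IsGalerkin g₁ g₂ Q r ε h C₀ τ n Y₀ Y →
    IsGalerkin g₁ g₂ Q r ε h C₀ τ m Y₀ V → ∀ t ∈ Icc 0 τ, ‖lowP (Y t - V t)‖
      ≤ B * (‖mulP (fun ξ => (cut n ξ : ℂ)) Y₀‖ + ‖mulP (fun ξ => (cut m ξ : ℂ)) Y₀‖) := by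
  obtain ⟨A, hA, hdiff⟩ := exists_diff_energy d hr
  obtain ⟨C, hC, hb⟩ := exists_quadP_bounds d hr
  obtain ⟨C', hC', hcut⟩ := exists_galerkin_cut_le d hr
  have hκ := hS.sym₁.nonneg
  obtain ⟨N, hN⟩ : ∃ N, N = C₀ * ‖Y₀‖ := ⟨_, rfl⟩
  have hN0 : 0 ≤ N := hN ▸ mul_nonneg hC₀ (norm_nonneg _)
  obtain ⟨ℓ, hℓ⟩ : ∃ ℓ, ℓ = C * (3 * κ) * ((1 + N) * N) := ⟨_, rfl⟩
  have hℓ0 : 0 ≤ ℓ := by rw [hℓ]; positivity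
  obtain ⟨E, hE⟩ : ∃ E, E = exp (ε * (A * (ℓ + 3 * κ * (1 + N) ^ 2 * (1 + N))) / h * τ) := ⟨_, rfl⟩
  have hE0 : 0 < E := hE ▸ exp_pos _
  obtain ⟨D, hD⟩ : ∃ D, D = C' * κ * (1 + N) * C₀ := ⟨_, rfl⟩
  have hD0 : 0 ≤ D := by rw [hD]; positivity
  have hYN : ∀ {n : ℝ} {Y : ℝ → HH d}, IsGalerkin g₁ g₂ Q r ε h C₀ τ n Y₀ Y → ∀ t ∈ Icc 0 τ,
      ‖Y t‖ ≤ N := fun H t ht => by rw [hN]; exact H.norm_le ht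
  have hYD : ∀ {n : ℝ} {Y : ℝ → HH d}, IsGalerkin g₁ g₂ Q r ε h C₀ τ n Y₀ Y → ∀ R : ℝ, 0 < R →
      ∀ t ∈ Icc 0 τ, ‖mulP (fun ξ => (cut R ξ : ℂ)) (quadP g₁ g₂ Q r ε (Y t) (Y t))‖
        ≤ D * ‖mulP (fun ξ => (cut R ξ : ℂ)) Y₀‖ := fun {n Y} H R hR t ht => by
    rw [hD, hN]
    exact hcut κ ε h C₀ τ n g₁ g₂ Q Y₀ Y hS hε0 hε1 hC₀ H R hR t ht
  have hYℓ : ∀ {n : ℝ}, 0 < n → ∀ y : HH d, ‖y‖ ≤ N → ‖-quadP (fun ξ => jn n ξ * g₁ ξ)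
      (fun ξ => jn n ξ * g₂ ξ) Q r ε y y‖ ≤ ℓ := fun {n} hn y hy => by
    rw [norm_neg, hℓ]
    exact (((hb _ _ _ Q (hS.jn_mul hn)).2 ε hε0 hε1).2.1 y).trans (mul_le_mul_of_nonneg_left
      (mul_le_mul (add_le_add le_rfl hy) hy (norm_nonneg _) (by linarith)) (by positivity))
  clear hb hcut
  have hAN : 0 ≤ 1 + A * N := by positivity
  refine ⟨E * ((1 + A * N) * (1 + 2 * |τ| * D)) / h, by positivity,
    fun n m Y V hn hm HY HV t ht => ?_⟩
  have hτ : 0 ≤ τ := ht.1.trans ht.2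
  have hd1 : ∀ t ∈ Icc 0 τ, HasDerivWithinAt (fun t => lowP (Y t))
      (-quadP (fun ξ => jn n ξ * g₁ ξ) (fun ξ => jn n ξ * g₂ ξ) Q r ε (Y t) (Y t)) (Icc 0 τ) t := by
    intro t ht
    have := HY.deriv_low hS hn ht
    rwa [← mulP_jn hn, ← quadP_mul (isMult_jn hn) hS] at this
  obtain ⟨a, ha⟩ : ∃ a, a = ‖mulP (fun ξ => (cut n ξ : ℂ)) Y₀‖ := ⟨_, rfl⟩
  obtain ⟨b, hb⟩ : ∃ b, b = ‖mulP (fun ξ => (cut m ξ : ℂ)) Y₀‖ := ⟨_, rfl⟩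
  have ha0 : 0 ≤ a := ha ▸ norm_nonneg _
  have hb0 : 0 ≤ b := hb ▸ norm_nonneg _
  rw [← ha, ← hb]
  have main := hdiff (3 * κ) _ _ Q (hS.jn_mul hn) ε τ h N N ℓ (D * (a + b)) 0 hε0 hε1 hh hh1 hℓ0
    (mul_nonneg hD0 (add_nonneg ha0 hb0)) le_rfl Y V
    (fun t => quadP (fun ξ => jn n ξ * g₁ ξ) (fun ξ => jn n ξ * g₂ ξ) Q r ε (V t) (V t)
      - (quadP g₁ g₂ Q r ε (V t) (V t)
        - mulP (fun ξ => (cut m ξ : ℂ)) (quadP g₁ g₂ Q r ε (V t) (V t))))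
    (lowP.continuous.comp_continuousOn (HY.continuousOn.sub HV.continuousOn))
    (fun t ht => ⟨(mem_galSub.1 (HY.mem t ht)).1, hYN HY t ht, hYN HV t ht, HY.nonCav t ht⟩)
    (fun t ht z hz => by
      rw [map_sub]
      exact (convex_Icc 0 τ).norm_image_sub_le_of_norm_hasDerivWithin_le (f := fun t => lowP (Y t))
        (fun x hx => hd1 x hx) (fun x hx => hYℓ hn _ (hYN HY x hx)) ht hz)
    (fun t ht => by
      have ht' := Ico_subset_Icc_self ht
      refine ⟨?_, ?_⟩
      · rw [quadP_mul (isMult_jn hn) hS, mulP_jn hn, sub_sub_sub_cancel_left, mul_add, add_comm,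
          ha, hb]
        exact (norm_sub_le _ _).trans (add_le_add (hYD HV m hm t ht') (hYD HV n hn t ht'))
      · have h1 := (hd1 t ht').sub (HV.deriv_low hS hm ht')
        have h2 := HasDerivWithinAt.nearDeriv h1 ht
        have e1 : (fun t => lowP (Y t - V t)) = (fun t => lowP (Y t)) - fun t => lowP (V t) := by
          ext1 t
          exact map_sub _ _ _
        rw [e1]
        convert h2 using 1
        abel) t ht
  rw [← hE] at main
  have i0 : ‖lowP (Y 0 - V 0)‖ ≤ a + b := by
    have e : Y 0 - V 0 = mulP (indicator {ξ | m < ‖ξ‖} 1) Y₀ - mulP (indicator {ξ | n < ‖ξ‖} 1) Y₀ := by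
      rw [HY.init, HV.init, ← sub_mulP_ball, ← sub_mulP_ball]
      abel
    rw [e, add_comm, ha, hb]
    exact (norm_lowP_le _).trans ((norm_sub_le _ _).trans (add_le_add
      (norm_mulP_compl_ball_le hm _) (norm_mulP_compl_ball_le hn _)))
  rw [div_mul_eq_mul_div, le_div_iff₀ hh, mul_comm]
  refine main.trans ?_
  rw [abs_of_nonneg hτ, add_zero, mul_assoc E]
  refine mul_le_mul_of_nonneg_left ?_ hE0.le
  rw [mul_assoc (1 + A * N) (1 + 2 * τ * D)]
  refine mul_le_mul_of_nonneg_left ?_ hAN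
  linarith

end

lemma continuous_quadP {r : ℝ} (hr : (d : ℝ) < 2 * r) {κ ε : ℝ} {g₁ g₂ Q : Space d → ℝ}
    (hS : IsSys κ g₁ g₂ Q) (hε0 : 0 ≤ ε) (hε1 : ε ≤ 1) :
    Continuous fun U : HH d => quadP g₁ g₂ Q r ε U U := by
  obtain ⟨C, hC, hb⟩ := exists_quadP_bounds d hr
  have hb2 := ((hb κ g₁ g₂ Q hS).2 ε hε0 hε1).2.2
  rw [continuous_iff_continuousAt]
  intro U
  rw [ContinuousAt, tendsto_iff_norm_sub_tendsto_zero]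
  have l1 : Tendsto (fun V : HH d => C * κ * ((1 + ‖V‖ + ‖U‖) * ‖V - U‖)) (𝓝 U)
      (𝓝 (C * κ * ((1 + ‖U‖ + ‖U‖) * ‖U - U‖))) := Continuous.tendsto (by fun_prop) U
  rw [sub_self, norm_zero, mul_zero, mul_zero] at l1
  exact squeeze_zero (fun _ => norm_nonneg _) (fun V => hb2 V U) l1

/-- Uniform convergence at regularity s, rather than weak compactness, yields continuity in time in
the top norm directly. The equation is then identified one level lower, where the operator is
continuous. -/
theorem exists_isSol (d : ℕ) {r : ℝ} (hr : (d : ℝ) < 2 * r) {κ : ℝ} (hκ : 0 ≤ κ) {hmin M : ℝ}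
    (hh : 0 < hmin) (hM : 0 < M) : ∃ T C₀ : ℝ, 0 < T ∧ T ≤ 1 ∧ 0 < C₀ ∧
    ∀ g₁ g₂ Q : Space d → ℝ, IsSys κ g₁ g₂ Q → ∀ ε, 0 < ε → ε ≤ 1 → ∀ Y₀ : HH d, HermP Y₀ →
    ‖Y₀‖ ≤ M → NonCav r ε hmin Y₀ → ∃ Y,
      IsSol g₁ g₂ Q r ε (min 1 (hmin / 2)) C₀ (T / ε) Y₀ Y := by
  obtain ⟨T, C₀, hT, hT1, hC₀, hgal⟩ := exists_isGalerkin d hr hκ hh hM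
  refine ⟨T, C₀, hT, hT1, hC₀, fun g₁ g₂ Q hS ε hε hε1 Y₀ hY₀ hYM hcav₀ => ?_⟩
  obtain ⟨n₀, hn₀, hex⟩ := hgal g₁ g₂ Q hS ε hε hε1 Y₀ hY₀ hYM hcav₀
  choose! Y hY using hex
  set h := min 1 (hmin / 2) with hh'
  have h0 : 0 < h := by positivity
  obtain ⟨B, hB, hdiff⟩ := exists_galerkin_diff_le (τ := T / ε) (Y₀ := Y₀) hr hS hε.le hε1 h0
    (min_le_left _ _) hC₀.le
  obtain ⟨C, hC, hb⟩ := exists_quadP_bounds d hr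
  obtain ⟨C', hC', hcut⟩ := exists_galerkin_cut_le d hr
  set τ := T / ε with hτdef
  have hτ : 0 ≤ τ := by positivity
  have h0τ : (0 : ℝ) ∈ Icc 0 τ := left_mem_Icc.2 hτ
  have hpos : ∀ {n : ℕ}, n₀ ≤ n → (0 : ℝ) < n := fun hn => by exact_mod_cast hn₀.trans_le hn
  set a : ℕ → ℝ := fun n => ‖mulP (fun ξ => (cut n ξ : ℂ)) Y₀‖ with ha
  have hta : Tendsto a atTop (𝓝 0) := tendsto_mulP_cut Y₀
  -- First R is chosen to make the tails of the data small, then n and m are taken large to beat the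
  -- factor 1 + 2πR.
  have hest : ∀ R n m : ℕ, n₀ ≤ R → n₀ ≤ n → n₀ ≤ m → ∀ t ∈ Icc 0 τ, ‖Y n t - Y m t‖
      ≤ (1 + 2 * π * R) * (B * (a n + a m)) + 2 * C₀ * a R := by
    intro R n m hR hn hm t ht
    refine (norm_le_low_add_cut (hpos hR) _).trans (add_le_add (mul_le_mul_of_nonneg_left
      (hdiff n m _ _ (hpos hn) (hpos hm) (hY n hn) (hY m hm) t ht) (by positivity)) ?_)
    rw [map_sub]
    refine (norm_sub_le _ _).trans ?_
    have e1 := (hY n hn).cut_le _ (isCut_cut (hpos hR)) t ht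
    have e2 := (hY m hm).cut_le _ (isCut_cut (hpos hR)) t ht
    simp only [ha]
    linarith
  have hcauchy : UniformCauchySeqOn Y atTop (Icc 0 τ) := by
    rw [Metric.uniformCauchySeqOn_iff]
    intro δ hδ
    have l1 : Tendsto (fun R => 2 * C₀ * a R) atTop (𝓝 (2 * C₀ * 0)) := hta.const_mul _
    rw [mul_zero] at l1
    obtain ⟨R, hR1, hR2⟩ := ((l1.eventually_lt_const (u := δ / 2) (by positivity)).and
      (eventually_ge_atTop n₀)).exists
    have l2 : Tendsto (fun n => (1 + 2 * π * R) * (B * a n)) atTop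
        (𝓝 ((1 + 2 * π * R) * (B * 0))) := (hta.const_mul _).const_mul _
    rw [mul_zero, mul_zero] at l2
    obtain ⟨N, hN⟩ := eventually_atTop.1 ((l2.eventually_lt_const (u := δ / 4) (by positivity)).and
      (eventually_ge_atTop n₀))
    refine ⟨N, fun n hn m hm t ht => ?_⟩
    rw [dist_eq_norm]
    refine (hest R n m hR2 (hN n hn).2 (hN m hm).2 t ht).trans_lt ?_
    have := (hN n hn).1
    have := (hN m hm).1
    linarith
  have hlim : ∀ t ∈ Icc 0 τ, ∃ y, Tendsto (fun n => Y n t) atTop (𝓝 y) := fun t ht =>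
    cauchySeq_tendsto_of_complete (hcauchy.cauchySeq ht)
  choose! Z hZ using hlim
  have hunif : TendstoUniformlyOn Y Z atTop (Icc 0 τ) :=
    hcauchy.tendstoUniformlyOn_of_tendsto hZ
  have hZc : ContinuousOn Z (Icc 0 τ) := hunif.continuousOn (Eventually.frequently (by
    filter_upwards [eventually_ge_atTop n₀] with n hn using (hY n hn).continuousOn))
  set N := C₀ * ‖Y₀‖ with hN
  have hN0 : 0 ≤ N := by positivity
  have hZN : ∀ t ∈ Icc 0 τ, ‖Z t‖ ≤ N := fun t ht => le_of_tendsto (hZ t ht).norm (by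
    filter_upwards [eventually_ge_atTop n₀] with n hn using (hY n hn).norm_le ht)
  have hZ0 : Z 0 = Y₀ := by
    refine tendsto_nhds_unique (hZ 0 h0τ) ?_
    rw [tendsto_iff_norm_sub_tendsto_zero]
    refine squeeze_zero' (.of_forall fun _ => norm_nonneg _) ?_ hta
    filter_upwards [eventually_ge_atTop n₀] with n hn
    rw [(hY n hn).init, norm_sub_rev, sub_mulP_ball]
    exact norm_mulP_compl_ball_le (hpos hn) Y₀
  obtain ⟨c, hc, -, hcav, -⟩ := exists_coef_bounds d hr
  have hqc : ContinuousOn (fun t => -quadP g₁ g₂ Q r ε (Z t) (Z t)) (Icc 0 τ) :=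
    ((continuous_quadP hr hS hε.le hε1).comp_continuousOn hZc).neg
  -- P is the time integral of the limiting field. It has the right derivative by construction, and
  -- it remains to show that it equals `lowP` of the limit.
  set P : ℝ → HH d := ODE.picard (fun _ U => -quadP g₁ g₂ Q r ε U U) 0 (lowP Y₀) Z with hP
  have hPd : ∀ t ∈ Icc 0 τ, HasDerivWithinAt P (-quadP g₁ g₂ Q r ε (Z t) (Z t)) (Icc 0 τ) t :=
    fun t ht => ODE.hasDerivWithinAt_picard_Icc (f := fun _ U => -quadP g₁ g₂ Q r ε U U)
      (u := univ) h0τ (((continuous_quadP hr hS hε.le hε1).neg.comp continuous_snd).continuousOn)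
      hZc (fun _ _ => mem_univ _) _ ht
  have hPe : ∀ t ∈ Icc 0 τ, P t = lowP (Z t) := by
    intro t ht
    -- For large n the derivative of `lowP (Y n) - P` is at most δ in norm: half from the truncated
    -- part of the field, half from the Lipschitz bound and uniform convergence. The mean value
    -- inequality is then passed to the limit.
    have key : ∀ δ > 0, ‖lowP (Z t) - P t‖ ≤ 0 + δ * τ := by
      intro δ hδ
      have hκ := hS.sym₁.nonneg
      have l3 : Tendsto (fun n => ‖(lowP (Y n t) - P t) - (lowP (Y n 0) - P 0)‖) atTop
          (𝓝 ‖(lowP (Z t) - P t) - (lowP (Z 0) - P 0)‖) :=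
        ((((lowP.continuous.tendsto _).comp (hZ t ht)).sub_const _).sub
          (((lowP.continuous.tendsto _).comp (hZ 0 h0τ)).sub_const _)).norm
      have e0 : lowP (Z 0) - P 0 = 0 := by
        rw [hZ0, hP, ODE.picard_apply₀, sub_self]
      rw [e0, sub_zero] at l3
      rw [zero_add]
      have l4 : Tendsto (fun n => C' * κ * (1 + N) * C₀ * a n) atTop
          (𝓝 (C' * κ * (1 + N) * C₀ * 0)) := hta.const_mul _
      rw [mul_zero] at l4
      set G := C * κ * (1 + N + N) + 1 with hG
      have hG0 : 0 < G := by positivity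
      refine le_of_tendsto l3 ?_
      filter_upwards [eventually_ge_atTop n₀, l4.eventually_lt_const (u := δ / 2) (by positivity),
        Metric.tendstoUniformlyOn_iff.1 hunif (δ / (2 * G)) (by positivity)] with n hn hn1 hn2
      have hder : ∀ s ∈ Icc 0 τ, HasDerivWithinAt (fun s => lowP (Y n s) - P s)
          (-(quadP g₁ g₂ Q r ε (Y n s) (Y n s)
            - mulP (fun ξ => (cut n ξ : ℂ)) (quadP g₁ g₂ Q r ε (Y n s) (Y n s)))
            - -quadP g₁ g₂ Q r ε (Z s) (Z s)) (Icc 0 τ) s := fun s hs =>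
        ((hY n hn).deriv_low hS (hpos hn) hs).sub (hPd s hs)
      have := (convex_Icc 0 τ).norm_image_sub_le_of_norm_hasDerivWithin_le hder (C := δ)
        (fun s hs => by
          have e1 : -(quadP g₁ g₂ Q r ε (Y n s) (Y n s)
            - mulP (fun ξ => (cut n ξ : ℂ)) (quadP g₁ g₂ Q r ε (Y n s) (Y n s)))
            - -quadP g₁ g₂ Q r ε (Z s) (Z s)
            = (quadP g₁ g₂ Q r ε (Z s) (Z s) - quadP g₁ g₂ Q r ε (Y n s) (Y n s))
              + mulP (fun ξ => (cut n ξ : ℂ)) (quadP g₁ g₂ Q r ε (Y n s) (Y n s)) := by abel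
          rw [e1]
          refine (norm_add_le _ _).trans ?_
          have b1 := hcut κ ε h C₀ τ n g₁ g₂ Q Y₀ (Y n) hS hε.le hε1 hC₀.le (hY n hn) n (hpos hn) s hs
          have b2 := ((hb κ g₁ g₂ Q hS).2 ε hε.le hε1).2.2 (Z s) (Y n s)
          have b3 := hn2 s hs
          rw [dist_eq_norm, lt_div_iff₀ (by positivity)] at b3
          have b4 : C * κ * ((1 + ‖Z s‖ + ‖Y n s‖) * ‖Z s - Y n s‖) ≤ G * ‖Z s - Y n s‖ := by
            rw [← mul_assoc]
            refine mul_le_mul_of_nonneg_right ?_ (norm_nonneg _)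
            have c1 := hZN s hs
            have c2 := (hY n hn).norm_le hs
            have : C * κ * (1 + ‖Z s‖ + ‖Y n s‖) ≤ C * κ * (1 + N + N) := by gcongr
            linarith
          have b5 : C' * κ * (1 + N) * C₀ * ‖mulP (fun ξ => (cut n ξ : ℂ)) Y₀‖ < δ / 2 := hn1
          linarith) h0τ ht
      refine this.trans ?_
      rw [sub_zero, Real.norm_of_nonneg ht.1]
      exact mul_le_mul_of_nonneg_left ht.2 hδ.le
    have hz : ‖lowP (Z t) - P t‖ ≤ 0 := by
      refine le_of_forall_pos_le_add fun δ hδ => (key (δ / (τ + 1)) (by positivity)).trans ?_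
      rw [div_mul_eq_mul_div, zero_add, zero_add, div_le_iff₀ (by positivity)]
      nlinarith
    exact (sub_eq_zero.1 (norm_le_zero_iff.1 hz)).symm
  refine ⟨Z, hZ0, hZc, fun t ht i => ?_, hZN, fun t ht x => ?_, fun t ht => ?_⟩
  · rw [herm_iff]
    have l1 : Tendsto (fun n => Y n t i) atTop (𝓝 (Z t i)) :=
      ((PiLp.continuous_apply 2 _ i).tendsto _).comp (hZ t ht)
    have l2 : Tendsto (fun n => conjL (Y n t i)) atTop (𝓝 (conjL (Z t i))) :=
      (conjL.continuous.tendsto _).comp l1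
    refine tendsto_nhds_unique l2 (l1.congr' ?_)
    filter_upwards [eventually_ge_atTop n₀] with n hn
    exact (herm_iff.1 ((mem_galSub.1 ((hY n hn).mem t ht)).1 i)).symm
  -- The depth bound is stable under small changes at the lower level, with a loss that tends to 0.
  · have l1 : Tendsto (fun n => h - ε * (c * ‖lowP (Y n t - Z t)‖)) atTop
        (𝓝 (h - ε * (c * ‖lowP (Z t - Z t)‖))) :=
      ((((lowP.continuous.tendsto _).comp ((hZ t ht).sub_const (Z t))).norm.const_mul c).const_mul
        ε).const_sub h
    rw [sub_self, map_zero, norm_zero, mul_zero, mul_zero, sub_zero] at l1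
    refine le_of_tendsto l1 ?_
    filter_upwards [eventually_ge_atTop n₀] with n hn
    exact hcav ε h (Y n t) (Z t) hε.le ((hY n hn).nonCav t ht) x
  · exact (hPd t ht).congr (fun s hs => (hPe s hs).symm) (hPe t ht).symm

/-! ### Density of compactly supported test functions -/

/-- A smooth function with compact support, as a complex-valued test function. -/
def testFn {g : Space d → ℝ} (hg : ContDiff ℝ (⊤ : ℕ∞) g) (hc : HasCompactSupport g) : 𝓢(Space d, ℂ) :=
  (show HasCompactSupport (Complex.ofRealCLM ∘ g) from hc.comp_left rfl).toSchwartzMap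
    (Complex.ofRealCLM.contDiff.comp hg)

lemma testFn_apply {g : Space d → ℝ} (hg : ContDiff ℝ (⊤ : ℕ∞) g) (hc : HasCompactSupport g)
    (x : Space d) : testFn hg hc x = (g x : ℂ) := rfl

lemma hasCompactSupport_testFn {g : Space d → ℝ} (hg : ContDiff ℝ (⊤ : ℕ∞) g)
    (hc : HasCompactSupport g) : HasCompactSupport (testFn hg hc) :=
  (show HasCompactSupport (Complex.ofRealCLM ∘ g) from hc.comp_left rfl)

/-- A plateau function on the unit ball. -/
def plateau (d : ℕ) : ContDiffBump (0 : Space d) := ⟨1, 2, one_pos, one_lt_two⟩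

lemma hasCompactSupport_plateau : HasCompactSupport (plateau d) := (plateau d).hasCompactSupport

/-- The dilation by `1 / (n + 1)`. -/
def dilation (d n : ℕ) : Space d →L[ℝ] Space d := ((n + 1 : ℝ)⁻¹) • ContinuousLinearMap.id ℝ _

lemma dilation_apply (n : ℕ) (x : Space d) : dilation d n x = ((n + 1 : ℝ)⁻¹) • x := rfl

lemma norm_dilation_le (n : ℕ) : ‖dilation d n‖ ≤ 1 := by
  refine ContinuousLinearMap.opNorm_le_bound _ zero_le_one fun x => ?_
  rw [dilation_apply, norm_smul, norm_inv, Real.norm_of_nonneg (by positivity)]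
  gcongr
  rw [inv_le_one₀ (by positivity)]
  linarith [(n.cast_nonneg : (0 : ℝ) ≤ n)]

lemma contDiff_dilated (n : ℕ) : ContDiff ℝ (⊤ : ℕ∞) (plateau d ∘ dilation d n) :=
  (plateau d).contDiff.comp (dilation d n).contDiff

lemma hasCompactSupport_dilated (n : ℕ) : HasCompactSupport (plateau d ∘ dilation d n) := by
  have h : ((n + 1 : ℝ)⁻¹) ≠ 0 := by positivity
  exact hasCompactSupport_plateau.comp_homeomorph (Homeomorph.smulOfNeZero _ h)

/-- Smooth even cutoffs to balls of radius `n + 1`. -/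
def cutoff (d n : ℕ) : 𝓢(Space d, ℂ) :=
  testFn (contDiff_dilated (d := d) n) (hasCompactSupport_dilated n)

lemma cutoff_apply (n : ℕ) (x : Space d) :
    cutoff d n x = (plateau d (((n + 1 : ℝ)⁻¹) • x) : ℂ) := rfl

lemma cutoff_neg (n : ℕ) (x : Space d) : cutoff d n (-x) = cutoff d n x := by
  rw [cutoff_apply, cutoff_apply, smul_neg, (plateau d).neg]

lemma conj_cutoff (n : ℕ) (x : Space d) : (starRingEnd ℂ) (cutoff d n x) = cutoff d n x :=
  Complex.conj_ofReal _

lemma cutoff_eq_one {n : ℕ} {x : Space d} (h : ‖x‖ ≤ n + 1) : cutoff d n x = 1 := by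
  rw [cutoff_apply, (plateau d).one_of_mem_closedBall]
  · simp
  · simp only [mem_closedBall_zero_iff, norm_smul, norm_inv]
    rw [Real.norm_of_nonneg (by positivity), inv_mul_le_iff₀ (by positivity)]
    simpa [plateau] using h

lemma cutoff_eq_comp (n : ℕ) : (cutoff d n : Space d → ℂ) = cutoff d 0 ∘ dilation d n := by
  ext x
  simp [cutoff_apply, dilation_apply]

lemma norm_iteratedFDeriv_cutoff_le (n i : ℕ) (x : Space d) :
    ‖iteratedFDeriv ℝ i (cutoff d n) x‖ ≤ SchwartzMap.seminorm ℝ 0 i (cutoff d 0) := by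
  rw [cutoff_eq_comp, (dilation d n).iteratedFDeriv_comp_right ((cutoff d 0).smooth ⊤) x
    (by exact_mod_cast le_top)]
  refine (ContinuousMultilinearMap.norm_compContinuousLinearMap_le _ _).trans ?_
  have h1 := SchwartzMap.le_seminorm ℝ 0 i (cutoff d 0) (dilation d n x)
  rw [pow_zero, one_mul] at h1
  refine le_trans (mul_le_of_le_one_right (norm_nonneg _) ?_) h1
  exact Finset.prod_le_one (fun _ _ => norm_nonneg _) fun _ _ => norm_dilation_le n

/-- Multiplication of a test function by a cutoff. -/
def cutMul (n : ℕ) (ψ : 𝓢(Space d, ℂ)) : 𝓢(Space d, ℂ) :=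
  SchwartzMap.smulLeftCLM ℂ (cutoff d n) ψ

lemma cutMul_apply (n : ℕ) (ψ : 𝓢(Space d, ℂ)) (x : Space d) :
    cutMul n ψ x = cutoff d n x * ψ x := by
  rw [cutMul, SchwartzMap.smulLeftCLM_apply_apply (cutoff d n).hasTemperateGrowth, smul_eq_mul]

lemma hasCompactSupport_cutMul (n : ℕ) (ψ : 𝓢(Space d, ℂ)) : HasCompactSupport (cutMul n ψ) := by
  have h := (hasCompactSupport_testFn (contDiff_dilated (d := d) n)
    (hasCompactSupport_dilated n)).mul_right (f' := (ψ : Space d → ℂ))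
  have e : (cutMul n ψ : Space d → ℂ) = (cutoff d n : Space d → ℂ) * ψ := by
    ext x
    exact cutMul_apply n ψ x
  rw [e]
  exact h

/-- The difference is supported where |x| ≥ n + 1, so one more power of |x| buys a factor 1/(n + 1).
The derivatives of the dilated cutoffs are bounded uniformly in n. -/
lemma tendsto_cutMul (ψ : 𝓢(Space d, ℂ)) : Tendsto (fun n => cutMul n ψ) atTop (𝓝 ψ) := by
  rw [(schwartz_withSeminorms ℝ (Space d) ℂ).tendsto_nhds]
  rintro ⟨k, l⟩ ε hε
  set B := ∑ i ∈ Finset.range (l + 1), (l.choose i : ℝ)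
    * SchwartzMap.seminorm ℝ 0 i (cutoff d 0) * SchwartzMap.seminorm ℝ (k + 1) (l - i) ψ
    + SchwartzMap.seminorm ℝ (k + 1) l ψ with hB
  have hB0 : 0 ≤ B := by
    refine add_nonneg (Finset.sum_nonneg fun i _ => ?_) (apply_nonneg _ _)
    exact mul_nonneg (mul_nonneg (Nat.cast_nonneg _) (apply_nonneg _ _)) (apply_nonneg _ _)
  have key : ∀ n : ℕ, SchwartzMap.seminorm ℝ k l (cutMul n ψ - ψ) ≤ B / (n + 1) := by
    intro n
    refine SchwartzMap.seminorm_le_bound ℝ k l _ (by positivity) fun x => ?_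
    rcases lt_or_ge ‖x‖ (n + 1) with hx | hx
    · have h0 : (cutMul n ψ - ψ : 𝓢(Space d, ℂ)) =ᶠ[𝓝 x] fun _ => (0 : ℂ) := by
        filter_upwards [(isOpen_lt continuous_norm continuous_const).mem_nhds hx] with y hy
        rw [sub_apply, cutMul_apply, cutoff_eq_one (le_of_lt hy), one_mul, sub_self]
      have h1 := h0.iteratedFDeriv ℝ l
      have h2 : iteratedFDeriv ℝ l (fun _ : Space d => (0 : ℂ)) = 0 := iteratedFDeriv_fun_zero
      rw [h1.eq_of_nhds, h2]
      simp only [Pi.zero_apply, norm_zero, mul_zero]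
      positivity
    · have e1 : (cutMul n ψ - ψ : 𝓢(Space d, ℂ)) = (fun y => cutoff d n y * ψ y) - (ψ : Space d → ℂ) := by
        ext y
        simp [cutMul_apply]
      have hd1 : ContDiff ℝ l fun y => cutoff d n y * ψ y :=
        ((cutoff d n).smooth l).mul (ψ.smooth l)
      have e2 : ‖iteratedFDeriv ℝ l (cutMul n ψ - ψ : 𝓢(Space d, ℂ)) x‖
          ≤ ∑ i ∈ Finset.range (l + 1), (l.choose i : ℝ)
            * SchwartzMap.seminorm ℝ 0 i (cutoff d 0) * ‖iteratedFDeriv ℝ (l - i) ψ x‖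
            + ‖iteratedFDeriv ℝ l ψ x‖ := by
        rw [e1, iteratedFDeriv_sub hd1 (ψ.smooth l), Pi.sub_apply]
        refine (norm_sub_le _ _).trans (add_le_add ?_ le_rfl)
        refine (norm_iteratedFDeriv_mul_le ((cutoff d n).smooth l) (ψ.smooth l) x le_rfl).trans ?_
        gcongr
        exact norm_iteratedFDeriv_cutoff_le n _ x
      have hx0 : (0 : ℝ) < n + 1 := by positivity
      rw [le_div_iff₀ hx0]
      calc ‖x‖ ^ k * ‖iteratedFDeriv ℝ l (cutMul n ψ - ψ : 𝓢(Space d, ℂ)) x‖ * (n + 1)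
          ≤ ‖x‖ ^ k * ‖iteratedFDeriv ℝ l (cutMul n ψ - ψ : 𝓢(Space d, ℂ)) x‖ * ‖x‖ := by gcongr
        _ = ‖x‖ ^ (k + 1) * ‖iteratedFDeriv ℝ l (cutMul n ψ - ψ : 𝓢(Space d, ℂ)) x‖ := by ring
        _ ≤ ‖x‖ ^ (k + 1) * (∑ i ∈ Finset.range (l + 1), (l.choose i : ℝ)
            * SchwartzMap.seminorm ℝ 0 i (cutoff d 0) * ‖iteratedFDeriv ℝ (l - i) ψ x‖
            + ‖iteratedFDeriv ℝ l ψ x‖) := by gcongr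
        _ = ∑ i ∈ Finset.range (l + 1), (l.choose i : ℝ)
            * SchwartzMap.seminorm ℝ 0 i (cutoff d 0)
              * (‖x‖ ^ (k + 1) * ‖iteratedFDeriv ℝ (l - i) ψ x‖)
            + ‖x‖ ^ (k + 1) * ‖iteratedFDeriv ℝ l ψ x‖ := by
          rw [mul_add, Finset.mul_sum]
          congr 1
          refine Finset.sum_congr rfl fun i _ => by ring
        _ ≤ B := by
          rw [hB]
          have h1 := SchwartzMap.le_seminorm ℝ (k + 1) l ψ x
          refine add_le_add (Finset.sum_le_sum fun i _ => ?_) h1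
          have h2 := SchwartzMap.le_seminorm ℝ (k + 1) (l - i) ψ x
          exact mul_le_mul_of_nonneg_left h2 (mul_nonneg (Nat.cast_nonneg _) (apply_nonneg _ _))
  have hlim : Tendsto (fun n : ℕ => B / ((n : ℝ) + 1)) atTop (𝓝 0) := by
    have := (tendsto_one_div_add_atTop_nhds_zero_nat (𝕜 := ℝ)).const_mul B
    simpa [div_eq_mul_inv] using this
  filter_upwards [hlim.eventually_lt_const hε] with n hn
  exact (key n).trans_lt hn

lemma tempered_ext {T T' : 𝓢'(Space d, ℂ)}
    (h : ∀ χ : 𝓢(Space d, ℂ), HasCompactSupport χ → T χ = T' χ) : T = T' := by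
  ext ψ
  have h1 := ((map_continuous T).tendsto ψ).comp (tendsto_cutMul ψ)
  have h2 := ((map_continuous T').tendsto ψ).comp (tendsto_cutMul ψ)
  refine tendsto_nhds_unique (h1.congr fun n => ?_) h2
  exact h _ (hasCompactSupport_cutMul n ψ)

/-! ### Distributions whose Fourier transform is a function -/

lemma integrable_test_mul {χ : 𝓢(Space d, ℂ)} (hχ : HasCompactSupport χ) {f : Space d → ℂ}
    (hf : LocallyIntegrable f) : Integrable fun ξ => χ ξ * f ξ := by
  simpa [smul_eq_mul] using
    hf.integrable_smul_left_of_hasCompactSupport χ.continuous hχ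

namespace IsFourierFn

variable {T T' : 𝓢'(Space d, ℂ)} {f f' : Space d → ℂ}

lemma ae_eq (h : IsFourierFn T f) (h' : IsFourierFn T f') : f =ᵐ[volume] f' := by
  refine ae_eq_of_integral_contDiff_smul_eq h.1 h'.1 fun g hg hc => ?_
  have h1 := h.2 (testFn hg hc) (hasCompactSupport_testFn hg hc)
  rw [h'.2 (testFn hg hc) (hasCompactSupport_testFn hg hc)] at h1
  simpa [testFn_apply] using h1.symm

lemma congr (h : IsFourierFn T f) (hf : f =ᵐ[volume] f') : IsFourierFn T f' := by
  refine ⟨h.1.congr hf, fun χ hχ => ?_⟩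
  rw [h.2 χ hχ]
  refine integral_congr_ae ?_
  filter_upwards [hf] with ξ e
  rw [e]

lemma sub (h : IsFourierFn T f) (h' : IsFourierFn T' f') : IsFourierFn (T - T') (f - f') := by
  refine ⟨h.1.sub h'.1, fun χ hχ => ?_⟩
  have e : (𝓕 (T - T') : 𝓢'(Space d, ℂ)) χ = (𝓕 T : 𝓢'(Space d, ℂ)) χ - (𝓕 T' : 𝓢'(Space d, ℂ)) χ := rfl
  rw [e, h.2 χ hχ, h'.2 χ hχ, ← integral_sub (integrable_test_mul hχ h.1)
    (integrable_test_mul hχ h'.1)]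
  simp [mul_sub]

lemma add (h : IsFourierFn T f) (h' : IsFourierFn T' f') : IsFourierFn (T + T') (f + f') := by
  refine ⟨h.1.add h'.1, fun χ hχ => ?_⟩
  have e : (𝓕 (T + T') : 𝓢'(Space d, ℂ)) χ = (𝓕 T : 𝓢'(Space d, ℂ)) χ + (𝓕 T' : 𝓢'(Space d, ℂ)) χ := rfl
  rw [e, h.2 χ hχ, h'.2 χ hχ, ← integral_add (integrable_test_mul hχ h.1)
    (integrable_test_mul hχ h'.1)]
  simp [mul_add]

lemma zero : IsFourierFn (0 : 𝓢'(Space d, ℂ)) 0 := by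
  refine ⟨locallyIntegrable_zero, fun χ _ => ?_⟩
  simp

lemma of_fourierFn (h : IsFourierFn T f) : IsFourierFn T (fourierFn T) := by
  have h' : ∃ f, IsFourierFn T f := ⟨f, h⟩
  rw [fourierFn, dif_pos h']
  exact h'.choose_spec

lemma fourierFn_ae_eq (h : IsFourierFn T f) : fourierFn T =ᵐ[volume] f := h.of_fourierFn.ae_eq h

lemma ext (h : IsFourierFn T f) (h' : IsFourierFn T' f) : T = T' := by
  have h1 : (𝓕 T : 𝓢'(Space d, ℂ)) = 𝓕 T' := tempered_ext fun χ hχ => by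
    rw [h.2 χ hχ, h'.2 χ hχ]
  have h2 := congrArg (fun S : 𝓢'(Space d, ℂ) => (𝓕⁻ S : 𝓢'(Space d, ℂ))) h1
  simpa using h2

lemma of_L2 (x : L2 d) :
    IsFourierFn (𝓕⁻ (Lp.toTemperedDistribution x) : 𝓢'(Space d, ℂ)) x := by
  refine ⟨(Lp.memLp x).locallyIntegrable (by norm_num), fun χ _ => ?_⟩
  rw [FourierTransform.fourier_fourierInv_eq, Lp.toTemperedDistribution_apply]
  rfl

end IsFourierFn

/-! ### Real distributions -/

/-- The reflection of a test function. -/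
def refl (χ : 𝓢(Space d, ℂ)) : 𝓢(Space d, ℂ) :=
  SchwartzMap.compCLMOfContinuousLinearEquiv ℂ (ContinuousLinearEquiv.neg ℝ) χ

lemma refl_apply (χ : 𝓢(Space d, ℂ)) (x : Space d) : refl χ x = χ (-x) := rfl

lemma hasCompactSupport_refl {χ : 𝓢(Space d, ℂ)} (h : HasCompactSupport χ) :
    HasCompactSupport (refl χ) :=
  h.comp_homeomorph (Homeomorph.neg _)

lemma conj_fourier {ψ : 𝓢(Space d, ℂ)} (h : ∀ ξ, ψ (-ξ) = (starRingEnd ℂ) (ψ ξ)) (x : Space d) :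
    (starRingEnd ℂ) ((𝓕 ψ : 𝓢(Space d, ℂ)) x) = (𝓕 ψ : 𝓢(Space d, ℂ)) x := by
  have e : ∀ y, (𝓕 ψ : 𝓢(Space d, ℂ)) y = (𝓕⁻ (ψ : Space d → ℂ) : Space d → ℂ) (-y) := fun y => by
    rw [SchwartzMap.fourier_coe, Real.fourierInv_eq_fourier_neg, neg_neg]
  rw [e, Herm.conj_fourierInv (.of_forall h)]

lemma fourier_im_eq_zero {T : 𝓢'(Space d, ℂ)} (hT : IsRealDistribution T) {ψ : 𝓢(Space d, ℂ)}
    (h : ∀ ξ, ψ (-ξ) = (starRingEnd ℂ) (ψ ξ)) : ((𝓕 T : 𝓢'(Space d, ℂ)) ψ).im = 0 := by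
  rw [TemperedDistribution.fourier_apply]
  exact hT _ fun x => Complex.conj_eq_iff_im.1 (conj_fourier h x)

lemma fourierInv_herm {φ : 𝓢(Space d, ℂ)} (h : ∀ x, (φ x).im = 0) (ξ : Space d) :
    (𝓕⁻ φ : 𝓢(Space d, ℂ)) (-ξ) = (starRingEnd ℂ) ((𝓕⁻ φ : 𝓢(Space d, ℂ)) ξ) := by
  rw [SchwartzMap.fourierInv_coe, Real.fourierInv_eq', Real.fourierInv_eq', ← integral_conj]
  refine integral_congr_ae (.of_forall fun x => ?_)
  simp only [smul_eq_mul, map_mul, ← Complex.exp_conj, Complex.conj_ofReal, Complex.conj_I,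
    Complex.conj_eq_iff_im.2 (h x), inner_neg_right]
  congr 2
  push_cast
  ring

/-- A real distribution has real Fourier pairings with Hermitian test functions. Taking χ + χ(-·)
and i(χ - χ(-·)) for real χ compares the imaginary and real parts of the pairings of f(-·) and of
the conjugate of f. -/
lemma IsFourierFn.herm {T : 𝓢'(Space d, ℂ)} {f : Space d → ℂ} (h : IsFourierFn T f)
    (hT : IsRealDistribution T) : Herm f := by
  have hneg : LocallyIntegrable fun ξ => f (-ξ) := by
    have := (Homeomorph.neg (Space d)).measurableEmbedding
    intro x
    obtain ⟨u, hu, hi⟩ := h.1 (-x)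
    refine ⟨Neg.neg ⁻¹' u, continuous_neg.continuousAt.preimage_mem_nhds hu, ?_⟩
    exact ((Measure.measurePreserving_neg (volume : Measure (Space d))).integrableOn_comp_preimage
      this).2 hi
  have hconj : LocallyIntegrable fun ξ => (starRingEnd ℂ) (f ξ) := fun x => by
    obtain ⟨u, hu, hi⟩ := h.1 x
    exact ⟨u, hu, hi.norm.mono' (Complex.continuous_conj.comp_aestronglyMeasurable hi.1)
      (.of_forall fun ξ => by simp)⟩
  refine ae_eq_of_integral_contDiff_smul_eq hneg hconj fun g hg hc => ?_
  set χ := testFn hg hc with hχ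
  have hχc := hasCompactSupport_testFn hg hc
  have e1 := h.2 χ hχc
  have e2 := h.2 (refl χ) (hasCompactSupport_refl hχc)
  have e3 : ∫ ξ, refl χ ξ * f ξ = ∫ ξ, χ ξ * f (-ξ) := by
    rw [← integral_neg_eq_self]
    simp [refl_apply]
  have r1 := fourier_im_eq_zero hT (ψ := χ + refl χ) fun ξ => by
    simp [refl_apply, hχ, testFn_apply, add_comm]
  have r2 := fourier_im_eq_zero hT (ψ := Complex.I • (χ - refl χ)) fun ξ => by
    simp only [refl_apply, hχ, testFn_apply, smul_apply, sub_apply, neg_neg, smul_eq_mul, map_mul,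
      map_sub, Complex.conj_I, Complex.conj_ofReal]
    ring
  rw [map_add, e1, e2, e3] at r1
  rw [map_smul, map_sub, e1, e2, e3] at r2
  have e4 : ∫ ξ, g ξ • (starRingEnd ℂ) (f ξ) = (starRingEnd ℂ) (∫ ξ, χ ξ * f ξ) := by
    rw [← integral_conj]
    refine integral_congr_ae (.of_forall fun ξ => ?_)
    simp [hχ, testFn_apply]
  have e5 : ∫ ξ, g ξ • f (-ξ) = ∫ ξ, χ ξ * f (-ξ) := by
    simp [hχ, testFn_apply]
  rw [e4, e5]
  simp only [Complex.add_im, smul_eq_mul, Complex.mul_im, Complex.I_re, Complex.I_im,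
    Complex.sub_re, zero_mul, one_mul, zero_add] at r1 r2
  refine Complex.ext ?_ ?_
  · rw [Complex.conj_re]; linarith
  · rw [Complex.conj_im]; linarith

/-- The inverse transform of a real test function is Hermitian, and real even cutoffs preserve this;
on the compactly supported approximants the pairing is an explicit integral invariant under
conjugation. -/
lemma IsFourierFn.isReal {T : 𝓢'(Space d, ℂ)} {f : Space d → ℂ} (h : IsFourierFn T f)
    (hf : Herm f) : IsRealDistribution T := by
  intro φ hφ
  set ψ : 𝓢(Space d, ℂ) := 𝓕⁻ φ with hψ
  have e : T φ = (𝓕 T : 𝓢'(Space d, ℂ)) ψ := by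
    rw [TemperedDistribution.fourier_apply, hψ, FourierTransform.fourier_fourierInv_eq]
  have hlim := (Complex.continuous_im.tendsto _).comp
    (((map_continuous (𝓕 T : 𝓢'(Space d, ℂ))).tendsto ψ).comp (tendsto_cutMul ψ))
  rw [e]
  refine tendsto_nhds_unique hlim (tendsto_const_nhds.congr fun n => ?_)
  have hc := h.2 _ (hasCompactSupport_cutMul n ψ)
  simp only [Function.comp_apply]
  rw [hc, eq_comm, ← Complex.conj_eq_iff_im, ← integral_conj, ← integral_neg_eq_self]
  refine integral_congr_ae ?_
  have hf' : ∀ᵐ ξ, f (-ξ) = (starRingEnd ℂ) (f ξ) := hf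
  filter_upwards [hf'] with ξ hξ
  rw [cutMul_apply, cutMul_apply, hξ, cutoff_neg, hψ, fourierInv_herm hφ]
  simp [conj_cutoff]

/-! ### States as elements of the Hilbert space -/

/-- The components of a state. -/
def State.comp (U : State d) : Option (Fin d) → 𝓢'(Space d, ℂ)
  | none => U.1
  | some k => U.2 k

/-- The components of a state on the Fourier side. -/
def FourierState.comp (W : FourierState d) : Option (Fin d) → Space d → ℂ
  | none => W.1
  | some k => W.2 k

lemma State.ext_comp {U U' : State d} (h : ∀ i, U.comp i = U'.comp i) : U = U' :=
  Prod.ext (h none) (funext fun k => h (some k))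

lemma State.comp_sub (U U' : State d) (i : Option (Fin d)) :
    (U - U').comp i = U.comp i - U'.comp i := by cases i <;> rfl

/-- The symbol acting on each component in the norm. -/
def compSymbol (g : Space d → ℝ) : Option (Fin d) → Space d → ℝ
  | none => fun _ => 1
  | some _ => g

/-- The factor between a component of a state and its representative. -/
def compWeight (g : Space d → ℝ) (r : ℝ) (i : Option (Fin d)) (ξ : Space d) : ℝ :=
  wt (-r) ξ / compSymbol g i ξ

/-- `Z` represents `U` at regularity `r`. -/
def Rep (g : Space d → ℝ) (r : ℝ) (U : State d) (Z : HH d) : Prop :=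
  ∀ i, IsFourierFn (U.comp i) fun ξ => (compWeight g r i ξ : ℂ) * Z i ξ

section

variable {g : Space d → ℝ} {r : ℝ}

lemma compSymbol_pos (hp : ∀ ξ, 0 < g ξ) (i : Option (Fin d)) (ξ : Space d) :
    0 < compSymbol g i ξ := by
  cases i
  · exact one_pos
  · exact hp ξ

lemma continuous_compSymbol (hc : Continuous g) (i : Option (Fin d)) :
    Continuous (compSymbol g i) := by
  cases i
  · exact continuous_const
  · exact hc

lemma compWeight_pos (hp : ∀ ξ, 0 < g ξ) (i : Option (Fin d)) (ξ : Space d) :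
    0 < compWeight g r i ξ := div_pos (wt_pos _ ξ) (compSymbol_pos hp i ξ)

lemma continuous_compWeight (hc : Continuous g) (hp : ∀ ξ, 0 < g ξ) (i : Option (Fin d)) :
    Continuous (compWeight g r i) :=
  (continuous_wt _).div (continuous_compSymbol hc i) fun ξ => (compSymbol_pos hp i ξ).ne'

lemma compWeight_add_one (i : Option (Fin d)) (ξ : Space d) :
    compWeight g (r + 1) i ξ = compWeight g r i ξ * wt (-1) ξ := by
  rw [compWeight, compWeight, neg_add, wt_add]
  ring

lemma wt_mul_compWeight (hp : ∀ ξ, 0 < g ξ) (i : Option (Fin d)) (ξ : Space d) :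
    wt r ξ * compSymbol g i ξ * compWeight g r i ξ = 1 := by
  have h := (compSymbol_pos hp i ξ).ne'
  rw [compWeight, mul_div_assoc', div_eq_one_iff_eq h, mul_right_comm, wt_mul_neg, one_mul]

lemma locallyIntegrable_weight_mul {w : Space d → ℝ} (hw : Continuous w) (x : L2 d) :
    LocallyIntegrable fun ξ => (w ξ : ℂ) * x ξ := by
  have h := (Lp.memLp x).locallyIntegrable (by norm_num)
  rw [← locallyIntegrableOn_univ] at h ⊢
  exact h.continuousOn_mul (Complex.continuous_ofReal.comp hw).continuousOn isOpen_univ.isLocallyClosed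

namespace Rep

variable {U U' : State d} {Z Z' : HH d}

lemma sub (h : Rep g r U Z) (h' : Rep g r U' Z') : Rep g r (U - U') (Z - Z') := by
  intro i
  rw [State.comp_sub]
  refine ((h i).sub (h' i)).congr ?_
  filter_upwards [Lp.coeFn_sub (Z i) (Z' i)] with ξ e
  rw [PiLp.sub_apply, e, Pi.sub_apply, Pi.sub_apply, mul_sub]

lemma zero : Rep g r (0 : State d) 0 := by
  intro i
  have : State.comp (0 : State d) i = 0 := by cases i <;> rfl
  rw [this]
  refine IsFourierFn.zero.congr ?_
  filter_upwards [Lp.coeFn_zero ℂ 2 (volume : Measure (Space d))] with ξ e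
  rw [PiLp.zero_apply, e]
  simp

lemma lowP (h : Rep g (r + 1) U Z) : Rep g r U (lowP Z) := by
  intro i
  refine (h i).congr ?_
  filter_upwards [coeFn_mulL isMult_wt_neg_one (Z i)] with ξ e
  rw [lowP_apply, lowL, e, compWeight_add_one, Complex.ofReal_mul, mul_assoc]

lemma eq (hp : ∀ ξ, 0 < g ξ) (h : Rep g r U Z) (h' : Rep g r U Z') : Z = Z' := by
  refine HH.ext_ae fun i => ?_
  filter_upwards [(h i).ae_eq (h' i)] with ξ e
  exact mul_left_cancel₀ (Complex.ofReal_ne_zero.2 (compWeight_pos hp i ξ).ne') e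

lemma state_eq (h : Rep g r U Z) (h' : Rep g r U' Z) : U = U' :=
  State.ext_comp fun i => (h i).ext (h' i)

lemma herm (hp : ∀ ξ, 0 < g ξ) (he : ∀ ξ, g (-ξ) = g ξ) (h : Rep g r U Z) (hU : IsRealState U) :
    HermP Z := by
  intro i
  have h1 : Herm fun ξ => (compWeight g r i ξ : ℂ) * Z i ξ := by
    refine (h i).herm ?_
    cases i
    · exact hU.1
    · exact hU.2 _
  have h1' : ∀ᵐ ξ, (compWeight g r i (-ξ) : ℂ) * Z i (-ξ)
    = (starRingEnd ℂ) ((compWeight g r i ξ : ℂ) * Z i ξ) := h1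
  filter_upwards [h1'] with ξ e
  have e1 : compWeight g r i (-ξ) = compWeight g r i ξ := by
    cases i <;> simp [compWeight, compSymbol, wt_neg_arg, he]
  rw [e1, map_mul, Complex.conj_ofReal] at e
  exact mul_left_cancel₀ (Complex.ofReal_ne_zero.2 (compWeight_pos hp i ξ).ne') e

lemma isReal (he : ∀ ξ, g (-ξ) = g ξ) (h : Rep g r U Z) (hZ : HermP Z) : IsRealState U := by
  have key : ∀ i, IsRealDistribution (U.comp i) := by
    intro i
    refine (h i).isReal ?_
    have h1 : ∀ᵐ ξ, Z i (-ξ) = (starRingEnd ℂ) (Z i ξ) := hZ i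
    filter_upwards [h1] with ξ e
    have e1 : compWeight g r i (-ξ) = compWeight g r i ξ := by
      cases i <;> simp [compWeight, compSymbol, wt_neg_arg, he]
    rw [e1, e, map_mul, Complex.conj_ofReal]
  exact ⟨key none, fun k => key (some k)⟩

lemma fourierFn_none (h : Rep g r U Z) : fourierFn U.1 =ᵐ[volume] low r (Z none) := by
  refine (h none).fourierFn_ae_eq.trans (.of_forall fun ξ => ?_)
  simp [compWeight, compSymbol, low]

lemma fourierFn_some (hp : ∀ ξ, 0 < g ξ) (h : Rep g r U Z) (k : Fin d) :
    (fun ξ => (g ξ : ℂ) * fourierFn (U.2 k) ξ) =ᵐ[volume] low r (Z (some k)) := by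
  filter_upwards [(h (some k)).fourierFn_ae_eq] with ξ e
  have e' : fourierFn (U.2 k) ξ = (compWeight g r (some k) ξ : ℂ) * Z (some k) ξ := e
  have : (g ξ : ℂ) ≠ 0 := Complex.ofReal_ne_zero.2 (hp ξ).ne'
  rw [e', compWeight, compSymbol, low]
  push_cast
  field_simp

lemma nonCav_iff {ε h : ℝ} (hU : Rep g (r + 1) U Z) :
    NonCavitating ε h U.1 ↔ NonCav r ε h Z := by
  have e : (𝓕⁻ (fourierFn U.1) : Space d → ℂ) = 𝓕⁻ (low (r + 1) (Z none)) := by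
    ext x
    rw [Real.fourierInv_eq, Real.fourierInv_eq]
    refine integral_congr_ae ?_
    filter_upwards [hU.fourierFn_none] with ξ e
    rw [e]
  rw [NonCavitating, NonCav, e]

end Rep

end

/-! ### Norms -/

section

variable {G : Space d → ℝ} {r : ℝ}

lemma multSobolevNorm_eq {T : 𝓢'(Space d, ℂ)} {w : Space d → ℝ} {x : L2 d}
    (hw : ∀ ξ, wt r ξ * G ((2 * π) • ξ) * w ξ = 1) (h : IsFourierFn T fun ξ => (w ξ : ℂ) * x ξ) :
    multSobolevNorm G r T = ENNReal.ofReal ‖x‖ := by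
  rw [multSobolevNorm, if_pos ⟨_, h⟩, ofReal_norm, Lp.enorm_def]
  refine eLpNorm_congr_ae ?_
  filter_upwards [h.fourierFn_ae_eq] with ξ e
  rw [e, Complex.real_smul, ← mul_assoc, ← Complex.ofReal_mul]
  have := hw ξ
  rw [wt, bk] at this
  rw [this]
  simp

lemma exists_L2_of_multSobolevNorm_lt_top {T : 𝓢'(Space d, ℂ)} {w : Space d → ℝ}
    (hG : Continuous G) (hw : ∀ ξ, wt r ξ * G ((2 * π) • ξ) * w ξ = 1)
    (h : multSobolevNorm G r T < ⊤) : ∃ x : L2 d, IsFourierFn T fun ξ => (w ξ : ℂ) * x ξ := by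
  rw [multSobolevNorm] at h
  split_ifs at h with hf
  · obtain ⟨f, hf⟩ := hf
    have hm : AEStronglyMeasurable
        (fun ξ => (bracket ((2 * π) • ξ) ^ r * G ((2 * π) • ξ)) • fourierFn T ξ) := by
      have h1 : AEStronglyMeasurable fun ξ : Space d => bracket ((2 * π) • ξ) ^ r * G ((2 * π) • ξ) :=
        ((continuous_wt (d := d) r).mul
          (hG.comp (continuous_const_smul (2 * π)))).aestronglyMeasurable
      exact h1.smul hf.of_fourierFn.1.aestronglyMeasurable
    have hL : MemLp (fun ξ => (bracket ((2 * π) • ξ) ^ r * G ((2 * π) • ξ)) • fourierFn T ξ) 2 :=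
      ⟨hm, h⟩
    refine ⟨hL.toLp _, hf.of_fourierFn.congr ?_⟩
    filter_upwards [hL.coeFn_toLp] with ξ e
    have := hw ξ
    rw [wt, bk] at this
    rw [e, Complex.real_smul, ← mul_assoc, ← Complex.ofReal_mul, mul_comm (w ξ), this]
    simp
  · exact absurd h (lt_irrefl _)

lemma wt_mul_compWeight_dilated (hp : ∀ ξ, 0 < G ξ) (i : Option (Fin d)) (ξ : Space d) :
    wt r ξ * compSymbol G i ((2 * π) • ξ) * compWeight (fun ξ => G ((2 * π) • ξ)) r i ξ = 1 := by
  have h := wt_mul_compWeight (r := r) (g := fun ξ => G ((2 * π) • ξ)) (fun ξ => hp _) i ξ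
  cases i <;> exact h

lemma Rep.xNorm_eq (hp : ∀ ξ, 0 < G ξ) {U : State d} {Z : HH d}
    (h : Rep (fun ξ => G ((2 * π) • ξ)) r U Z) :
    xNorm G r U = ENNReal.ofReal (‖Z none‖ + √(∑ k, ‖Z (some k)‖ ^ 2)) := by
  have e1 : multSobolevNorm (fun _ => 1) r U.1 = ENNReal.ofReal ‖Z none‖ :=
    multSobolevNorm_eq (wt_mul_compWeight_dilated hp none) (h none)
  have e2 : ∀ k, multSobolevNorm G r (U.2 k) = ENNReal.ofReal ‖Z (some k)‖ := fun k =>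
    multSobolevNorm_eq (wt_mul_compWeight_dilated hp (some k)) (h (some k))
  have hs : 0 ≤ ∑ k, ‖Z (some k)‖ ^ 2 := Finset.sum_nonneg fun k _ => sq_nonneg _
  rw [xNorm, e1, ENNReal.ofReal_add (norm_nonneg _) (sqrt_nonneg _)]
  congr 1
  simp_rw [e2, ← ENNReal.ofReal_pow (norm_nonneg _)]
  rw [← ENNReal.ofReal_sum_of_nonneg fun k _ => sq_nonneg _, sqrt_eq_rpow,
    ENNReal.ofReal_rpow_of_nonneg hs (by norm_num)]

lemma Rep.le_xNorm (hp : ∀ ξ, 0 < G ξ) {U : State d} {Z : HH d}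
    (h : Rep (fun ξ => G ((2 * π) • ξ)) r U Z) : ENNReal.ofReal ‖Z‖ ≤ xNorm G r U := by
  rw [h.xNorm_eq hp]
  refine ENNReal.ofReal_le_ofReal ?_
  have hs : 0 ≤ ∑ k, ‖Z (some k)‖ ^ 2 := Finset.sum_nonneg fun k _ => sq_nonneg _
  refine le_of_sq_le_sq ?_ (by positivity)
  rw [HH.norm_sq_eq, add_sq, sq_sqrt hs]
  have : 0 ≤ 2 * ‖Z none‖ * √(∑ k, ‖Z (some k)‖ ^ 2) := by positivity
  linarith

lemma Rep.xNorm_le (hp : ∀ ξ, 0 < G ξ) {U : State d} {Z : HH d}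
    (h : Rep (fun ξ => G ((2 * π) • ξ)) r U Z) : xNorm G r U ≤ ENNReal.ofReal (2 * ‖Z‖) := by
  rw [h.xNorm_eq hp]
  refine ENNReal.ofReal_le_ofReal ?_
  have hs : √(∑ k, ‖Z (some k)‖ ^ 2) ≤ ‖Z‖ := by
    rw [sqrt_le_left (norm_nonneg _), HH.norm_sq_eq]
    linarith [sq_nonneg ‖Z none‖]
  linarith [HH.norm_apply_le Z none]

lemma exists_rep (hG : Continuous G) (hp : ∀ ξ, 0 < G ξ) {U : State d} (h : xNorm G r U < ⊤) :
    ∃ Z : HH d, Rep (fun ξ => G ((2 * π) • ξ)) r U Z := by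
  rw [xNorm, ENNReal.add_lt_top] at h
  obtain ⟨h1, h2⟩ := h
  rw [ENNReal.rpow_lt_top_iff_of_pos (by norm_num), ENNReal.sum_lt_top] at h2
  have key : ∀ i, ∃ x : L2 d, IsFourierFn (U.comp i)
      fun ξ => (compWeight (fun ξ => G ((2 * π) • ξ)) r i ξ : ℂ) * x ξ := by
    intro i
    rcases i with _ | k
    · exact exists_L2_of_multSobolevNorm_lt_top (G := fun _ => 1) continuous_const
        (wt_mul_compWeight_dilated hp none) h1
    · refine exists_L2_of_multSobolevNorm_lt_top hG (wt_mul_compWeight_dilated hp (some k)) ?_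
      have := h2 k (Finset.mem_univ _)
      rwa [ENNReal.pow_lt_top_iff, or_iff_left two_ne_zero] at this
  choose x hx using key
  exact ⟨WithLp.toLp 2 x, hx⟩

end

/-! ### The quasilinear operator in terms of representatives -/

/-- `x` represents `f` at regularity `r`. -/
def IsLow (r : ℝ) (f : Space d → ℂ) (x : L2 d) : Prop := f =ᵐ[volume] low r x

namespace IsLow

variable {r : ℝ} {f f' : Space d → ℂ} {x x' : L2 d}

lemma add (h : IsLow r f x) (h' : IsLow r f' x') : IsLow r (f + f') (x + x') := by
  unfold IsLow at *
  filter_upwards [h, h', Lp.coeFn_add x x'] with ξ e e' e1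
  rw [low, e1, Pi.add_apply, e, e', Pi.add_apply, low, low, mul_add]

lemma smul (h : IsLow r f x) (c : ℂ) : IsLow r (c • f) (c • x) := by
  unfold IsLow at *
  filter_upwards [h, Lp.coeFn_smul c x] with ξ e e1
  rw [low, e1, Pi.smul_apply, e, Pi.smul_apply, low, smul_eq_mul, smul_eq_mul, mul_left_comm]

lemma zero : IsLow r (0 : Space d → ℂ) 0 := by
  unfold IsLow
  filter_upwards [Lp.coeFn_zero ℂ 2 (volume : Measure (Space d))] with ξ e
  rw [low, e]
  simp

lemma sum {ι : Type*} (s : Finset ι) {f : ι → Space d → ℂ} {x : ι → L2 d}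
    (h : ∀ i ∈ s, IsLow r (f i) (x i)) : IsLow r (∑ i ∈ s, f i) (∑ i ∈ s, x i) := by
  classical
  induction s using Finset.induction_on with
  | empty => simpa using zero
  | insert a s ha ih =>
    rw [Finset.sum_insert ha, Finset.sum_insert ha]
    exact (h a (Finset.mem_insert_self _ _)).add
      (ih fun i hi => h i (Finset.mem_insert_of_mem hi))

lemma mulL {m : Space d → ℂ} (hm : IsMult m) (h : IsLow r f x) :
    IsLow r (fun ξ => m ξ * f ξ) (mulL m x) := by
  unfold IsLow at *
  filter_upwards [h, coeFn_mulL hm x] with ξ e e1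
  rw [low, e1, e, low, mul_left_comm]

lemma diff (h : IsLow (r + 1) f x) (j : Fin d) :
    IsLow r (WhithamBoussinesq.diff j f) (WhithamBoussinesq.mulL (dm j) x) := by
  unfold IsLow at *
  filter_upwards [h, coeFn_mulL (isMult_dm j) x] with ξ e e1
  rw [low, e1, WhithamBoussinesq.diff, e, low, dm, dl, neg_add, wt_add, Complex.ofReal_mul]
  ring

lemma lowL (h : IsLow (r + 1) f x) : IsLow r f (lowL x) := h.trans (low_lowL r x).symm

lemma prod (hr : (d : ℝ) < 2 * r) (h : IsLow r f x) (h' : IsLow r f' x') :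
    IsLow r (WhithamBoussinesq.prod f f') (Bil r x x') := by
  obtain ⟨c, hc, hi⟩ := exists_integral_low_le hr
  have hr0 : 0 ≤ r := by
    have : (0 : ℝ) ≤ d := by positivity
    linarith
  have e1 : WhithamBoussinesq.prod f f' = WhithamBoussinesq.prod (low r x) (low r x') := by
    unfold WhithamBoussinesq.prod
    have e : ∀ {a b : Space d → ℂ}, a =ᵐ[volume] b →
        (𝓕⁻ a : Space d → ℂ) = (𝓕⁻ b : Space d → ℂ) := fun hab => by
      ext y
      rw [Real.fourierInv_eq, Real.fourierInv_eq]
      refine integral_congr_ae ?_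
      filter_upwards [hab] with ξ e
      rw [e]
    rw [e h, e h']
  rw [e1]
  refine (prod_ae_eq_cv (hi x).1 (hi x').1 (memLp_low hr0 (Lp.memLp x))
    (memLp_low hr0 (Lp.memLp x'))).trans ?_
  filter_upwards [coeFn_Bil hr x x'] with ξ e
  rw [low, e, ← mul_assoc, ← Complex.ofReal_mul, mul_comm (wt (-r) ξ), wt_mul_neg]
  simp

end IsLow

/-- The time derivative of a velocity component, without the symbol. -/
def velN (Q : Space d → ℝ) (r ε : ℝ) (k : Fin d) (Y : HH d) : L2 d :=
  mulL (dm k) (Y none) + (ε : ℂ) • ∑ j,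
    Bil r (lowL (mulL (fun ξ => (Q ξ : ℂ)) (Y (some j))))
      (mulL (dm j) (mulL (fun ξ => (Q ξ : ℂ)) (Y (some k))))

section

variable {g₁ g₂ Q : Space d → ℝ} {r κ ε : ℝ}

lemma quadP_some (Y : HH d) (k : Fin d) :
    quadP g₁ g₂ Q r ε Y Y (some k) = mulL (fun ξ => (g₁ ξ : ℂ)) (velN Q r ε k Y) := by
  rw [velN, map_add, map_smul, map_sum]
  rfl

lemma quadP_none (Y : HH d) :
    quadP g₁ g₂ Q r ε Y Y none = ∑ j, (mulL (fun ξ => (g₁ ξ : ℂ)) (mulL (dm j) (Y (some j)))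
      + (ε : ℂ) • mulL (fun ξ => (g₂ ξ : ℂ))
        (Bil r (lowL (mulL (fun ξ => (Q ξ : ℂ)) (Y (some j)))) (mulL (dm j) (Y none))
        + Bil r (lowL (Y none)) (mulL (dm j) (mulL (fun ξ => (Q ξ : ℂ)) (Y (some j)))))) := by
  rw [Finset.sum_add_distrib, ← Finset.smul_sum]
  rfl

end

section

variable {G₁ G₂ : Space d → ℝ} {r κ ε : ℝ}

/-- Matches the operator of the statement with `quadP`. In the velocity block the original operator
has no outer G₁; the factor g₁ in `quadP_some` is cancelled by the division in `compWeight`. -/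
lemma quasilinear_comp (hr : (d : ℝ) < 2 * r) (hp : ∀ ξ, 0 < G₁ ξ)
    (hS : IsSys κ (fun ξ => G₁ ((2 * π) • ξ)) (fun ξ => G₂ ((2 * π) • ξ)) (quot G₁ G₂))
    {U : State d} {Y : HH d} (hU : Rep (fun ξ => G₁ ((2 * π) • ξ)) (r + 1) U Y)
    (i : Option (Fin d)) :
    (quasilinear G₁ G₂ ε (State.hat U)).comp i =ᵐ[volume] fun ξ =>
      (compWeight (fun ξ => G₁ ((2 * π) • ξ)) r i ξ : ℂ) * quadP (fun ξ => G₁ ((2 * π) • ξ))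
        (fun ξ => G₂ ((2 * π) • ξ)) (quot G₁ G₂) r ε Y Y i ξ := by
  have z0 : IsLow (r + 1) (fourierFn U.1) (Y none) := hU.fourierFn_none
  have z1 : ∀ k, IsLow (r + 1) (mul G₁ (fourierFn (U.2 k))) (Y (some k)) := fun k =>
    hU.fourierFn_some (fun ξ => hp _) k
  have hquot : ∀ f : Space d → ℂ, mul G₂ f = fun ξ => (quot G₁ G₂ ξ : ℂ) * mul G₁ f ξ := fun f => by
    ext ξ
    have e := hS.eq ξ
    simp only [mul]
    rw [e]
    push_cast
    ring
  have z2 : ∀ k, IsLow (r + 1) (mul G₂ (fourierFn (U.2 k)))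
      (mulL (fun ξ => (quot G₁ G₂ ξ : ℂ)) (Y (some k))) := fun k => by
    rw [hquot]
    exact (z1 k).mulL hS.isMult
  have hcomm : ∀ (G : Space d → ℝ) (j : Fin d) (f : Space d → ℂ),
      mul G (diff j f) = diff j (mul G f) := fun G j f => by
    ext ξ
    simp only [mul, diff]
    ring
  rcases i with _ | k
  · have e : (quasilinear G₁ G₂ ε (State.hat U)).comp none
        = ∑ j, (mul G₁ (mul G₁ (diff j (fourierFn (U.2 j)))) + (ε : ℂ) •
          mul G₂ (prod (mul G₂ (fourierFn (U.2 j))) (diff j (fourierFn U.1))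
            + prod (fourierFn U.1) (mul G₂ (diff j (fourierFn (U.2 j)))))) := by
      simp only [FourierState.comp, quasilinear, Prod.fst_sum]
      refine Finset.sum_congr rfl fun j _ => ?_
      simp only [opA, FourierState.diff, State.hat]
      ext ξ
      simp only [mul, Pi.add_apply, Pi.smul_apply, smul_eq_mul]
      ring
    rw [e]
    have key : IsLow r (∑ j, (mul G₁ (mul G₁ (diff j (fourierFn (U.2 j)))) + (ε : ℂ) •
          mul G₂ (prod (mul G₂ (fourierFn (U.2 j))) (diff j (fourierFn U.1))
            + prod (fourierFn U.1) (mul G₂ (diff j (fourierFn (U.2 j)))))))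
          (quadP (fun ξ => G₁ ((2 * π) • ξ)) (fun ξ => G₂ ((2 * π) • ξ)) (quot G₁ G₂) r ε Y Y
            none) := by
      rw [quadP_none]
      refine IsLow.sum _ fun j _ => IsLow.add ?_ (IsLow.smul ?_ _)
      · rw [hcomm]
        exact ((z1 j).diff j).mulL hS.sym₁.isMult
      · rw [hcomm]
        exact (((z2 j).lowL.prod hr (z0.diff j)).add (z0.lowL.prod hr ((z2 j).diff j))).mulL
          hS.sym₂.isMult
    refine key.trans (.of_forall fun ξ => ?_)
    simp only [low, compWeight, compSymbol, div_one]
  · have e : (quasilinear G₁ G₂ ε (State.hat U)).comp (some k)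
        = diff k (fourierFn U.1) + (ε : ℂ) • ∑ j,
          prod (mul G₂ (fourierFn (U.2 j))) (mul G₂ (diff j (fourierFn (U.2 k)))) := by
      simp only [FourierState.comp, quasilinear, Prod.snd_sum, Finset.sum_apply, opA,
        FourierState.diff, State.hat, Finset.sum_add_distrib, Finset.sum_ite_eq', Finset.mem_univ,
        if_true, Finset.smul_sum]
    have key : IsLow r (diff k (fourierFn U.1) + (ε : ℂ) • ∑ j,
          prod (mul G₂ (fourierFn (U.2 j))) (mul G₂ (diff j (fourierFn (U.2 k)))))
          (velN (quot G₁ G₂) r ε k Y) := by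
      refine IsLow.add (z0.diff k) (IsLow.smul (IsLow.sum _ fun j _ => ?_) _)
      rw [hcomm]
      exact (z2 j).lowL.prod hr ((z2 k).diff j)
    rw [e, quadP_some]
    refine key.trans ?_
    filter_upwards [coeFn_mulL hS.sym₁.isMult (velN (quot G₁ G₂) r ε k Y)] with ξ e1
    have h0 : (G₁ ((2 * π) • ξ) : ℂ) ≠ 0 := Complex.ofReal_ne_zero.2 (hp _).ne'
    rw [e1, low, compWeight, compSymbol]
    push_cast
    field_simp

end

/-! ### Duality with test functions -/

lemma memLp_test_mul {w : Space d → ℝ} (hw : Continuous w) {χ : 𝓢(Space d, ℂ)}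
    (hχ : HasCompactSupport χ) : MemLp (fun ξ => (starRingEnd ℂ) (χ ξ) * (w ξ : ℂ)) 2 := by
  refine Continuous.memLp_of_hasCompactSupport ?_ ?_
  · exact (Complex.continuous_conj.comp χ.continuous).mul (Complex.continuous_ofReal.comp hw)
  · exact (hχ.comp_left (g := starRingEnd ℂ) (map_zero _)).mul_right

lemma inner_test {w : Space d → ℝ} {χ : 𝓢(Space d, ℂ)} {x : L2 d}
    (hx : x =ᵐ[volume] fun ξ => (starRingEnd ℂ) (χ ξ) * (w ξ : ℂ)) (z : L2 d) :
    ⟪x, z⟫_ℂ = ∫ ξ, χ ξ * ((w ξ : ℂ) * z ξ) := by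
  rw [L2.inner_def]
  refine integral_congr_ae ?_
  filter_upwards [hx] with ξ e
  rw [e, RCLike.inner_apply, map_mul, Complex.conj_conj, Complex.conj_ofReal]
  ring

/-- Weighted test functions. -/
def testSub (w : Option (Fin d) → Space d → ℝ) : Submodule ℂ (HH d) where
  carrier := {x | ∃ χ : Option (Fin d) → 𝓢(Space d, ℂ), (∀ i, HasCompactSupport (χ i)) ∧
    ∀ i, x i =ᵐ[volume] fun ξ => (starRingEnd ℂ) (χ i ξ) * (w i ξ : ℂ)}
  add_mem' := by
    rintro x y ⟨χ, hχ, hx⟩ ⟨χ', hχ', hy⟩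
    refine ⟨χ + χ', fun i => (hχ i).add (hχ' i), fun i => ?_⟩
    filter_upwards [hx i, hy i, Lp.coeFn_add (x i) (y i)] with ξ e1 e2 e3
    rw [PiLp.add_apply, e3, Pi.add_apply, e1, e2, Pi.add_apply, add_apply, map_add, add_mul]
  zero_mem' := by
    refine ⟨0, fun i => HasCompactSupport.zero, fun i => ?_⟩
    filter_upwards [Lp.coeFn_zero ℂ 2 (volume : Measure (Space d))] with ξ e
    rw [PiLp.zero_apply, e]
    simp
  smul_mem' := by
    rintro c x ⟨χ, hχ, hx⟩
    refine ⟨fun i => (starRingEnd ℂ) c • χ i, fun i => (hχ i).smul_left (f := fun _ => (starRingEnd ℂ) c),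
      fun i => ?_⟩
    filter_upwards [hx i, Lp.coeFn_smul c (x i)] with ξ e1 e2
    rw [PiLp.smul_apply, e2, Pi.smul_apply, e1, smul_apply, smul_eq_mul, smul_eq_mul, map_mul,
      Complex.conj_conj, mul_assoc]

/-- If z is orthogonal to all weighted test functions, then w z vanishes as a distribution, and w >
0 forces z = 0. -/
lemma testSub_dense {w : Option (Fin d) → Space d → ℝ} (hw : ∀ i, Continuous (w i))
    (hpos : ∀ i ξ, 0 < w i ξ) : (testSub w).topologicalClosure = ⊤ := by
  classical
  rw [Submodule.topologicalClosure_eq_top_iff, Submodule.eq_bot_iff]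
  intro z hz
  rw [Submodule.mem_orthogonal] at hz
  refine HH.ext_ae fun i => ?_
  have h0 : (fun ξ => (w i ξ : ℂ) * z i ξ) =ᵐ[volume] fun _ => (0 : ℂ) := by
    refine ae_eq_of_integral_contDiff_smul_eq (locallyIntegrable_weight_mul (hw i) (z i))
      locallyIntegrable_zero fun g hg hc => ?_
    set χ := testFn hg hc with hχ
    have hχc := hasCompactSupport_testFn hg hc
    set x : HH d := WithLp.toLp 2 (Pi.single i ((memLp_test_mul (hw i) hχc).toLp _)) with hx
    have hxi : x i = (memLp_test_mul (hw i) hχc).toLp _ := by simp [hx]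
    have hxj : ∀ j, j ≠ i → x j = 0 := fun j hj => by simp [hx, hj]
    have hmem : x ∈ testSub w := by
      refine ⟨Pi.single i χ, fun j => ?_, fun j => ?_⟩
      · rcases eq_or_ne j i with rfl | hj
        · simpa using hχc
        · simpa [hj] using HasCompactSupport.zero
      · rcases eq_or_ne j i with rfl | hj
        · rw [hxi]
          simpa using (memLp_test_mul (hw j) hχc).coeFn_toLp
        · rw [hxj j hj]
          filter_upwards [Lp.coeFn_zero ℂ 2 (volume : Measure (Space d))] with ξ e
          rw [e]
          simp [hj]
    have h1 := hz x hmem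
    rw [PiLp.inner_apply, Finset.sum_eq_single i (fun j _ hj => by rw [hxj j hj, inner_zero_left])
      (by simp), hxi, inner_test (memLp_test_mul (hw i) hχc).coeFn_toLp] at h1
    simpa [hχ, testFn_apply] using h1
  filter_upwards [h0, Lp.coeFn_zero ℂ 2 (volume : Measure (Space d))] with ξ e e0
  rw [PiLp.zero_apply, e0]
  exact (mul_eq_zero.1 e).resolve_left (Complex.ofReal_ne_zero.2 (hpos i ξ).ne')

/-- By density the bound extends to x = e, and a factor ‖e‖ cancels. -/
lemma norm_le_of_test {w : Option (Fin d) → Space d → ℝ} (hw : ∀ i, Continuous (w i))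
    (hpos : ∀ i ξ, 0 < w i ξ) {e : HH d} {c : ℝ} (hc : 0 ≤ c)
    (h : ∀ x ∈ testSub w, ‖⟪x, e⟫_ℂ‖ ≤ c * ‖x‖) : ‖e‖ ≤ c := by
  have hclosed : IsClosed {x : HH d | ‖⟪x, e⟫_ℂ‖ ≤ c * ‖x‖} :=
    isClosed_le (by fun_prop) (by fun_prop)
  have hsub : closure (testSub w : Set (HH d)) ⊆ {x : HH d | ‖⟪x, e⟫_ℂ‖ ≤ c * ‖x‖} :=
    closure_minimal h hclosed
  have huniv : e ∈ closure (testSub w : Set (HH d)) := by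
    rw [← Submodule.topologicalClosure_coe, testSub_dense hw hpos]
    trivial
  have h1 : ‖⟪e, e⟫_ℂ‖ ≤ c * ‖e‖ := hsub huniv
  rw [inner_self_eq_norm_sq_to_K] at h1
  simp only [Complex.coe_algebraMap, norm_pow, Complex.norm_real, norm_norm] at h1
  rcases (norm_nonneg e).eq_or_lt with h0 | h0
  · rwa [← h0]
  · rw [sq] at h1
    exact le_of_mul_le_mul_right h1 h0

/-! ### Solutions in terms of representatives -/

lemma MemCX.exists_rep {G : Space d → ℝ} {r τ : ℝ} {U : ℝ → State d} (hG : Continuous G)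
    (hp : ∀ ξ, 0 < G ξ) (he : ∀ ξ, G (-ξ) = G ξ) (h : MemCX G r τ U) : ∃ Y : ℝ → HH d,
    (∀ t ∈ Icc 0 τ, Rep (fun ξ => G ((2 * π) • ξ)) r (U t) (Y t) ∧ HermP (Y t)) ∧
    ContinuousOn Y (Icc 0 τ) := by
  have hex : ∀ t ∈ Icc 0 τ, ∃ Z : HH d, Rep (fun ξ => G ((2 * π) • ξ)) r (U t) Z := fun t ht =>
    WhithamBoussinesq.exists_rep hG hp (h.1 t ht).2
  choose! Y hY using hex
  refine ⟨Y, fun t ht => ⟨hY t ht, (hY t ht).herm (fun ξ => hp _) (fun ξ => ?_) (h.1 t ht).1⟩,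
    fun t ht => ?_⟩
  · rw [smul_neg, he]
  · have h1 : Tendsto (fun t' => ENNReal.ofReal ‖Y t' - Y t‖) (𝓝[Icc 0 τ] t) (𝓝 0) := by
      refine tendsto_of_tendsto_of_tendsto_of_le_of_le' tendsto_const_nhds (h.2 t ht)
        (.of_forall fun _ => zero_le) ?_
      filter_upwards [self_mem_nhdsWithin] with t' ht'
      exact ((hY t' ht').sub (hY t ht)).le_xNorm hp
    have h2 := (ENNReal.tendsto_toReal ENNReal.zero_ne_top).comp h1
    rw [ContinuousWithinAt, tendsto_iff_norm_sub_tendsto_zero]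
    refine h2.congr fun t' => ?_
    simp

lemma NearDeriv.sub {H : Type*} [NormedAddCommGroup H] [Module ℂ H] {f f' : ℝ → H}
    {t ρ ρ' : ℝ} {g g' : H} (h : NearDeriv f t g ρ) (h' : NearDeriv f' t g' ρ') :
    NearDeriv (fun t => f t - f' t) t (g - g') (ρ + ρ') := by
  intro η hη
  filter_upwards [h (η / 2) (by positivity), h' (η / 2) (by positivity)] with z h1 h2
  calc _ = ‖(f z - f t - ((z - t : ℝ) : ℂ) • g) - (f' z - f' t - ((z - t : ℝ) : ℂ) • g')‖ := by
        rw [smul_sub]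
        congr 1
        abel
    _ ≤ _ := norm_sub_le _ _
    _ ≤ _ := add_le_add h1 h2
    _ = _ := by ring

section

variable {G₁ G₂ : Space d → ℝ} {r κ ε τ : ℝ}

lemma IsSolution.evolves_comp {s : ℝ} {U R : ℝ → State d} (h : IsSolution G₁ G₂ ε s τ U R)
    (i : Option (Fin d)) : Evolves τ (fun t => (U t).comp i) (fun t => (R t).comp i)
      fun t => (quasilinear G₁ G₂ ε (State.hat (U t))).comp i := by
  rcases i with _ | k
  · exact h.elevation
  · exact h.velocity k

/-- Pair the weak equation with weighted test functions. At almost every time the residual is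
represented by an element of norm at most ρ, so scalar integrals suffice and the residual is never
integrated as a Hilbert-space valued function. -/
lemma IsSolution.norm_increment_le (hr : (d : ℝ) < 2 * r) (hG : Continuous G₁)
    (hp : ∀ ξ, 0 < G₁ ξ) (hε0 : 0 ≤ ε) (hε1 : ε ≤ 1)
    (hS : IsSys κ (fun ξ => G₁ ((2 * π) • ξ)) (fun ξ => G₂ ((2 * π) • ξ)) (quot G₁ G₂))
    {U R : ℝ → State d} (h : IsSolution G₁ G₂ ε (r + 1) τ U R) {Y : ℝ → HH d}
    (hY : ∀ t ∈ Icc 0 τ, Rep (fun ξ => G₁ ((2 * π) • ξ)) (r + 1) (U t) (Y t))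
    (hYc : ContinuousOn Y (Icc 0 τ)) {t₀ ρ : ℝ} (ht₀ : t₀ ≤ τ) (hρ : 0 ≤ ρ)
    (hR : ∀ᵐ t ∂volume.restrict (Icc 0 t₀), xNorm G₁ r (R t) ≤ ENNReal.ofReal ρ) {a b : ℝ}
    (ha : 0 ≤ a) (hab : a ≤ b) (hb : b ≤ t₀) :
    ‖lowP (Y b) - lowP (Y a) + ∫ t in a..b, quadP (fun ξ => G₁ ((2 * π) • ξ))
      (fun ξ => G₂ ((2 * π) • ξ)) (quot G₁ G₂) r ε (Y t) (Y t)‖ ≤ ρ * (b - a) := by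
  set g : Space d → ℝ := fun ξ => G₁ ((2 * π) • ξ) with hg
  have hgc : Continuous g := hG.comp (continuous_const_smul (2 * π))
  have hgp : ∀ ξ, 0 < g ξ := fun ξ => hp _
  set q : ℝ → HH d := fun t => quadP g (fun ξ => G₂ ((2 * π) • ξ)) (quot G₁ G₂) r ε (Y t) (Y t)
    with hq
  have hqc : ContinuousOn q (Icc 0 τ) := (continuous_quadP hr hS hε0 hε1).comp_continuousOn hYc
  have hsub : Icc a b ⊆ Icc 0 τ := Icc_subset_Icc ha (hb.trans ht₀)
  have hqi : IntervalIntegrable q volume a b := by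
    refine ContinuousOn.intervalIntegrable ?_
    rw [uIcc_of_le hab]
    exact hqc.mono hsub
  refine norm_le_of_test (w := compWeight g r) (continuous_compWeight hgc hgp)
    (compWeight_pos hgp) (mul_nonneg hρ (sub_nonneg.2 hab)) fun x hx => ?_
  obtain ⟨χ, hχ, hxχ⟩ := hx
  have hpair : ∀ z : HH d, ⟪x, z⟫_ℂ
      = ∑ i, ∫ ξ, χ i ξ * ((compWeight g r i ξ : ℂ) * z i ξ) := fun z => by
    rw [PiLp.inner_apply]
    exact Finset.sum_congr rfl fun i _ => inner_test (hxχ i) (z i)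
  have hrep : ∀ {V : State d} {Z : HH d}, Rep g r V Z →
      ∑ i, (𝓕 (V.comp i) : 𝓢'(Space d, ℂ)) (χ i) = ⟪x, Z⟫_ℂ := fun hV => by
    rw [hpair]
    exact Finset.sum_congr rfl fun i _ => (hV i).2 (χ i) (hχ i)
  set F : Option (Fin d) → ℝ → ℂ := fun i t => (𝓕 ((R t).comp i) : 𝓢'(Space d, ℂ)) (χ i)
    - ∫ ξ, χ i ξ * (quasilinear G₁ G₂ ε (State.hat (U t))).comp i ξ with hF
  have hFi : ∀ i, IntervalIntegrable (F i) volume 0 τ := fun i => (h.evolves_comp i (χ i) (hχ i)).1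
  have h0τ : (0 : ℝ) ≤ τ := ha.trans (hab.trans (hb.trans ht₀))
  have hFab : ∀ i, ∀ u v, u ∈ Icc 0 τ → v ∈ Icc 0 τ → IntervalIntegrable (F i) volume u v := by
    intro i u v hu hv
    refine (hFi i).mono_set ?_
    rw [uIcc_of_le h0τ]
    exact uIcc_subset_Icc hu hv
  have haτ : a ∈ Icc 0 τ := hsub (left_mem_Icc.2 hab)
  have hbτ : b ∈ Icc 0 τ := hsub (right_mem_Icc.2 hab)
  have h00 : (0 : ℝ) ∈ Icc 0 τ := left_mem_Icc.2 h0τ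
  have hinc : ⟪x, lowP (Y b) - lowP (Y a)⟫_ℂ = ∫ t in a..b, ∑ i, F i t := by
    rw [inner_sub_right, ← hrep (hY b hbτ).lowP, ← hrep (hY a haτ).lowP,
      intervalIntegral.integral_finsetSum fun i _ => hFab i a b haτ hbτ, ← Finset.sum_sub_distrib]
    refine Finset.sum_congr rfl fun i _ => ?_
    have e1 := (h.evolves_comp i (χ i) (hχ i)).2 a haτ
    have e2 := (h.evolves_comp i (χ i) (hχ i)).2 b hbτ
    have e3 := intervalIntegral.integral_interval_sub_left (hFab i 0 b h00 hbτ) (hFab i 0 a h00 haτ)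
    rw [← e3]
    simp only [hF]
    rw [← e1, ← e2]
    ring
  have hint : ⟪x, ∫ t in a..b, q t⟫_ℂ = ∫ t in a..b, ⟪x, q t⟫_ℂ :=
    ((innerSL ℂ x).intervalIntegral_comp_comm hqi).symm
  have hqxi : IntervalIntegrable (fun t => ⟪x, q t⟫_ℂ) volume a b := by
    refine ContinuousOn.intervalIntegrable ?_
    rw [uIcc_of_le hab]
    exact (innerSL ℂ x).continuous.comp_continuousOn (hqc.mono hsub)
  have hFsum : IntervalIntegrable (fun t => ∑ i, F i t) volume a b := by
    have := IntervalIntegrable.sum Finset.univ fun i _ => hFab i a b haτ hbτ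
    simpa [Finset.sum_fn] using this
  rw [inner_add_right, hinc, hint, ← intervalIntegral.integral_add hFsum hqxi]
  have hbound : ∀ᵐ t, t ∈ uIoc a b → ‖(∑ i, F i t) + ⟪x, q t⟫_ℂ‖ ≤ ρ * ‖x‖ := by
    rw [ae_restrict_iff' measurableSet_Icc] at hR
    filter_upwards [hR] with t hRt ht
    rw [uIoc_of_le hab] at ht
    have htτ : t ∈ Icc 0 τ := hsub (Ioc_subset_Icc_self ht)
    have hxR := hRt ⟨htτ.1, ht.2.trans hb⟩
    obtain ⟨Z, hZ⟩ := exists_rep hG hp (hxR.trans_lt ENNReal.ofReal_lt_top)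
    have hZρ : ‖Z‖ ≤ ρ := (ENNReal.ofReal_le_ofReal_iff hρ).1 ((hZ.le_xNorm hp).trans hxR)
    have e : ∑ i, F i t = ⟪x, Z⟫_ℂ - ⟪x, q t⟫_ℂ := by
      rw [← hrep hZ, hpair, ← Finset.sum_sub_distrib]
      refine Finset.sum_congr rfl fun i _ => ?_
      simp only [hF]
      congr 1
      refine integral_congr_ae ?_
      filter_upwards [quasilinear_comp (ε := ε) hr hp hS (hY t htτ) i] with ξ e
      rw [e]
    rw [e, sub_add_cancel, mul_comm]
    exact (norm_inner_le_norm _ _).trans (mul_le_mul_of_nonneg_left hZρ (norm_nonneg _))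
  have := intervalIntegral.norm_integral_le_of_norm_le_const_ae hbound
  rw [abs_of_nonneg (sub_nonneg.2 hab)] at this
  linarith

/-- A residual that is merely bounded in time gives no derivative; but q is continuous, so its
average over a short interval is close to q(t) and the increment bound becomes an approximate right
derivative with error ρ. -/
lemma nearDeriv_of_norm_increment_le {f q : ℝ → HH d} {t₀ ρ : ℝ} (hq : ContinuousOn q (Icc 0 t₀))
    (h : ∀ a b, 0 ≤ a → a ≤ b → b ≤ t₀ → ‖f b - f a + ∫ t in a..b, q t‖ ≤ ρ * (b - a)) {t : ℝ}
    (ht : t ∈ Ico 0 t₀) : NearDeriv f t (-q t) ρ := by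
  intro η hη
  have hc := Metric.continuousWithinAt_iff.1 (hq t (Ico_subset_Icc_self ht)) η hη
  obtain ⟨δ, hδ, hδ'⟩ := hc
  have hpos : (0 : ℝ) < min δ (t₀ - t) := lt_min hδ (sub_pos.2 ht.2)
  filter_upwards [Ioo_mem_nhdsGT (show t < t + min δ (t₀ - t) by linarith)] with z hz
  have hz1 : z < t + δ := hz.2.trans_le (by linarith [min_le_left δ (t₀ - t)])
  have hz2 : z ≤ t₀ := by linarith [hz.2, min_le_right δ (t₀ - t)]
  have htz : t ≤ z := hz.1.le
  have hqi : IntervalIntegrable q volume t z := by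
    refine ContinuousOn.intervalIntegrable ?_
    rw [uIcc_of_le htz]
    exact hq.mono (Icc_subset_Icc ht.1 hz2)
  have e : f z - f t - ((z - t : ℝ) : ℂ) • (-q t)
      = (f z - f t + ∫ u in t..z, q u) - ∫ u in t..z, (q u - q t) := by
    rw [intervalIntegral.integral_sub hqi intervalIntegrable_const, intervalIntegral.integral_const,
      smul_neg]
    rw [← algebraMap_smul ℂ (z - t) (q t)]
    simp only [Complex.coe_algebraMap]
    abel
  have h2 : ‖∫ u in t..z, (q u - q t)‖ ≤ η * |z - t| := by
    refine intervalIntegral.norm_integral_le_of_norm_le_const fun u hu => ?_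
    rw [uIoc_of_le htz] at hu
    have := hδ' (x := u) ⟨ht.1.trans hu.1.le, hu.2.trans hz2⟩ (by
      rw [Real.dist_eq, abs_of_nonneg (by linarith [hu.1])]
      linarith [hu.2])
    rw [dist_eq_norm] at this
    exact this.le
  rw [abs_of_nonneg (sub_nonneg.2 htz)] at h2
  rw [e]
  refine (norm_sub_le _ _).trans ?_
  linarith [h t z ht.1 htz hz2]

end

/-! ### From representatives to solutions -/

lemma continuous_Bil {r : ℝ} (hr : (d : ℝ) < 2 * r) :
    Continuous fun p : L2 d × L2 d => Bil r p.1 p.2 := by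
  obtain ⟨C, hC, -, hb⟩ := exists_Bil_bound hr
  have hB : ∀ x y : L2 d, ‖Bil r x y‖ ≤ C * (‖x‖ * ‖y‖ + ‖x‖ * ‖y‖) := fun x y => by
    have := hb _ isCut_one x y
    simpa [mulL_one] using this
  rw [continuous_iff_continuousAt]
  rintro ⟨x, y⟩
  rw [ContinuousAt, tendsto_iff_norm_sub_tendsto_zero]
  have l1 : Tendsto (fun p : L2 d × L2 d => C * (‖p.1 - x‖ * ‖p.2‖ + ‖p.1 - x‖ * ‖p.2‖)
      + C * (‖x‖ * ‖p.2 - y‖ + ‖x‖ * ‖p.2 - y‖)) (𝓝 (x, y))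
      (𝓝 (C * (‖x - x‖ * ‖y‖ + ‖x - x‖ * ‖y‖) + C * (‖x‖ * ‖y - y‖ + ‖x‖ * ‖y - y‖))) :=
    Continuous.tendsto (by fun_prop) (x, y)
  simp only [sub_self, norm_zero, zero_mul, mul_zero, add_zero] at l1
  refine squeeze_zero (fun _ => norm_nonneg _) (fun p => ?_) l1
  have e : Bil r p.1 p.2 - Bil r x y = Bil r (p.1 - x) p.2 + Bil r x (p.2 - y) := by
    rw [Bil_sub_left hr, Bil_sub_right hr]
    abel
  rw [e]
  exact (norm_add_le _ _).trans (add_le_add (hB _ _) (hB _ _))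

lemma continuous_velN {r : ℝ} (hr : (d : ℝ) < 2 * r) (Q : Space d → ℝ) (ε : ℝ) (k : Fin d) :
    Continuous (velN Q r ε k) := by
  have hp : ∀ i, Continuous fun Y : HH d => Y i := fun i => PiLp.continuous_apply 2 _ i
  unfold velN
  refine ((mulL (dm k)).continuous.comp (hp none)).add (Continuous.fun_const_smul
    (continuous_finsetSum _ fun j _ => ?_) _)
  exact (continuous_Bil hr).comp₂
    (lowL.continuous.comp ((mulL _).continuous.comp (hp (some j))))
    ((mulL _).continuous.comp ((mulL _).continuous.comp (hp (some k))))

/-- Dividing an arbitrary L² function by G₁ may leave the tempered distributions. If the velocity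
representative differs from that of a given state by G₁ times an L² function, the division cancels
and only a tempered correction is added to the given velocity. -/
lemma Rep.exists_state {g : Space d → ℝ} {r : ℝ} (hp : ∀ ξ, 0 < g ξ)
    (hm : IsMult fun ξ => (g ξ : ℂ)) (hr : 0 ≤ r) {U₀ : State d} {Y₀ Y : HH d}
    (h₀ : Rep g (r + 1) U₀ Y₀)
    (h : ∀ k, ∃ x : L2 d, lowL (Y (some k)) = lowL (Y₀ (some k)) + mulL (fun ξ => (g ξ : ℂ)) x) :
    ∃ U : State d, Rep g (r + 1) U Y := by
  choose x hx using h
  have hw : IsMult fun ξ : Space d => (wt (-(r + 1)) ξ : ℂ) := isMult_wt_neg (by linarith)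
  have hw' : IsMult fun ξ : Space d => (wt (-r) ξ : ℂ) := isMult_wt_neg (by linarith)
  refine ⟨((𝓕⁻ (Lp.toTemperedDistribution (mulL (fun ξ => (wt (-(r + 1)) ξ : ℂ)) (Y none))) :
      𝓢'(Space d, ℂ)), fun k => U₀.2 k + (𝓕⁻ (Lp.toTemperedDistribution
      (mulL (fun ξ => (wt (-r) ξ : ℂ)) (x k))) : 𝓢'(Space d, ℂ))), fun i => ?_⟩
  rcases i with _ | k
  · refine (IsFourierFn.of_L2 _).congr ?_
    filter_upwards [coeFn_mulL hw (Y none)] with ξ e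
    rw [e, compWeight, compSymbol, div_one]
  · refine ((h₀ (some k)).add (IsFourierFn.of_L2 _)).congr ?_
    have e0 : lowL (Y (some k)) =ᵐ[volume]
        (lowL (Y₀ (some k)) + mulL (fun ξ => (g ξ : ℂ)) (x k) : L2 d) := by rw [hx k]
    filter_upwards [coeFn_mulL hw' (x k), e0, coeFn_mulL hm (x k),
      coeFn_mulL isMult_wt_neg_one (Y (some k)), coeFn_mulL isMult_wt_neg_one (Y₀ (some k)),
      Lp.coeFn_add (lowL (Y₀ (some k))) (mulL (fun ξ => (g ξ : ℂ)) (x k))] with ξ e1 e2 e3 e4 e5 e6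
    have hg : (g ξ : ℂ) ≠ 0 := Complex.ofReal_ne_zero.2 (hp ξ).ne'
    rw [e6, Pi.add_apply, lowL, e4, e5, e3] at e2
    rw [Pi.add_apply, e1, compWeight_add_one]
    push_cast
    rw [mul_assoc, mul_assoc, e2, mul_add]
    congr 1
    rw [compWeight, compSymbol]
    push_cast
    field_simp

section

variable {g₁ g₂ Q : Space d → ℝ} {r κ ε h C₀ τ : ℝ} {Y₀ : HH d} {Y : ℝ → HH d}

lemma IsSol.continuousOn_quadP (hr : (d : ℝ) < 2 * r) (hS : IsSys κ g₁ g₂ Q) (hε0 : 0 ≤ ε)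
    (hε1 : ε ≤ 1) (H : IsSol g₁ g₂ Q r ε h C₀ τ Y₀ Y) :
    ContinuousOn (fun t => quadP g₁ g₂ Q r ε (Y t) (Y t)) (Icc 0 τ) :=
  (continuous_quadP hr hS hε0 hε1).comp_continuousOn H.cont

lemma IsSol.lowP_sub (hr : (d : ℝ) < 2 * r) (hS : IsSys κ g₁ g₂ Q) (hε0 : 0 ≤ ε)
    (hε1 : ε ≤ 1) (H : IsSol g₁ g₂ Q r ε h C₀ τ Y₀ Y) {t : ℝ} (ht : t ∈ Icc 0 τ) :
    lowP (Y t) - lowP (Y 0) = -∫ u in (0 : ℝ)..t, quadP g₁ g₂ Q r ε (Y u) (Y u) := by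
  have hsub : Icc 0 t ⊆ Icc 0 τ := Icc_subset_Icc_right ht.2
  rw [← intervalIntegral.integral_neg, eq_comm]
  refine intervalIntegral.integral_eq_sub_of_hasDerivAt_of_le (f := fun t => lowP (Y t)) ht.1
    (lowP.continuous.comp_continuousOn (H.cont.mono hsub)) (fun u hu => ?_) ?_
  · exact (H.deriv u (hsub (Ioo_subset_Icc_self hu))).hasDerivAt
      (Icc_mem_nhds hu.1 (hu.2.trans_le ht.2))
  · refine ContinuousOn.intervalIntegrable ?_
    rw [uIcc_of_le ht.1]
    exact ((H.continuousOn_quadP hr hS hε0 hε1).mono hsub).neg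

/-- Integrate the velocity equation with G₁ factored out: the integrand `velN` is already continuous
in L², and G₁ can be taken out of the time integral. -/
lemma IsSol.exists_velocity (hr : (d : ℝ) < 2 * r) (hS : IsSys κ g₁ g₂ Q) (hε0 : 0 ≤ ε)
    (hε1 : ε ≤ 1) (H : IsSol g₁ g₂ Q r ε h C₀ τ Y₀ Y) {t : ℝ} (ht : t ∈ Icc 0 τ) (k : Fin d) :
    ∃ x : L2 d, lowL (Y t (some k)) = lowL (Y₀ (some k)) + mulL (fun ξ => (g₁ ξ : ℂ)) x := by
  have hsub : Icc 0 t ⊆ Icc 0 τ := Icc_subset_Icc_right ht.2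
  have hi : ∀ {E : Type} [NormedAddCommGroup E] {f : HH d → E}, Continuous f →
      IntervalIntegrable (fun u => f (Y u)) volume 0 t := fun hf => by
    refine ContinuousOn.intervalIntegrable ?_
    rw [uIcc_of_le ht.1]
    exact hf.comp_continuousOn (H.cont.mono hsub)
  refine ⟨-∫ u in (0 : ℝ)..t, velN Q r ε k (Y u), ?_⟩
  have e1 := congrArg (PiLp.proj (𝕜 := ℂ) 2 (fun _ : Option (Fin d) => L2 d) (some k))
    (H.lowP_sub hr hS hε0 hε1 ht)
  rw [map_neg, ← ContinuousLinearMap.intervalIntegral_comp_comm _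
    (hi (continuous_quadP hr hS hε0 hε1))] at e1
  rw [map_neg, ← ContinuousLinearMap.intervalIntegral_comp_comm _ (hi (continuous_velN hr Q ε k))]
  have e2 : ∀ u, (PiLp.proj (𝕜 := ℂ) 2 (fun _ : Option (Fin d) => L2 d) (some k))
      (quadP g₁ g₂ Q r ε (Y u) (Y u)) = mulL (fun ξ => (g₁ ξ : ℂ)) (velN Q r ε k (Y u)) :=
    fun u => quadP_some (Y u) k
  simp_rw [e2] at e1
  rw [← e1, H.init]
  simp [lowP_apply]

end

section

variable {G₁ G₂ : Space d → ℝ} {r κ ε h C₀ τ : ℝ} {Y₀ : HH d} {Y : ℝ → HH d}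

lemma memCX_of_rep {G : Space d → ℝ} {s : ℝ} {U : ℝ → State d}
    (hp : ∀ ξ, 0 < G ξ) (he : ∀ ξ, G (-ξ) = G ξ)
    (hU : ∀ t ∈ Icc 0 τ, Rep (fun ξ => G ((2 * π) • ξ)) s (U t) (Y t))
    (hY : ContinuousOn Y (Icc 0 τ)) (hH : ∀ t ∈ Icc 0 τ, HermP (Y t)) : MemCX G s τ U := by
  refine ⟨fun t ht => ⟨(hU t ht).isReal (fun ξ => ?_) (hH t ht),
    ((hU t ht).xNorm_le hp).trans_lt ENNReal.ofReal_lt_top⟩, fun t ht => ?_⟩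
  · rw [smul_neg, he]
  · have h1 := tendsto_iff_norm_sub_tendsto_zero.1 (hY t ht)
    have h2 := ENNReal.tendsto_ofReal (h1.const_mul 2)
    rw [mul_zero, ENNReal.ofReal_zero] at h2
    refine tendsto_of_tendsto_of_tendsto_of_le_of_le' tendsto_const_nhds h2
      (.of_forall fun _ => zero_le) ?_
    filter_upwards [self_mem_nhdsWithin] with t' ht'
    exact ((hU t' ht').sub (hU t ht)).xNorm_le hp

/-- At each time a state is reconstructed from the initial one. The weak equation follows by
applying the continuous functional ℓ defined by a test function to the integrated equation at the
lower level. -/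
theorem IsSol.exists_isSolution (hr : (d : ℝ) < 2 * r) (hG : Continuous G₁)
    (hp : ∀ ξ, 0 < G₁ ξ) (he : ∀ ξ, G₁ (-ξ) = G₁ ξ) (hε0 : 0 ≤ ε) (hε1 : ε ≤ 1)
    (hS : IsSys κ (fun ξ => G₁ ((2 * π) • ξ)) (fun ξ => G₂ ((2 * π) • ξ)) (quot G₁ G₂))
    (hτ : 0 ≤ τ) {U₀ : State d} (hU₀ : Rep (fun ξ => G₁ ((2 * π) • ξ)) (r + 1) U₀ Y₀)
    (H : IsSol (fun ξ => G₁ ((2 * π) • ξ)) (fun ξ => G₂ ((2 * π) • ξ)) (quot G₁ G₂)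
      r ε h C₀ τ Y₀ Y) :
    ∃ U : ℝ → State d, IsSolution G₁ G₂ ε (r + 1) τ U 0 ∧ U 0 = U₀ ∧
      ∀ t ∈ Icc 0 τ, Rep (fun ξ => G₁ ((2 * π) • ξ)) (r + 1) (U t) (Y t) := by
  have hr0 : 0 ≤ r := by
    have : (0 : ℝ) ≤ d := by positivity
    linarith
  have hex : ∀ t ∈ Icc 0 τ, ∃ u : State d, Rep (fun ξ => G₁ ((2 * π) • ξ)) (r + 1) u (Y t) :=
    fun t ht => hU₀.exists_state (fun ξ => hp _) hS.sym₁.isMult hr0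
      fun k => H.exists_velocity hr hS hε0 hε1 ht k
  choose! U hU using hex
  have h00 : (0 : ℝ) ∈ Icc 0 τ := left_mem_Icc.2 hτ
  have hgc : Continuous fun ξ => G₁ ((2 * π) • ξ) := hG.comp (continuous_const_smul (2 * π))
  have hev : ∀ i, Evolves τ (fun t => (U t).comp i) (fun _ => 0)
      fun t => (quasilinear G₁ G₂ ε (State.hat (U t))).comp i := by
    intro i χ hχ
    have hmem := memLp_test_mul
      (continuous_compWeight (r := r) hgc (fun ξ => hp _) i) hχ
    set x : L2 d := hmem.toLp _ with hx
    have hpair := inner_test (x := x) hmem.coeFn_toLp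
    set ℓ : HH d →L[ℂ] ℂ := (innerSL ℂ x) ∘L
      (PiLp.proj (𝕜 := ℂ) 2 (fun _ : Option (Fin d) => L2 d) i) with hℓ
    have hℓ' : ∀ z : HH d, ℓ z = ⟪x, z i⟫_ℂ := fun z => rfl
    have e1 : ∀ t ∈ Icc 0 τ, (𝓕 (0 : 𝓢'(Space d, ℂ)) : 𝓢'(Space d, ℂ)) χ
        - ∫ ξ, χ ξ * (quasilinear G₁ G₂ ε (State.hat (U t))).comp i ξ
        = -ℓ (quadP (fun ξ => G₁ ((2 * π) • ξ)) (fun ξ => G₂ ((2 * π) • ξ)) (quot G₁ G₂) r ε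
          (Y t) (Y t)) := fun t ht => by
      rw [hℓ', hpair]
      have e0 : (𝓕 (0 : 𝓢'(Space d, ℂ)) : 𝓢'(Space d, ℂ)) χ = 0 := by simp
      rw [e0, zero_sub]
      congr 1
      refine integral_congr_ae ?_
      filter_upwards [quasilinear_comp (ε := ε) hr hp hS (hU t ht) i] with ξ e
      rw [e]
    have hqc := H.continuousOn_quadP hr hS hε0 hε1
    have hint : ∀ t ∈ Icc 0 τ, IntervalIntegrable (fun t => quadP (fun ξ => G₁ ((2 * π) • ξ))
        (fun ξ => G₂ ((2 * π) • ξ)) (quot G₁ G₂) r ε (Y t) (Y t)) volume 0 t := fun t ht => by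
      refine ContinuousOn.intervalIntegrable ?_
      rw [uIcc_of_le ht.1]
      exact hqc.mono (Icc_subset_Icc_right ht.2)
    refine ⟨?_, fun t ht => ?_⟩
    · refine ContinuousOn.intervalIntegrable ?_
      rw [uIcc_of_le hτ]
      exact (ℓ.continuous.comp_continuousOn hqc).neg.congr e1
    · have e2 : ∀ t ∈ Icc 0 τ, (𝓕 ((U t).comp i) : 𝓢'(Space d, ℂ)) χ = ℓ (lowP (Y t)) :=
        fun t ht => by
          rw [hℓ', hpair]
          exact (hU t ht).lowP i |>.2 χ hχ
      rw [e2 t ht, e2 0 h00, ← map_sub, H.lowP_sub hr hS hε0 hε1 ht, map_neg,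
        ← ℓ.intervalIntegral_comp_comm (hint t ht), ← intervalIntegral.integral_neg]
      refine intervalIntegral.integral_congr fun u hu => ?_
      rw [uIcc_of_le ht.1] at hu
      exact (e1 u ⟨hu.1, hu.2.trans ht.2⟩).symm
  refine ⟨U, ⟨memCX_of_rep hp he hU H.cont H.herm, hev none, fun k => hev (some k)⟩, ?_, hU⟩
  have := hU 0 h00
  rw [H.init] at this
  exact this.state_eq hU₀

end

/-! ### Stability -/

/-- The speed of the constructed solution is read off from its equation, and the condition εt ≤ 1
removes time from the exponent. The constants depend on the norms of the two solutions on [0, t]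
only, as the stability estimate demands. -/
lemma exists_lowP_sub_le (d : ℕ) {r : ℝ} (hr : (d : ℝ) < 2 * r) : ∃ A B, 0 ≤ A ∧ 0 ≤ B ∧
    ∀ (κ ε h C₀ τ τ' : ℝ) (G₁ G₂ : Space d → ℝ), Continuous G₁ → (∀ ξ, 0 < G₁ ξ) →
    IsSys κ (fun ξ => G₁ ((2 * π) • ξ)) (fun ξ => G₂ ((2 * π) • ξ)) (quot G₁ G₂) →
    0 ≤ ε → ε ≤ 1 → 0 < h → h ≤ 1 → ∀ (Y₀ : HH d) (Y Z : ℝ → HH d) (V R : ℝ → State d),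
    IsSol (fun ξ => G₁ ((2 * π) • ξ)) (fun ξ => G₂ ((2 * π) • ξ)) (quot G₁ G₂)
      r ε h C₀ τ Y₀ Y →
    IsSolution G₁ G₂ ε (r + 1) τ' V R →
    (∀ t ∈ Icc 0 τ', Rep (fun ξ => G₁ ((2 * π) • ξ)) (r + 1) (V t) (Z t)) →
    ContinuousOn Z (Icc 0 τ') → ∀ t ρ N₁ N₂ : ℝ, t ≤ τ → t ≤ τ' → ε * t ≤ 1 → 0 ≤ ρ → 0 ≤ N₁ →
    0 ≤ N₂ → (∀ᵐ u ∂volume.restrict (Icc 0 t), xNorm G₁ r (R u) ≤ ENNReal.ofReal ρ) →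
    (∀ u ∈ Icc 0 t, ‖Y u‖ ≤ N₁ ∧ ‖Z u‖ ≤ N₂) → ∀ u ∈ Icc 0 t,
    h * ‖lowP (Y u - Z u)‖ ≤ exp (A * (B * κ * ((1 + N₁) * N₁) + κ * (1 + N₁) ^ 2 * (1 + N₂)) / h)
      * ((1 + A * N₁) * (‖lowP (Y 0 - Z 0)‖ + 2 * t * ρ)) := by
  obtain ⟨A, hA, hdiff⟩ := exists_diff_energy d hr
  obtain ⟨B, hB, hb⟩ := exists_quadP_bounds d hr
  refine ⟨A, B, hA, hB, fun κ ε h C₀ τ τ' G₁ G₂ hG hp hS hε0 hε1 h0 h1 Y₀ Y Z V R H HV hZ hZc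
    t ρ N₁ N₂ htτ htτ' hεt hρ hN₁ hN₂ hR hN u hu => ?_⟩
  have hκ := hS.sym₁.nonneg
  have ht : 0 ≤ t := hu.1.trans hu.2
  have hsub : Icc 0 t ⊆ Icc 0 τ := Icc_subset_Icc_right htτ
  have hsub' : Icc 0 t ⊆ Icc 0 τ' := Icc_subset_Icc_right htτ'
  obtain ⟨ℓ, hℓ⟩ : ∃ ℓ, ℓ = B * κ * ((1 + N₁) * N₁) := ⟨_, rfl⟩
  have hℓ0 : 0 ≤ ℓ := by rw [hℓ]; positivity
  have main := hdiff κ _ _ _ hS ε t h N₁ N₂ ℓ 0 ρ hε0 hε1 h0 h1 hℓ0 le_rfl hρ Y Z (fun _ => 0)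
    (lowP.continuous.comp_continuousOn ((H.cont.mono hsub).sub (hZc.mono hsub')))
    (fun v hv => ⟨H.herm v (hsub hv), (hN v hv).1, (hN v hv).2, H.nonCav v (hsub hv)⟩)
    (fun v hv z hz => by
      rw [map_sub]
      refine (convex_Icc 0 t).norm_image_sub_le_of_norm_hasDerivWithin_le (f := fun t => lowP (Y t))
        (fun x hx => (H.deriv x (hsub hx)).mono hsub) (fun x hx => ?_) hv hz
      rw [norm_neg, hℓ]
      refine (((hb _ _ _ _ hS).2 ε hε0 hε1).2.1 (Y x)).trans ?_
      have := (hN x hx).1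
      gcongr)
    (fun v hv => by
      refine ⟨by simp, ?_⟩
      have n1 := HasDerivWithinAt.nearDeriv (H.deriv v (hsub (Ico_subset_Icc_self hv)))
        ⟨hv.1, hv.2.trans_le htτ⟩
      have n2 := nearDeriv_of_norm_increment_le (f := fun t => lowP (Z t)) (t₀ := t) (ρ := ρ)
        (((continuous_quadP hr hS hε0 hε1).comp_continuousOn hZc).mono hsub')
        (fun a b ha hab hbt => HV.norm_increment_le hr hG hp hε0 hε1 hS hZ hZc htτ' hρ hR ha hab hbt)
        hv
      have n3 := n1.sub n2
      simp only [zero_add, ← map_sub] at n3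
      convert n3 using 1
      simp only [Function.comp_apply]
      abel) u hu
  refine main.trans ?_
  rw [zero_add]
  have e : ε * (A * (ℓ + κ * (1 + N₁) ^ 2 * (1 + N₂))) / h * t
      = ε * t * (A * (ℓ + κ * (1 + N₁) ^ 2 * (1 + N₂)) / h) := by ring
  rw [e, hℓ]
  gcongr
  refine mul_le_of_le_one_left ?_ hεt
  positivity

/-- The constant of the stability estimate. -/
def stabConst (A B κ a b c : ℝ) : ℝ :=
  4 * max 1 (2 * a) * exp (A * (B * κ * ((1 + max 0 b) * max 0 b)
    + κ * (1 + max 0 b) ^ 2 * (1 + max 0 c)) * max 1 (2 * a)) * (1 + A * max 0 b)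

section

variable {A B κ : ℝ}

lemma stabConst_pos (hA : 0 ≤ A) (a b c : ℝ) : 0 < stabConst A B κ a b c := by
  have h1 : (0 : ℝ) < max 1 (2 * a) := lt_max_of_lt_left one_pos
  have h2 : (0 : ℝ) ≤ max 0 b := le_max_left _ _
  unfold stabConst
  positivity

lemma stabConst_mono (hA : 0 ≤ A) (hB : 0 ≤ B) (hκ : 0 ≤ κ) {a a' b b' c c' : ℝ} (ha : a ≤ a')
    (hb : b ≤ b') (hc : c ≤ c') : stabConst A B κ a b c ≤ stabConst A B κ a' b' c' := by
  have h1 : (0 : ℝ) ≤ max 1 (2 * a) := zero_le_one.trans (le_max_left _ _)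
  have h2 : (0 : ℝ) ≤ max 0 b := le_max_left _ _
  have h3 : (0 : ℝ) ≤ max 0 c := le_max_left _ _
  have h1' : (0 : ℝ) ≤ max 1 (2 * a') := zero_le_one.trans (le_max_left _ _)
  have h2' : (0 : ℝ) ≤ max 0 b' := le_max_left _ _
  have h3' : (0 : ℝ) ≤ max 0 c' := le_max_left _ _
  unfold stabConst
  gcongr

/-- 1/min(1, hmin/2) = max(1, 2/hmin). The factor 4 is 2 for comparing the sum norm of X^(s-1) with
the Hilbert norm, times 2 for y + 2z ≤ 2(y + z). -/
lemma le_stabConst (hA : 0 ≤ A) {hmin N₁ N₂ x y z : ℝ}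
    (hN₁ : 0 ≤ N₁) (hN₂ : 0 ≤ N₂) (hh : 0 < hmin) (hy : 0 ≤ y)
    (h : min 1 (hmin / 2) * x ≤ exp (A * (B * κ * ((1 + N₁) * N₁)
      + κ * (1 + N₁) ^ 2 * (1 + N₂)) / min 1 (hmin / 2)) * ((1 + A * N₁) * (y + 2 * z))) :
    2 * x ≤ stabConst A B κ (1 / hmin) N₁ N₂ * (y + z) := by
  have hm : (0 : ℝ) < min 1 (hmin / 2) := by positivity
  have e : max 1 (2 * (1 / hmin)) = (min 1 (hmin / 2))⁻¹ := by
    rcases le_total 1 (hmin / 2) with h1 | h1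
    · rw [min_eq_left h1, max_eq_left, inv_one]
      rw [mul_one_div, div_le_one hh]
      linarith
    · rw [min_eq_right h1, max_eq_right, inv_div, mul_one_div]
      rw [mul_one_div, le_div_iff₀ hh]
      linarith
  rw [stabConst, max_eq_right hN₁, max_eq_right hN₂, e]
  rw [div_eq_mul_inv _ (min 1 (hmin / 2))] at h
  obtain ⟨E, hE⟩ : ∃ E, E = exp (A * (B * κ * ((1 + N₁) * N₁)
      + κ * (1 + N₁) ^ 2 * (1 + N₂)) * (min 1 (hmin / 2))⁻¹) := ⟨_, rfl⟩
  have hE0 : 0 < E := by rw [hE]; exact exp_pos _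
  rw [← hE] at h ⊢
  have h2 : x ≤ (min 1 (hmin / 2))⁻¹ * (E * ((1 + A * N₁) * (y + 2 * z))) := by
    rwa [← div_eq_inv_mul, le_div_iff₀ hm, mul_comm]
  have h3 : (min 1 (hmin / 2))⁻¹ * (E * ((1 + A * N₁) * (y + 2 * z)))
      ≤ (min 1 (hmin / 2))⁻¹ * (E * ((1 + A * N₁) * (2 * (y + z)))) := by
    gcongr
    linarith
  calc 2 * x ≤ 2 * ((min 1 (hmin / 2))⁻¹ * (E * ((1 + A * N₁) * (2 * (y + z))))) := by linarith
    _ = _ := by ring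

end

lemma norm_le_toReal_supNorm {G : Space d → ℝ} {s t : ℝ} {U : ℝ → State d} {Y : ℝ → HH d}
    (hp : ∀ ξ, 0 < G ξ) (hU : ∀ u ∈ Icc 0 t, Rep (fun ξ => G ((2 * π) • ξ)) s (U u) (Y u))
    (hY : ContinuousOn Y (Icc 0 t)) {u : ℝ} (hu : u ∈ Icc 0 t) :
    ‖Y u‖ ≤ (supNorm G s t U).toReal := by
  obtain ⟨C, hC⟩ := isCompact_Icc.exists_bound_of_continuousOn hY
  have h1 : supNorm G s t U ≤ ENNReal.ofReal (2 * C) := by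
    refine iSup₂_le fun v hv => ((hU v hv).xNorm_le hp).trans (ENNReal.ofReal_le_ofReal ?_)
    linarith [hC v hv]
  have h2 : ENNReal.ofReal ‖Y u‖ ≤ supNorm G s t U :=
    ((hU u hu).le_xNorm hp).trans (le_iSup₂ (f := fun v (_ : v ∈ Icc 0 t) => xNorm G s (U v)) u hu)
  exact (ENNReal.ofReal_le_iff_le_toReal (h1.trans_lt ENNReal.ofReal_lt_top).ne).1 h2

end WhithamBoussinesq

end

/-! ### Existence, uniqueness and stability assembled. -/

open WhithamBoussinesq in
theorem proposition1p2 (d : ℕ) (hd : d = 1 ∨ d = 2) (s : ℝ) (hs : (d : ℝ) / 2 + 1 < s) (K : ℝ) :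
    ∃ C : ℝ → ℝ → ℝ → ℝ,
      (∀ a b c, 0 < C a b c) ∧
      (∀ a a' b b' c c', a ≤ a' → b ≤ b' → c ≤ c' → C a b c ≤ C a' b' c') ∧
      ∀ hmin : ℝ, 0 < hmin → ∀ M : ℝ, 0 < M →
      ∃ T : ℝ, 0 < T ∧ ∃ C₀ : ℝ, 0 < C₀ ∧
      ∀ G₁ G₂ : WhithamBoussinesq.Space d → ℝ, WhithamBoussinesq.Admissible K G₁ G₂ →
      ∀ ε : ℝ, 0 < ε → ε ≤ 1 →
      ∀ U₀ : WhithamBoussinesq.State d, WhithamBoussinesq.IsRealState U₀ →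
        WhithamBoussinesq.xNorm G₁ s U₀ ≤ ENNReal.ofReal M →
        WhithamBoussinesq.NonCavitating ε hmin U₀.1 →
      ∃ U : ℝ → WhithamBoussinesq.State d,
        -- `U` is the unique solution of the Cauchy problem, and it is bounded by the data
        WhithamBoussinesq.IsSolution G₁ G₂ ε s (T / ε) U 0 ∧ U 0 = U₀ ∧
        (∀ V : ℝ → WhithamBoussinesq.State d,
          WhithamBoussinesq.IsSolution G₁ G₂ ε s (T / ε) V 0 → V 0 = U₀ →
            ∀ t ∈ Icc 0 (T / ε), V t = U t) ∧
        WhithamBoussinesq.supNorm G₁ s (T / ε) U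
          ≤ ENNReal.ofReal C₀ * WhithamBoussinesq.xNorm G₁ s U₀ ∧
        -- stability
        ∀ T' : ℝ, 0 < T' → ∀ U' R' : ℝ → WhithamBoussinesq.State d,
          WhithamBoussinesq.MemLinftyX G₁ (s - 1) (T' / ε) R' →
          WhithamBoussinesq.IsSolution G₁ G₂ ε s (T' / ε) U' R' →
          ∀ t ∈ Icc 0 (min T' T / ε),
            WhithamBoussinesq.supNorm G₁ (s - 1) t (U - U')
              ≤ ENNReal.ofReal (C (1 / hmin)
                    (WhithamBoussinesq.supNorm G₁ s t U).toReal
                    (WhithamBoussinesq.supNorm G₁ s t U').toReal)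
                * (WhithamBoussinesq.xNorm G₁ (s - 1) (U 0 - U' 0)
                    + ENNReal.ofReal t * WhithamBoussinesq.essSupNorm G₁ (s - 1) t R') := by
  obtain ⟨r, rfl⟩ : ∃ r, s = r + 1 := ⟨s - 1, by ring⟩
  have hr : (d : ℝ) < 2 * r := by linarith
  -- The constants are chosen before any admissible pair is at hand, so K might be negative at this
  -- stage; an admissible pair later forces |K| = K.
  have hκ : 0 ≤ 3 * |K| := by positivity
  obtain ⟨A, B, hA, hB, hstab⟩ := exists_lowP_sub_le d hr
  refine ⟨stabConst A B (3 * |K|), stabConst_pos hA,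
    fun a a' b b' c c' ha hb hc => stabConst_mono hA hB hκ ha hb hc, fun hmin hh M hM => ?_⟩
  obtain ⟨T, C₀, hT, hT1, hC₀, hex⟩ := exists_isSol d hr hκ hh hM
  refine ⟨T, hT, 2 * C₀, by positivity, fun G₁ G₂ hadm ε hε hε1 U₀ hU₀ hU₀M hcav => ?_⟩
  have hK : |K| = K := abs_of_nonneg ((abs_nonneg _).trans (hadm.symbol₁.bound 0))
  have hS : IsSys (3 * |K|) (fun ξ => G₁ ((2 * π) • ξ)) (fun ξ => G₂ ((2 * π) • ξ))
      (quot G₁ G₂) := by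
    rw [hK]
    exact hadm.isSys
  have hG : Continuous G₁ := hadm.symbol₁.lipschitz.choose_spec.continuous
  have hp := hadm.pos
  have he := hadm.symbol₁.even
  rw [add_sub_cancel_right]
  obtain ⟨Y₀, hY₀⟩ := exists_rep hG hp (hU₀M.trans_lt ENNReal.ofReal_lt_top)
  have hY₀M : ‖Y₀‖ ≤ M := (ENNReal.ofReal_le_ofReal_iff hM.le).1 ((hY₀.le_xNorm hp).trans hU₀M)
  have hY₀h : HermP Y₀ := hY₀.herm (fun ξ => hp _) (fun ξ => by rw [smul_neg, he]) hU₀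
  obtain ⟨Y, hY⟩ := hex _ _ _ hS ε hε hε1 Y₀ hY₀h hY₀M (hY₀.nonCav_iff.1 hcav)
  have hτ : 0 ≤ T / ε := by positivity
  have h0τ : (0 : ℝ) ∈ Icc 0 (T / ε) := left_mem_Icc.2 hτ
  have hm : 0 < min 1 (hmin / 2) := by positivity
  obtain ⟨U, hU, hU0, hUY⟩ := hY.exists_isSolution hr hG hp he hε.le hε1 hS hτ hY₀
  -- The bound T ≤ 1 is used here.
  have hεt : ∀ t, t ≤ T / ε → ε * t ≤ 1 := fun t ht => by
    rw [le_div_iff₀ hε] at ht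
    linarith
  refine ⟨U, hU, hU0, fun V hV hV0 t ht => ?_, ?_, fun T' hT' U' R' hR' hU' t ht => ?_⟩
  · obtain ⟨Z, hZ, hZc⟩ := hV.continuous.exists_rep hG hp he
    have hZ0 : Z 0 = Y 0 := by
      have h1 := (hZ 0 h0τ).1
      rw [hV0] at h1
      rw [hY.init]
      exact h1.eq (fun ξ => hp _) hY₀
    have hZr := fun t ht => (hZ t ht).1
    -- Uniqueness is the stability estimate with zero residual and equal data; equality of the lower
    -- representatives already identifies the states.
    have h1 := hstab _ ε _ C₀ (T / ε) (T / ε) G₁ G₂ hG hp hS hε.le hε1 hm (min_le_left _ _) Y₀ Y Z V 0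
      hY hV hZr hZc (T / ε) 0 _ _ le_rfl le_rfl (hεt _ le_rfl) le_rfl
      ENNReal.toReal_nonneg ENNReal.toReal_nonneg (.of_forall fun u => by
        simpa using Rep.zero.xNorm_le (r := r) hp)
      (fun u hu => ⟨norm_le_toReal_supNorm hp hUY hY.cont hu, norm_le_toReal_supNorm hp hZr hZc hu⟩)
      t ht
    rw [hZ0, sub_self, map_zero, norm_zero, mul_zero, add_zero, mul_zero, mul_zero] at h1
    have h2 : lowP (Y t - Z t) = 0 := norm_le_zero_iff.1 (nonpos_of_mul_nonpos_right h1 hm)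
    have h3 := ((hUY t ht).sub (hZr t ht)).lowP
    rw [h2] at h3
    exact (sub_eq_zero.1 (h3.state_eq Rep.zero)).symm
  · refine iSup₂_le fun t ht => ((hUY t ht).xNorm_le hp).trans ?_
    calc _ ≤ ENNReal.ofReal (2 * C₀ * ‖Y₀‖) := by
          refine ENNReal.ofReal_le_ofReal ?_
          linarith [hY.norm_le t ht]
      _ = ENNReal.ofReal (2 * C₀) * ENNReal.ofReal ‖Y₀‖ := ENNReal.ofReal_mul (by positivity)
      _ ≤ _ := by
        gcongr
        exact hY₀.le_xNorm hp
  · have htT : t ≤ T / ε := ht.2.trans (by gcongr; exact min_le_right _ _)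
    have htT' : t ≤ T' / ε := ht.2.trans (by gcongr; exact min_le_left _ _)
    have hs : Icc 0 t ⊆ Icc 0 (T / ε) := Icc_subset_Icc_right htT
    have hs' : Icc 0 t ⊆ Icc 0 (T' / ε) := Icc_subset_Icc_right htT'
    obtain ⟨Z, hZ, hZc⟩ := hU'.continuous.exists_rep hG hp he
    have hZr := fun t ht => (hZ t ht).1
    have hρ : essSupNorm G₁ r t R' ≠ ⊤ := ((essSup_mono_measure
      (Measure.absolutelyContinuous_of_le (Measure.restrict_mono_set _ hs'))).trans_lt hR'.2).ne
    have hae : ∀ᵐ u ∂volume.restrict (Icc 0 t),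
        xNorm G₁ r (R' u) ≤ ENNReal.ofReal (essSupNorm G₁ r t R').toReal := by
      rw [ENNReal.ofReal_toReal hρ]
      exact ENNReal.ae_le_essSup _
    have h00 : (0 : ℝ) ∈ Icc 0 t := left_mem_Icc.2 ht.1
    refine iSup₂_le fun u hu => ?_
    have h1 := hstab _ ε _ C₀ (T / ε) (T' / ε) G₁ G₂ hG hp hS hε.le hε1 hm (min_le_left _ _) Y₀ Y Z
      U' R' hY hU' hZr hZc t _ _ _ htT htT' (hεt _ htT) ENNReal.toReal_nonneg
      ENNReal.toReal_nonneg ENNReal.toReal_nonneg hae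
      (fun u hu => ⟨norm_le_toReal_supNorm hp (fun v hv => hUY v (hs hv)) (hY.cont.mono hs) hu,
        norm_le_toReal_supNorm hp (fun v hv => hZr v (hs' hv)) (hZc.mono hs') hu⟩) u hu
    rw [mul_assoc 2 t] at h1
    have h2 := le_stabConst hA ENNReal.toReal_nonneg ENNReal.toReal_nonneg hh
      (norm_nonneg _) h1
    refine ((((hUY u (hs hu)).sub (hZr u (hs' hu))).lowP).xNorm_le hp).trans
      ((ENNReal.ofReal_le_ofReal h2).trans ?_)
    rw [ENNReal.ofReal_mul (stabConst_pos hA _ _ _).le, ENNReal.ofReal_add (norm_nonneg _)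
      (mul_nonneg ht.1 ENNReal.toReal_nonneg), ENNReal.ofReal_mul ht.1, ENNReal.ofReal_toReal hρ]
    gcongr
    exact (((hUY 0 (hs h00)).sub (hZr 0 (hs' h00))).lowP).le_xNorm hp
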